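/- **Definitions.** An instance of WRAC consists of $n$ axis-aligned boxes $B_1,\dots,B_n$, where $B_i$ has a prescribed width $w_i>0$ and height $h_i>0$ (real numbers), and of a graph $G$ on the boxes, the supporting graph, given by a list of its edges. A representation assigns to each box a position in the plane (no rotation) such that no two boxes overlap, i.e. their interiors are pairwise disjoint. Two boxes touch if they share a piece of boundary of positive length. A representation realizes $G$ if every two boxes that are adjacent in $G$ touch (other pairs may touch as well), and the instance is realizable if such a representation exists. WRAC is the problem of deciding whether a given instance is realizable, and of finding a representation that realizes $G$ if there is one. A graph is quasi-triangulated if it is connected, has an embedding in the plane whose outer face is bounded by a cycle on four distinct vertices and all of whose other faces are bounded by triangles, and has no separating triangle, i.e. no three pairwise adjacent vertices whose deletion disconnects the graph. The model of computation is the real RAM: in one step one may read or write a memory cell that is addressed by a natural number, compare, increment or decrement natural numbers (addresses), or compare, add, subtract or halve real numbers. **Theorem.** WRAC can be solved in linear time for quasi-triangulated supporting graphs. That is, there are a real RAM program and a constant $C$ such that for all $n$, all positive real widths and heights $w_i,h_i$, every quasi-triangulated graph $G$ on the $n$ boxes and every list of the edges of $G$ (each edge once, in any order), the program halts after at most $C\,n$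 steps, correctly reports whether the instance is realizable, and, if it is, outputs the bottom-left corners of the boxes in a representation that realizes $G$. -/

import Mathlib

namespace WRAC

/-! ## Boxes, representations, realizability -/

/-- The open box of width `w` and height `h` whose bottom-left corner is `p`. -/
def openBox (w h : ℝ) (p : ℝ × ℝ) : Set (ℝ × ℝ) :=
  Set.Ioo p.1 (p.1 + w) ×ˢ Set.Ioo p.2 (p.2 + h)

/-- Two boxes with bottom-left corners `p`, `p'` touch: a side of one and a side of the other lie on
a common line and share a segment of positive length. -/
def Touch (w h : ℝ) (p : ℝ × ℝ) (w' h' : ℝ) (p' : ℝ × ℝ) : Prop :=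
  ((p.1 + w = p'.1 ∨ p'.1 + w' = p.1) ∧ max p.2 p'.2 < min (p.2 + h) (p'.2 + h')) ∨
  ((p.2 + h = p'.2 ∨ p'.2 + h' = p.2) ∧ max p.1 p'.1 < min (p.1 + w) (p'.1 + w'))

/-- `pos` gives the bottom-left corners of a representation of the boxes (no two of them overlap)
in which any two boxes adjacent in the supporting graph `G` touch. -/
def Realizes {n : ℕ} (w h : Fin n → ℝ) (G : SimpleGraph (Fin n)) (pos : Fin n → ℝ × ℝ) : Prop :=
  (∀ i j, i ≠ j → Disjoint (openBox (w i) (h i) (pos i)) (openBox (w j) (h j) (pos j))) ∧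
  ∀ i j, G.Adj i j → Touch (w i) (h i) (pos i) (w j) (h j) (pos j)

/-- The boxes have a representation that realizes the supporting graph `G`. -/
def Realizable {n : ℕ} (w h : Fin n → ℝ) (G : SimpleGraph (Fin n)) : Prop :=
  ∃ pos : Fin n → ℝ × ℝ, Realizes w h G pos

/-! ## Plane graphs and quasi-triangulated graphs -/

/-- A rotation system of `G`: a cyclic order of the darts (oriented edges) leaving each vertex,
given by the permutation `rot` that sends a dart to the next one around its source. -/
structure RotationSystem {V : Type*} (G : SimpleGraph V) where
  rot : Equiv.Perm G.Dart
  fst_rot : ∀ d, (rot d).fst = d.fst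
  sameCycle : ∀ d e : G.Dart, d.fst = e.fst → rot.SameCycle d e

namespace RotationSystem

variable {V : Type*} {G : SimpleGraph V}

/-- The permutation that sends a dart to the next dart along the boundary of the face beside it. -/
def next (R : RotationSystem G) : Equiv.Perm G.Dart :=
  (Function.Involutive.toPerm _ SimpleGraph.Dart.symm_involutive).trans R.rot

/-- The faces are the orbits of `next`. -/
def Face (R : RotationSystem G) : Type _ :=
  Quotient (Equiv.Perm.SameCycle.setoid R.next)

/-- Euler's formula `|V| - |E| + |F| = 2`. For a connected graph with at least one edge, the rotation
systems with this property are exactly those of its embeddings in the plane (equivalently, in the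
sphere; the choice of the outer face is made separately). -/
def IsPlane (R : RotationSystem G) : Prop :=
  Nat.card V + Nat.card R.Face = Nat.card G.edgeSet + 2

/-- The face beside the dart `d` is bounded by a cycle through four distinct vertices. -/
def IsQuadrangle (R : RotationSystem G) (d : G.Dart) : Prop :=
  (R.next ^ 4) d = d ∧
    [d.fst, (R.next d).fst, ((R.next ^ 2) d).fst, ((R.next ^ 3) d).fst].Nodup

/-- The face beside the dart `d` is bounded by a triangle. -/
def IsTriangle (R : RotationSystem G) (d : G.Dart) : Prop :=
  (R.next ^ 3) d = d

end RotationSystem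

/-- Three pairwise adjacent vertices whose deletion disconnects the graph. -/
def IsSeparatingTriangle {V : Type*} (G : SimpleGraph V) (a b c : V) : Prop :=
  G.Adj a b ∧ G.Adj b c ∧ G.Adj a c ∧ ¬ (G.induce ({a, b, c}ᶜ : Set V)).Preconnected

/-- Planar, with an embedding whose outer face (the one beside the dart `o`) is a quadrangle and all
of whose other faces are triangles, and without separating triangles. -/
def IsQuasiTriangulated {V : Type*} (G : SimpleGraph V) : Prop :=
  G.Connected ∧
  (∃ R : RotationSystem G, R.IsPlane ∧
    ∃ o : G.Dart, R.IsQuadrangle o ∧ ∀ d, ¬ R.next.SameCycle o d → R.IsTriangle d) ∧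
  ∀ a b c, ¬ IsSeparatingTriangle G a b c

/-! ## The machine model: a real RAM with a step count

The memory consists of arrays of natural numbers and arrays of real numbers; a program mentions
finitely many of them. Natural numbers serve as indices and pointers and can only be compared,
copied, incremented and decremented, so that after `t` steps no natural number in memory exceeds the
largest one in the initial memory or in the program by more than `t`. Real numbers can be compared, copied, added, subtracted and halved, and cannot be turned
into natural numbers. -/

structure State where
  nat : ℕ → ℕ → ℕ
  real : ℕ → ℕ → ℝ

/-- Expressions for natural numbers; `get a i` reads the `i`-th cell of the `a`-th array. -/
inductive NExp
  | lit (k : ℕ)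
  | get (a : ℕ) (i : NExp)
  | succ (e : NExp)
  | pred (e : NExp)

/-- Expressions for real numbers. -/
inductive RExp
  | zero
  | get (a : ℕ) (i : NExp)
  | add (e f : RExp)
  | sub (e f : RExp)
  | half (e : RExp)

/-- Tests. -/
inductive BExp
  | nlt (e f : NExp)
  | rlt (e f : RExp)
  | not (b : BExp)
  | and (b c : BExp)

/-- Programs; `nset a i e` and `rset a i e` write `e` into the `i`-th cell of the `a`-th array. -/
inductive Prog
  | skip
  | nset (a : ℕ) (i : NExp) (e : NExp)
  | rset (a : ℕ) (i : NExp) (e : RExp)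
  | seq (p q : Prog)
  | ite (b : BExp) (p q : Prog)
  | while (b : BExp) (p : Prog)

/-! Every operation in an expression costs one step. -/

def NExp.cost : NExp → ℕ
  | .lit _ => 1
  | .get _ i => i.cost + 1
  | .succ e => e.cost + 1
  | .pred e => e.cost + 1

def RExp.cost : RExp → ℕ
  | .zero => 1
  | .get _ i => i.cost + 1
  | .add e f => e.cost + f.cost + 1
  | .sub e f => e.cost + f.cost + 1
  | .half e => e.cost + 1

def BExp.cost : BExp → ℕ
  | .nlt e f => e.cost + f.cost + 1
  | .rlt e f => e.cost + f.cost + 1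
  | .not b => b.cost + 1
  | .and b c => b.cost + c.cost + 1

def NExp.eval (σ : State) : NExp → ℕ
  | .lit k => k
  | .get a i => σ.nat a (i.eval σ)
  | .succ e => e.eval σ + 1
  | .pred e => e.eval σ - 1

noncomputable def RExp.eval (σ : State) : RExp → ℝ
  | .zero => 0
  | .get a i => σ.real a (i.eval σ)
  | .add e f => e.eval σ + f.eval σ
  | .sub e f => e.eval σ - f.eval σ
  | .half e => e.eval σ / 2

def BExp.Holds (σ : State) : BExp → Prop
  | .nlt e f => e.eval σ < f.eval σ
  | .rlt e f => e.eval σ < f.eval σ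
  | .not b => ¬ b.Holds σ
  | .and b c => b.Holds σ ∧ c.Holds σ

/-- Write the natural number `x` into cell `i` of array `a`. -/
def State.setNat (σ : State) (a i x : ℕ) : State :=
  { σ with nat := Function.update σ.nat a (Function.update (σ.nat a) i x) }

/-- Write the real number `x` into cell `i` of array `a`. -/
noncomputable def State.setReal (σ : State) (a i : ℕ) (x : ℝ) : State :=
  { σ with real := Function.update σ.real a (Function.update (σ.real a) i x) }

/-- `Run p σ t τ`: the program `p`, started in memory `σ`, halts after exactly `t` steps with
memory `τ`. At most one rule applies to given `p` and `σ`, so `t` and `τ` are determined by them. -/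
inductive Run : Prog → State → ℕ → State → Prop
  | skip (σ : State) : Run .skip σ 1 σ
  | nset (a : ℕ) (i e : NExp) (σ : State) :
      Run (.nset a i e) σ (i.cost + e.cost + 1) (σ.setNat a (i.eval σ) (e.eval σ))
  | rset (a : ℕ) (i : NExp) (e : RExp) (σ : State) :
      Run (.rset a i e) σ (i.cost + e.cost + 1) (σ.setReal a (i.eval σ) (e.eval σ))
  | seq {p q : Prog} {σ τ υ : State} {s t : ℕ} (hp : Run p σ s τ) (hq : Run q τ t υ) :
      Run (.seq p q) σ (s + t + 1) υ
  | iteTrue {b : BExp} {p q : Prog} {σ τ : State} {t : ℕ} (hb : b.Holds σ) (hp : Run p σ t τ) :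
      Run (.ite b p q) σ (b.cost + t + 1) τ
  | iteFalse {b : BExp} {p q : Prog} {σ τ : State} {t : ℕ} (hb : ¬ b.Holds σ) (hq : Run q σ t τ) :
      Run (.ite b p q) σ (b.cost + t + 1) τ
  | whileFalse {b : BExp} {p : Prog} {σ : State} (hb : ¬ b.Holds σ) :
      Run (.while b p) σ (b.cost + 1) σ
  | whileTrue {b : BExp} {p : Prog} {σ τ υ : State} {s t : ℕ} (hb : b.Holds σ)
      (hp : Run p σ s τ) (hw : Run (.while b p) τ t υ) :
      Run (.while b p) σ (b.cost + s + t + 1) υ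

/-! ## Input -/

/-- The list `E` contains every edge of `G` exactly once (in arbitrary order and orientation). -/
def ListsEdges {n : ℕ} (G : SimpleGraph (Fin n)) (E : List (Fin n × Fin n)) : Prop :=
  (E.map fun e => s(e.1, e.2)).Nodup ∧ ∀ u v, G.Adj u v ↔ s(u, v) ∈ E.map fun e => s(e.1, e.2)

/-- Initial memory. Natural array `0` holds the number of boxes and the number of edges in its cells
`0` and `1`; natural arrays `1` and `2` hold the two ends of the edges in `E`; real arrays `0` and `1`
hold the widths and the heights of the boxes. All other cells are `0`. -/
noncomputable def inputState {n : ℕ} (w h : Fin n → ℝ) (E : List (Fin n × Fin n)) : State where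
  nat := fun a i => match a with
    | 0 => if i = 0 then n else if i = 1 then E.length else 0
    | 1 => if hi : i < E.length then ((E[i]).1 : ℕ) else 0
    | 2 => if hi : i < E.length then ((E[i]).2 : ℕ) else 0
    | _ => 0
  real := fun a i => match a with
    | 0 => if hi : i < n then w ⟨i, hi⟩ else 0
    | 1 => if hi : i < n then h ⟨i, hi⟩ else 0
    | _ => 0

end WRAC

namespace WRAC

/-! ## Reasoning about programs -/

/-! Geometry of contacts. Two touching boxes share a segment. A box that touches both of them sits
at one of the two ends of this segment, and two boxes at the same end overlap (`Box.up_or_down`,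
`Box.Up.unique`). So in a realizable graph the ends of an edge have at most two common neighbours.
In a quasi-triangulated graph the ends of an edge off the outer 4-cycle have at least two, because
the triangular faces on its two sides have different third vertices
(`IsQuasiTriangulated.exists_outerCycle`). The ends of an outer edge have at least one, and exactly
one if the graph is realizable (`OuterCycle.common_unique`). The lists of common neighbours
therefore reveal the outer cycle and all the local structure that is needed; no embedding is
computed.

Forced positions. Both ends of every contact of an inner box are closed by further boxes. Hence an
inner box has neighbours on all four sides, and the four outer boxes surround the inner ones. After
reflections, a translation and at most one step of rotation of the names, `a`, `b`, `c`, `d` lie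
left, below, right and above, and the frame has its lower left corner at the origin
(`exists_normal`). Now every inner position is determined. The bottom-left corner of an inner box
`z` is the concave corner formed by the right side of a box `x` and the top side of a box `y`
adjacent to `x`. Unless these are `a` and `b`, they have a second common neighbour `z'`, which lies
further down or to the left. Whether `z` goes into that corner is decided by the positions of `x`,
`y`, `z'` (`Normal.corner_of_test`), and all three precede `z` in the order by `l + b`, so that a
search driven by a queue reaches every inner box (`Normal.all_placed`). The extent of the inner
boxes gives the rectangle, and the outer boxes go around it like the blades of a windmill (`Framed`,
`Normal.rep_framed`). If there is any representation in this orientation, the outcome is one.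

Verification. The outcome has to be checked in linear time, although disjointness concerns
quadratically many pairs. Local conditions suffice (`rep_of_checks`): adjacent boxes touch, the two
common neighbours along an edge with an inner end do not overlap, the inner boxes lie in the
rectangle, and the column of boxes along each right side has only one start. Then the boxes along a
right side form a single chain, hence so do the boxes met by a horizontal line, and no two boxes
overlap. If the check fails for both orientations, there is no representation. With four boxes only,
there always is one (`Crossed.rep`).

Linear time. Each contact can be charged to one of its two boxes, at most four to each (`Box.Owns`),
so a realizable graph has at most `4 n` edges, and the sum over the edges of the smaller degree of
the two ends is at most `8 m` (`sum_small_le`). Common neighbours are found by marking the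
neighbours of the larger end and scanning those of the smaller one. Both bounds are enforced at run
time: an excess of edges or an exhausted supply of fuel proves that the instance is not realizable.
During the placement each box is queued once, and the lists that are traversed have total length at
most `4 m`. -/

theorem State.setNat_nat (σ : State) (a i x b : ℕ) :
    (σ.setNat a i x).nat b = if b = a then Function.update (σ.nat b) i x else σ.nat b := by
  unfold State.setNat
  by_cases h : b = a
  · subst h; simp
  · simp [h]

@[simp] theorem State.setNat_real (σ : State) (a i x : ℕ) : (σ.setNat a i x).real = σ.real := rfl

theorem State.setReal_real (σ : State) (a i : ℕ) (x : ℝ) (b : ℕ) :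
    (σ.setReal a i x).real b = if b = a then Function.update (σ.real b) i x else σ.real b := by
  unfold State.setReal
  by_cases h : b = a
  · subst h; simp
  · simp [h]

@[simp] theorem State.setReal_nat (σ : State) (a i : ℕ) (x : ℝ) :
    (σ.setReal a i x).nat = σ.nat := rfl

/-- `Ex P σ Q`: the program `P` halts when started in `σ`, and `Q` holds of the final memory and of
the number of steps. -/
def Ex (P : Prog) (σ : State) (Q : State → ℕ → Prop) : Prop :=
  ∃ t τ, Run P σ t τ ∧ Q τ t

theorem Ex.mono {P : Prog} {σ : State} {Q Q' : State → ℕ → Prop} (h : Ex P σ Q)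
    (hQ : ∀ τ t, Q τ t → Q' τ t) : Ex P σ Q' := by
  obtain ⟨t, τ, hr, hq⟩ := h
  exact ⟨t, τ, hr, hQ _ _ hq⟩

theorem Ex.seq {P P' : Prog} {σ : State} {Q : State → ℕ → Prop}
    (h : Ex P σ fun τ t => Ex P' τ fun υ s => Q υ (t + s + 1)) : Ex (.seq P P') σ Q := by
  obtain ⟨t, τ, hr, s, υ, hr', hq⟩ := h
  exact ⟨_, υ, .seq hr hr', hq⟩

theorem Ex.iteTrue {b : BExp} {P P' : Prog} {σ : State} {Q : State → ℕ → Prop} (hb : b.Holds σ)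
    (h : Ex P σ fun τ t => Q τ (b.cost + t + 1)) : Ex (.ite b P P') σ Q := by
  obtain ⟨t, τ, hr, hq⟩ := h
  exact ⟨_, τ, .iteTrue hb hr, hq⟩

theorem Ex.iteFalse {b : BExp} {P P' : Prog} {σ : State} {Q : State → ℕ → Prop} (hb : ¬ b.Holds σ)
    (h : Ex P' σ fun τ t => Q τ (b.cost + t + 1)) : Ex (.ite b P P') σ Q := by
  obtain ⟨t, τ, hr, hq⟩ := h
  exact ⟨_, τ, .iteFalse hb hr, hq⟩

/-- The loop rule; the invariant also speaks about the time `t` spent so far. -/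
theorem Ex.whileLoop {b : BExp} {P : Prog} (Inv : State → ℕ → Prop) (μ : State → ℕ)
    (step : ∀ σ t, Inv σ t → b.Holds σ →
      Ex P σ fun τ s => Inv τ (t + (b.cost + s + 1)) ∧ μ τ < μ σ) :
    ∀ σ t, Inv σ t →
      Ex (.while b P) σ fun τ s => ¬ b.Holds τ ∧ ∃ t', Inv τ t' ∧ t + s = t' + (b.cost + 1) := by
  intro σ
  induction hm : μ σ using Nat.strong_induction_on generalizing σ with
  | _ k ih =>
    intro t hI
    by_cases hb : b.Holds σ
    · obtain ⟨s, τ, hr, hI', hlt⟩ := step σ t hI hb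
      obtain ⟨s', υ, hr', hnb, t', hI'', ht'⟩ := ih (μ τ) (hm ▸ hlt) τ rfl _ hI'
      exact ⟨_, υ, .whileTrue hb hr hr', hnb, t', hI'', by omega⟩
    · exact ⟨_, σ, .whileFalse hb, hb, t, hI, rfl⟩

/-! ### Programs without loops -/

/-- The memory after running a program without loops. -/
noncomputable def Prog.exec : Prog → State → State
  | .skip, σ => σ
  | .nset a i e, σ => σ.setNat a (i.eval σ) (e.eval σ)
  | .rset a i e, σ => σ.setReal a (i.eval σ) (e.eval σ)
  | .seq p q, σ => q.exec (p.exec σ)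
  | .ite b p q, σ => open scoped Classical in if b.Holds σ then p.exec σ else q.exec σ
  | .while _ _, σ => σ

def Prog.LoopFree : Prog → Prop
  | .seq p q => p.LoopFree ∧ q.LoopFree
  | .ite _ p q => p.LoopFree ∧ q.LoopFree
  | .while _ _ => False
  | _ => True

/-- A bound for the running time of a program without loops. -/
def Prog.bound : Prog → ℕ
  | .skip => 1
  | .nset _ i e => i.cost + e.cost + 1
  | .rset _ i e => i.cost + e.cost + 1
  | .seq p q => p.bound + q.bound + 1
  | .ite b p q => b.cost + (p.bound + q.bound) + 1
  | .while _ _ => 0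

theorem Prog.halts_exec {P : Prog} (h : P.LoopFree) (σ : State) :
    ∃ t, Run P σ t (P.exec σ) ∧ t ≤ P.bound := by
  induction P generalizing σ with
  | skip => exact ⟨_, .skip σ, le_rfl⟩
  | nset a i e => exact ⟨_, .nset a i e σ, le_rfl⟩
  | rset a i e => exact ⟨_, .rset a i e σ, le_rfl⟩
  | seq p q hp hq =>
    obtain ⟨t, ht, hb⟩ := hp h.1 σ
    obtain ⟨s, hs, hb'⟩ := hq h.2 (p.exec σ)
    exact ⟨_, .seq ht hs, by simp only [Prog.bound]; omega⟩
  | ite b p q hp hq =>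
    by_cases hb : b.Holds σ
    · obtain ⟨t, ht, hb'⟩ := hp h.1 σ
      exact ⟨_, by simpa [Prog.exec, hb] using Run.iteTrue hb ht, by simp only [Prog.bound]; omega⟩
    · obtain ⟨t, ht, hb'⟩ := hq h.2 σ
      exact ⟨_, by simpa [Prog.exec, hb] using Run.iteFalse hb ht, by simp only [Prog.bound]; omega⟩
  | _ => exact h.elim

theorem Ex.of_exec {P : Prog} (h : P.LoopFree) {σ : State} {Q : State → ℕ → Prop}
    (hQ : ∀ t ≤ P.bound, Q (P.exec σ) t) : Ex P σ Q := by
  obtain ⟨t, hr, ht⟩ := Prog.halts_exec h σ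
  exact ⟨t, _, hr, hQ t ht⟩

/-! ### What a program leaves unchanged -/

/-- The arrays of natural numbers that a program may write to. -/
def Prog.natWrites : Prog → List ℕ
  | .nset a _ _ => [a]
  | .seq p q => p.natWrites ++ q.natWrites
  | .ite _ p q => p.natWrites ++ q.natWrites
  | .while _ p => p.natWrites
  | _ => []

/-- The arrays of real numbers that a program may write to. -/
def Prog.realWrites : Prog → List ℕ
  | .rset a _ _ => [a]
  | .seq p q => p.realWrites ++ q.realWrites
  | .ite _ p q => p.realWrites ++ q.realWrites
  | .while _ p => p.realWrites
  | _ => []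

theorem Run.nat_eq {P : Prog} {σ τ : State} {t : ℕ} (h : Run P σ t τ) {a : ℕ}
    (ha : a ∉ P.natWrites) : τ.nat a = σ.nat a := by
  induction h with
  | skip => rfl
  | nset b i e σ =>
    simp only [Prog.natWrites, List.mem_singleton] at ha
    simp [State.setNat_nat, ha]
  | rset => rfl
  | seq _ _ h₁ h₂ =>
    simp only [Prog.natWrites, List.mem_append, not_or] at ha
    rw [h₂ ha.2, h₁ ha.1]
  | iteTrue _ _ h₁ =>
    simp only [Prog.natWrites, List.mem_append, not_or] at ha
    exact h₁ ha.1
  | iteFalse _ _ h₁ =>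
    simp only [Prog.natWrites, List.mem_append, not_or] at ha
    exact h₁ ha.2
  | whileFalse => rfl
  | whileTrue _ _ _ h₁ h₂ => rw [h₂ ha, h₁ ha]

theorem Run.real_eq {P : Prog} {σ τ : State} {t : ℕ} (h : Run P σ t τ) {a : ℕ}
    (ha : a ∉ P.realWrites) : τ.real a = σ.real a := by
  induction h with
  | skip => rfl
  | nset => rfl
  | rset b i e σ =>
    simp only [Prog.realWrites, List.mem_singleton] at ha
    simp [State.setReal_real, ha]
  | seq _ _ h₁ h₂ =>
    simp only [Prog.realWrites, List.mem_append, not_or] at ha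
    rw [h₂ ha.2, h₁ ha.1]
  | iteTrue _ _ h₁ =>
    simp only [Prog.realWrites, List.mem_append, not_or] at ha
    exact h₁ ha.1
  | iteFalse _ _ h₁ =>
    simp only [Prog.realWrites, List.mem_append, not_or] at ha
    exact h₁ ha.2
  | whileFalse => rfl
  | whileTrue _ _ _ h₁ h₂ => rw [h₂ ha, h₁ ha]

/-- The memories `σ` and `τ` differ at most in the given arrays. -/
def SameBut (ns rs : List ℕ) (σ τ : State) : Prop :=
  (∀ a, a ∉ ns → τ.nat a = σ.nat a) ∧ ∀ a, a ∉ rs → τ.real a = σ.real a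

theorem Ex.frame {P : Prog} {σ : State} {Q : State → ℕ → Prop} (h : Ex P σ Q) :
    Ex P σ fun τ t => Q τ t ∧ SameBut P.natWrites P.realWrites σ τ := by
  obtain ⟨t, τ, hr, hq⟩ := h
  exact ⟨t, τ, hr, hq, fun _ ha => hr.nat_eq ha, fun _ ha => hr.real_eq ha⟩

/-! ### Counting loops -/

/-- The scalar stored in cell `0` of a natural array. -/
abbrev sc (a : ℕ) : NExp := .get a (.lit 0)

/-- Run `body` with cell `0` of array `i` holding `0`, `1`, …, `N - 1`. -/
def forLoop (i : ℕ) (N : NExp) (body : Prog) : Prog :=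
  .seq (.nset i (.lit 0) (.lit 0))
    (.while (.nlt (sc i) N) (.seq body (.nset i (.lit 0) (.succ (sc i)))))

/-- The invariant sees the time spent so far, so that iterations of different cost can be amortised.
Each round adds `Nx.cost + 10` to the cost of the body: test, increment and bookkeeping.
`Ex.forLoop` is the special case of a uniform bound. -/
theorem Ex.forLoop' {i : ℕ} {Nx : NExp} {body : Prog} {σ : State} (N : ℕ)
    (Inv : ℕ → State → ℕ → Prop)
    (hN : ∀ k τ t, Inv k τ t → Nx.eval τ = N)
    (h0 : Inv 0 (σ.setNat i 0 0) 0)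
    (step : ∀ k τ t, k < N → τ.nat i 0 = k → Inv k τ t →
      Ex body τ fun υ s => υ.nat i 0 = k ∧
        Inv (k + 1) (υ.setNat i 0 (k + 1)) (t + s + (Nx.cost + 10))) :
    Ex (forLoop i Nx body) σ fun τ t => ∃ t', Inv N τ t' ∧ t ≤ t' + Nx.cost + 20 := by
  refine Ex.seq ⟨_, _, .nset _ _ _ _, ?_⟩
  have key := Ex.whileLoop (b := .nlt (sc i) Nx) (P := .seq body (.nset i (.lit 0) (.succ (sc i))))
    (fun τ t => τ.nat i 0 ≤ N ∧ Inv (τ.nat i 0) τ t) (fun τ => N - τ.nat i 0) ?_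
    (σ.setNat i 0 0) 0 ?_
  · refine key.mono ?_
    rintro τ s ⟨hb, t', ⟨hle, hI⟩, ht⟩
    have hk : τ.nat i 0 = N := by
      simp only [BExp.Holds, NExp.eval] at hb
      rw [hN _ _ _ hI] at hb; omega
    refine ⟨t', hk ▸ hI, ?_⟩
    simp only [BExp.cost, NExp.cost, zero_add] at *
    omega
  · rintro τ t ⟨hle, hI⟩ hb
    simp only [BExp.Holds, NExp.eval] at hb
    rw [hN _ _ _ hI] at hb
    refine Ex.seq ((step _ τ t hb rfl hI).mono ?_)
    rintro υ s ⟨hk, hI'⟩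
    refine ⟨_, _, .nset _ _ _ _, ?_⟩
    have e1 : (υ.setNat i 0 (υ.nat i 0 + 1)).nat i 0 = υ.nat i 0 + 1 := by
      simp [State.setNat_nat]
    simp only [NExp.eval, NExp.cost, BExp.cost]
    rw [e1, hk]
    refine ⟨⟨by omega, ?_⟩, by omega⟩
    convert hI' using 1
    omega
  · have : (σ.setNat i 0 0).nat i 0 = 0 := by simp [State.setNat_nat]
    rw [this]
    exact ⟨Nat.zero_le _, h0⟩

theorem Ex.forLoop {i : ℕ} {Nx : NExp} {body : Prog} {σ : State} (N B : ℕ)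
    (Inv : ℕ → State → Prop)
    (hN : ∀ k τ, Inv k τ → Nx.eval τ = N)
    (h0 : Inv 0 (σ.setNat i 0 0))
    (step : ∀ k τ, k < N → τ.nat i 0 = k → Inv k τ →
      Ex body τ fun υ s => s ≤ B ∧ υ.nat i 0 = k ∧ Inv (k + 1) (υ.setNat i 0 (k + 1))) :
    Ex (forLoop i Nx body) σ fun τ t => t ≤ (N + 1) * (B + Nx.cost + 20) ∧ Inv N τ := by
  refine (Ex.forLoop' (σ := σ) N (fun k τ t => t ≤ k * (B + Nx.cost + 10) ∧ Inv k τ)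
    (fun k τ t h => hN k τ h.2) ⟨by simp, h0⟩ ?_).mono ?_
  · rintro k τ t hk hi ⟨ht, hI⟩
    refine (step k τ hk hi hI).mono ?_
    rintro υ s ⟨hs, h1, h2⟩
    refine ⟨h1, ?_, h2⟩
    rw [Nat.add_mul, one_mul]; omega
  · rintro τ t ⟨t', ⟨ht', hI⟩, ht⟩
    refine ⟨?_, hI⟩
    have : N * (B + Nx.cost + 10) ≤ N * (B + Nx.cost + 20) := Nat.mul_le_mul_left _ (by omega)
    rw [Nat.add_mul, one_mul]; omega

/-! ## Boxes and their contacts -/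

/-- The sides of a box. -/
@[ext] structure Box where
  l : ℝ
  r : ℝ
  b : ℝ
  t : ℝ

namespace Box

def Pos (x : Box) : Prop := x.l < x.r ∧ x.b < x.t

/-- `x` touches `y` from the left. -/
def Beside (x y : Box) : Prop := x.r = y.l ∧ x.b < y.t ∧ y.b < x.t

/-- `x` touches `y` from below. -/
def Below (x y : Box) : Prop := x.t = y.b ∧ x.l < y.r ∧ y.l < x.r

def Contact (x y : Box) : Prop := Beside x y ∨ Beside y x ∨ Below x y ∨ Below y x

/-- The interiors are disjoint. -/
def Apart (x y : Box) : Prop := x.r ≤ y.l ∨ y.r ≤ x.l ∨ x.t ≤ y.b ∨ y.t ≤ x.b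

theorem Contact.symm {x y : Box} (h : Contact x y) : Contact y x := by
  unfold Contact at *; tauto

theorem Apart.symm {x y : Box} (h : Apart x y) : Apart y x := by
  unfold Apart at *; tauto

/-- Rotation by a quarter turn. -/
def rot (x : Box) : Box := ⟨-x.t, -x.b, x.l, x.r⟩

def flipX (x : Box) : Box := ⟨-x.r, -x.l, x.b, x.t⟩

def flipY (x : Box) : Box := ⟨x.l, x.r, -x.t, -x.b⟩

def swap (x : Box) : Box := ⟨x.b, x.t, x.l, x.r⟩

def shift (p q : ℝ) (x : Box) : Box := ⟨x.l + p, x.r + p, x.b + q, x.t + q⟩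

section

variable {x y z z' : Box}

theorem Pos.rot (h : x.Pos) : x.rot.Pos := ⟨neg_lt_neg h.2, h.1⟩
theorem Pos.flipX (h : x.Pos) : x.flipX.Pos := ⟨neg_lt_neg h.1, h.2⟩
theorem Pos.flipY (h : x.Pos) : x.flipY.Pos := ⟨h.1, neg_lt_neg h.2⟩
theorem Pos.swap (h : x.Pos) : x.swap.Pos := ⟨h.2, h.1⟩

theorem beside_rot : Beside x.rot y.rot ↔ Below y x := by
  simp only [Beside, Below, Box.rot, neg_inj]
  exact ⟨fun ⟨a, b, c⟩ => ⟨a.symm, c, b⟩, fun ⟨a, b, c⟩ => ⟨a.symm, c, b⟩⟩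

theorem below_rot : Below x.rot y.rot ↔ Beside x y := by
  simp only [Beside, Below, Box.rot, neg_lt_neg_iff]
  exact ⟨fun ⟨a, b, c⟩ => ⟨a, c, b⟩, fun ⟨a, b, c⟩ => ⟨a, c, b⟩⟩

theorem Contact.rot (h : Contact x y) : Contact x.rot y.rot := by
  simp only [Contact, beside_rot, below_rot] at *; tauto

theorem Apart.rot (h : Apart x y) : Apart x.rot y.rot := by
  simp only [Apart, Box.rot, neg_le_neg_iff] at *; tauto

theorem beside_flipX : Beside x.flipX y.flipX ↔ Beside y x := by
  simp only [Beside, Box.flipX, neg_inj]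
  exact ⟨fun ⟨a, b, c⟩ => ⟨a.symm, c, b⟩, fun ⟨a, b, c⟩ => ⟨a.symm, c, b⟩⟩

theorem below_flipX : Below x.flipX y.flipX ↔ Below x y := by
  simp only [Below, Box.flipX, neg_lt_neg_iff]
  exact ⟨fun ⟨a, b, c⟩ => ⟨a, c, b⟩, fun ⟨a, b, c⟩ => ⟨a, c, b⟩⟩

theorem Contact.flipX (h : Contact x y) : Contact x.flipX y.flipX := by
  simp only [Contact, beside_flipX, below_flipX] at *; tauto

theorem Apart.flipX (h : Apart x y) : Apart x.flipX y.flipX := by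
  simp only [Apart, Box.flipX, neg_le_neg_iff] at *; tauto

theorem beside_flipY : Beside x.flipY y.flipY ↔ Beside x y := by
  simp only [Beside, Box.flipY, neg_lt_neg_iff]
  exact ⟨fun ⟨a, b, c⟩ => ⟨a, c, b⟩, fun ⟨a, b, c⟩ => ⟨a, c, b⟩⟩

theorem below_flipY : Below x.flipY y.flipY ↔ Below y x := by
  simp only [Below, Box.flipY, neg_inj]
  exact ⟨fun ⟨a, b, c⟩ => ⟨a.symm, c, b⟩, fun ⟨a, b, c⟩ => ⟨a.symm, c, b⟩⟩

theorem Contact.flipY (h : Contact x y) : Contact x.flipY y.flipY := by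
  simp only [Contact, beside_flipY, below_flipY] at *; tauto

theorem Apart.flipY (h : Apart x y) : Apart x.flipY y.flipY := by
  simp only [Apart, Box.flipY, neg_le_neg_iff] at *; tauto

theorem Contact.swap (h : Contact x y) : Contact x.swap y.swap := by
  simp only [Contact, Beside, Below, Box.swap] at *; tauto

theorem Apart.swap (h : Apart x y) : Apart x.swap y.swap := by
  simp only [Apart, Box.swap] at *; tauto

theorem Contact.shift (p q : ℝ) (h : Contact x y) : Contact (x.shift p q) (y.shift p q) := by
  simpa [Contact, Beside, Below, Box.shift] using h

theorem Apart.shift (p q : ℝ) (h : Apart x y) : Apart (x.shift p q) (y.shift p q) := by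
  simpa [Apart, Box.shift] using h

/-- If `x` touches `y` from the left, `z` sits at the upper end of the common segment. -/
def Up (x y z : Box) : Prop :=
  (x.t < y.t ∧ z.b = x.t ∧ z.r = x.r) ∨ (y.t < x.t ∧ z.b = y.t ∧ z.l = x.r) ∨
    (x.t = y.t ∧ z.b = x.t ∧ z.l < x.r ∧ x.r < z.r)

/-- If `x` touches `y` from the left, `z` sits at the lower end of the common segment. -/
def Down (x y z : Box) : Prop :=
  (y.b < x.b ∧ z.t = x.b ∧ z.r = x.r) ∨ (x.b < y.b ∧ z.t = y.b ∧ z.l = x.r) ∨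
    (x.b = y.b ∧ z.t = x.b ∧ z.l < x.r ∧ x.r < z.r)

/-- A box on the far left of `x` cannot reach `y`, nor can one on the far right of `y` reach `x`. So
`z` lies above or below one of the two boxes, and contact with the other one pins it to an end of
the segment. -/
theorem up_or_down (hx : x.Pos) (hy : y.Pos) (hz : z.Pos) (h : Beside x y) (hxz : Contact x z)
    (hyz : Contact y z) : Up x y z ∨ Down x y z := by
  obtain ⟨hx1, hx2⟩ := hx
  obtain ⟨hy1, hy2⟩ := hy
  obtain ⟨hz1, hz2⟩ := hz
  obtain ⟨h1, h2, h3⟩ := h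
  unfold Up Down
  rcases hxz with ⟨a1, a2, a3⟩ | ⟨a1, a2, a3⟩ | ⟨a1, a2, a3⟩ | ⟨a1, a2, a3⟩ <;>
  rcases hyz with ⟨b1, b2, b3⟩ | ⟨b1, b2, b3⟩ | ⟨b1, b2, b3⟩ | ⟨b1, b2, b3⟩ <;>
  first
  | (exfalso; linarith)
  | grind

/-- The tops of `x` and `y` decide which case of `Up` applies. In each case the box contains one
fixed quadrant near the upper end of the segment, so two such boxes overlap. -/
theorem Up.unique (hx : x.Pos) (hz : z.Pos) (hz' : z'.Pos) (h : Up x y z) (h' : Up x y z')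
    (ha : Apart z z') : False := by
  obtain ⟨hx1, hx2⟩ := hx
  obtain ⟨hz1, hz2⟩ := hz
  obtain ⟨hy1, hy2⟩ := hz'
  unfold Up at *
  unfold Apart at ha
  grind

theorem Down.unique (hx : x.Pos) (hz : z.Pos) (hz' : z'.Pos) (h : Down x y z) (h' : Down x y z')
    (ha : Apart z z') : False := by
  obtain ⟨hx1, hx2⟩ := hx
  obtain ⟨hz1, hz2⟩ := hz
  obtain ⟨hy1, hy2⟩ := hz'
  unfold Down at *
  unfold Apart at ha
  grind

/-- Two boxes that touch both `x` and `y` sit at different ends of the segment between them. -/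
theorem up_and_down (hx : x.Pos) (hy : y.Pos) (hz : z.Pos) (hz' : z'.Pos) (h : Beside x y)
    (hxz : Contact x z) (hyz : Contact y z) (hxz' : Contact x z') (hyz' : Contact y z')
    (ha : Apart z z') : (Up x y z ∧ Down x y z') ∨ (Down x y z ∧ Up x y z') := by
  rcases up_or_down hx hy hz h hxz hyz with h1 | h1 <;>
    rcases up_or_down hx hy hz' h hxz' hyz' with h2 | h2
  · exact (h1.unique hx hz hz' h2 ha).elim
  · exact .inl ⟨h1, h2⟩
  · exact .inr ⟨h1, h2⟩
  · exact (h1.unique hx hz hz' h2 ha).elim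

theorem three_common_of_beside {z'' : Box} (hx : x.Pos) (hy : y.Pos) (hz : z.Pos) (hz' : z'.Pos)
    (hz'' : z''.Pos) (h : Beside x y) (hxz : Contact x z) (hyz : Contact y z) (hxz' : Contact x z')
    (hyz' : Contact y z') (hxz'' : Contact x z'') (hyz'' : Contact y z'') (h1 : Apart z z')
    (h2 : Apart z z'') (h3 : Apart z' z'') : False := by
  rcases up_and_down hx hy hz hz' h hxz hyz hxz' hyz' h1 with ⟨a, b⟩ | ⟨a, b⟩ <;>
    rcases up_or_down hx hy hz'' h hxz'' hyz'' with c | c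
  · exact a.unique hx hz hz'' c h2
  · exact b.unique hx hz' hz'' c h3
  · exact b.unique hx hz' hz'' c h3
  · exact a.unique hx hz hz'' c h2

/-- Pigeonhole: three boxes, but only two ends of the common segment. Horizontal segments are
reduced to vertical ones by a quarter turn. -/
theorem three_common {z'' : Box} (hx : x.Pos) (hy : y.Pos) (hz : z.Pos) (hz' : z'.Pos)
    (hz'' : z''.Pos) (h : Contact x y) (hxz : Contact x z) (hyz : Contact y z) (hxz' : Contact x z')
    (hyz' : Contact y z') (hxz'' : Contact x z'') (hyz'' : Contact y z'') (h1 : Apart z z')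
    (h2 : Apart z z'') (h3 : Apart z' z'') : False := by
  rcases h with h | h | h | h
  · exact three_common_of_beside hx hy hz hz' hz'' h hxz hyz hxz' hyz' hxz'' hyz'' h1 h2 h3
  · exact three_common_of_beside hy hx hz hz' hz'' h hyz hxz hyz' hxz' hyz'' hxz'' h1 h2 h3
  · exact three_common_of_beside hy.rot hx.rot hz.rot hz'.rot hz''.rot (beside_rot.2 h) hyz.rot
      hxz.rot hyz'.rot hxz'.rot hyz''.rot hxz''.rot h1.rot h2.rot h3.rot
  · exact three_common_of_beside hx.rot hy.rot hz.rot hz'.rot hz''.rot (beside_rot.2 h) hxz.rot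
      hyz.rot hxz'.rot hyz'.rot hxz''.rot hyz''.rot h1.rot h2.rot h3.rot

/-- The bottom-left corner of `z` is the concave corner formed by the right side of `x` and the top
side of `y`. -/
def Corner (x y z : Box) : Prop := z.l = x.r ∧ z.b = y.t

/-- The alternative to `Corner` for the second common neighbour: the bottom-left corner of `z` is
weakly below and to the left of the concave corner and differs from it. -/
def Low (x y z : Box) : Prop := z.l ≤ x.r ∧ z.b ≤ y.t ∧ (z.l < x.r ∨ z.b < y.t)

/-- As `y` is less high than `x`, the upper end of the segment is the concave corner itself, and the
box at this end has its bottom-left corner there. The box at the lower end is the low one. -/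
theorem corner_and_low_of_beside (hx : x.Pos) (hy : y.Pos) (hz : z.Pos) (hz' : z'.Pos)
    (h : Beside x y) (ht : y.t < x.t)
    (hxz : Contact x z) (hyz : Contact y z) (hxz' : Contact x z') (hyz' : Contact y z')
    (ha : Apart z z') : (Corner x y z ∧ Low x y z') ∨ (Low x y z ∧ Corner x y z') := by
  have := up_and_down hx hy hz hz' h hxz hyz hxz' hyz' ha
  obtain ⟨h1, h2, h3⟩ := h
  obtain ⟨hz1, hz2⟩ := hz
  obtain ⟨hy1, hy2⟩ := hz'
  obtain ⟨hy3, hy4⟩ := hy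
  unfold Up Down at this
  unfold Corner Low
  grind

/-- The two inequalities leave only the cases that `x` is to the left of `y` or on top of `y`. They
are exchanged by the reflection in the diagonal. -/
theorem corner_and_low (hx : x.Pos) (hy : y.Pos) (hz : z.Pos) (hz' : z'.Pos)
    (h : Contact x y) (hr : x.r < y.r) (ht : y.t < x.t)
    (hxz : Contact x z) (hyz : Contact y z) (hxz' : Contact x z') (hyz' : Contact y z')
    (ha : Apart z z') : (Corner x y z ∧ Low x y z') ∨ (Low x y z ∧ Corner x y z') := by
  rcases h with h | h | h | h
  · exact corner_and_low_of_beside hx hy hz hz' h ht hxz hyz hxz' hyz' ha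
  · have := h.1; have := hx.1; linarith
  · have := h.1; have := hy.2; linarith
  · have := corner_and_low_of_beside hy.swap hx.swap hz.swap hz'.swap h hr hyz.swap hxz.swap
      hyz'.swap hxz'.swap ha.swap
    simp only [Corner, Low, Box.swap] at *
    tauto

/-! ### Each contact is charged to one of the two boxes -/

/-- `y` is the box that touches `x` at the upper end of its left side, at the upper end of its right
side, at the right end of its bottom side, or at the right end of its top side. -/
def Owns (x : Box) (k : Fin 4) (y : Box) : Prop :=
  match k with
  | 0 => Beside y x ∧ x.t ≤ y.t
  | 1 => Beside x y ∧ x.t ≤ y.t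
  | 2 => Below y x ∧ x.r ≤ y.r
  | 3 => Below x y ∧ x.r ≤ y.r

/-- Of two boxes along a vertical segment, one whose top is not the higher is the owner: the other
box covers the upper end of its side. Horizontal segments are treated alike with right ends. -/
theorem Contact.owns (h : Contact x y) : (∃ k, Owns x k y) ∨ ∃ k, Owns y k x := by
  rcases h with h | h | h | h
  · rcases le_total x.t y.t with ht | ht
    · exact .inl ⟨1, h, ht⟩
    · exact .inr ⟨0, h, ht⟩
  · rcases le_total x.t y.t with ht | ht
    · exact .inl ⟨0, h, ht⟩
    · exact .inr ⟨1, h, ht⟩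
  · rcases le_total x.r y.r with ht | ht
    · exact .inl ⟨3, h, ht⟩
    · exact .inr ⟨2, h, ht⟩
  · rcases le_total x.r y.r with ht | ht
    · exact .inl ⟨2, h, ht⟩
    · exact .inr ⟨3, h, ht⟩

/-- Two boxes in the same slot both cover the points just outside the same end of the same side of
`x`. -/
theorem Owns.not_apart {k : Fin 4} (hx : x.Pos) (hz : z.Pos) (hz' : z'.Pos) (h : Owns x k z)
    (h' : Owns x k z') : ¬ Apart z z' := by
  obtain ⟨hx1, hx2⟩ := hx
  obtain ⟨hz1, hz2⟩ := hz
  obtain ⟨hy1, hy2⟩ := hz'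
  unfold Apart
  rintro (ha | ha | ha | ha) <;> fin_cases k <;>
    simp only [Owns, Beside, Below] at h h' <;>
    obtain ⟨⟨_, _, _⟩, _⟩ := h <;> obtain ⟨⟨_, _, _⟩, _⟩ := h' <;> linarith

end

end Box

/-! ## Local structure of a representation -/

open Box
/-- Adjacent boxes touch, and the two ends of a contact of a box in `I` are closed by two further
boxes. -/
structure Local {V : Type*} (G : SimpleGraph V) (I : Set V) (B : V → Box) : Prop where
  pos : ∀ v, (B v).Pos
  contact : ∀ u v, G.Adj u v → Contact (B u) (B v)
  two : ∀ u v, G.Adj u v → u ∈ I → ∃ z z', G.Adj u z ∧ G.Adj v z ∧ G.Adj u z' ∧ G.Adj v z' ∧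
    Apart (B z) (B z')

namespace Local

variable {V : Type*} {G : SimpleGraph V} {I : Set V} {B : V → Box}

theorem rot (h : Local G I B) : Local G I (fun v => (B v).rot) where
  pos v := (h.pos v).rot
  contact u v huv := (h.contact u v huv).rot
  two u v huv hu := by
    obtain ⟨z, z', h1, h2, h3, h4, h5⟩ := h.two u v huv hu
    exact ⟨z, z', h1, h2, h3, h4, h5.rot⟩

/-- The two common neighbours supplied by `two` do not overlap, so they occupy different ends. -/
theorem ends (h : Local G I B) {u v : V} (huv : G.Adj u v) (hI : u ∈ I ∨ v ∈ I)
    (hb : Beside (B u) (B v)) :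
    (∃ z, G.Adj u z ∧ G.Adj v z ∧ Up (B u) (B v) (B z)) ∧
      ∃ z, G.Adj u z ∧ G.Adj v z ∧ Down (B u) (B v) (B z) := by
  obtain ⟨z, z', h1, h2, h3, h4, h5⟩ : ∃ z z', G.Adj u z ∧ G.Adj v z ∧ G.Adj u z' ∧ G.Adj v z' ∧
      Apart (B z) (B z') := by
    rcases hI with hI | hI
    · exact h.two u v huv hI
    · obtain ⟨z, z', h1, h2, h3, h4, h5⟩ := h.two v u huv.symm hI
      exact ⟨z, z', h2, h1, h4, h3, h5⟩
  rcases up_and_down (h.pos u) (h.pos v) (h.pos z) (h.pos z') hb (h.contact _ _ h1)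
    (h.contact _ _ h2) (h.contact _ _ h3) (h.contact _ _ h4) h5 with ⟨a, b⟩ | ⟨a, b⟩
  · exact ⟨⟨z, h1, h2, a⟩, ⟨z', h3, h4, b⟩⟩
  · exact ⟨⟨z', h3, h4, b⟩, ⟨z, h1, h2, a⟩⟩

/-- The left neighbour at the bottom end of the left side, and what closes that end. -/
theorem lowest_left [Finite V] (h : Local G I B) {z x₀ : V} (hz : z ∈ I) (ha : G.Adj x₀ z)
    (hb : Beside (B x₀) (B z)) :
    ∃ x y, G.Adj x z ∧ G.Adj y z ∧ G.Adj x y ∧ Beside (B x) (B z) ∧ (B x).b ≤ (B z).b ∧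
      (B y).t = (B z).b ∧ (B y).l ≤ (B z).l ∧ (B z).l < (B y).r := by
  obtain ⟨x, ⟨hx, hxb⟩, hmin⟩ := Set.exists_min_image {x | G.Adj x z ∧ Beside (B x) (B z)}
    (fun x => (B x).b) (Set.toFinite _) ⟨x₀, ha, hb⟩
  obtain ⟨y, hy, hyz, hd⟩ := (h.ends hx (.inr hz) hxb).2
  have p1 := h.pos y
  have p2 := h.pos x
  have p3 := h.pos z
  obtain ⟨h1, h2, h3⟩ := hxb
  rcases hd with ⟨d1, d2, d3⟩ | ⟨d1, d2, d3⟩ | ⟨d1, d2, d3, d4⟩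
  -- Here the closing box `y` ends on the line of contact, so it is itself a left neighbour of `z`
  -- and starts lower than `x`.
  · have := hmin y ⟨hyz.symm, d3.trans h1, by linarith [p1.2], by linarith⟩
    linarith [p1.2]
  · exact ⟨x, y, hx, hyz.symm, hy, ⟨h1, h2, h3⟩, d1.le, d2, by linarith, by linarith [p1.1]⟩
  · exact ⟨x, y, hx, hyz.symm, hy, ⟨h1, h2, h3⟩, d1.le, by linarith, by linarith, by linarith⟩

theorem exists_below [Finite V] (h : Local G I B) {z x₀ : V} (hz : z ∈ I) (ha : G.Adj z x₀)
    (hb : Beside (B x₀) (B z)) : ∃ y, G.Adj z y ∧ Below (B y) (B z) := by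
  obtain ⟨x, y, -, h2, -, -, -, h6, h7, h8⟩ := h.lowest_left hz ha.symm hb
  exact ⟨y, h2.symm, h6, by linarith [(h.pos z).1], h8⟩

/-- A box of `I` has neighbours on all sides. -/
theorem exists_left [Finite V] (h : Local G I B) {z x₀ : V} (hz : z ∈ I) (ha : G.Adj z x₀) :
    ∃ y, G.Adj z y ∧ Beside (B y) (B z) := by
  -- A neighbour on the left yields one below. Applied to rotated copies, this also leads from above
  -- to the left, from the right to above, and from below to the right, so any neighbour at all
  -- suffices.
  have s0 : ∀ B : V → Box, Local G I B → (∃ y, G.Adj z y ∧ Beside (B y) (B z)) →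
      ∃ y, G.Adj z y ∧ Below (B y) (B z) := fun B h ⟨_, hy, hb⟩ => h.exists_below hz hy hb
  have s1 : ∀ B : V → Box, Local G I B → (∃ y, G.Adj z y ∧ Below (B z) (B y)) →
      ∃ y, G.Adj z y ∧ Beside (B y) (B z) := fun B h ⟨y, hy, hb⟩ => by
    obtain ⟨y', hy', hb'⟩ := s0 _ h.rot ⟨y, hy, beside_rot.2 hb⟩
    exact ⟨y', hy', below_rot.1 hb'⟩
  have s2 : ∀ B : V → Box, Local G I B → (∃ y, G.Adj z y ∧ Beside (B z) (B y)) →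
      ∃ y, G.Adj z y ∧ Below (B z) (B y) := fun B h ⟨y, hy, hb⟩ => by
    obtain ⟨y', hy', hb'⟩ := s1 _ h.rot ⟨y, hy, below_rot.2 hb⟩
    exact ⟨y', hy', beside_rot.1 hb'⟩
  have s3 : ∀ B : V → Box, Local G I B → (∃ y, G.Adj z y ∧ Below (B y) (B z)) →
      ∃ y, G.Adj z y ∧ Beside (B z) (B y) := fun B h ⟨y, hy, hb⟩ => by
    obtain ⟨y', hy', hb'⟩ := s2 _ h.rot ⟨y, hy, beside_rot.2 hb⟩
    exact ⟨y', hy', below_rot.1 hb'⟩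
  rcases h.contact _ _ ha with hc | hc | hc | hc
  · exact s1 _ h (s2 _ h ⟨x₀, ha, hc⟩)
  · exact ⟨x₀, ha, hc⟩
  · exact s1 _ h ⟨x₀, ha, hc⟩
  · exact s1 _ h (s2 _ h (s3 _ h ⟨x₀, ha, hc⟩))

/-- The left side of a box of `I` is covered by its neighbours. -/
theorem left_cover [Finite V] (h : Local G I B) {z x₀ : V} (hz : z ∈ I) (ha : G.Adj z x₀) {y : ℝ}
    (hy : (B z).b ≤ y) (hy' : y < (B z).t) :
    ∃ x, G.Adj x z ∧ Beside (B x) (B z) ∧ (B x).b ≤ y ∧ y < (B x).t := by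
  obtain ⟨x₁, hx₁, hb₁⟩ := h.exists_left hz ha
  obtain ⟨x₂, -, hx₂, -, -, hb₂, hle, -⟩ := h.lowest_left hz hx₁.symm hb₁
  obtain ⟨x, ⟨hx, hxb, hxy⟩, hmax⟩ := Set.exists_max_image
    {x | G.Adj x z ∧ Beside (B x) (B z) ∧ (B x).b ≤ y} (fun x => (B x).b) (Set.toFinite _)
    ⟨x₂, hx₂, hb₂, hle.trans hy⟩
  refine ⟨x, hx, hxb, hxy, ?_⟩
  -- If the highest candidate ended at or below `y`, the box closing its upper end would be a left
  -- neighbour that starts higher and still not above `y`.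
  by_contra! hlt
  obtain ⟨w, hw, hwz, hu⟩ := (h.ends hx (.inr hz) hxb).1
  obtain ⟨h1, h2, h3⟩ := hxb
  have p1 := h.pos w
  have p2 := h.pos x
  rcases hu with ⟨d1, d2, d3⟩ | ⟨d1, d2, d3⟩ | ⟨d1, d2, d3, d4⟩
  · have := hmax w ⟨hwz.symm, ⟨d3.trans h1, by linarith, by linarith [p1.2]⟩, by linarith⟩
    linarith [p2.2]
  · linarith
  · linarith

end Local

/-! ## Local checks imply that no two boxes overlap -/

/-- Intervals that are linked into chains by an injective predecessor relation with a single root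
form one chain. -/
theorem eq_or_le_of_chain {ι : Type*} {S : Set ι} (hS : S.Finite) (s e : ι → ℝ)
    (hse : ∀ i ∈ S, s i < e i) (root : ι → Prop) (pred : ι → ι → Prop)
    (hpred : ∀ i ∈ S, root i ∨ ∃ k ∈ S, pred k i)
    (heq : ∀ k ∈ S, ∀ i ∈ S, pred k i → e k = s i)
    (hinj : ∀ k ∈ S, ∀ i ∈ S, ∀ j ∈ S, pred k i → pred k j → i = j)
    (hroot : ∀ i ∈ S, ∀ j ∈ S, root i → root j → i = j)
    (hfirst : ∀ i ∈ S, ∀ k ∈ S, root i → ¬ e k ≤ s i) :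
    ∀ i ∈ S, ∀ j ∈ S, i = j ∨ e i ≤ s j ∨ e j ≤ s i := by
  have hrank : ∀ k ∈ S, ∀ i ∈ S, s k < s i →
      {x ∈ S | s x < s k}.ncard < {x ∈ S | s x < s i}.ncard := by
    intro k hk i hi hki
    refine Set.ncard_lt_ncard ?_ (hS.subset fun x hx => hx.1)
    exact ⟨fun x hx => ⟨hx.1, hx.2.trans hki⟩, fun h => lt_irrefl _ (h ⟨hk, hki⟩).2⟩
  -- Induction on the total number of intervals that start before one of the two. Going to a
  -- predecessor lowers this number.
  have main : ∀ N, ∀ i ∈ S, ∀ j ∈ S,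
      {x ∈ S | s x < s i}.ncard + {x ∈ S | s x < s j}.ncard = N →
      i = j ∨ e i ≤ s j ∨ e j ≤ s i := by
    intro N
    induction N using Nat.strong_induction_on with
    | _ N ih =>
      intro i hi j hj hN
      have one : ∀ i ∈ S, ∀ j ∈ S, {x ∈ S | s x < s i}.ncard + {x ∈ S | s x < s j}.ncard = N →
          ∀ k ∈ S, pred k i → root j → i = j ∨ e i ≤ s j ∨ e j ≤ s i := by
        intro i hi j hj hN k hk hki hrj
        have hsk : s k < s i := (hse k hk).trans_le (heq k hk i hi hki).le
        rcases ih _ (by have := hrank k hk i hi hsk; omega) k hk j hj rfl with h | h | h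
        · subst h; exact .inr (.inr (heq k hk i hi hki).le)
        · exact (hfirst j hj k hk hrj h).elim
        · exact .inr (.inr (h.trans hsk.le))
      rcases hpred i hi with hri | ⟨k, hk, hki⟩ <;> rcases hpred j hj with hrj | ⟨k', hk', hkj⟩
      · exact .inl (hroot i hi j hj hri hrj)
      · rcases one j hj i hi (by omega) k' hk' hkj hri with h | h | h
        · exact .inl h.symm
        · exact .inr (.inr h)
        · exact .inr (.inl h)
      · exact one i hi j hj hN k hk hki hrj
      · have hsk : s k < s i := (hse k hk).trans_le (heq k hk i hi hki).le
        have hsk' : s k' < s j := (hse k' hk').trans_le (heq k' hk' j hj hkj).le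
        have r1 := hrank k hk i hi hsk
        have r2 := hrank k' hk' j hj hsk'
        rcases ih _ (by omega) k hk k' hk' rfl with h | h | h
        · subst h; exact .inl (hinj k hk i hi j hj hki hkj)
        -- The predecessor `k` of `i` ends before `k'` starts, and `i` starts where `k` ends. So `i`
        -- starts no later than `k'`, and the comparison of `i` with `k'` settles the matter.
        · rw [heq k hk i hi hki] at h
          rcases ih _ (by omega) i hi k' hk' rfl with h' | h' | h'
          · subst h'; exact .inr (.inl (heq _ hk' j hj hkj).le)
          · exact .inr (.inl (h'.trans hsk'.le))
          · linarith [hse k' hk']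
        · rw [heq k' hk' j hj hkj] at h
          rcases ih _ (by omega) k hk j hj rfl with h' | h' | h'
          · subst h'; exact .inr (.inr (heq _ hk i hi hki).le)
          · linarith [hse k hk]
          · exact .inr (.inr (h'.trans hsk.le))
  exact fun i hi j hj => main _ i hi j hj rfl

section Soundness

variable {V : Type*} [Finite V] {G : SimpleGraph V} {I : Set V} {B : V → Box} {a b c d : V}
  {W H : ℝ}

/-- Boxes inside a frame whose contacts are locally consistent do not overlap. -/
theorem apart_of_local (hpos : ∀ v, (B v).Pos) (hcon : ∀ u v, G.Adj u v → Contact (B u) (B v))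
    (hpair : ∀ u v, G.Adj u v → u ∈ I → ∃ z z', G.Adj u z ∧ G.Adj v z ∧ G.Adj u z' ∧ G.Adj v z' ∧
      Apart (B z) (B z') ∧ ∀ y, G.Adj u y → G.Adj v y → y = z ∨ y = z')
    (hV : ∀ v, v ∈ I ∨ v = a ∨ v = b ∨ v = c ∨ v = d)
    (hnb : ∀ v ∈ I, ∃ u, G.Adj v u)
    (hin : ∀ v ∈ I, 0 ≤ (B v).l ∧ (B v).r ≤ W ∧ 0 ≤ (B v).b ∧ (B v).t ≤ H)
    (ha : (B a).r = 0) (hb : (B b).t = 0) (hc : (B c).l = W) (hd : (B d).b = H)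
    (hroot : ∀ j i i', G.Adj j i → G.Adj j i' → i ∈ I → i' ∈ I → Beside (B j) (B i) →
      Beside (B j) (B i') → ((B i).b ≤ (B j).b ∨ (B i).b ≤ 0) →
      ((B i').b ≤ (B j).b ∨ (B i').b ≤ 0) → i = i') :
    ∀ i ∈ I, ∀ j ∈ I, i ≠ j → Apart (B i) (B j) := by
  have hL : Local G I B := ⟨hpos, hcon, fun u v huv hu => by
    obtain ⟨z, z', h1, h2, h3, h4, h5, -⟩ := hpair u v huv hu
    exact ⟨z, z', h1, h2, h3, h4, h5⟩⟩
  -- The inner boxes along the right side of `j` form a chain. A root reaches down to the bottom of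
  -- `j` or of the rectangle; any other box rests on a predecessor in the same column.
  have right : ∀ j, ∀ i i', G.Adj j i → i ∈ I → Beside (B j) (B i) → G.Adj j i' → i' ∈ I →
      Beside (B j) (B i') → i = i' ∨ (B i).t ≤ (B i').b ∨ (B i').t ≤ (B i).b := by
    intro j i i' h1 h2 h3 h1' h2' h3'
    refine eq_or_le_of_chain (S := {i | G.Adj j i ∧ i ∈ I ∧ Beside (B j) (B i)}) (Set.toFinite _)
      (fun i => (B i).b) (fun i => (B i).t) (fun i _ => (hpos i).2)
      (fun i => (B i).b ≤ (B j).b ∨ (B i).b ≤ 0) (fun k i => G.Adj k i ∧ (B k).t = (B i).b)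
      ?_ (fun k _ i _ h => h.2) ?_ ?_ ?_ i ⟨h1, h2, h3⟩ i' ⟨h1', h2', h3'⟩
    · rintro i ⟨hi1, hi2, hi3⟩
      by_cases hr : (B i).b ≤ (B j).b ∨ (B i).b ≤ 0
      · exact .inl hr
      refine .inr ?_
      push Not at hr
      -- Since `i` starts above the bottom of `j`, the box closing the lower end of their contact
      -- lies under `i` and also touches `j` from the right. It is inner, because the outer boxes
      -- lie outside the rectangle.
      obtain ⟨z, hjz, hiz, hz⟩ := (hL.ends hi1 (.inr hi2) hi3).2
      have pz := hpos z
      have pi := hpos i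
      have hin' := hin i hi2
      obtain ⟨e1, e2, e3⟩ := hi3
      obtain ⟨z1, z2⟩ : (B z).t = (B i).b ∧ (B z).l = (B j).r := by
        rcases hz with hz | hz | hz
        · linarith [hz.1]
        · exact hz.2
        · linarith [hz.1]
      refine ⟨z, ⟨hjz, ?_, z2.symm, by linarith, by linarith [pz.2]⟩, hiz.symm, z1⟩
      rcases hV z with h | h | h | h | h
      · exact h
      · subst h; linarith [pz.1]
      · subst h; linarith
      · subst h; linarith [pi.1]
      · subst h; linarith [pz.2, pi.2]
    -- Two successors `i`, `i'` of `k` would both be common neighbours of `j` and `k` at the upper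
    -- end of their contact. If they differ, they are the two known common neighbours, which do not
    -- overlap.
    · rintro k ⟨hk1, hk2, hk3⟩ i ⟨hi1, hi2, hi3⟩ i' ⟨hj1, hj2, hj3⟩ ⟨hki, hki'⟩ ⟨hkj, hkj'⟩
      obtain ⟨z, z', -, -, -, -, hap, hall⟩ := hpair k j hk1.symm hk2
      by_contra hne
      have hap' : Apart (B i) (B i') := by
        rcases hall i hki hi1 with h | h <;> rcases hall i' hkj hj1 with h' | h'
        · exact (hne (h.trans h'.symm)).elim
        · rw [h, h']; exact hap
        · rw [h, h']; exact hap.symm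
        · exact (hne (h.trans h'.symm)).elim
      refine Up.unique (x := B j) (y := B k) (hpos j) (hpos i) (hpos i') ?_ ?_ hap'
      · exact .inr (.inl ⟨by linarith [hi3.2.2], hki'.symm, hi3.1.symm⟩)
      · exact .inr (.inl ⟨by linarith [hj3.2.2], hkj'.symm, hj3.1.symm⟩)
    · rintro i ⟨hi1, hi2, hi3⟩ i' ⟨hj1, hj2, hj3⟩ hr hr'
      exact hroot j i i' hi1 hj1 hi2 hj2 hi3 hj3 hr hr'
    · rintro i ⟨hi1, hi2, hi3⟩ k ⟨hk1, hk2, hk3⟩ hr hle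
      rcases hr with hr | hr
      · linarith [hk3.2.1]
      · linarith [(hpos k).2, (hin k hk2).2.2.1]
  intro i hi j hj hne
  by_contra hap
  unfold Apart at hap
  push Not at hap
  obtain ⟨p1, p2, p3, p4⟩ := hap
  -- A height that both overlapping boxes have in common. The inner boxes met by this horizontal
  -- line form a chain that starts at `a`; a box has only one right neighbour on the line by
  -- `right`.
  set y := max (B i).b (B j).b with hy
  have hyi : y < (B i).t := max_lt (hpos i).2 p3
  have hyj : y < (B j).t := max_lt p4 (hpos j).2
  have := eq_or_le_of_chain (S := {i | i ∈ I ∧ (B i).b ≤ y ∧ y < (B i).t}) (Set.toFinite _)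
      (fun i => (B i).l) (fun i => (B i).r) (fun i _ => (hpos i).1)
      (fun i => G.Adj a i ∧ Beside (B a) (B i)) (fun k i => G.Adj k i ∧ Beside (B k) (B i))
      ?_ (fun k _ i _ h => h.2.1) ?_ ?_ ?_ i ⟨hi, le_max_left _ _, hyi⟩ j ⟨hj, le_max_right _ _, hyj⟩
  · rcases this with h | h | h
    · exact hne h
    · linarith
    · linarith
  · rintro i ⟨hi, hi1, hi2⟩
    obtain ⟨u, hu⟩ := hnb i hi
    obtain ⟨x, hx, hxb, hx1, hx2⟩ := hL.left_cover hi hu hi1 hi2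
    have hin' := hin i hi
    rcases hV x with h | h | h | h | h
    · exact .inr ⟨x, ⟨h, hx1, hx2⟩, hx, hxb⟩
    · subst h; exact .inl ⟨hx, hxb⟩
    · subst h; linarith
    · subst h; linarith [hxb.1, (hpos x).1, (hpos i).1]
    · subst h; linarith
  · rintro k - i ⟨hi, hi1, hi2⟩ i' ⟨hi', hi1', hi2'⟩ ⟨h1, h2⟩ ⟨h1', h2'⟩
    rcases right k i i' h1 hi h2 h1' hi' h2' with h | h | h
    · exact h
    · linarith
    · linarith
  · rintro i ⟨hi, hi1, hi2⟩ i' ⟨hi', hi1', hi2'⟩ ⟨h1, h2⟩ ⟨h1', h2'⟩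
    rcases right a i i' h1 hi h2 h1' hi' h2' with h | h | h
    · exact h
    · linarith
    · linarith
  · rintro i - k ⟨hk, -, -⟩ ⟨h1, h2⟩ hle
    linarith [h2.1, (hin k hk).1, (hpos k).1]

end Soundness

/-! ## Representations and their frames -/

section

variable {V : Type*} {G : SimpleGraph V} {w h : V → ℝ} {I : Set V} {B : V → Box} {a b c d : V}
  {W H : ℝ}

/-- `B` is a representation of boxes with widths `w` and heights `h` that realizes `G`. -/
structure Rep (G : SimpleGraph V) (w h : V → ℝ) (B : V → Box) : Prop where
  r_eq : ∀ v, (B v).r = (B v).l + w v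
  t_eq : ∀ v, (B v).t = (B v).b + h v
  apart : ∀ u v, u ≠ v → Apart (B u) (B v)
  contact : ∀ u v, G.Adj u v → Contact (B u) (B v)

theorem Rep.flipX (hB : Rep G w h B) : Rep G w h (fun v => (B v).flipX) where
  r_eq v := by simp [Box.flipX, hB.r_eq v]
  t_eq v := by simp [Box.flipX, hB.t_eq v]
  apart u v huv := (hB.apart u v huv).flipX
  contact u v huv := (hB.contact u v huv).flipX

theorem Rep.flipY (hB : Rep G w h B) : Rep G w h (fun v => (B v).flipY) where
  r_eq v := by simp [Box.flipY, hB.r_eq v]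
  t_eq v := by simp [Box.flipY, hB.t_eq v]
  apart u v huv := (hB.apart u v huv).flipY
  contact u v huv := (hB.contact u v huv).flipY

theorem Rep.shift (p q : ℝ) (hB : Rep G w h B) : Rep G w h (fun v => (B v).shift p q) where
  r_eq v := by simp [Box.shift, hB.r_eq v]; ring
  t_eq v := by simp [Box.shift, hB.t_eq v]; ring
  apart u v huv := (hB.apart u v huv).shift p q
  contact u v huv := (hB.contact u v huv).shift p q

theorem Rep.pos (hB : Rep G w h B) (hw : ∀ v, 0 < w v) (hh : ∀ v, 0 < h v) (v : V) : (B v).Pos :=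
  ⟨by rw [hB.r_eq]; linarith [hw v], by rw [hB.t_eq]; linarith [hh v]⟩

/-- The boxes `a`, `b`, `c`, `d` lie to the left of, below, to the right of, and above the boxes in
`I`. -/
structure Sides (I : Set V) (B : V → Box) (a b c d : V) : Prop where
  left : ∀ i ∈ I, (B a).r ≤ (B i).l
  bottom : ∀ i ∈ I, (B b).t ≤ (B i).b
  right : ∀ i ∈ I, (B i).r ≤ (B c).l
  top : ∀ i ∈ I, (B i).t ≤ (B d).b
  touch_left : ∃ i ∈ I, Beside (B a) (B i)
  touch_bottom : ∃ i ∈ I, Below (B b) (B i)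
  touch_right : ∃ i ∈ I, Beside (B i) (B c)
  touch_top : ∃ i ∈ I, Below (B i) (B d)

namespace Sides

theorem flipX (s : Sides I B a b c d) : Sides I (fun v => (B v).flipX) c b a d where
  left i hi := neg_le_neg (s.right i hi)
  bottom i hi := s.bottom i hi
  right i hi := neg_le_neg (s.left i hi)
  top i hi := s.top i hi
  touch_left := by
    obtain ⟨i, hi, hb⟩ := s.touch_right
    exact ⟨i, hi, beside_flipX.2 hb⟩
  touch_bottom := by
    obtain ⟨i, hi, hb⟩ := s.touch_bottom
    exact ⟨i, hi, below_flipX.2 hb⟩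
  touch_right := by
    obtain ⟨i, hi, hb⟩ := s.touch_left
    exact ⟨i, hi, beside_flipX.2 hb⟩
  touch_top := by
    obtain ⟨i, hi, hb⟩ := s.touch_top
    exact ⟨i, hi, below_flipX.2 hb⟩

theorem flipY (s : Sides I B a b c d) : Sides I (fun v => (B v).flipY) a d c b where
  left i hi := s.left i hi
  bottom i hi := neg_le_neg (s.top i hi)
  right i hi := s.right i hi
  top i hi := neg_le_neg (s.bottom i hi)
  touch_left := by
    obtain ⟨i, hi, hb⟩ := s.touch_left
    exact ⟨i, hi, beside_flipY.2 hb⟩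
  touch_bottom := by
    obtain ⟨i, hi, hb⟩ := s.touch_top
    exact ⟨i, hi, below_flipY.2 hb⟩
  touch_right := by
    obtain ⟨i, hi, hb⟩ := s.touch_right
    exact ⟨i, hi, beside_flipY.2 hb⟩
  touch_top := by
    obtain ⟨i, hi, hb⟩ := s.touch_bottom
    exact ⟨i, hi, below_flipY.2 hb⟩

theorem shift (p q : ℝ) (s : Sides I B a b c d) :
    Sides I (fun v => (B v).shift p q) a b c d where
  left i hi := by simpa [Box.shift] using s.left i hi
  bottom i hi := by simpa [Box.shift] using s.bottom i hi
  right i hi := by simpa [Box.shift] using s.right i hi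
  top i hi := by simpa [Box.shift] using s.top i hi
  touch_left := by
    obtain ⟨i, hi, hb⟩ := s.touch_left
    exact ⟨i, hi, by simpa [Box.shift, Beside] using hb⟩
  touch_bottom := by
    obtain ⟨i, hi, hb⟩ := s.touch_bottom
    exact ⟨i, hi, by simpa [Box.shift, Below] using hb⟩
  touch_right := by
    obtain ⟨i, hi, hb⟩ := s.touch_right
    exact ⟨i, hi, by simpa [Box.shift, Beside] using hb⟩
  touch_top := by
    obtain ⟨i, hi, hb⟩ := s.touch_top
    exact ⟨i, hi, by simpa [Box.shift, Below] using hb⟩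

theorem not_contact_ac (s : Sides I B a b c d) (hpos : ∀ v, (B v).Pos) :
    ¬ Contact (B a) (B c) := by
  obtain ⟨i, hi, -⟩ := s.touch_left
  have h1 := s.left i hi
  have h2 := s.right i hi
  have h3 := (hpos i).1
  have h4 := (hpos a).1
  have h5 := (hpos c).1
  rintro (⟨e1, e2, e3⟩ | ⟨e1, e2, e3⟩ | ⟨e1, e2, e3⟩ | ⟨e1, e2, e3⟩) <;> linarith

theorem not_contact_bd (s : Sides I B a b c d) (hpos : ∀ v, (B v).Pos) :
    ¬ Contact (B b) (B d) := by
  obtain ⟨i, hi, -⟩ := s.touch_left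
  have h1 := s.bottom i hi
  have h2 := s.top i hi
  have h3 := (hpos i).2
  have h4 := (hpos b).2
  have h5 := (hpos d).2
  rintro (⟨e1, e2, e3⟩ | ⟨e1, e2, e3⟩ | ⟨e1, e2, e3⟩ | ⟨e1, e2, e3⟩) <;> linarith

theorem beside_left (s : Sides I B a b c d) (hpos : ∀ v, (B v).Pos) {i : V} (hi : i ∈ I)
    (hc : Contact (B a) (B i)) : Beside (B a) (B i) := by
  have h1 := s.left i hi
  have h2 := (hpos i).1
  have h3 := (hpos a).1
  rcases hc with h | ⟨e1, e2, e3⟩ | ⟨e1, e2, e3⟩ | ⟨e1, e2, e3⟩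
  · exact h
  all_goals linarith

theorem below_bottom (s : Sides I B a b c d) (hpos : ∀ v, (B v).Pos) {i : V} (hi : i ∈ I)
    (hc : Contact (B b) (B i)) : Below (B b) (B i) := by
  have h1 := s.bottom i hi
  have h2 := (hpos i).2
  have h3 := (hpos b).2
  rcases hc with ⟨e1, e2, e3⟩ | ⟨e1, e2, e3⟩ | h | ⟨e1, e2, e3⟩
  on_goal 3 => exact h
  all_goals linarith

theorem beside_right (s : Sides I B a b c d) (hpos : ∀ v, (B v).Pos) {i : V} (hi : i ∈ I)
    (hc : Contact (B c) (B i)) : Beside (B i) (B c) := by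
  have := s.flipX.beside_left (fun v => (hpos v).flipX) hi hc.flipX
  exact beside_flipX.1 this

theorem below_top (s : Sides I B a b c d) (hpos : ∀ v, (B v).Pos) {i : V} (hi : i ∈ I)
    (hc : Contact (B d) (B i)) : Below (B i) (B d) := by
  have := s.flipY.below_bottom (fun v => (hpos v).flipY) hi hc.flipY
  exact below_flipY.1 this

/-- A common neighbour of the left and the bottom box is the box at the corner. -/
theorem common_ab (s : Sides I B a b c d) (hpos : ∀ v, (B v).Pos)
    (hV : ∀ v, v ∈ I ∨ v = a ∨ v = b ∨ v = c ∨ v = d)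
    (hcon : ∀ u v, G.Adj u v → Contact (B u) (B v)) {z : V} (haz : G.Adj a z) (hbz : G.Adj b z) :
    z ∈ I ∧ (B z).l = (B a).r ∧ (B z).b = (B b).t := by
  have hz : z ∈ I := by
    rcases hV z with h | h | h | h | h
    · exact h
    · subst h; exact (haz.ne rfl).elim
    · subst h; exact (hbz.ne rfl).elim
    · subst h; exact (s.not_contact_ac hpos (hcon _ _ haz)).elim
    · subst h; exact (s.not_contact_bd hpos (hcon _ _ hbz)).elim
  exact ⟨hz, (s.beside_left hpos hz (hcon _ _ haz)).1.symm,
    (s.below_bottom hpos hz (hcon _ _ hbz)).1.symm⟩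

theorem common_ab_unique (s : Sides I B a b c d) (hpos : ∀ v, (B v).Pos)
    (hV : ∀ v, v ∈ I ∨ v = a ∨ v = b ∨ v = c ∨ v = d)
    (hcon : ∀ u v, G.Adj u v → Contact (B u) (B v)) (hap : ∀ u v, u ≠ v → Apart (B u) (B v))
    {z z' : V} (haz : G.Adj a z) (hbz : G.Adj b z) (haz' : G.Adj a z') (hbz' : G.Adj b z') :
    z = z' := by
  obtain ⟨-, h1, h2⟩ := s.common_ab hpos hV hcon haz hbz
  obtain ⟨-, h1', h2'⟩ := s.common_ab hpos hV hcon haz' hbz'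
  by_contra hne
  have p1 := hpos z
  have p2 := hpos z'
  rcases hap z z' hne with h | h | h | h
  · linarith [p1.1]
  · linarith [p2.1]
  · linarith [p1.2]
  · linarith [p2.2]

end Sides

/-- A leftmost inner box has a left neighbour, which cannot be inner. Quarter turns give the other
three sides. -/
theorem exists_sides [Finite V] (hL : Local G I B) (hI : I.Nonempty)
    (hnb : ∀ v ∈ I, ∃ u, G.Adj v u) :
    ∃ a b c d, a ∉ I ∧ b ∉ I ∧ c ∉ I ∧ d ∉ I ∧ Sides I B a b c d := by
  have hpos := hL.pos
  have key : ∀ B : V → Box, Local G I B → ∃ a ∉ I, (∀ i ∈ I, (B a).r ≤ (B i).l) ∧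
      ∃ i ∈ I, Beside (B a) (B i) := by
    intro B hL
    obtain ⟨z, hz, hmin⟩ := Set.exists_min_image I (fun v => (B v).l) (Set.toFinite _) hI
    obtain ⟨u, hu⟩ := hnb z hz
    obtain ⟨y, hy, hb⟩ := hL.exists_left hz hu
    refine ⟨y, fun hyI => ?_, fun i hi => hb.1.trans_le (hmin i hi), z, hz, hb⟩
    linarith [hmin y hyI, hb.1, (hL.pos y).1]
  obtain ⟨a, ha, ha1, ia, hia, ha2⟩ := key _ hL
  obtain ⟨d, hd, hd1, id, hid, hd2⟩ := key _ hL.rot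
  obtain ⟨c, hc, hc1, ic, hic, hc2⟩ := key _ hL.rot.rot
  obtain ⟨b, hb, hb1, ib, hib, hb2⟩ := key _ hL.rot.rot.rot
  refine ⟨a, b, c, d, ha, hb, hc, hd, ha1, fun i hi => ?_, fun i hi => ?_, fun i hi => ?_,
    ⟨ia, hia, ha2⟩, ⟨ib, hib, ?_⟩, ⟨ic, hic, ?_⟩, ⟨id, hid, beside_rot.1 hd2⟩⟩
  · have := hb1 i hi; simp only [Box.rot, neg_neg] at this; exact this
  · have := hc1 i hi; simp only [Box.rot] at this; linarith
  · have := hd1 i hi; simp only [Box.rot] at this; linarith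
  · rw [beside_rot, below_rot, beside_rot] at hb2; exact hb2
  · rw [beside_rot, below_rot] at hc2; exact hc2

theorem Sides.ne [DecidableEq V] (s : Sides I B a b c d) (hpos : ∀ v, (B v).Pos) :
    a ≠ b ∧ a ≠ c ∧ a ≠ d ∧ b ≠ c ∧ b ≠ d ∧ c ≠ d := by
  obtain ⟨i, hi, a1, a2, a3⟩ := s.touch_left
  obtain ⟨j, hj, b1, b2, b3⟩ := s.touch_right
  have hc := s.not_contact_ac hpos
  have := hpos i
  have := hpos j
  refine ⟨?_, ?_, ?_, ?_, ?_, ?_⟩ <;> rintro rfl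
  · linarith [s.bottom i hi]
  · linarith [s.left i hi, s.right i hi, (hpos a).1, (hpos i).1]
  · linarith [s.top i hi]
  · linarith [s.bottom j hj]
  · linarith [s.bottom i hi, s.top i hi, (hpos b).2, (hpos i).2]
  · linarith [s.top j hj]

/-- Opposite sides are not adjacent, so they are opposite vertices of the 4-cycle. What remains are
the eight symmetries of a square. -/
theorem cycle_cases {L D R T : V} (hab : G.Adj a b) (hbc : G.Adj b c) (hcd : G.Adj c d)
    (hda : G.Adj d a) (o1 : L = a ∨ L = b ∨ L = c ∨ L = d) (o2 : D = a ∨ D = b ∨ D = c ∨ D = d)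
    (o3 : R = a ∨ R = b ∨ R = c ∨ R = d) (o4 : T = a ∨ T = b ∨ T = c ∨ T = d)
    (n1 : L ≠ D) (n2 : L ≠ T) (n3 : D ≠ R) (n4 : R ≠ T) (hLR : ¬ G.Adj L R) (hDT : ¬ G.Adj D T)
    (n5 : L ≠ R) (n6 : D ≠ T) :
    (L = a ∧ R = c ∧ (D = b ∧ T = d ∨ D = d ∧ T = b)) ∨
    (L = c ∧ R = a ∧ (D = b ∧ T = d ∨ D = d ∧ T = b)) ∨
    (L = b ∧ R = d ∧ (D = c ∧ T = a ∨ D = a ∧ T = c)) ∨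
    (L = d ∧ R = b ∧ (D = c ∧ T = a ∨ D = a ∧ T = c)) := by
  have hba := hab.symm
  have hcb := hbc.symm
  have hdc := hcd.symm
  have had := hda.symm
  rcases o1 with rfl | rfl | rfl | rfl <;> rcases o3 with rfl | rfl | rfl | rfl <;>
    first
    | contradiction
    | (rcases o2 with rfl | rfl | rfl | rfl <;> rcases o4 with rfl | rfl | rfl | rfl <;>
        first | contradiction | simp)

/-- After reflections and a translation, either `a`, `b`, `c`, `d` or `b`, `c`, `d`, `a` are the
left, bottom, right and top box, and the lower left corner of the frame is the origin. -/
theorem exists_normal [Finite V] (hB : Rep G w h B)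
    (hI : ∀ v, v ∈ I ↔ v ≠ a ∧ v ≠ b ∧ v ≠ c ∧ v ≠ d)
    (hL : Local G I B) (hne : I.Nonempty) (hnb : ∀ v ∈ I, ∃ u, G.Adj v u)
    (hab : G.Adj a b) (hbc : G.Adj b c) (hcd : G.Adj c d) (hda : G.Adj d a) :
    ∃ B', Rep G w h B' ∧
      ((Sides I B' a b c d ∧ (B' a).r = 0 ∧ (B' b).t = 0) ∨
        (Sides I B' b c d a ∧ (B' b).r = 0 ∧ (B' c).t = 0)) := by
  classical
  have hpos := hL.pos
  obtain ⟨L, D, R, T, hL', hD', hR', hT', s⟩ := exists_sides hL hne hnb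
  have hLR : ¬ G.Adj L R := fun hadj => s.not_contact_ac hpos (hB.contact _ _ hadj)
  have hDT : ¬ G.Adj D T := fun hadj => s.not_contact_bd hpos (hB.contact _ _ hadj)
  obtain ⟨n1, n2, n3, n4, n5, n6⟩ := s.ne hpos
  have out : ∀ v, v ∉ I → v = a ∨ v = b ∨ v = c ∨ v = d := by
    intro v hv; rw [hI] at hv; tauto
  have fin : ∀ (B : V → Box) (a b c d : V), Rep G w h B → Sides I B a b c d →
      ∃ B', Rep G w h B' ∧ Sides I B' a b c d ∧ (B' a).r = 0 ∧ (B' b).t = 0 := by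
    intro B a b c d hB s
    exact ⟨_, hB.shift (-(B a).r) (-(B b).t), s.shift _ _, by simp [Box.shift],
      by simp [Box.shift]⟩
  have fin1 : (∃ B', Rep G w h B' ∧ Sides I B' a b c d) → ∃ B', Rep G w h B' ∧
      ((Sides I B' a b c d ∧ (B' a).r = 0 ∧ (B' b).t = 0) ∨
        (Sides I B' b c d a ∧ (B' b).r = 0 ∧ (B' c).t = 0)) := by
    rintro ⟨B, hB, s⟩
    obtain ⟨B', h1, h2⟩ := fin B a b c d hB s
    exact ⟨B', h1, .inl h2⟩
  have fin2 : (∃ B', Rep G w h B' ∧ Sides I B' b c d a) → ∃ B', Rep G w h B' ∧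
      ((Sides I B' a b c d ∧ (B' a).r = 0 ∧ (B' b).t = 0) ∨
        (Sides I B' b c d a ∧ (B' b).r = 0 ∧ (B' c).t = 0)) := by
    rintro ⟨B, hB, s⟩
    obtain ⟨B', h1, h2⟩ := fin B b c d a hB s
    exact ⟨B', h1, .inr h2⟩
  have hcases := cycle_cases hab hbc hcd hda (out L hL') (out D hD') (out R hR') (out T hT')
    n1 n3 n4 n6 hLR hDT n2 n5
  rcases hcases with ⟨rfl, rfl, ⟨rfl, rfl⟩ | ⟨rfl, rfl⟩⟩ | ⟨rfl, rfl, ⟨rfl, rfl⟩ | ⟨rfl, rfl⟩⟩ |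
    ⟨rfl, rfl, ⟨rfl, rfl⟩ | ⟨rfl, rfl⟩⟩ | ⟨rfl, rfl, ⟨rfl, rfl⟩ | ⟨rfl, rfl⟩⟩
  · exact fin1 ⟨B, hB, s⟩
  · exact fin1 ⟨_, hB.flipY, s.flipY⟩
  · exact fin1 ⟨_, hB.flipX, s.flipX⟩
  · exact fin1 ⟨_, hB.flipX.flipY, s.flipX.flipY⟩
  · exact fin2 ⟨B, hB, s⟩
  · exact fin2 ⟨_, hB.flipY, s.flipY⟩
  · exact fin2 ⟨_, hB.flipX, s.flipX⟩
  · exact fin2 ⟨_, hB.flipX.flipY, s.flipX.flipY⟩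

end

section

variable {V : Type*} {G : SimpleGraph V} {w h : V → ℝ} {I : Set V} {B F : V → Box} {a b c d : V}
  {W H : ℝ}

/-! ## Placing the four outer boxes -/

/-- The four outer boxes are placed around the rectangle `[0, W] × [0, H]`: each of them takes the
corner that follows it in counterclockwise order, unless it is too short to do so. -/
structure Framed (w h : V → ℝ) (F : V → Box) (a b c d : V) (W H : ℝ) : Prop where
  r_eq : ∀ v, (F v).r = (F v).l + w v
  t_eq : ∀ v, (F v).t = (F v).b + h v
  al : (F a).l = -w a
  ab : (F a).b = if W < w d then H - h a else (H - h a) / 2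
  bl : (F b).l = if H < h a then 0 else (W - w b) / 2
  bb : (F b).b = -h b
  cl : (F c).l = W
  cb : (F c).b = if W < w b then 0 else (H - h c) / 2
  dl : (F d).l = if H < h c then W - w d else (W - w d) / 2
  db : (F d).b = H

theorem Framed.pos (hF : Framed w h F a b c d W H) (hw : ∀ v, 0 < w v) (hh : ∀ v, 0 < h v) (v : V) :
    (F v).Pos :=
  ⟨by rw [hF.r_eq]; linarith [hw v], by rw [hF.t_eq]; linarith [hh v]⟩

/-- At the corner of `a` and `b`: if `a` is longer than the side, `b` starts at abscissa `0`, to the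
right of `a`; otherwise `a` stays at or above height `0`, where `b` ends. The other corners are
similar. `Fits` is not assumed, so this also serves for candidates that have yet to be verified. -/
theorem Framed.apart (hF : Framed w h F a b c d W H) (hW : 0 < W) (hH : 0 < H) :
    Apart (F a) (F b) ∧ Apart (F a) (F c) ∧ Apart (F a) (F d) ∧ Apart (F b) (F c) ∧
      Apart (F b) (F d) ∧ Apart (F c) (F d) := by
  obtain ⟨hr, ht, al, ab, bl, bb, cl, cb, dl, db⟩ := hF
  refine ⟨?_, .inl ?_, ?_, ?_, .inr (.inr (.inl ?_)), ?_⟩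
  · by_cases h1 : H < h a
    · rw [if_pos h1] at bl
      exact .inl (by rw [hr]; linarith)
    · refine .inr (.inr (.inr ?_))
      rw [ht, ab]; split_ifs <;> linarith
  · rw [hr]; linarith
  · by_cases h1 : W < w d
    · rw [if_pos h1] at ab
      exact .inr (.inr (.inl (by rw [ht]; linarith)))
    · refine .inl ?_
      rw [hr, dl]; split_ifs <;> linarith
  · by_cases h1 : W < w b
    · rw [if_pos h1] at cb
      exact .inr (.inr (.inl (by rw [ht]; linarith)))
    · refine .inl ?_
      rw [hr, bl]; split_ifs <;> linarith
  · rw [ht]; linarith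
  · by_cases h1 : H < h c
    · rw [if_pos h1] at dl
      exact .inr (.inl (by rw [hr]; linarith))
    · refine .inr (.inr (.inl ?_))
      rw [ht, cb]; split_ifs <;> linarith

/-- The sizes of the outer boxes allow to place them around the rectangle. -/
structure Fits (w h : V → ℝ) (a b c d : V) (W H : ℝ) : Prop where
  W_pos : 0 < W
  H_pos : 0 < H
  a_le : H ≤ h a
  b_le : W ≤ w b
  c_le : H ≤ h c
  d_le : W ≤ w d
  ab : H < h a ∨ W < w b
  bc : W < w b ∨ H < h c
  cd : H < h c ∨ W < w d
  da : W < w d ∨ H < h a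

/-- At each corner one of the two boxes is strictly longer than its side, by `Fits`. The corner of
`a` and `b` belongs to `a` if `H < h a`. Otherwise `h a = H` and `W < w b`, and the centred box `b`
protrudes beyond the corner under `a`. -/
theorem Framed.contact (hF : Framed w h F a b c d W H) (hw : ∀ v, 0 < w v) (hh : ∀ v, 0 < h v)
    (f : Fits w h a b c d W H) :
    Contact (F a) (F b) ∧ Contact (F b) (F c) ∧ Contact (F c) (F d) ∧ Contact (F d) (F a) := by
  obtain ⟨hr, ht, al, ab, bl, bb, cl, cb, dl, db⟩ := hF
  have wa := hw a; have wb := hw b; have wc := hw c; have wd := hw d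
  have ha := hh a; have hb := hh b; have hc := hh c; have hd := hh d
  obtain ⟨W0, H0, f1, f2, f3, f4, g1, g2, g3, g4⟩ := f
  refine ⟨?_, ?_, ?_, ?_⟩
  · by_cases h1 : H < h a
    · rw [if_pos h1] at bl
      refine .inl ⟨by rw [hr]; linarith, ?_, ?_⟩
      · rw [ht, ab]; split_ifs <;> linarith
      · rw [ht, ab]; split_ifs <;> linarith
    · have e1 : W < w d := g4.resolve_right h1
      have e2 : W < w b := g1.resolve_left h1
      rw [if_neg h1] at bl
      rw [if_pos e1] at ab
      exact .inr (.inr (.inr ⟨by rw [ht]; linarith, by rw [hr]; linarith, by rw [hr]; linarith⟩))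
  · by_cases h1 : W < w b
    · rw [if_pos h1] at cb
      refine .inr (.inr (.inl ⟨by rw [ht]; linarith, ?_, ?_⟩))
      · rw [hr, bl]; split_ifs <;> linarith
      · rw [hr, bl]; split_ifs <;> linarith
    · have e1 : H < h a := g1.resolve_right h1
      have e2 : H < h c := g2.resolve_left h1
      rw [if_neg h1] at cb
      rw [if_pos e1] at bl
      exact .inl ⟨by rw [hr]; linarith, by rw [ht]; linarith, by rw [ht]; linarith⟩
  · by_cases h1 : H < h c
    · rw [if_pos h1] at dl
      refine .inr (.inl ⟨by rw [hr]; linarith, ?_, ?_⟩)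
      · rw [ht, cb]; split_ifs <;> linarith
      · rw [ht, cb]; split_ifs <;> linarith
    · have e1 : W < w b := g2.resolve_right h1
      have e2 : W < w d := g3.resolve_left h1
      rw [if_neg h1] at dl
      rw [if_pos e1] at cb
      exact .inr (.inr (.inl ⟨by rw [ht]; linarith, by rw [hr]; linarith, by rw [hr]; linarith⟩))
  · by_cases h1 : W < w d
    · rw [if_pos h1] at ab
      refine .inr (.inr (.inr ⟨by rw [ht]; linarith, ?_, ?_⟩))
      · rw [hr, dl]; split_ifs <;> linarith
      · rw [hr, dl]; split_ifs <;> linarith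
    · have e1 : H < h c := g3.resolve_right h1
      have e2 : H < h a := g4.resolve_left h1
      rw [if_neg h1] at ab
      rw [if_pos e1] at dl
      exact .inr (.inl ⟨by rw [hr]; linarith, by rw [ht]; linarith, by rw [ht]; linarith⟩)

/-- The conditions that are checked for a placement of all boxes imply that it is a representation. -/
theorem rep_of_checks [Finite V] (hw : ∀ v, 0 < w v) (hh : ∀ v, 0 < h v)
    (hF : Framed w h F a b c d W H) (hW : 0 < W) (hH : 0 < H)
    (hcon : ∀ u v, G.Adj u v → Contact (F u) (F v))
    (hpair : ∀ u v, G.Adj u v → u ∈ I → ∃ z z', G.Adj u z ∧ G.Adj v z ∧ G.Adj u z' ∧ G.Adj v z' ∧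
      Apart (F z) (F z') ∧ ∀ y, G.Adj u y → G.Adj v y → y = z ∨ y = z')
    (hV : ∀ v, v ∈ I ∨ v = a ∨ v = b ∨ v = c ∨ v = d)
    (hnb : ∀ v ∈ I, ∃ u, G.Adj v u)
    (hin : ∀ v ∈ I, 0 ≤ (F v).l ∧ (F v).r ≤ W ∧ 0 ≤ (F v).b ∧ (F v).t ≤ H)
    (hroot : ∀ j i i', G.Adj j i → G.Adj j i' → i ∈ I → i' ∈ I → Beside (F j) (F i) →
      Beside (F j) (F i') → ((F i).b ≤ (F j).b ∨ (F i).b ≤ 0) →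
      ((F i').b ≤ (F j).b ∨ (F i').b ≤ 0) → i = i') : Rep G w h F := by
  have hpos := hF.pos hw hh
  have ha : (F a).r = 0 := by rw [hF.r_eq, hF.al]; ring
  have hb : (F b).t = 0 := by rw [hF.t_eq, hF.bb]; ring
  have hI := apart_of_local hpos hcon hpair hV hnb hin ha hb hF.cl hF.db hroot
  obtain ⟨p1, p2, p3, p4, p5, p6⟩ := hF.apart hW hH
  have ai : ∀ i ∈ I, Apart (F a) (F i) := fun i hi => .inl (by rw [ha]; exact (hin i hi).1)
  have bi : ∀ i ∈ I, Apart (F b) (F i) := fun i hi =>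
    .inr (.inr (.inl (by rw [hb]; exact (hin i hi).2.2.1)))
  have ci : ∀ i ∈ I, Apart (F c) (F i) := fun i hi =>
    .inr (.inl (by rw [hF.cl]; exact (hin i hi).2.1))
  have di : ∀ i ∈ I, Apart (F d) (F i) := fun i hi =>
    .inr (.inr (.inr (by rw [hF.db]; exact (hin i hi).2.2.2)))
  refine ⟨hF.r_eq, hF.t_eq, fun u v huv => ?_, hcon⟩
  rcases hV u with hu | rfl | rfl | rfl | rfl <;> rcases hV v with hv | rfl | rfl | rfl | rfl <;>
  first
  | exact (huv rfl).elim
  | assumption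
  | (apply Apart.symm; assumption)
  | exact hI u hu v hv huv
  | (first
     | exact ai _ hv | exact bi _ hv | exact ci _ hv | exact di _ hv | exact (ai _ hu).symm
     | exact (bi _ hu).symm | exact (ci _ hu).symm | exact (di _ hu).symm)

/-! ## Representations in normal position -/

/-- A representation with `a`, `b`, `c`, `d` on the left, bottom, right and top, in which the lower
left corner of the frame is the origin. -/
structure Normal (G : SimpleGraph V) (w h : V → ℝ) (I : Set V) (B : V → Box) (a b c d : V) :
    Prop where
  rep : Rep G w h B
  wpos : ∀ v, 0 < w v
  hpos : ∀ v, 0 < h v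
  sides : Sides I B a b c d
  ra : (B a).r = 0
  tb : (B b).t = 0
  hI : ∀ v, v ∈ I ↔ v ≠ a ∧ v ≠ b ∧ v ≠ c ∧ v ≠ d
  hab : G.Adj a b
  hbc : G.Adj b c
  hcd : G.Adj c d
  hda : G.Adj d a

/-- Each of `a` and `b` touches an inner box. Hence `a` reaches higher than the top of `b`, and `b`
reaches further right than the right side of `a`. The only possible contacts are `a` to the left of
`b`, and `b` below `a`. -/
theorem Sides.corner_ab (s : Sides I B a b c d) (hpos : ∀ v, (B v).Pos)
    (hc : Contact (B a) (B b)) :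
    (B a).b ≤ (B b).t ∧ (B b).l ≤ (B a).r ∧ ((B a).b < (B b).t ∨ (B b).l < (B a).r) := by
  obtain ⟨i, hi, a1, a2, a3⟩ := s.touch_left
  obtain ⟨j, hj, b1, b2, b3⟩ := s.touch_bottom
  have h1 := s.left j hj
  have h2 := s.bottom i hi
  have p1 := hpos a
  have p2 := hpos b
  have p3 := hpos i
  have p4 := hpos j
  unfold Pos at *
  rcases hc with ⟨e1, e2, e3⟩ | ⟨e1, e2, e3⟩ | ⟨e1, e2, e3⟩ | ⟨e1, e2, e3⟩
  · exact ⟨e2.le, e1.ge, .inl e2⟩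
  · linarith
  · linarith
  · exact ⟨e1.ge, e2.le, .inr e2⟩

namespace Normal

theorem pos (N : Normal G w h I B a b c d) (v : V) : (B v).Pos := N.rep.pos N.wpos N.hpos v

theorem cover (N : Normal G w h I B a b c d) (v : V) : v ∈ I ∨ v = a ∨ v = b ∨ v = c ∨ v = d := by
  rw [N.hI]; tauto

/-- Consecutive outer boxes touch at a corner of the rectangle: both reach it and at least one goes
strictly beyond. The four reflections of `Sides.corner_ab` are added up along the sides. -/
theorem fits (N : Normal G w h I B a b c d) :
    Fits w h a b c d (B c).l (B d).b := by
  obtain ⟨i, hi, -⟩ := N.sides.touch_left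
  have hp := N.pos
  have c1 := N.sides.corner_ab hp (N.rep.contact _ _ N.hab)
  have c2 := N.sides.flipX.corner_ab (fun v => (hp v).flipX)
    (N.rep.contact _ _ N.hbc.symm).flipX
  have c3 := N.sides.flipY.corner_ab (fun v => (hp v).flipY)
    (N.rep.contact _ _ N.hda.symm).flipY
  have c4 := N.sides.flipX.flipY.corner_ab (fun v => (hp v).flipX.flipY)
    (N.rep.contact _ _ N.hcd).flipX.flipY
  simp only [Box.flipX, Box.flipY, neg_lt_neg_iff, neg_le_neg_iff] at c2 c3 c4
  have e1 := N.rep.r_eq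
  have e2 := N.rep.t_eq
  have ra := N.ra
  have tb := N.tb
  have l1 := N.sides.left i hi
  have l2 := N.sides.right i hi
  have l3 := N.sides.bottom i hi
  have l4 := N.sides.top i hi
  have pi := hp i
  have q1 := e1 b
  have q2 := e1 d
  have q3 := e2 a
  have q4 := e2 c
  obtain ⟨d1, d2, d3⟩ := c1
  obtain ⟨d4, d5, d6⟩ := c2
  obtain ⟨d7, d8, d9⟩ := c3
  obtain ⟨d10, d11, d12⟩ := c4
  refine ⟨by linarith [pi.1], by linarith [pi.2], by linarith, by linarith, by linarith,
    by linarith, ?_, ?_, ?_, ?_⟩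
  · rcases d3 with h | h
    · exact .inl (by linarith)
    · exact .inr (by linarith)
  · rcases d6 with h | h
    · exact .inr (by linarith)
    · exact .inl (by linarith)
  · rcases d12 with h | h
    · exact .inl (by linarith)
    · exact .inr (by linarith)
  · rcases d9 with h | h
    · exact .inr (by linarith)
    · exact .inl (by linarith)

/-- The outer boxes of a representation can be moved to their standard places. -/
theorem rep_framed (N : Normal G w h I B a b c d)
    (hF : Framed w h F a b c d (B c).l (B d).b) (hFI : ∀ i ∈ I, F i = B i) :
    Rep G w h F := by
  have hp := N.pos
  have f := N.fits
  have s := N.sides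
  obtain ⟨k1, k2, k3, k4⟩ := hF.contact N.wpos N.hpos f
  obtain ⟨p1, p2, p3, p4, p5, p6⟩ := hF.apart f.W_pos f.H_pos
  have ra : (F a).r = 0 := by rw [hF.r_eq, hF.al]; ring
  have tb : (F b).t = 0 := by rw [hF.t_eq, hF.bb]; ring
  have hac : ¬ G.Adj a c := fun hh => s.not_contact_ac hp (N.rep.contact _ _ hh)
  have hbd : ¬ G.Adj b d := fun hh => s.not_contact_bd hp (N.rep.contact _ _ hh)
  have in1 : ∀ i ∈ I, 0 ≤ (B i).l := fun i hi => by rw [← N.ra]; exact s.left i hi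
  have in2 : ∀ i ∈ I, 0 ≤ (B i).b := fun i hi => by rw [← N.tb]; exact s.bottom i hi
  have in3 := s.right
  have in4 := s.top
  have ai : ∀ i ∈ I, Apart (F a) (F i) := fun i hi =>
    .inl (by rw [ra, hFI i hi]; exact in1 i hi)
  have bi : ∀ i ∈ I, Apart (F b) (F i) := fun i hi =>
    .inr (.inr (.inl (by rw [tb, hFI i hi]; exact in2 i hi)))
  have ci : ∀ i ∈ I, Apart (F c) (F i) := fun i hi =>
    .inr (.inl (by rw [hF.cl, hFI i hi]; exact in3 i hi))
  have di : ∀ i ∈ I, Apart (F d) (F i) := fun i hi =>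
    .inr (.inr (.inr (by rw [hF.db, hFI i hi]; exact in4 i hi)))
  have ta := hF.t_eq a
  have tc := hF.t_eq c
  have rb := hF.r_eq b
  have rd := hF.r_eq d
  have f1 := f.a_le
  have f2 := f.b_le
  have f3 := f.c_le
  have f4 := f.d_le
  -- Each outer box still spans its whole side of the rectangle, so its contacts with inner boxes
  -- survive the move.
  have xa : (F a).b ≤ 0 ∧ (B d).b ≤ (F a).t := by
    rw [ta, hF.ab]; split_ifs <;> constructor <;> linarith
  have xb : (F b).l ≤ 0 ∧ (B c).l ≤ (F b).r := by
    rw [rb, hF.bl]; split_ifs <;> constructor <;> linarith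
  have xc : (F c).b ≤ 0 ∧ (B d).b ≤ (F c).t := by
    rw [tc, hF.cb]; split_ifs <;> constructor <;> linarith
  have xd : (F d).l ≤ 0 ∧ (B c).l ≤ (F d).r := by
    rw [rd, hF.dl]; split_ifs <;> constructor <;> linarith
  have ca : ∀ i ∈ I, G.Adj a i → Contact (F a) (F i) := fun i hi hadj => by
    have e := s.beside_left hp hi (N.rep.contact _ _ hadj)
    rw [hFI i hi]
    exact .inl ⟨by rw [ra, ← N.ra]; exact e.1, by linarith [in2 i hi, (hp i).2],
      by linarith [in4 i hi, (hp i).2]⟩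
  have cb : ∀ i ∈ I, G.Adj b i → Contact (F b) (F i) := fun i hi hadj => by
    have e := s.below_bottom hp hi (N.rep.contact _ _ hadj)
    rw [hFI i hi]
    exact .inr (.inr (.inl ⟨by rw [tb, ← N.tb]; exact e.1, by linarith [in1 i hi, (hp i).1],
      by linarith [in3 i hi, (hp i).1]⟩))
  have cc : ∀ i ∈ I, G.Adj c i → Contact (F c) (F i) := fun i hi hadj => by
    have e := s.beside_right hp hi (N.rep.contact _ _ hadj)
    rw [hFI i hi]
    exact .inr (.inl ⟨by rw [hF.cl]; exact e.1, by linarith [in4 i hi, (hp i).2],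
      by linarith [in2 i hi, (hp i).2]⟩)
  have cd : ∀ i ∈ I, G.Adj d i → Contact (F d) (F i) := fun i hi hadj => by
    have e := s.below_top hp hi (N.rep.contact _ _ hadj)
    rw [hFI i hi]
    exact .inr (.inr (.inr ⟨by rw [hF.db]; exact e.1, by linarith [in3 i hi, (hp i).1],
      by linarith [in1 i hi, (hp i).1]⟩))
  refine ⟨hF.r_eq, hF.t_eq, fun u v huv => ?_, fun u v huv => ?_⟩
  · rcases N.cover u with hu | rfl | rfl | rfl | rfl <;>
      rcases N.cover v with hv | rfl | rfl | rfl | rfl <;>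
    first
    | exact (huv rfl).elim
    | assumption
    | (apply Apart.symm; assumption)
    | (rw [hFI u hu, hFI v hv]; exact N.rep.apart u v huv)
    | (first
       | exact ai _ hv | exact bi _ hv | exact ci _ hv | exact di _ hv | exact (ai _ hu).symm
       | exact (bi _ hu).symm | exact (ci _ hu).symm | exact (di _ hu).symm)
  · have huv' := huv.symm
    rcases N.cover u with hu | rfl | rfl | rfl | rfl <;>
      rcases N.cover v with hv | rfl | rfl | rfl | rfl <;>
    first
    | exact (huv.ne rfl).elim
    | assumption
    | contradiction
    | (apply Contact.symm; assumption)
    | (rw [hFI u hu, hFI v hv]; exact N.rep.contact u v huv)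
    | (first
       | exact ca _ hv huv | exact cb _ hv huv | exact cc _ hv huv | exact cd _ hv huv
       | exact (ca _ hu huv').symm | exact (cb _ hu huv').symm | exact (cc _ hu huv').symm
       | exact (cd _ hu huv').symm)

end Normal

/-! ## Finding the positions of the inner boxes -/

/-- While the inner boxes are being placed, `a` and `b` are represented by these boxes. -/
structure Provisional (w h : V → ℝ) (I : Set V) (B P : V → Box) (a b : V) : Prop where
  inner : ∀ i ∈ I, P i = B i
  pa : P a = ⟨-w a, 0, -h b, h a⟩
  pb : P b = ⟨0, w b, -h b, 0⟩

/-- The test that a box can be placed in the concave corner of `x` and `y`, where `z'` is the other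
common neighbour of `x` and `y`. -/
def CornerTest (x y z' : Box) : Prop := x.r < y.r ∧ y.t < x.t ∧ (z'.l < x.r ∨ z'.b < y.t)

namespace Normal

variable {P : V → Box}

theorem provisional_pos (N : Normal G w h I B a b c d) (hP : Provisional w h I B P a b)
    {u : V} (hu : u ∈ I ∨ u = a ∨ u = b) : (P u).Pos := by
  rcases hu with hu | rfl | rfl
  · rw [hP.inner u hu]; exact N.pos u
  · rw [hP.pa]
    exact ⟨by simp [N.wpos], by simp only; linarith [N.hpos u, N.hpos b]⟩
  · rw [hP.pb]
    exact ⟨N.wpos u, by simp [N.hpos]⟩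

/-- The true positions of `a` and `b` along their sides are unknown while the inner boxes are being
placed. The provisional boxes serve because they span the left and the bottom side, by `H ≤ h a` and
`W ≤ w b`. The box of `a` is lengthened downwards by `h b` so that it touches that of `b`. -/
theorem provisional_contact (N : Normal G w h I B a b c d) (hP : Provisional w h I B P a b)
    {u v : V} (hu : u ∈ I ∨ u = a ∨ u = b) (hv : v ∈ I ∨ v = a ∨ v = b)
    (huv : G.Adj u v) : Contact (P u) (P v) := by
  have f := N.fits
  have s := N.sides
  have hp := N.pos
  have ca : ∀ i ∈ I, G.Adj a i → Contact (P a) (P i) := fun i hi hadj => by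
    have e := s.beside_left hp hi (N.rep.contact _ _ hadj)
    rw [hP.inner i hi, hP.pa]
    refine .inl ⟨by rw [← e.1, N.ra], ?_, ?_⟩ <;> simp only
    · linarith [s.bottom i hi, N.tb, (hp i).2, N.hpos b]
    · linarith [s.top i hi, (hp i).2, f.a_le]
  have cb : ∀ i ∈ I, G.Adj b i → Contact (P b) (P i) := fun i hi hadj => by
    have e := s.below_bottom hp hi (N.rep.contact _ _ hadj)
    rw [hP.inner i hi, hP.pb]
    refine .inr (.inr (.inl ⟨by rw [← e.1, N.tb], ?_, ?_⟩)) <;> simp only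
    · linarith [s.left i hi, N.ra, (hp i).1]
    · linarith [s.right i hi, (hp i).1, f.b_le]
  have cab : Contact (P a) (P b) := by
    rw [hP.pa, hP.pb]
    exact .inl ⟨rfl, by simp [N.hpos], by simp only; linarith [N.hpos a, N.hpos b]⟩
  rcases hu with hu | rfl | rfl <;> rcases hv with hv | rfl | rfl
  · rw [hP.inner u hu, hP.inner v hv]; exact N.rep.contact u v huv
  · exact (ca u hu huv.symm).symm
  · exact (cb u hu huv.symm).symm
  · exact ca v hv huv
  · exact (huv.ne rfl).elim
  · exact cab
  · exact cb v hv huv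
  · exact cab.symm
  · exact (huv.ne rfl).elim

theorem provisional_apart (N : Normal G w h I B a b c d) (hP : Provisional w h I B P a b)
    {u v : V} (hu : u ∈ I) (hv : v ∈ I ∨ v = a ∨ v = b)
    (huv : u ≠ v) : Apart (P u) (P v) := by
  have s := N.sides
  rcases hv with hv | rfl | rfl
  · rw [hP.inner u hu, hP.inner v hv]; exact N.rep.apart u v huv
  · rw [hP.inner u hu, hP.pa]
    exact .inr (.inl (by rw [← N.ra]; exact s.left u hu))
  · rw [hP.inner u hu, hP.pb]
    exact .inr (.inr (.inr (by rw [← N.tb]; exact s.bottom u hu)))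

/-- Boxes that pass the test are placed correctly. -/
theorem corner_of_test (N : Normal G w h I B a b c d) (hP : Provisional w h I B P a b)
    {x y z z' : V} (hx : x ∈ I ∨ x = a ∨ x = b) (hy : y ∈ I ∨ y = a ∨ y = b)
    (hz : z ∈ I) (hz' : z' ∈ I ∨ z' = a ∨ z' = b) (hzz : z ≠ z') (hxy : G.Adj x y)
    (hxz : G.Adj x z) (hyz : G.Adj y z) (hxz' : G.Adj x z') (hyz' : G.Adj y z')
    (ht : CornerTest (P x) (P y) (P z')) : (B z).l = (P x).r ∧ (B z).b = (P y).t := by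
  obtain ⟨t1, t2, t3⟩ := ht
  have pc := fun {u v : V} => N.provisional_contact hP (u := u) (v := v)
  rcases corner_and_low (N.provisional_pos hP hx) (N.provisional_pos hP hy)
    (N.provisional_pos hP (.inl hz)) (N.provisional_pos hP hz') (pc hx hy hxy) t1 t2
    (pc hx (.inl hz) hxz) (pc hy (.inl hz) hyz) (pc hx hz' hxz') (pc hy hz' hyz')
    (N.provisional_apart hP hz hz' hzz) with ⟨h1, -⟩ | ⟨-, h1⟩
  · rw [← hP.inner z hz]; exact h1
  · obtain ⟨e1, e2⟩ := h1
    rcases t3 with t3 | t3 <;> linarith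

/-- A set that contains `a`, `b` and their common neighbour and is closed under placing boxes in
corners contains all inner boxes. -/
theorem all_placed [Finite V] (N : Normal G w h I B a b c d) (hP : Provisional w h I B P a b)
    (hL : Local G I B) (hnb : ∀ v ∈ I, ∃ u, G.Adj v u)
    (htwo : ∀ x y z, (x ∈ I ∨ x = a) → (y ∈ I ∨ y = b) → ¬ (x = a ∧ y = b) → G.Adj x y →
      G.Adj x z → G.Adj y z → ∃ z', z' ≠ z ∧ G.Adj x z' ∧ G.Adj y z')
    (S : Set V) (ha : a ∈ S) (hb : b ∈ S) (h0 : ∀ z, G.Adj a z → G.Adj b z → z ∈ S)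
    (hcl : ∀ x y z z', (x ∈ I ∨ x = a) → (y ∈ I ∨ y = b) → ¬ (x = a ∧ y = b) →
      x ∈ S → y ∈ S → z' ∈ S → z ∈ I → z ≠ z' → G.Adj x y → G.Adj x z →
      G.Adj y z → G.Adj x z' → G.Adj y z' → CornerTest (P x) (P y) (P z') → z ∈ S) :
    I ⊆ S := by
  have f := N.fits
  have s := N.sides
  have hp := N.pos
  have ra := N.ra
  have tb := N.tb
  intro z hz
  -- Induction on `l + b`, which is smaller for each of the boxes `x`, `y` and `z'` that determine
  -- the place of `z`.
  have hwf : WellFounded fun u v : V => (B u).l + (B u).b < (B v).l + (B v).b :=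
    Finite.wellFounded_of_trans_of_irrefl _
  induction z using hwf.induction with
  | _ z ih =>
    obtain ⟨u, hu⟩ := hnb z hz
    obtain ⟨x₀, hx₀, hb₀⟩ := hL.exists_left hz hu
    -- `z` sits in the concave corner formed by its lowest left neighbour `x` and the box `y` that
    -- closes the lower end of their contact.
    obtain ⟨x, y, hxz, hyz, hxy, ⟨e1, e2, e3⟩, e4, e5, e6, e7⟩ := hL.lowest_left hz hx₀.symm hb₀
    have i1 := s.left z hz
    have i2 := s.bottom z hz
    have i3 := s.right z hz
    have i4 := s.top z hz
    have pz := hp z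
    have px := hp x
    have py := hp y
    unfold Pos at pz px py
    have hx : x ∈ I ∨ x = a := by
      rcases N.cover x with h | h | h | h | h
      · exact .inl h
      · exact .inr h
      all_goals (subst h; linarith)
    have hy : y ∈ I ∨ y = b := by
      rcases N.cover y with h | h | h | h | h
      · exact .inl h
      · subst h; linarith
      · exact .inr h
      all_goals (subst h; linarith)
    by_cases hxyab : x = a ∧ y = b
    · obtain ⟨rfl, rfl⟩ := hxyab
      exact h0 z hxz hyz
    obtain ⟨z', hzz', hxz', hyz'⟩ := htwo x y z hx hy hxyab hxy hxz hyz
    have pz' := hp z'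
    unfold Pos at pz'
    -- `z` starts where `x` ends and where `y` ends, so it is not the low one of the two common
    -- neighbours; hence `z'` is.
    have hlow : Low (B x) (B y) (B z') := by
      rcases corner_and_low (hp x) (hp y) (hp z) (hp z') (N.rep.contact _ _ hxy) (by linarith)
        (by linarith) (N.rep.contact _ _ hxz) (N.rep.contact _ _ hyz) (N.rep.contact _ _ hxz')
        (N.rep.contact _ _ hyz') (N.rep.apart _ _ hzz'.symm) with ⟨-, h1⟩ | ⟨⟨h1, h2, h3⟩, -⟩
      · exact h1
      · rcases h3 with h3 | h3 <;> linarith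
    obtain ⟨l1, l2, l3⟩ := hlow
    have hz' : z' ∈ I ∨ z' = a ∨ z' = b := by
      rcases N.cover z' with h | h | h | h | h
      · exact .inl h
      · exact .inr (.inl h)
      · exact .inr (.inr h)
      all_goals (subst h; linarith)
    have hxS : x ∈ S := by
      rcases hx with h | rfl
      · exact ih x (by linarith) h
      · exact ha
    have hyS : y ∈ S := by
      rcases hy with h | rfl
      · exact ih y (by linarith) h
      · exact hb
    have hzS : z' ∈ S := by
      rcases hz' with h | rfl | rfl
      · exact ih z' (by rcases l3 with l3 | l3 <;> linarith) h
      · exact ha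
      · exact hb
    refine hcl x y z z' hx hy hxyab hxS hyS hzS hz hzz'.symm hxy hxz hyz hxz' hyz' ?_
    have Pxr : (P x).r = (B x).r := by
      rcases hx with h | rfl
      · rw [hP.inner x h]
      · rw [hP.pa, ra]
    have Pyt : (P y).t = (B y).t := by
      rcases hy with h | rfl
      · rw [hP.inner y h]
      · rw [hP.pb, tb]
    have f1 := f.a_le
    have f2 := f.b_le
    refine ⟨?_, ?_, ?_⟩
    · rw [Pxr]
      rcases hy with h | rfl
      · rw [hP.inner y h]; linarith
      · rw [hP.pb]; simp only; linarith
    · rw [Pyt]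
      rcases hx with h | rfl
      · rw [hP.inner x h]; linarith
      · rw [hP.pa]; simp only; linarith
    · rw [Pxr, Pyt]
      rcases hz' with h | rfl | rfl
      · rw [hP.inner z' h]; exact l3
      · rw [hP.pa]; left; simp only; linarith [N.wpos z']
      · rw [hP.pb]; right; simp only; linarith [N.hpos z']

end Normal

end

/-! ## Triangles in quasi-triangulated graphs -/

section

variable {V : Type*} {G : SimpleGraph V}

theorem dart_ext {d e : G.Dart} (h1 : d.fst = e.fst) (h2 : d.snd = e.snd) : d = e :=
  SimpleGraph.Dart.ext _ _ (Prod.ext h1 h2)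

theorem mem_of_closed (hG : G.Preconnected) {S : Set V} {u : V} (hu : u ∈ S)
    (hS : ∀ x ∈ S, ∀ y, G.Adj x y → y ∈ S) (x : V) : x ∈ S := by
  obtain ⟨p⟩ := hG u x
  induction p with
  | nil => exact hu
  | cons hadj _ ih => exact ih (hS _ hu _ hadj)

namespace RotationSystem

variable (R : RotationSystem G)

theorem next_apply (d : G.Dart) : R.next d = R.rot d.symm := rfl

theorem fst_next (d : G.Dart) : (R.next d).fst = d.snd := by
  rw [next_apply, R.fst_rot]; rfl

theorem rot_eq_next (d : G.Dart) : R.rot d = R.next d.symm := by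
  rw [next_apply, SimpleGraph.Dart.symm_symm]

theorem next_pow_succ (k : ℕ) (d : G.Dart) : (R.next ^ (k + 1)) d = R.next ((R.next ^ k) d) := by
  rw [pow_succ', Equiv.Perm.mul_apply]

/-- The darts around a vertex form one orbit of `rot`; if `rot` exchanges two of them, there are no
others. -/
theorem eq_or_eq_of_rot {p q : G.Dart} (hpq : R.rot p = q) (hqp : R.rot q = p) (f : G.Dart)
    (hf : f.fst = p.fst) : f = p ∨ f = q := by
  obtain ⟨i, hi⟩ := R.sameCycle p f hf.symm
  have h2 : (R.rot ^ (2 : ℤ)) p = p := by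
    rw [show (2 : ℤ) = 1 + 1 from rfl, zpow_add, zpow_one, Equiv.Perm.mul_apply, hpq, hqp]
  have hj : ∀ j : ℤ, (R.rot ^ (2 * j)) p = p := by
    intro j
    rw [zpow_mul]
    exact Equiv.Perm.zpow_apply_eq_self_of_apply_eq_self h2 j
  rcases Int.even_or_odd' i with ⟨j, rfl | rfl⟩
  · rw [hj] at hi; exact .inl hi.symm
  · rw [add_comm, zpow_add, zpow_one, Equiv.Perm.mul_apply, hj, hpq] at hi; exact .inr hi.symm

theorem sameCycle_of_pow_four {o e : G.Dart} (h : (R.next ^ 4) o = o)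
    (he : R.next.SameCycle o e) :
    e = o ∨ e = R.next o ∨ e = (R.next ^ 2) o ∨ e = (R.next ^ 3) o := by
  obtain ⟨i, hi⟩ := he
  have hj : ∀ j : ℤ, (R.next ^ (4 * j)) o = o := by
    intro j
    rw [zpow_mul]
    exact Equiv.Perm.zpow_apply_eq_self_of_apply_eq_self (by exact_mod_cast h) j
  have hmod : i = i % 4 + 4 * (i / 4) := by omega
  rw [hmod, zpow_add, Equiv.Perm.mul_apply, hj] at hi
  have h4 : i % 4 = 0 ∨ i % 4 = 1 ∨ i % 4 = 2 ∨ i % 4 = 3 := by omega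
  rcases h4 with h4 | h4 | h4 | h4 <;> rw [h4] at hi
  · exact .inl hi.symm
  · exact .inr (.inl (by simpa using hi.symm))
  · exact .inr (.inr (.inl (by exact_mod_cast hi.symm)))
  · exact .inr (.inr (.inr (by exact_mod_cast hi.symm)))

/-- The third vertex of a triangular face, with the steps along the boundary of the face. -/
theorem exists_third {u v : V} (huv : G.Adj u v) (ht : R.IsTriangle ⟨(u, v), huv⟩) :
    ∃ (w : V) (hvw : G.Adj v w) (hwu : G.Adj w u),
      R.next ⟨(u, v), huv⟩ = ⟨(v, w), hvw⟩ ∧ R.next ⟨(v, w), hvw⟩ = ⟨(w, u), hwu⟩ ∧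
      R.next ⟨(w, u), hwu⟩ = ⟨(u, v), huv⟩ := by
  set e : G.Dart := ⟨(u, v), huv⟩ with he
  have h1 : (R.next e).fst = v := R.fst_next e
  have h3 : R.next (R.next (R.next e)) = e := by
    have := ht
    unfold IsTriangle at this
    rwa [show 3 = 0 + 1 + 1 + 1 from rfl, next_pow_succ, next_pow_succ, next_pow_succ, pow_zero,
      Equiv.Perm.one_apply] at this
  have h2 : (R.next (R.next e)).snd = u := by
    rw [← R.fst_next, h3]
  have h4 : (R.next (R.next e)).fst = (R.next e).snd := R.fst_next _
  have a1 : G.Adj v (R.next e).snd := h1 ▸ (R.next e).adj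
  have a2 : G.Adj (R.next e).snd u := by
    have := (R.next (R.next e)).adj
    rw [h4, h2] at this; exact this
  have e1 : R.next e = ⟨(v, (R.next e).snd), a1⟩ := dart_ext h1 rfl
  have e2 : R.next (R.next e) = ⟨((R.next e).snd, u), a2⟩ := dart_ext h4 h2
  refine ⟨(R.next e).snd, a1, a2, e1, ?_, ?_⟩
  · rw [← e1]; exact e2
  · rw [← e2]; exact h3

end RotationSystem

/-- `a`, `b`, `c`, `d` form a cycle, and every edge that is not on this cycle is in two triangles. -/
structure OuterCycle (G : SimpleGraph V) (a b c d : V) : Prop where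
  nodup : a ≠ b ∧ a ≠ c ∧ a ≠ d ∧ b ≠ c ∧ b ≠ d ∧ c ≠ d
  hab : G.Adj a b
  hbc : G.Adj b c
  hcd : G.Adj c d
  hda : G.Adj d a
  one_ab : ∃ z, G.Adj a z ∧ G.Adj b z
  one_bc : ∃ z, G.Adj b z ∧ G.Adj c z
  one_cd : ∃ z, G.Adj c z ∧ G.Adj d z
  one_da : ∃ z, G.Adj d z ∧ G.Adj a z
  two : ∀ u v, G.Adj u v → s(u, v) ≠ s(a, b) → s(u, v) ≠ s(b, c) → s(u, v) ≠ s(c, d) →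
    s(u, v) ≠ s(d, a) → ∃ z z', z ≠ z' ∧ G.Adj u z ∧ G.Adj v z ∧ G.Adj u z' ∧ G.Adj v z'
  not_K4 : (∀ v, v = a ∨ v = b ∨ v = c ∨ v = d) → ¬ (G.Adj a c ∧ G.Adj b d)

theorem OuterCycle.rotate {a b c d : V} (h : OuterCycle G a b c d) : OuterCycle G b c d a where
  nodup := by have := h.nodup; tauto
  hab := h.hbc
  hbc := h.hcd
  hcd := h.hda
  hda := h.hab
  one_ab := h.one_bc
  one_bc := h.one_cd
  one_cd := h.one_da
  one_da := h.one_ab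
  two u v huv h1 h2 h3 h4 := h.two u v huv h4 h1 h2 h3
  not_K4 hv := by
    rintro ⟨h1, h2⟩
    exact h.not_K4 (fun v => by have := hv v; tauto) ⟨h2.symm, h1⟩

/-- The faces beside the two darts of an edge supply its common neighbours: both faces are triangles
off the outer cycle, and the one opposite to the outer face is a triangle for an outer edge.
Connectedness is what makes the two third vertices different. -/
theorem IsQuasiTriangulated.exists_outerCycle (h : IsQuasiTriangulated G) :
    ∃ a b c d, OuterCycle G a b c d := by
  obtain ⟨hconn, ⟨R, -, o, ⟨ho4, hnd⟩, htri⟩, -⟩ := h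
  have e2 : (R.next ^ 2) o = R.next (R.next o) := rfl
  have e3 : (R.next ^ 3) o = R.next (R.next (R.next o)) := rfl
  have e4 : R.next (R.next (R.next (R.next o))) = o := ho4
  obtain ⟨a, ha⟩ : ∃ a, a = o.fst := ⟨_, rfl⟩
  obtain ⟨b, hb⟩ : ∃ b, b = (R.next o).fst := ⟨_, rfl⟩
  obtain ⟨c, hc⟩ : ∃ c, c = ((R.next ^ 2) o).fst := ⟨_, rfl⟩
  obtain ⟨d, hd⟩ : ∃ d, d = ((R.next ^ 3) o).fst := ⟨_, rfl⟩
  rw [← ha, ← hb, ← hc, ← hd] at hnd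
  have hnd' : a ≠ b ∧ a ≠ c ∧ a ≠ d ∧ b ≠ c ∧ b ≠ d ∧ c ≠ d := by
    simp only [List.nodup_cons, List.mem_cons, List.not_mem_nil, or_false, not_or] at hnd; tauto
  have sab : o.snd = b := by rw [hb, R.fst_next]
  have sbc : (R.next o).snd = c := by rw [hc, e2, R.fst_next]
  have scd : (R.next (R.next o)).snd = d := by rw [hd, e3, R.fst_next]
  have sda : (R.next (R.next (R.next o))).snd = a := by rw [ha, ← R.fst_next, e4]
  have hab : G.Adj a b := by rw [ha, ← sab]; exact o.adj
  have hbc : G.Adj b c := by rw [hb, ← sbc]; exact (R.next o).adj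
  have hcd : G.Adj c d := by rw [hc, ← scd]; exact (R.next (R.next o)).adj
  have hda : G.Adj d a := by rw [hd, ← sda]; exact (R.next (R.next (R.next o))).adj
  have d0 : o = ⟨(a, b), hab⟩ := dart_ext ha.symm sab
  have d1 : R.next o = ⟨(b, c), hbc⟩ := dart_ext hb.symm sbc
  have d2 : R.next (R.next o) = ⟨(c, d), hcd⟩ := dart_ext hc.symm scd
  have d3 : R.next (R.next (R.next o)) = ⟨(d, a), hda⟩ := dart_ext hd.symm sda
  have houter : ∀ u v (huv : G.Adj u v), ¬ (u = a ∧ v = b) → ¬ (u = b ∧ v = c) →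
      ¬ (u = c ∧ v = d) → ¬ (u = d ∧ v = a) → R.IsTriangle ⟨(u, v), huv⟩ := by
    intro u v huv h1 h2 h3 h4
    refine htri _ fun hs => ?_
    rcases R.sameCycle_of_pow_four ho4 hs with h | h | h | h
    · rw [d0] at h; simp only [SimpleGraph.Dart.mk.injEq, Prod.mk.injEq] at h; exact h1 h
    · rw [d1] at h; simp only [SimpleGraph.Dart.mk.injEq, Prod.mk.injEq] at h; exact h2 h
    · rw [e2, d2] at h; simp only [SimpleGraph.Dart.mk.injEq, Prod.mk.injEq] at h; exact h3 h
    · rw [e3, d3] at h; simp only [SimpleGraph.Dart.mk.injEq, Prod.mk.injEq] at h; exact h4 h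
  obtain ⟨n1, n2, n3, n4, n5, n6⟩ := hnd'
  have tab := houter b a hab.symm (by tauto) (by tauto) (by tauto) (by tauto)
  have tbc := houter c b hbc.symm (by tauto) (by tauto) (by tauto) (by tauto)
  have tcd := houter d c hcd.symm (by tauto) (by tauto) (by tauto) (by tauto)
  have tda := houter a d hda.symm (by tauto) (by tauto) (by tauto) (by tauto)
  refine ⟨a, b, c, d, ⟨n1, n2, n3, n4, n5, n6⟩, hab, hbc, hcd, hda, ?_, ?_, ?_, ?_, ?_, ?_⟩
  · obtain ⟨w, h1, h2, -⟩ := R.exists_third _ tab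
    exact ⟨w, h1, h2.symm⟩
  · obtain ⟨w, h1, h2, -⟩ := R.exists_third _ tbc
    exact ⟨w, h1, h2.symm⟩
  · obtain ⟨w, h1, h2, -⟩ := R.exists_third _ tcd
    exact ⟨w, h1, h2.symm⟩
  · obtain ⟨w, h1, h2, -⟩ := R.exists_third _ tda
    exact ⟨w, h1, h2.symm⟩
  · intro u v huv h1 h2 h3 h4
    have hs : ∀ x y x' y' : V, s(x, y) ≠ s(x', y') →
        ¬ (x = x' ∧ y = y') ∧ ¬ (y = x' ∧ x = y') := by
      intro x y x' y' hne
      rw [Ne, Sym2.eq_iff] at hne; tauto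
    obtain ⟨w, v1, v2, v3, v4, v5⟩ := R.exists_third huv (houter u v huv (hs _ _ _ _ h1).1
      (hs _ _ _ _ h2).1 (hs _ _ _ _ h3).1 (hs _ _ _ _ h4).1)
    obtain ⟨w', v1', v2', v3', v4', v5'⟩ := R.exists_third huv.symm (houter v u huv.symm
      (hs _ _ _ _ h1).2 (hs _ _ _ _ h2).2 (hs _ _ _ _ h3).2 (hs _ _ _ _ h4).2)
    -- If both triangles have the same third vertex, each of the three vertices has only two darts.
    -- By connectedness the graph is then a triangle, too small for four outer vertices.
    by_cases hw : w = w'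
    · exfalso
      subst hw
      have cu : ∀ x, G.Adj u x → x = v ∨ x = w := by
        intro x hx
        have := R.eq_or_eq_of_rot (p := ⟨(u, w), v1'⟩) (q := ⟨(u, v), huv⟩)
          ((R.rot_eq_next _).trans v5) ((R.rot_eq_next _).trans v3') ⟨(u, x), hx⟩ rfl
        simp only [SimpleGraph.Dart.mk.injEq, Prod.mk.injEq] at this; tauto
      have cv : ∀ x, G.Adj v x → x = u ∨ x = w := by
        intro x hx
        have := R.eq_or_eq_of_rot (p := ⟨(v, w), v1⟩) (q := ⟨(v, u), huv.symm⟩)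
          ((R.rot_eq_next _).trans v5') ((R.rot_eq_next _).trans v3) ⟨(v, x), hx⟩ rfl
        simp only [SimpleGraph.Dart.mk.injEq, Prod.mk.injEq] at this; tauto
      have cw : ∀ x, G.Adj w x → x = u ∨ x = v := by
        intro x hx
        have := R.eq_or_eq_of_rot (p := ⟨(w, v), v2'⟩) (q := ⟨(w, u), v2⟩)
          ((R.rot_eq_next _).trans v4) ((R.rot_eq_next _).trans v4') ⟨(w, x), hx⟩ rfl
        simp only [SimpleGraph.Dart.mk.injEq, Prod.mk.injEq] at this; tauto
      have hall : ∀ x, x = u ∨ x = v ∨ x = w := by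
        refine mem_of_closed hconn.preconnected (S := {x | x = u ∨ x = v ∨ x = w}) (.inl rfl) ?_
        rintro x (rfl | rfl | rfl) y hxy
        · rcases cu y hxy with h | h <;> simp [h]
        · rcases cv y hxy with h | h <;> simp [h]
        · rcases cw y hxy with h | h <;> simp [h]
      have ia := hall a
      have ib := hall b
      have ic := hall c
      have id := hall d
      clear * - ia ib ic id n1 n2 n3 n4 n5 n6
      grind
    · exact ⟨w, w', hw, v2.symm, v1, v1', v2'.symm⟩
  · rintro hV ⟨hac, hbd⟩
    obtain ⟨x, v1, v2, v3, v4, v5⟩ := R.exists_third _ tab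
    -- With only four vertices, the third vertex of the triangle at `ab` is `c` or `d`. In the first
    -- case `rot` exchanges the darts from `b` to `a` and to `c`, so `bd` is not an edge. In the
    -- second case it exchanges those from `a` to `b` and to `d`, so `ac` is not an edge.
    have rad : R.rot ⟨(a, d), hda.symm⟩ = ⟨(a, b), hab⟩ := by
      rw [R.rot_eq_next, ← d0]
      conv_rhs => rw [← e4, d3]
      rfl
    have rba : R.rot ⟨(b, a), hab.symm⟩ = ⟨(b, c), hbc⟩ := by
      rw [R.rot_eq_next, ← d1, d0]
      rfl
    rcases hV x with rfl | rfl | rfl | rfl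
    · exact v1.ne rfl
    · exact v2.ne rfl
    · have := R.eq_or_eq_of_rot (q := ⟨(b, x), hbc⟩) rba ((R.rot_eq_next _).trans v5)
        ⟨(b, d), hbd⟩ rfl
      simp only [SimpleGraph.Dart.mk.injEq, Prod.mk.injEq] at this
      rcases this with h | h
      · exact n3 h.2.symm
      · exact n6 h.2.symm
    · have := R.eq_or_eq_of_rot (q := ⟨(a, b), hab⟩) rad ((R.rot_eq_next _).trans v3)
        ⟨(a, c), hac⟩ rfl
      simp only [SimpleGraph.Dart.mk.injEq, Prod.mk.injEq] at this
      rcases this with h | h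
      · exact n6 h.2
      · exact n4 h.2.symm

end

/-! ## Linked lists of cells

Cells are numbered `0`, `1`, …; cell `c` belongs to the list of `key c`. A pointer is `0` (nil) or
`c + 1`; the cells of a list appear in decreasing order. -/

/-- The pointer to the last cell before `k` with key `v`. -/
def lastCell (key : ℕ → ℕ) (v : ℕ) : ℕ → ℕ
  | 0 => 0
  | k + 1 => if key k = v then k + 1 else lastCell key v k

theorem lastCell_le (key : ℕ → ℕ) (v k : ℕ) : lastCell key v k ≤ k := by
  induction k with
  | zero => exact le_rfl
  | succ k ih => unfold lastCell; split_ifs <;> omega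

theorem key_of_lastCell {key : ℕ → ℕ} {v k c : ℕ} (h : lastCell key v k = c + 1) : key c = v := by
  induction k with
  | zero => simp [lastCell] at h
  | succ k ih =>
    unfold lastCell at h
    split_ifs at h with h1
    · obtain rfl : k = c := by omega
      exact h1
    · exact ih h

theorem key_ne_of_lastCell_le {key : ℕ → ℕ} {v k c : ℕ} (h : lastCell key v k ≤ c) (hc : c < k) :
    key c ≠ v := by
  induction k with
  | zero => omega
  | succ k ih =>
    unfold lastCell at h
    split_ifs at h with h1
    · omega
    · rcases Nat.lt_succ_iff_lt_or_eq.1 hc with h2 | rfl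
      · exact ih h h2
      · exact h1

/-- The arrays `head` and `next` hold the lists of the first `k` cells. -/
def Buckets (head next key : ℕ → ℕ) (k : ℕ) : Prop :=
  (∀ v, head v = lastCell key v k) ∧ ∀ c < k, next c = lastCell key (key c) c

theorem Buckets.nil {head next key : ℕ → ℕ} (h : ∀ v, head v = 0) : Buckets head next key 0 :=
  ⟨h, fun _ hc => (Nat.not_lt_zero _ hc).elim⟩

theorem Buckets.insert {head next key : ℕ → ℕ} {k v : ℕ} (h : Buckets head next key k)
    (hv : key k = v) :
    Buckets (Function.update head v (k + 1)) (Function.update next k (head v)) key (k + 1) := by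
  refine ⟨fun u => ?_, fun c hc => ?_⟩
  · unfold lastCell
    by_cases huv : u = v
    · subst huv; simp [hv]
    · rw [Function.update_of_ne huv, if_neg (by rw [hv]; exact Ne.symm huv), h.1]
  · rcases Nat.lt_succ_iff_lt_or_eq.1 hc with h2 | rfl
    · rw [Function.update_of_ne h2.ne, h.2 c h2]
    · rw [Function.update_self, hv, h.1]

/-- Run `body` for the cells of a list, as long as `g` holds. The scalar `pa` points to the current
cell. -/
def traverse (pa head next : ℕ) (v : NExp) (g : BExp) (body : Prog) : Prog :=
  .seq (.nset pa (.lit 0) (.get head v))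
    (.while (.and (.nlt (.lit 0) (sc pa)) g)
      (.seq body (.nset pa (.lit 0) (.get next (.pred (sc pa))))))

/-- The index of the invariant says that the cells of the list with number at least `j` have been
treated. Since lists are decreasing, `hskip` lowers it past cells with other keys. The loop ends at
`j = 0` or because the guard fails. -/
theorem Ex.traverse {pa head next : ℕ} {vx : NExp} {g : BExp} {body : Prog} {σ : State}
    {hd nx key : ℕ → ℕ} {K v : ℕ} (hB : Buckets hd nx key K)
    (Inv : ℕ → State → ℕ → Prop)
    (hhead : σ.nat head = hd) (hv : vx.eval σ = v)
    (hskip : ∀ j j' τ t, j' ≤ j → (∀ c, j' ≤ c → c < j → key c ≠ v) → Inv j τ t → Inv j' τ t)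
    (h0 : Inv K (σ.setNat pa 0 (lastCell key v K)) 0)
    (step : ∀ c τ t, c < K → key c = v → τ.nat pa 0 = c + 1 → g.Holds τ → Inv (c + 1) τ t →
      Ex body τ fun υ s => υ.nat pa 0 = c + 1 ∧ υ.nat next = nx ∧
        Inv c (υ.setNat pa 0 (lastCell key v c)) (t + s + (g.cost + 13))) :
    Ex (traverse pa head next vx g body) σ fun τ t =>
      ∃ j t', Inv j τ t' ∧ t ≤ t' + vx.cost + g.cost + 20 ∧ (j = 0 ∨ ¬ g.Holds τ) := by
  refine Ex.seq ⟨_, _, .nset _ _ _ _, ?_⟩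
  have e0 : σ.setNat pa ((NExp.lit 0).eval σ) ((NExp.get head vx).eval σ) =
      σ.setNat pa 0 (lastCell key v K) := by
    simp only [NExp.eval, hhead, hv]
    rw [hB.1]
  rw [e0]
  have key' := Ex.whileLoop (b := .and (.nlt (.lit 0) (sc pa)) g)
    (P := .seq body (.nset pa (.lit 0) (.get next (.pred (sc pa)))))
    (fun τ t => Inv (τ.nat pa 0) τ t ∧ ∃ k ≤ K, τ.nat pa 0 = lastCell key v k)
    (fun τ => τ.nat pa 0) ?_ (σ.setNat pa 0 (lastCell key v K)) 0 ?_
  · refine key'.mono ?_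
    rintro τ s ⟨hb, t', ⟨hI, -⟩, ht⟩
    refine ⟨_, t', hI, ?_, ?_⟩
    · simp only [BExp.cost, NExp.cost, zero_add] at *
      omega
    · simp only [BExp.Holds, NExp.eval] at hb
      by_cases hg : g.Holds τ
      · left
        by_contra h
        exact hb ⟨Nat.pos_of_ne_zero h, hg⟩
      · exact .inr hg
  · rintro τ t ⟨hI, k, hk, hp⟩ ⟨hb, hg⟩
    simp only [BExp.Holds, NExp.eval] at hb
    obtain ⟨c, hc⟩ : ∃ c, τ.nat pa 0 = c + 1 := ⟨τ.nat pa 0 - 1, by omega⟩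
    have hle := lastCell_le key v k
    have hck : c < K := by omega
    have hkey : key c = v := key_of_lastCell (hp.symm.trans hc)
    refine Ex.seq ((step c τ t hck hkey hc hg (hc ▸ hI)).mono ?_)
    rintro υ s ⟨h1, h2, h3⟩
    refine ⟨_, _, .nset _ _ _ _, ?_⟩
    have e1 : υ.setNat pa ((NExp.lit 0).eval υ) ((NExp.get next (.pred (sc pa))).eval υ) =
        υ.setNat pa 0 (lastCell key v c) := by
      simp only [NExp.eval, h1, h2]
      rw [Nat.add_sub_cancel, hB.2 c hck, hkey]
    have e2 : (υ.setNat pa 0 (lastCell key v c)).nat pa 0 = lastCell key v c := by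
      simp [State.setNat_nat]
    rw [e1]
    beta_reduce
    rw [e2]
    refine ⟨⟨hskip c _ _ _ (lastCell_le _ _ _) (fun c' h h' => key_ne_of_lastCell_le h h') ?_, c,
      hck.le, rfl⟩, ?_⟩
    · convert h3 using 1
      simp only [BExp.cost, NExp.cost]; omega
    · have := lastCell_le key v c; omega
  · have e2 : (σ.setNat pa 0 (lastCell key v K)).nat pa 0 = lastCell key v K := by
      simp [State.setNat_nat]
    rw [e2]
    exact ⟨hskip K _ _ _ (lastCell_le _ _ _) (fun c' h h' => key_ne_of_lastCell_le h h') h0, K,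
      le_rfl, rfl⟩

theorem add_le_mul {x N a b c : ℕ} (h : x ≤ (N + 1) * a) (hab : a + c ≤ b) :
    x + c ≤ (N + 1) * b := by
  have : (N + 1) * (a + c) ≤ (N + 1) * b := Nat.mul_le_mul_left _ hab
  nlinarith [Nat.zero_le (N * c)]

/-- Run the given programs one after the other. -/
def seqs : List Prog → Prog
  | [] => .skip
  | p :: l => .seq p (seqs l)

abbrev NExp.eq (e f : NExp) : BExp := .and (.not (.nlt e f)) (.not (.nlt f e))

abbrev BExp.or (b c : BExp) : BExp := .not (.and (.not b) (.not c))

/-- A small finite set described by its size and, if it has at most two elements, its elements. -/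
def Reg (c x y : ℕ) (S : Set ℕ) : Prop :=
  S.Finite ∧ S.ncard = c ∧ (c = 1 → S = {x}) ∧ (c = 2 → S = {x, y})

theorem Reg.empty (x y : ℕ) : Reg 0 x y ∅ := by
  refine ⟨Set.finite_empty, Set.ncard_empty _, ?_, ?_⟩ <;> intro h <;> omega

/-- The case distinctions are those of `register`. From the third element on nothing is recorded,
and `Reg` then claims only the size. -/
theorem Reg.insert {c x y : ℕ} {S : Set ℕ} (h : Reg c x y S) {z : ℕ} (hz : z ∉ S) :
    Reg (c + 1) (if c < 1 then z else x) (if c < 1 then y else if c < 2 then z else y)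
      (insert z S) := by
  obtain ⟨h1, h2, h3, h4⟩ := h
  refine ⟨h1.insert z, by rw [Set.ncard_insert_of_notMem hz h1, h2], fun hc => ?_, fun hc => ?_⟩
  · obtain rfl : c = 0 := by omega
    rw [Set.ncard_eq_zero h1] at h2
    simp [h2]
  · obtain rfl : c = 1 := by omega
    simp [h3 rfl, Set.pair_comm]

/-! ## Names of the arrays -/

notation "sI" => (10 : ℕ)
notation "sK" => (11 : ℕ)
notation "sFuel" => (12 : ℕ)
notation "sLim" => (13 : ℕ)
notation "sP" => (14 : ℕ)
notation "sQ" => (15 : ℕ)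
notation "sR" => (16 : ℕ)
notation "aHead" => (30 : ℕ)
notation "aNext" => (31 : ℕ)
notation "aOth" => (33 : ℕ)
notation "aVal" => (34 : ℕ)
notation "aDeg" => (35 : ℕ)
notation "aMark" => (36 : ℕ)
notation "aCnt" => (37 : ℕ)
notation "aT1" => (38 : ℕ)
notation "aT2" => (39 : ℕ)

/-! ## Incidence lists -/

/-- The number of edges must not exceed four times the number of vertices. -/
def limitProg : Prog :=
  forLoop sI (.get 0 (.lit 0)) (.nset sLim (.lit 0) (.succ (.succ (.succ (.succ (sc sLim))))))

theorem limitProg_spec (σ : State) (h0 : σ.nat sLim 0 = 0) :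
    Ex limitProg σ fun τ t => t ≤ (σ.nat 0 0 + 1) * 40 ∧ τ.nat sLim 0 = 4 * σ.nat 0 0 := by
  refine (Ex.forLoop (σ := σ) (σ.nat 0 0) 10
    (fun k τ => τ.nat 0 = σ.nat 0 ∧ τ.nat sLim 0 = 4 * k) ?_ ?_ ?_).mono ?_
  · rintro k τ ⟨h, -⟩; simp [NExp.eval, h]
  · simp [State.setNat_nat, h0]
  · rintro k τ hk hi ⟨h1, h2⟩
    refine Ex.of_exec (by trivial) fun t ht => ⟨ht.trans (by simp [Prog.bound, NExp.cost]), ?_, ?_, ?_⟩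
    · simp [Prog.exec, State.setNat_nat, hi]
    · simp [Prog.exec, State.setNat_nat, h1]
    · simp [Prog.exec, State.setNat_nat, NExp.eval, h2]; ring
  · rintro τ t ⟨h1, h2, h3⟩
    exact ⟨h1.trans (Nat.mul_le_mul_left _ (by simp [NExp.cost])), h3⟩

/-- The key of cell `c` when edge `e` occupies the cells `2 e` and `2 e + 1`. -/
def endKey (e₁ e₂ : ℕ → ℕ) (c : ℕ) : ℕ := if c % 2 = 0 then e₁ (c / 2) else e₂ (c / 2)

theorem endKey_two_mul (e₁ e₂ : ℕ → ℕ) (e : ℕ) : endKey e₁ e₂ (2 * e) = e₁ e := by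
  simp [endKey]

theorem endKey_two_mul_add_one (e₁ e₂ : ℕ → ℕ) (e : ℕ) : endKey e₁ e₂ (2 * e + 1) = e₂ e := by
  have h1 : (2 * e + 1) % 2 = 1 := by omega
  have h2 : (2 * e + 1) / 2 = e := by omega
  simp [endKey, h1, h2]

/-- Add a cell with key `x` and other end `y` for the current edge. -/
def addCell (x y : NExp) : Prog :=
  seqs [.nset aNext (sc sK) (.get aHead x), .nset aOth (sc sK) y, .nset aVal (sc sK) (sc sI),
    .nset aHead x (.succ (sc sK)), .nset aDeg x (.succ (.get aDeg x)),
    .nset sK (.lit 0) (.succ (sc sK))]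

/-- The fuel is `8 m + 1`: for a realizable graph the scans consume at most `8 m`, so at least one
unit remains. It is produced edge by edge, as the machine cannot multiply. -/
def incidenceProg : Prog :=
  .seq (.nset sFuel (.lit 0) (.lit 1))
    (forLoop sI (.get 0 (.lit 1))
      (seqs [addCell (.get 1 (sc sI)) (.get 2 (sc sI)), addCell (.get 2 (sc sI)) (.get 1 (sc sI)),
        .nset sFuel (.lit 0) (NExp.succ^[8] (sc sFuel))]))

/-- The incidence lists of the first `m` edges. -/
structure Incidence (σ : State) (m : ℕ) : Prop where
  buckets : Buckets (σ.nat aHead) (σ.nat aNext) (endKey (σ.nat 1) (σ.nat 2)) (2 * m)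
  oth : ∀ c < 2 * m, σ.nat aOth c = endKey (σ.nat 2) (σ.nat 1) c
  val : ∀ c < 2 * m, σ.nat aVal c = c / 2
  deg : ∀ v, σ.nat aDeg v = Nat.count (fun c => endKey (σ.nat 1) (σ.nat 2) c = v) (2 * m)

theorem incidenceProg_spec : ∃ B, ∀ σ : State, (∀ v, σ.nat aHead v = 0) → (∀ v, σ.nat aDeg v = 0) →
    σ.nat sK 0 = 0 →
    Ex incidenceProg σ fun τ t => t ≤ (σ.nat 0 1 + 1) * B ∧ Incidence τ (σ.nat 0 1) ∧
      τ.nat sFuel 0 = 8 * σ.nat 0 1 + 1 := by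
  let body := seqs [addCell (.get 1 (sc sI)) (.get 2 (sc sI)),
    addCell (.get 2 (sc sI)) (.get 1 (sc sI)), .nset sFuel (.lit 0) (NExp.succ^[8] (sc sFuel))]
  refine ⟨body.bound + 40, fun σ hh hd hk => ?_⟩
  refine Ex.seq ⟨_, _, .nset _ _ _ _, ?_⟩
  set σ' := σ.setNat sFuel 0 1 with hσ'
  refine (Ex.forLoop (σ := σ') (body := body) (σ.nat 0 1) body.bound
    (fun k τ => τ.nat 0 = σ.nat 0 ∧ τ.nat sK 0 = 2 * k ∧ Incidence τ k ∧
      τ.nat sFuel 0 = 8 * k + 1) ?_ ?_ ?_).mono ?_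
  · rintro k τ ⟨h, -⟩; simp [NExp.eval, h]
  · refine ⟨by simp [hσ', State.setNat_nat], by simp [hσ', State.setNat_nat, hk],
      ⟨?_, by simp, by simp, ?_⟩, by simp [hσ', State.setNat_nat]⟩
    · exact Buckets.nil (by simp [hσ', State.setNat_nat, hh])
    · simp [hσ', State.setNat_nat, hd]
  · rintro k τ hk hi ⟨h0, h1, ⟨b1, b2, b3, b4⟩, h5⟩
    refine Ex.of_exec (by simp [body, seqs, addCell, Prog.LoopFree]) fun t ht => ⟨ht, ?_⟩
    set e₁ := τ.nat 1 with he₁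
    set e₂ := τ.nat 2 with he₂
    have eHead : (body.exec τ).nat aHead = Function.update
        (Function.update (τ.nat aHead) (e₁ k) (2 * k + 1)) (e₂ k) (2 * k + 1 + 1) := by
      simp [body, seqs, addCell, Prog.exec, State.setNat_nat, NExp.eval, hi, h1, he₁, he₂]
    have eNext : (body.exec τ).nat aNext = Function.update
        (Function.update (τ.nat aNext) (2 * k) (τ.nat aHead (e₁ k))) (2 * k + 1)
        (Function.update (τ.nat aHead) (e₁ k) (2 * k + 1) (e₂ k)) := by
      simp [body, seqs, addCell, Prog.exec, State.setNat_nat, NExp.eval, hi, h1, he₁, he₂]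
    have eOth : (body.exec τ).nat aOth = Function.update
        (Function.update (τ.nat aOth) (2 * k) (e₂ k)) (2 * k + 1) (e₁ k) := by
      simp [body, seqs, addCell, Prog.exec, State.setNat_nat, NExp.eval, hi, h1, he₁, he₂]
    have eVal : (body.exec τ).nat aVal = Function.update
        (Function.update (τ.nat aVal) (2 * k) k) (2 * k + 1) k := by
      simp [body, seqs, addCell, Prog.exec, State.setNat_nat, NExp.eval, hi, h1]
    have eDeg : (body.exec τ).nat aDeg = Function.update
        (Function.update (τ.nat aDeg) (e₁ k) (τ.nat aDeg (e₁ k) + 1)) (e₂ k)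
        (Function.update (τ.nat aDeg) (e₁ k) (τ.nat aDeg (e₁ k) + 1) (e₂ k) + 1) := by
      simp [body, seqs, addCell, Prog.exec, State.setNat_nat, NExp.eval, hi, h1, he₁, he₂]
    have eK : (body.exec τ).nat sK 0 = 2 * (k + 1) := by
      simp [body, seqs, addCell, Prog.exec, State.setNat_nat, NExp.eval, h1]; ring
    have eFuel : (body.exec τ).nat sFuel 0 = 8 * (k + 1) + 1 := by
      simp [body, seqs, addCell, Prog.exec, State.setNat_nat, NExp.eval, h5]; ring
    have eI : (body.exec τ).nat sI 0 = k := by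
      simp [body, seqs, addCell, Prog.exec, State.setNat_nat, hi]
    have e0 : (body.exec τ).nat 0 = σ.nat 0 := by
      simp [body, seqs, addCell, Prog.exec, State.setNat_nat, h0]
    have e1 : (body.exec τ).nat 1 = e₁ := by
      simp [body, seqs, addCell, Prog.exec, State.setNat_nat, he₁]
    have e2 : (body.exec τ).nat 2 = e₂ := by
      simp [body, seqs, addCell, Prog.exec, State.setNat_nat, he₂]
    refine ⟨eI, ?_⟩
    generalize body.exec τ = υ at *
    have k1 := endKey_two_mul e₁ e₂ k
    have k2 := endKey_two_mul_add_one e₁ e₂ k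
    refine ⟨by simp [State.setNat_nat, e0], by simp [State.setNat_nat, eK], ⟨?_, ?_, ?_, ?_⟩,
      by simp [State.setNat_nat, eFuel]⟩
    · simp only [State.setNat_nat, e1, e2, eHead, eNext]
      exact (b1.insert k1).insert k2
    · intro c hc
      simp only [State.setNat_nat, e1, e2, eOth]
      have k1 := endKey_two_mul e₂ e₁ k
      have k2 := endKey_two_mul_add_one e₂ e₁ k
      by_cases hc1 : c = 2 * k + 1
      · subst hc1; simp [k2]
      · by_cases hc2 : c = 2 * k
        · subst hc2; simp [k1]
        · simp [hc1, hc2, b2 c (by omega)]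
    · intro c hc
      simp only [State.setNat_nat, eVal]
      by_cases hc1 : c = 2 * k + 1
      · subst hc1; simp; omega
      · by_cases hc2 : c = 2 * k
        · subst hc2; simp
        · simp [hc1, hc2, b3 c (by omega)]
    · intro v
      simp only [State.setNat_nat, e1, e2, eDeg, Nat.reduceEqDiff, reduceIte]
      rw [show 2 * (k + 1) = 2 * k + 1 + 1 by ring, Nat.count_succ, Nat.count_succ, ← b4 v, k1, k2]
      simp only [Function.update_apply]
      clear * -
      grind
  · rintro τ t ⟨h1, h2, h3, h4, h5⟩
    refine ⟨?_, h4, h5⟩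
    have := add_le_mul (c := 4) (b := body.bound + 40) h1 (by simp [NExp.cost])
    simp only [NExp.cost]
    omega

/-! ### Tracking unchanged memory through sequences of writes -/

theorem SameBut.refl (ns rs : List ℕ) (σ : State) : SameBut ns rs σ σ :=
  ⟨fun _ _ => rfl, fun _ _ => rfl⟩

theorem SameBut.setNat {ns rs : List ℕ} {σ τ : State} (h : SameBut ns rs σ τ) {a : ℕ} (i x : ℕ)
    (ha : a ∈ ns) : SameBut ns rs σ (τ.setNat a i x) := by
  refine ⟨fun b hb => ?_, h.2⟩
  rw [State.setNat_nat, if_neg (by rintro rfl; exact hb ha), h.1 b hb]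

theorem SameBut.trans {ns rs ns' rs' : List ℕ} {σ τ υ : State} (h : SameBut ns rs σ τ)
    (h' : SameBut ns' rs' τ υ) (hn : ns' ⊆ ns) (hr : rs' ⊆ rs) : SameBut ns rs σ υ :=
  ⟨fun b hb => (h'.1 b fun hh => hb (hn hh)).trans (h.1 b hb),
    fun b hb => (h'.2 b fun hh => hb (hr hh)).trans (h.2 b hb)⟩

theorem SameBut.mono {ns rs ns' rs' : List ℕ} {σ τ : State} (h : SameBut ns rs σ τ)
    (hn : ns ⊆ ns') (hr : rs ⊆ rs') : SameBut ns' rs' σ τ :=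
  ⟨fun b hb => h.1 b fun hh => hb (hn hh), fun b hb => h.2 b fun hh => hb (hr hh)⟩

theorem SameBut.of_exec {P : Prog} (hP : P.LoopFree) (σ : State) :
    SameBut P.natWrites P.realWrites σ (P.exec σ) := by
  obtain ⟨t, hr, -⟩ := Prog.halts_exec hP σ
  exact ⟨fun _ ha => hr.nat_eq ha, fun _ ha => hr.real_eq ha⟩

/-! ## The common neighbours of the ends of an edge -/

abbrev trueTest : BExp := .nlt (.lit 0) (.lit 1)

/-- Mark the neighbours of the current vertex `v` with `v + 1`. -/
def markProg : Prog :=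
  traverse sP aHead aNext (sc sI) trueTest
    (.nset aMark (.get aOth (.pred (sc sP))) (.succ (sc sI)))

/-- Marks left by earlier vertices are at most `v`, so the mark `v + 1` is fresh and the array need
not be cleared between vertices. -/
theorem markProg_spec {σ : State} {key : ℕ → ℕ} {K v : ℕ}
    (hB : Buckets (σ.nat aHead) (σ.nat aNext) key K) (hv : σ.nat sI 0 = v)
    (hm : ∀ w, σ.nat aMark w ≤ v) :
    Ex markProg σ fun τ t => SameBut [sP, aMark] [] σ τ ∧
      t ≤ 100 * (Nat.count (fun c => key c = v) K + 1) ∧ (∀ w, τ.nat aMark w ≤ v + 1) ∧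
      ∀ w, τ.nat aMark w = v + 1 ↔ ∃ c < K, key c = v ∧ σ.nat aOth c = w := by
  refine (Ex.traverse (σ := σ) (v := v) hB
    (fun j τ t => SameBut [sP, aMark] [] σ τ ∧
      t + 100 * Nat.count (fun c => key c = v) j ≤ 100 * Nat.count (fun c => key c = v) K ∧
      (∀ w, τ.nat aMark w ≤ v + 1) ∧
      ∀ w, τ.nat aMark w = v + 1 ↔ ∃ c < K, j ≤ c ∧ key c = v ∧ σ.nat aOth c = w)
    rfl (by simp only [NExp.eval]; exact hv) ?_ ?_ ?_).mono ?_
  · rintro j j' τ t hj hne ⟨h1, h2, h3, h4⟩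
    have := Nat.count_monotone (fun c => key c = v) hj
    refine ⟨h1, by omega, h3, fun w => (h4 w).trans ?_⟩
    constructor
    · rintro ⟨c, h5, h6, h7⟩; exact ⟨c, h5, hj.trans h6, h7⟩
    · rintro ⟨c, h5, h6, h7⟩
      refine ⟨c, h5, ?_, h7⟩
      by_contra! h8
      exact hne c h6 h8 h7.1
  · refine ⟨(SameBut.refl _ _ σ).setNat _ _ (by simp), by simp, fun w => ?_, fun w => ?_⟩
    · have := hm w
      simp only [State.setNat_nat, Nat.reduceEqDiff, reduceIte]; omega
    · have := hm w
      simp only [State.setNat_nat, Nat.reduceEqDiff, reduceIte]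
      constructor
      · intro h; omega
      · rintro ⟨c, h1, h2, -⟩; omega
  · rintro c τ t hc hk hp - ⟨h1, h2, h3, h4⟩
    refine Ex.of_exec (by trivial) fun s hs => ?_
    have hb : s ≤ 20 := hs.trans (by simp [Prog.bound, NExp.cost])
    have e1 : τ.nat sI 0 = v := by rw [h1.1 _ (by decide)]; exact hv
    have e2 : τ.nat aOth = σ.nat aOth := h1.1 _ (by decide)
    have e3 : τ.nat aNext = σ.nat aNext := h1.1 _ (by decide)
    have hct : Nat.count (fun c => key c = v) (c + 1) = Nat.count (fun c => key c = v) c + 1 := by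
      rw [Nat.count_succ, if_pos hk]
    simp only [Prog.exec, NExp.eval, hp, Nat.add_sub_cancel, e1, e2]
    refine ⟨by simp [State.setNat_nat, hp], by simp [State.setNat_nat, e3],
      (h1.setNat _ _ (by simp)).setNat _ _ (by simp), ?_, fun w => ?_, fun w => ?_⟩
    · simp only [BExp.cost, NExp.cost]; omega
    · simp only [State.setNat_nat, Nat.reduceEqDiff, reduceIte, Function.update_apply]
      split_ifs
      · exact le_rfl
      · exact h3 w
    · simp only [State.setNat_nat, Nat.reduceEqDiff, reduceIte, Function.update_apply]
      split_ifs with hw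
      · simp only [true_iff]
        exact ⟨c, hc, le_rfl, hk, hw.symm⟩
      · rw [h4 w]
        constructor
        · rintro ⟨c', g1, g2, g3⟩; exact ⟨c', g1, by omega, g3⟩
        · rintro ⟨c', g1, g2, g3⟩
          refine ⟨c', g1, ?_, g3⟩
          rcases Nat.lt_or_eq_of_le g2 with h | rfl
          · exact h
          · exact (hw g3.2.symm).elim
  · rintro τ t ⟨j, t', ⟨h1, h2, h3, h4⟩, ht, hj⟩
    obtain rfl : j = 0 := hj.resolve_right (by simp [BExp.Holds, NExp.eval])
    refine ⟨h1, ?_, h3, fun w => (h4 w).trans (by simp)⟩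
    simp only [BExp.cost, NExp.cost] at ht
    omega

/-- Record `w` as a common neighbour of the ends of `e`. -/
def register (e w : NExp) : Prog :=
  .seq (.ite (.nlt (.get aCnt e) (.lit 1)) (.nset aT1 e w)
      (.ite (.nlt (.get aCnt e) (.lit 2)) (.nset aT2 e w) .skip))
    (.nset aCnt e (.succ (.get aCnt e)))

/-- Look for marked vertices among the neighbours of the other end of the current cell. -/
def scanProg : Prog :=
  traverse sR aHead aNext (.get aOth (.pred (sc sQ))) (.nlt (.lit 0) (sc sFuel))
    (.seq (.ite (NExp.eq (.get aMark (.get aOth (.pred (sc sR)))) (.succ (sc sI)))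
        (register (.get aVal (.pred (sc sQ))) (.get aOth (.pred (sc sR)))) .skip)
      (.nset sFuel (.lit 0) (.pred (sc sFuel))))

/-- Each inspected cell burns one unit of fuel, which pays for 200 steps, so that time is controlled
without knowing the length of the list. The recorded common neighbours are claimed to be complete
only if fuel is left. -/
theorem scanProg_spec {σ : State} {key : ℕ → ℕ} {K v e u : ℕ}
    (hB : Buckets (σ.nat aHead) (σ.nat aNext) key K)
    (hinj : ∀ c < K, ∀ c' < K, key c = key c' → σ.nat aOth c = σ.nat aOth c' → c = c')
    (hv : σ.nat sI 0 = v) (he : σ.nat aVal (σ.nat sQ 0 - 1) = e)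
    (hu : σ.nat aOth (σ.nat sQ 0 - 1) = u) (hcnt : σ.nat aCnt e = 0) :
    Ex scanProg σ fun τ t => SameBut [sR, sFuel, aCnt, aT1, aT2] [] σ τ ∧
      (∀ e' ≠ e, τ.nat aCnt e' = σ.nat aCnt e' ∧ τ.nat aT1 e' = σ.nat aT1 e' ∧
        τ.nat aT2 e' = σ.nat aT2 e') ∧
      τ.nat sFuel 0 ≤ σ.nat sFuel 0 ∧
      σ.nat sFuel 0 ≤ τ.nat sFuel 0 + Nat.count (fun c => key c = u) K ∧
      (0 < τ.nat sFuel 0 → Reg (τ.nat aCnt e) (τ.nat aT1 e) (τ.nat aT2 e)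
        {w | (∃ c < K, key c = u ∧ σ.nat aOth c = w) ∧ σ.nat aMark w = v + 1}) ∧
      t + 200 * τ.nat sFuel 0 ≤ 200 * σ.nat sFuel 0 + 50 := by
  refine (Ex.traverse (σ := σ) (v := u) hB
    (fun j τ t => SameBut [sR, sFuel, aCnt, aT1, aT2] [] σ τ ∧
      (∀ e' ≠ e, τ.nat aCnt e' = σ.nat aCnt e' ∧ τ.nat aT1 e' = σ.nat aT1 e' ∧
        τ.nat aT2 e' = σ.nat aT2 e') ∧
      τ.nat sFuel 0 ≤ σ.nat sFuel 0 ∧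
      σ.nat sFuel 0 + Nat.count (fun c => key c = u) j ≤
        τ.nat sFuel 0 + Nat.count (fun c => key c = u) K ∧
      Reg (τ.nat aCnt e) (τ.nat aT1 e) (τ.nat aT2 e)
        {w | (∃ c < K, j ≤ c ∧ key c = u ∧ σ.nat aOth c = w) ∧ σ.nat aMark w = v + 1} ∧
      t + 200 * τ.nat sFuel 0 ≤ 200 * σ.nat sFuel 0)
    rfl (by simp only [NExp.eval]; exact hu) ?_ ?_ ?_).mono ?_
  · rintro j j' τ t hj hne ⟨h1, h2, h3, h4, h5, h6⟩
    have := Nat.count_monotone (fun c => key c = u) hj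
    refine ⟨h1, h2, h3, by omega, ?_, h6⟩
    convert h5 using 4
    constructor
    · rintro ⟨c, h5, h6, h7⟩
      refine ⟨c, h5, ?_, h7⟩
      by_contra! h8
      exact hne c h6 h8 h7.1
    · rintro ⟨c, h5, h6, h7⟩; exact ⟨c, h5, hj.trans h6, h7⟩
  · refine ⟨(SameBut.refl _ _ σ).setNat _ _ (by simp), by simp [State.setNat_nat],
      by simp [State.setNat_nat], by simp [State.setNat_nat], ?_, by simp [State.setNat_nat]⟩
    have : {w | (∃ c < K, K ≤ c ∧ key c = u ∧ σ.nat aOth c = w) ∧ σ.nat aMark w = v + 1} = ∅ := by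
      ext w
      simp only [Set.mem_ofPred_eq, Set.mem_empty_iff_false, iff_false]
      rintro ⟨⟨c, h1, h2, -⟩, -⟩; omega
    rw [this]
    simp only [State.setNat_nat, Nat.reduceEqDiff, reduceIte, hcnt]
    exact Reg.empty _ _
  · rintro c τ t hc hk hp hg ⟨h1, h2, h3, h4, h5, h6⟩
    refine Ex.of_exec (by simp [Prog.LoopFree, register]) fun s hs => ?_
    have hb : s ≤ 150 := hs.trans (by simp [Prog.bound, NExp.cost, BExp.cost, register])
    have e1 : τ.nat sI = σ.nat sI := h1.1 _ (by decide)
    have e2 : τ.nat aOth = σ.nat aOth := h1.1 _ (by decide)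
    have e3 : τ.nat aNext = σ.nat aNext := h1.1 _ (by decide)
    have e4 : τ.nat aMark = σ.nat aMark := h1.1 _ (by decide)
    have e5 : τ.nat sQ = σ.nat sQ := h1.1 _ (by decide)
    have e6 : τ.nat aVal = σ.nat aVal := h1.1 _ (by decide)
    have hct : Nat.count (fun c => key c = u) (c + 1) = Nat.count (fun c => key c = u) c + 1 := by
      rw [Nat.count_succ, if_pos hk]
    simp only [BExp.Holds, NExp.eval] at hg
    have htest : (NExp.eq (.get aMark (.get aOth (.pred (sc sR)))) (.succ (sc sI))).Holds τ ↔
        σ.nat aMark (σ.nat aOth c) = v + 1 := by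
      simp only [BExp.Holds, NExp.eval, hp, e1, e2, e4, hv, Nat.add_sub_cancel]; omega
    set w₀ := σ.nat aOth c with hw₀
    have hset : {w | (∃ c' < K, c ≤ c' ∧ key c' = u ∧ σ.nat aOth c' = w) ∧ σ.nat aMark w = v + 1} =
        if σ.nat aMark w₀ = v + 1 then insert w₀
          {w | (∃ c' < K, c + 1 ≤ c' ∧ key c' = u ∧ σ.nat aOth c' = w) ∧ σ.nat aMark w = v + 1}
        else {w | (∃ c' < K, c + 1 ≤ c' ∧ key c' = u ∧ σ.nat aOth c' = w) ∧
          σ.nat aMark w = v + 1} := by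
      have hsub : ∀ w, (∃ c' < K, c ≤ c' ∧ key c' = u ∧ σ.nat aOth c' = w) ↔
          w = w₀ ∨ ∃ c' < K, c + 1 ≤ c' ∧ key c' = u ∧ σ.nat aOth c' = w := by
        intro w
        constructor
        · rintro ⟨c', g1, g2, g3, g4⟩
          rcases Nat.lt_or_eq_of_le g2 with g | rfl
          · exact .inr ⟨c', g1, g, g3, g4⟩
          · exact .inl g4.symm
        · rintro (rfl | ⟨c', g1, g2, g3⟩)
          · exact ⟨c, hc, le_rfl, hk, rfl⟩
          · exact ⟨c', g1, by omega, g3⟩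
      ext w
      simp only [Set.mem_ofPred_eq, hsub]
      split_ifs with hw
      · simp only [Set.mem_insert_iff, Set.mem_ofPred_eq]
        constructor
        · rintro ⟨h | h, h'⟩
          · exact .inl h
          · exact .inr ⟨h, h'⟩
        · rintro (rfl | h)
          · exact ⟨.inl rfl, hw⟩
          · exact ⟨.inr h.1, h.2⟩
      · simp only [Set.mem_ofPred_eq]
        constructor
        · rintro ⟨rfl | h, h'⟩
          · exact (hw h').elim
          · exact ⟨h, h'⟩
        · rintro ⟨h, h'⟩
          exact ⟨.inr h, h'⟩
    have hx : ∃ υ : State, Prog.exec (.seq (.ite (NExp.eq (.get aMark (.get aOth (.pred (sc sR))))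
          (.succ (sc sI))) (register (.get aVal (.pred (sc sQ))) (.get aOth (.pred (sc sR)))) .skip)
          (.nset sFuel (.lit 0) (.pred (sc sFuel)))) τ = υ ∧
          SameBut [sR, sFuel, aCnt, aT1, aT2] [] τ υ ∧ υ.nat sR = τ.nat sR ∧
          υ.nat sFuel 0 = τ.nat sFuel 0 - 1 ∧
          if σ.nat aMark w₀ = v + 1 then
          υ.nat aCnt = Function.update (τ.nat aCnt) e (τ.nat aCnt e + 1) ∧
          υ.nat aT1 = (if τ.nat aCnt e < 1 then Function.update (τ.nat aT1) e w₀ else τ.nat aT1) ∧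
          υ.nat aT2 = (if τ.nat aCnt e < 1 then τ.nat aT2 else if τ.nat aCnt e < 2 then
            Function.update (τ.nat aT2) e w₀ else τ.nat aT2)
          else υ.nat aCnt = τ.nat aCnt ∧ υ.nat aT1 = τ.nat aT1 ∧ υ.nat aT2 = τ.nat aT2 := by
      refine ⟨_, rfl, (SameBut.of_exec (by simp [Prog.LoopFree, register]) _).mono
        (by decide) (by decide), ?_⟩
      simp only [Prog.exec]
      by_cases hw : σ.nat aMark w₀ = v + 1
      · rw [if_pos (htest.2 hw), if_pos hw]
        simp only [register, Prog.exec, NExp.eval, BExp.Holds, e5, e6, he, hp,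
          e2, Nat.add_sub_cancel, ← hw₀]
        split_ifs <;> simp [State.setNat_nat, he, e5, e6]
      · rw [if_neg (mt htest.1 hw), if_neg hw]
        simp [State.setNat_nat, NExp.eval]
    obtain ⟨υ, hυ, f1, f2, f3, f4⟩ := hx
    rw [hυ, f2, f1.1 aNext (by decide), e3]
    refine ⟨hp, rfl, ((h1.trans f1 (by simp) (by simp))).setNat _ _ (by simp), ?_, ?_, ?_, ?_, ?_⟩
    · intro e' he'
      simp only [State.setNat_nat, Nat.reduceEqDiff, reduceIte]
      by_cases hw : σ.nat aMark w₀ = v + 1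
      · obtain ⟨f4, f5, f6⟩ := (if_pos hw).mp f4
        rw [f4, f5, f6, Function.update_of_ne he']
        obtain ⟨g1, g2, g3⟩ := h2 e' he'
        refine ⟨g1, ?_, ?_⟩ <;> split_ifs <;> simp [he', g2, g3]
      · obtain ⟨f4, f5, f6⟩ := (if_neg hw).mp f4
        rw [f4, f5, f6]
        exact h2 e' he'
    · simp only [State.setNat_nat, Nat.reduceEqDiff, reduceIte, f3]; omega
    · simp only [State.setNat_nat, Nat.reduceEqDiff, reduceIte, f3]; omega
    · rw [hset]
      simp only [State.setNat_nat, Nat.reduceEqDiff, reduceIte]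
      by_cases hw : σ.nat aMark w₀ = v + 1
      · obtain ⟨f4, f5, f6⟩ := (if_pos hw).mp f4
        rw [if_pos hw]
        rw [f4, f5, f6]
        convert h5.insert (z := w₀) ?_ using 1
        · simp
        · split_ifs <;> simp
        · split_ifs <;> simp
        -- A vertex occurs only once in the list of `u`, since a cell is determined by its two ends;
        -- so the count is that of a set.
        · rintro ⟨⟨c', g1, g2, g3, g4⟩, -⟩
          have := hinj c hc c' g1 (hk.trans g3.symm) g4.symm
          omega
      · obtain ⟨f4, f5, f6⟩ := (if_neg hw).mp f4
        rw [if_neg hw, f4, f5, f6]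
        exact h5
    · simp only [State.setNat_nat, Nat.reduceEqDiff, reduceIte, f3, BExp.cost, NExp.cost]; omega
  · rintro τ t ⟨j, t', ⟨h1, h2, h3, h4, h5, h6⟩, ht, hj⟩
    refine ⟨h1, h2, h3, by omega, fun hf => ?_, ?_⟩
    · obtain rfl : j = 0 := hj.resolve_right (not_not.2 hf)
      simpa using h5
    · simp only [BExp.cost, NExp.cost] at ht
      omega

/-- The arrays `e₁` and `e₂` list the ends of `m` different edges on the vertices below `n`. -/
structure EdgeList (e₁ e₂ : ℕ → ℕ) (m n : ℕ) : Prop where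
  lt₁ : ∀ e < m, e₁ e < n
  lt₂ : ∀ e < m, e₂ e < n
  ne : ∀ e < m, e₁ e ≠ e₂ e
  inj : ∀ e < m, ∀ e' < m, (e₁ e = e₁ e' ∧ e₂ e = e₂ e' ∨ e₁ e = e₂ e' ∧ e₂ e = e₁ e') → e = e'

theorem endKey_cases (e₁ e₂ : ℕ → ℕ) {c m : ℕ} (hc : c < 2 * m) :
    ∃ e < m, c / 2 = e ∧ (c = 2 * e ∧ endKey e₁ e₂ c = e₁ e ∧ endKey e₂ e₁ c = e₂ e ∨
      c = 2 * e + 1 ∧ endKey e₁ e₂ c = e₂ e ∧ endKey e₂ e₁ c = e₁ e) := by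
  refine ⟨c / 2, by omega, rfl, ?_⟩
  rcases Nat.mod_two_eq_zero_or_one c with h | h
  · left; refine ⟨by omega, by simp [endKey, h], by simp [endKey, h]⟩
  · right; refine ⟨by omega, by simp [endKey, h], by simp [endKey, h]⟩

theorem EdgeList.cell_inj {e₁ e₂ : ℕ → ℕ} {m n : ℕ} (h : EdgeList e₁ e₂ m n) {c c' : ℕ}
    (hc : c < 2 * m) (hc' : c' < 2 * m) (hk : endKey e₁ e₂ c = endKey e₁ e₂ c')
    (ho : endKey e₂ e₁ c = endKey e₂ e₁ c') : c = c' := by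
  obtain ⟨e, he, -, h1⟩ := endKey_cases e₁ e₂ hc
  obtain ⟨e', he', -, h2⟩ := endKey_cases e₁ e₂ hc'
  have h3 := h.inj e he e' he'
  have h4 := h.ne e he
  rcases h1 with ⟨h5, h6, h7⟩ | ⟨h5, h6, h7⟩ <;> rcases h2 with ⟨h8, h9, h10⟩ | ⟨h8, h9, h10⟩ <;>
    rw [h6, h9] at hk <;> rw [h7, h10] at ho
  · have := h3 (.inl ⟨hk, ho⟩); omega
  · obtain rfl := h3 (.inr ⟨hk, ho⟩); exact (h4 hk).elim
  · obtain rfl := h3 (.inr ⟨ho, hk⟩); exact (h4 ho).elim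
  · have := h3 (.inl ⟨ho, hk⟩); omega

/-- `u` precedes `v` in the order by degree (and number). -/
def Smaller (deg : ℕ → ℕ) (u v : ℕ) : Prop := deg u < deg v ∨ ¬ deg v < deg u ∧ u < v

theorem Smaller.asymm {deg : ℕ → ℕ} {u v : ℕ} (h : Smaller deg u v) : ¬ Smaller deg v u := by
  unfold Smaller at *; omega

theorem Smaller.total (deg : ℕ → ℕ) {u v : ℕ} (h : u ≠ v) : Smaller deg u v ∨ Smaller deg v u := by
  unfold Smaller; omega

/-- The cell `c` leads to the smaller end of its edge. -/
def SmallCell (e₁ e₂ deg : ℕ → ℕ) (c : ℕ) : Prop := Smaller deg (endKey e₂ e₁ c) (endKey e₁ e₂ c)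

/-- The two cells of an edge lead in opposite directions, and `Smaller` is asymmetric. So each edge
is treated from one end only. -/
theorem SmallCell.unique {e₁ e₂ deg : ℕ → ℕ} {c c' m : ℕ} (hc : c < 2 * m)
    (hs : SmallCell e₁ e₂ deg c) (hs' : SmallCell e₁ e₂ deg c') (he : c / 2 = c' / 2) : c = c' := by
  have hc' : c' < 2 * m := by omega
  unfold SmallCell at *
  obtain ⟨e, -, h0, h1⟩ := endKey_cases e₁ e₂ hc
  obtain ⟨e', -, h0', h2⟩ := endKey_cases e₁ e₂ hc'
  obtain rfl : e = e' := by omega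
  rcases h1 with ⟨h5, h6, h7⟩ | ⟨h5, h6, h7⟩ <;> rcases h2 with ⟨h8, h9, h10⟩ | ⟨h8, h9, h10⟩ <;>
    rw [h6, h7] at hs <;> rw [h9, h10] at hs'
  · omega
  · exact (hs.asymm hs').elim
  · exact (hs.asymm hs').elim
  · omega

theorem EdgeList.exists_small {e₁ e₂ : ℕ → ℕ} {m n : ℕ} (h : EdgeList e₁ e₂ m n) (deg : ℕ → ℕ)
    {e : ℕ} (he : e < m) : ∃ c < 2 * m, c / 2 = e ∧ SmallCell e₁ e₂ deg c ∧
      (endKey e₁ e₂ c = e₁ e ∧ endKey e₂ e₁ c = e₂ e ∨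
        endKey e₁ e₂ c = e₂ e ∧ endKey e₂ e₁ c = e₁ e) := by
  rcases Smaller.total deg (h.ne e he) with hs | hs
  · refine ⟨2 * e + 1, by omega, by omega, ?_, .inr ?_⟩
    · unfold SmallCell; rwa [endKey_two_mul_add_one, endKey_two_mul_add_one]
    · rw [endKey_two_mul_add_one, endKey_two_mul_add_one]; exact ⟨rfl, rfl⟩
  · refine ⟨2 * e, by omega, by omega, ?_, .inl ?_⟩
    · unfold SmallCell; rwa [endKey_two_mul, endKey_two_mul]
    · rw [endKey_two_mul, endKey_two_mul]; exact ⟨rfl, rfl⟩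

/-- `w` is a neighbour of `u`. -/
def Nb (e₁ e₂ : ℕ → ℕ) (m u w : ℕ) : Prop :=
  ∃ c < 2 * m, endKey e₁ e₂ c = u ∧ endKey e₂ e₁ c = w

theorem count_lt_succ (key : ℕ → ℕ) (v K : ℕ) : Nat.count (fun c => key c < v + 1) K =
    Nat.count (fun c => key c < v) K + Nat.count (fun c => key c = v) K := by
  induction K with
  | zero => simp
  | succ K ih =>
    simp only [Nat.count_succ, ih]
    split_ifs <;> omega

/-- The state of the search for common neighbours after the cells in `D` have been treated. -/
structure Thirds (σ τ : State) (m : ℕ) (D : ℕ → Prop) : Prop where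
  reg : 0 < τ.nat sFuel 0 → ∀ c < 2 * m, SmallCell (σ.nat 1) (σ.nat 2) (σ.nat aDeg) c → D c →
    Reg (τ.nat aCnt (c / 2)) (τ.nat aT1 (c / 2)) (τ.nat aT2 (c / 2))
      {w | Nb (σ.nat 1) (σ.nat 2) m (endKey (σ.nat 2) (σ.nat 1) c) w ∧
        Nb (σ.nat 1) (σ.nat 2) m (endKey (σ.nat 1) (σ.nat 2) c) w}
  zero : ∀ c < 2 * m, SmallCell (σ.nat 1) (σ.nat 2) (σ.nat aDeg) c → ¬ D c →
    τ.nat aCnt (c / 2) = 0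
  le : τ.nat sFuel 0 ≤ σ.nat sFuel 0
  fuel : ∀ S : Finset ℕ,
    (∀ c < 2 * m, SmallCell (σ.nat 1) (σ.nat 2) (σ.nat aDeg) c → D c → c ∈ S) →
    σ.nat sFuel 0 ≤ τ.nat sFuel 0 + ∑ c ∈ S, σ.nat aDeg (endKey (σ.nat 2) (σ.nat 1) c)

theorem Thirds.congr {σ τ : State} {m : ℕ} {D D' : ℕ → Prop} (h : Thirds σ τ m D)
    (hD : ∀ c < 2 * m, SmallCell (σ.nat 1) (σ.nat 2) (σ.nat aDeg) c → (D c ↔ D' c)) :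
    Thirds σ τ m D' where
  reg hf c hc hs hd := h.reg hf c hc hs ((hD c hc hs).2 hd)
  zero c hc hs hd := h.zero c hc hs fun hh => hd ((hD c hc hs).1 hh)
  le := h.le
  fuel S hS := h.fuel S fun c hc hs hd => hS c hc hs ((hD c hc hs).1 hd)

theorem Thirds.of_eq {σ τ υ : State} {m : ℕ} {D : ℕ → Prop} (h : Thirds σ τ m D)
    (h1 : υ.nat sFuel = τ.nat sFuel) (h2 : υ.nat aCnt = τ.nat aCnt) (h3 : υ.nat aT1 = τ.nat aT1)
    (h4 : υ.nat aT2 = τ.nat aT2) : Thirds σ υ m D := by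
  obtain ⟨g1, g2, g3, g4⟩ := h
  constructor
  · rwa [h1, h2, h3, h4]
  · rwa [h2]
  · rwa [h1]
  · rwa [h1]

/-- Treat the edges from the current vertex to smaller ones. -/
def nbrProg : Prog :=
  traverse sQ aHead aNext (sc sI) trueTest
    (.ite (.or (.nlt (.get aDeg (.get aOth (.pred (sc sQ)))) (.get aDeg (sc sI)))
        (.and (.not (.nlt (.get aDeg (sc sI)) (.get aDeg (.get aOth (.pred (sc sQ))))))
          (.nlt (.get aOth (.pred (sc sQ))) (sc sI))))
      scanProg .skip)

/-- While the neighbours of `v` are marked, the list of each smaller neighbour `u` is scanned for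
marks, which finds the common neighbours of `u` and `v`. -/
theorem nbrProg_spec {σ τ₀ : State} {m n v : ℕ} (hE : EdgeList (σ.nat 1) (σ.nat 2) m n)
    (hI : Incidence σ m)
    (hσ : SameBut [sI, sP, sQ, sR, aMark, sFuel, aCnt, aT1, aT2] [] σ τ₀)
    (hv : τ₀.nat sI 0 = v)
    (hm : ∀ w, τ₀.nat aMark w = v + 1 ↔ Nb (σ.nat 1) (σ.nat 2) m v w)
    (hT : Thirds σ τ₀ m fun c => endKey (σ.nat 1) (σ.nat 2) c < v) :
    Ex nbrProg τ₀ fun τ t => SameBut [sQ, sR, sFuel, aCnt, aT1, aT2] [] τ₀ τ ∧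
      Thirds σ τ m (fun c => endKey (σ.nat 1) (σ.nat 2) c < v + 1) ∧
      t + 200 * τ.nat sFuel 0 ≤ 200 * τ₀.nat sFuel 0 +
        300 * (Nat.count (fun c => endKey (σ.nat 1) (σ.nat 2) c = v) (2 * m) + 1) := by
  set key := endKey (σ.nat 1) (σ.nat 2) with hkey
  set oth := endKey (σ.nat 2) (σ.nat 1) with hoth
  have a1 : τ₀.nat aHead = σ.nat aHead := hσ.1 _ (by decide)
  refine (Ex.traverse (σ := τ₀) (v := v) hI.buckets
    (fun j τ t => SameBut [sQ, sR, sFuel, aCnt, aT1, aT2] [] τ₀ τ ∧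
      Thirds σ τ m (fun c => key c < v ∨ key c = v ∧ j ≤ c) ∧
      t + 200 * τ.nat sFuel 0 + 300 * Nat.count (fun c => key c = v) j ≤ 200 * τ₀.nat sFuel 0 +
        300 * Nat.count (fun c => key c = v) (2 * m))
    a1 (by simp only [NExp.eval]; exact hv) ?_ ?_ ?_).mono ?_
  · rintro j j' τ t hj hne ⟨h1, h2, h3⟩
    have := Nat.count_monotone (fun c => key c = v) hj
    refine ⟨h1, h2.congr fun c _ _ => or_congr Iff.rfl (and_congr_right fun hk => ?_), by omega⟩
    constructor
    · exact hj.trans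
    · intro h
      by_contra! h'
      exact hne c h h' hk
  · refine ⟨(SameBut.refl _ _ τ₀).setNat _ _ (by simp), ?_, by simp [State.setNat_nat]⟩
    refine (hT.of_eq ?_ ?_ ?_ ?_).congr fun c hc _ => ?_
    · simp [State.setNat_nat]
    · simp [State.setNat_nat]
    · simp [State.setNat_nat]
    · simp [State.setNat_nat]
    · constructor
      · exact .inl
      · rintro (h | h)
        · exact h
        · omega
  · rintro c τ t hc hk hp - ⟨h1, h2, h3⟩
    replace hk : key c = v := hk
    have hστ : SameBut [sI, sP, sQ, sR, aMark, sFuel, aCnt, aT1, aT2] [] σ τ :=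
      hσ.trans h1 (by decide) (by simp)
    have e1 : τ.nat sI 0 = v := by rw [h1.1 _ (by decide)]; exact hv
    have e2 : τ.nat aOth = σ.nat aOth := hστ.1 _ (by decide)
    have e3 : τ.nat aNext = σ.nat aNext := hστ.1 _ (by decide)
    have e4 : τ.nat aDeg = σ.nat aDeg := hστ.1 _ (by decide)
    have e5 : τ.nat aVal = σ.nat aVal := hστ.1 _ (by decide)
    have e6 : τ.nat aHead = σ.nat aHead := hστ.1 _ (by decide)
    have e7 : τ.nat aMark = τ₀.nat aMark := h1.1 _ (by decide)
    have hct : Nat.count (fun c => key c = v) (c + 1) = Nat.count (fun c => key c = v) c + 1 := by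
      rw [Nat.count_succ, if_pos hk]
    have ho : σ.nat aOth c = oth c := hI.oth c hc
    have htest : (BExp.or (.nlt (.get aDeg (.get aOth (.pred (sc sQ)))) (.get aDeg (sc sI)))
        (.and (.not (.nlt (.get aDeg (sc sI)) (.get aDeg (.get aOth (.pred (sc sQ))))))
          (.nlt (.get aOth (.pred (sc sQ))) (sc sI)))).Holds τ ↔
        SmallCell (σ.nat 1) (σ.nat 2) (σ.nat aDeg) c := by
      unfold SmallCell Smaller
      rw [← hkey, ← hoth, hk]
      simp only [BExp.Holds, NExp.eval, hp, e1, e2, e4, ho, Nat.add_sub_cancel]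
      tauto
    have hD : ∀ c' < 2 * m, c' ≠ c → ((key c' < v ∨ key c' = v ∧ c + 1 ≤ c') ↔
        (key c' < v ∨ key c' = v ∧ c ≤ c')) := fun c' _ hne => by omega
    by_cases hs : SmallCell (σ.nat 1) (σ.nat 2) (σ.nat aDeg) c
    · refine Ex.iteTrue (htest.2 hs) ?_
      have hB : Buckets (τ.nat aHead) (τ.nat aNext) key (2 * m) := by
        rw [e6, e3]; exact hI.buckets
      have hvc : σ.nat aVal c = c / 2 := hI.val c hc
      refine (scanProg_spec (v := v) (e := c / 2) (u := oth c) hB ?_ e1 ?_ ?_ ?_).mono ?_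
      · intro d hd d' hd' hk' ho'
        rw [e2, hI.oth d hd, hI.oth d' hd'] at ho'
        exact hE.cell_inj hd hd' hk' ho'
      · rw [hp, Nat.add_sub_cancel, e5, hvc]
      · rw [hp, Nat.add_sub_cancel, e2, ho]
      · exact h2.zero c hc hs (by omega)
      rintro υ s ⟨g1, g2, g3, g4, g5, g6⟩
      have hset : {w | (∃ d < 2 * m, key d = oth c ∧ τ.nat aOth d = w) ∧ τ.nat aMark w = v + 1} =
          {w | Nb (σ.nat 1) (σ.nat 2) m (oth c) w ∧ Nb (σ.nat 1) (σ.nat 2) m (key c) w} := by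
        ext w
        simp only [Set.mem_ofPred_eq, e7, hm, hk]
        refine and_congr (exists_congr fun d => and_congr_right fun hd => ?_) Iff.rfl
        rw [e2, hI.oth d hd]
      rw [hset] at g5
      refine ⟨by rw [g1.1 _ (by decide)]; exact hp, by rw [g1.1 _ (by decide)]; exact e3,
        (h1.trans g1 (by decide) (by simp)).setNat _ _ (by simp), ?_, ?_⟩
      · refine Thirds.of_eq (τ := υ) ?_ (by simp [State.setNat_nat]) (by simp [State.setNat_nat])
          (by simp [State.setNat_nat]) (by simp [State.setNat_nat])
        have hne : ∀ c' < 2 * m, SmallCell (σ.nat 1) (σ.nat 2) (σ.nat aDeg) c' → c' ≠ c →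
            c' / 2 ≠ c / 2 := fun c' hc' hs' hn he => hn (hs'.unique hc' hs he)
        constructor
        · intro hf c' hc' hs' hd'
          by_cases hcc : c' = c
          · subst hcc; exact g5 hf
          · obtain ⟨f1, f2, f3⟩ := g2 _ (hne c' hc' hs' hcc)
            rw [f1, f2, f3]
            exact h2.reg (by omega) c' hc' hs' ((hD c' hc' hcc).2 hd')
        · intro c' hc' hs' hd'
          have hcc : c' ≠ c := by rintro rfl; exact hd' (.inr ⟨hk, le_rfl⟩)
          rw [(g2 _ (hne c' hc' hs' hcc)).1]
          exact h2.zero c' hc' hs' fun h => hd' ((hD c' hc' hcc).1 h)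
        · exact g3.trans h2.le
        · intro S hS
          have hcS : c ∈ S := hS c hc hs (.inr ⟨hk, le_rfl⟩)
          -- The cells treated before lie in `S` without `c`; the term of `c` in the sum is the
          -- length of the list just scanned, a bound for the fuel burnt by this scan.
          have h4 := h2.fuel (S.erase c) fun c' hc' hs' hd' => by
            have hcc : c' ≠ c := by rintro rfl; omega
            exact Finset.mem_erase.2 ⟨hcc, hS c' hc' hs' ((hD c' hc' hcc).1 hd')⟩
          rw [← Finset.add_sum_erase _ _ hcS, hI.deg (endKey (σ.nat 2) (σ.nat 1) c)]
          have : Nat.count (fun c' => key c' = oth c) (2 * m) =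
            Nat.count (fun c' => endKey (σ.nat 1) (σ.nat 2) c' = endKey (σ.nat 2) (σ.nat 1) c)
              (2 * m) := rfl
          omega
      · simp only [State.setNat_nat, Nat.reduceEqDiff, reduceIte, BExp.cost, NExp.cost]
        omega
    · refine Ex.iteFalse (mt htest.1 hs) ⟨_, _, .skip _, ?_⟩
      refine ⟨hp, e3, h1.setNat _ _ (by simp), ?_, ?_⟩
      · refine Thirds.of_eq (τ := τ) ?_ (by simp [State.setNat_nat]) (by simp [State.setNat_nat])
          (by simp [State.setNat_nat]) (by simp [State.setNat_nat])
        exact h2.congr fun c' hc' hs' => hD c' hc' (by rintro rfl; exact hs hs')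
      · simp only [State.setNat_nat, Nat.reduceEqDiff, reduceIte, BExp.cost, NExp.cost]
        omega
  · rintro τ t ⟨j, t', ⟨h1, h2, h3⟩, ht, hj⟩
    obtain rfl : j = 0 := hj.resolve_right (by simp [BExp.Holds, NExp.eval])
    refine ⟨h1, h2.congr fun c _ _ => by omega, ?_⟩
    simp only [BExp.cost, NExp.cost, Nat.count_zero] at ht h3
    omega

/-- Find the common neighbours of the ends of every edge. -/
def thirdsProg : Prog := forLoop sI (.get 0 (.lit 0)) (.seq markProg nbrProg)

/-- The scans burn at most the sum of the smaller degrees over all edges; everything else is linear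
in `n + m`. The last clause turns an exhausted supply of fuel into a lower bound for that sum. -/
theorem thirdsProg_spec {σ : State} {m n : ℕ} (hn : σ.nat 0 0 = n)
    (hE : EdgeList (σ.nat 1) (σ.nat 2) m n) (hI : Incidence σ m)
    (hm : ∀ w, σ.nat aMark w = 0) (hc : ∀ e, σ.nat aCnt e = 0) :
    Ex thirdsProg σ fun τ t =>
      t ≤ 200 * σ.nat sFuel 0 + 500 * (2 * m + n + 1) ∧
      (0 < τ.nat sFuel 0 → ∀ e < m, Reg (τ.nat aCnt e) (τ.nat aT1 e) (τ.nat aT2 e)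
        {w | Nb (σ.nat 1) (σ.nat 2) m (σ.nat 1 e) w ∧ Nb (σ.nat 1) (σ.nat 2) m (σ.nat 2 e) w}) ∧
      ∀ S : Finset ℕ, (∀ c < 2 * m, SmallCell (σ.nat 1) (σ.nat 2) (σ.nat aDeg) c → c ∈ S) →
        σ.nat sFuel 0 ≤ τ.nat sFuel 0 + ∑ c ∈ S, σ.nat aDeg (endKey (σ.nat 2) (σ.nat 1) c) := by
  set key := endKey (σ.nat 1) (σ.nat 2) with hkey
  refine (Ex.forLoop' (σ := σ) n
    (fun v τ t => SameBut [sI, sP, sQ, sR, aMark, sFuel, aCnt, aT1, aT2] [] σ τ ∧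
      (∀ w, τ.nat aMark w ≤ v) ∧ Thirds σ τ m (fun c => key c < v) ∧
      t + 200 * τ.nat sFuel 0 ≤ 200 * σ.nat sFuel 0 +
        500 * (Nat.count (fun c => key c < v) (2 * m) + v)) ?_ ?_ ?_).mono ?_
  · rintro v τ t ⟨h, -⟩
    simp only [NExp.eval]
    rw [h.1 _ (by decide), hn]
  · refine ⟨(SameBut.refl _ _ σ).setNat _ _ (by simp), by simp [State.setNat_nat, hm], ?_,
      by simp [State.setNat_nat]⟩
    constructor
    · intro _ c _ _ h; omega
    · intro c _ _ _; simp [State.setNat_nat, hc]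
    · simp [State.setNat_nat]
    · intro S _; simp [State.setNat_nat]
  · rintro v τ t hv hi ⟨h1, h2, h3, h4⟩
    refine Ex.seq ((markProg_spec (key := key) (K := 2 * m) ?_ hi h2).mono ?_)
    · rw [h1.1 aHead (by decide), h1.1 aNext (by decide)]; exact hI.buckets
    rintro υ s ⟨g1, g2, g3, g4⟩
    have hu : SameBut [sI, sP, sQ, sR, aMark, sFuel, aCnt, aT1, aT2] [] σ υ :=
      h1.trans g1 (by decide) (by simp)
    have f1 : υ.nat sI 0 = v := by rw [g1.1 _ (by decide)]; exact hi
    refine (nbrProg_spec (v := v) hE hI hu f1 ?_ ?_).mono ?_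
    · intro w
      rw [g4]
      refine exists_congr fun c => and_congr_right fun hc => ?_
      rw [h1.1 aOth (by decide), hI.oth c hc]
    · exact h3.of_eq (g1.1 _ (by decide)) (g1.1 _ (by decide)) (g1.1 _ (by decide))
        (g1.1 _ (by decide))
    rintro ω s' ⟨k1, k2, k3⟩
    refine ⟨by rw [k1.1 _ (by decide)]; exact f1,
      (hu.trans k1 (by decide) (by simp)).setNat _ _ (by simp), ?_, ?_, ?_⟩
    · intro w
      simp only [State.setNat_nat, Nat.reduceEqDiff, reduceIte]
      rw [k1.1 _ (by decide)]; exact g3 w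
    · exact k2.of_eq (by simp [State.setNat_nat]) (by simp [State.setNat_nat])
        (by simp [State.setNat_nat]) (by simp [State.setNat_nat])
    · simp only [State.setNat_nat, Nat.reduceEqDiff, reduceIte, NExp.cost]
      rw [count_lt_succ]
      have : υ.nat sFuel = τ.nat sFuel := g1.1 _ (by decide)
      rw [this] at k3
      have : Nat.count (fun c => key c = v) (2 * m) =
        Nat.count (fun c => endKey (σ.nat 1) (σ.nat 2) c = v) (2 * m) := rfl
      omega
  · rintro τ t ⟨t', ⟨h1, h2, h3, h4⟩, ht⟩
    have hlt : ∀ c < 2 * m, key c < n := fun c hc => by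
      obtain ⟨e, he, -, h⟩ := endKey_cases (σ.nat 1) (σ.nat 2) hc
      rw [hkey]
      rcases h with ⟨-, h, -⟩ | ⟨-, h, -⟩ <;> rw [h]
      · exact hE.lt₁ e he
      · exact hE.lt₂ e he
    refine ⟨?_, fun hf e he => ?_, fun S hS => h3.fuel S fun c hc hs _ => hS c hc hs⟩
    · have := Nat.count_le (p := fun c => key c < n) (n := 2 * m)
      simp only [NExp.cost] at ht
      omega
    · obtain ⟨c, hc, rfl, hs, hk⟩ := hE.exists_small (σ.nat aDeg) he
      have := h3.reg hf c hc hs (hlt c hc)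
      rcases hk with ⟨k1, k2⟩ | ⟨k1, k2⟩
      · rw [k1, k2] at this
        simpa only [and_comm] using this
      · rw [k1, k2] at this
        exact this

/-! ## Triangles by vertex -/

notation "aHd2" => (43 : ℕ)
notation "aNx2" => (44 : ℕ)
notation "aVal2" => (46 : ℕ)
notation "sK2" => (47 : ℕ)

/-- The key of cell `c` when edge `e` occupies the cells `4 e`, …, `4 e + 3`. -/
def quadKey (e₁ e₂ t₁ t₂ : ℕ → ℕ) (c : ℕ) : ℕ :=
  if c % 4 = 0 then e₁ (c / 4) else if c % 4 = 1 then e₂ (c / 4) else if c % 4 = 2 then t₁ (c / 4)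
  else t₂ (c / 4)

section

variable (e₁ e₂ t₁ t₂ : ℕ → ℕ) (e : ℕ)

theorem quadKey_zero : quadKey e₁ e₂ t₁ t₂ (4 * e) = e₁ e := by
  have h1 : (4 * e) % 4 = 0 := by omega
  have h2 : (4 * e) / 4 = e := by omega
  simp [quadKey]

theorem quadKey_one : quadKey e₁ e₂ t₁ t₂ (4 * e + 1) = e₂ e := by
  have h1 : (4 * e + 1) % 4 = 1 := by omega
  have h2 : (4 * e + 1) / 4 = e := by omega
  simp [quadKey, h1, h2]

theorem quadKey_two : quadKey e₁ e₂ t₁ t₂ (4 * e + 2) = t₁ e := by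
  have h1 : (4 * e + 2) % 4 = 2 := by omega
  have h2 : (4 * e + 2) / 4 = e := by omega
  simp [quadKey, h1, h2]

theorem quadKey_three : quadKey e₁ e₂ t₁ t₂ (4 * e + 3) = t₂ e := by
  have h1 : (4 * e + 3) % 4 = 3 := by omega
  have h2 : (4 * e + 3) / 4 = e := by omega
  simp [quadKey, h1, h2]

end

/-- Add the current edge to the list of `x`. -/
def addQuad (x : NExp) : Prog :=
  seqs [.nset aNx2 (sc sK2) (.get aHd2 x), .nset aVal2 (sc sK2) (sc sI),
    .nset aHd2 x (.succ (sc sK2)), .nset sK2 (.lit 0) (.succ (sc sK2))]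

/-- For every vertex, list the edges `e` such that it is an end of `e` or a common neighbour of the
ends of `e`. -/
def quadsProg : Prog :=
  forLoop sI (.get 0 (.lit 1))
    (seqs [addQuad (.get 1 (sc sI)), addQuad (.get 2 (sc sI)), addQuad (.get aT1 (sc sI)),
      addQuad (.get aT2 (sc sI))])

structure Quads (σ : State) (m : ℕ) : Prop where
  buckets : Buckets (σ.nat aHd2) (σ.nat aNx2)
    (quadKey (σ.nat 1) (σ.nat 2) (σ.nat aT1) (σ.nat aT2)) (4 * m)
  val : ∀ c < 4 * m, σ.nat aVal2 c = c / 4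

theorem addQuad_exec {p k i : ℕ} {τ : State} (hi : τ.nat sI 0 = i) (hk : τ.nat sK2 0 = k)
    (hp : p ∉ [sI, sK2, aHd2, aNx2, aVal2]) :
    let υ := (addQuad (.get p (sc sI))).exec τ
    SameBut [sK2, aHd2, aNx2, aVal2] [] τ υ ∧ υ.nat sK2 0 = k + 1 ∧
      υ.nat aHd2 = Function.update (τ.nat aHd2) (τ.nat p i) (k + 1) ∧
      υ.nat aNx2 = Function.update (τ.nat aNx2) k (τ.nat aHd2 (τ.nat p i)) ∧
      υ.nat aVal2 = Function.update (τ.nat aVal2) k i := by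
  simp only [List.mem_cons, List.not_mem_nil, or_false, not_or] at hp
  obtain ⟨h1, h2, h3, h4, h5⟩ := hp
  refine ⟨(SameBut.of_exec (by simp [addQuad, seqs, Prog.LoopFree]) _).mono (by simp [addQuad, seqs,
    Prog.natWrites]) (by simp [addQuad, seqs, Prog.realWrites]), ?_⟩
  simp [addQuad, seqs, Prog.exec, NExp.eval, State.setNat_nat, hi, hk, h4, h5]

theorem quadsProg_spec {σ : State} {m : ℕ} (hm : σ.nat 0 1 = m) (hh : ∀ v, σ.nat aHd2 v = 0)
    (hk : σ.nat sK2 0 = 0) :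
    Ex quadsProg σ fun τ t => t ≤ (m + 1) * 300 ∧ Quads τ m ∧
      SameBut [sI, sK2, aHd2, aNx2, aVal2] [] σ τ := by
  refine (Ex.forLoop (σ := σ) m 200
    (fun k τ => SameBut [sI, sK2, aHd2, aNx2, aVal2] [] σ τ ∧ τ.nat sK2 0 = 4 * k ∧ Quads τ k)
    ?_ ?_ ?_).mono ?_
  · rintro k τ ⟨h, -⟩; simp only [NExp.eval]; rw [h.1 0 (by decide), hm]
  · refine ⟨(SameBut.refl _ _ σ).setNat _ _ (by simp), by simp [State.setNat_nat, hk], ⟨?_, by simp⟩⟩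
    exact Buckets.nil (by simp [State.setNat_nat, hh])
  · rintro k τ hk hi ⟨h0, h1, ⟨b1, b2⟩⟩
    refine Ex.of_exec (by simp [seqs, addQuad, Prog.LoopFree]) fun t ht => ⟨?_, ?_⟩
    · exact ht.trans (by simp [seqs, addQuad, Prog.bound, NExp.cost])
    simp only [seqs, Prog.exec]
    obtain ⟨f1, f2, f3, f4, f5⟩ := addQuad_exec (p := 1) hi h1 (by decide)
    generalize (addQuad (.get 1 (sc sI))).exec τ = τ₁ at *
    obtain ⟨g1, g2, g3, g4, g5⟩ := addQuad_exec (p := 2) (τ := τ₁) (i := k)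
      (by rw [f1.1 _ (by decide)]; exact hi) f2 (by decide)
    generalize (addQuad (.get 2 (sc sI))).exec τ₁ = τ₂ at *
    obtain ⟨k1, k2, k3, k4, k5⟩ := addQuad_exec (p := aT1) (τ := τ₂) (i := k)
      (by rw [g1.1 _ (by decide), f1.1 _ (by decide)]; exact hi) g2 (by decide)
    generalize (addQuad (.get aT1 (sc sI))).exec τ₂ = τ₃ at *
    obtain ⟨l1, l2, l3, l4, l5⟩ := addQuad_exec (p := aT2) (τ := τ₃) (i := k)
      (by rw [k1.1 _ (by decide), g1.1 _ (by decide), f1.1 _ (by decide)]; exact hi) k2 (by decide)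
    generalize (addQuad (.get aT2 (sc sI))).exec τ₃ = τ₄ at *
    have s2 := f1.trans g1 (by simp) (by simp)
    have s3 := s2.trans k1 (by simp) (by simp)
    have s4 := s3.trans l1 (by simp) (by simp)
    refine ⟨by rw [s4.1 _ (by decide)]; exact hi, ?_⟩
    have s5 : SameBut [sI, sK2, aHd2, aNx2, aVal2] [] τ (τ₄.setNat sI 0 (k + 1)) :=
      (s4.mono (by simp) (by simp)).setNat _ _ (by simp)
    refine ⟨h0.trans s5 (by simp) (by simp), by simp [State.setNat_nat, l2]; omega, ?_, ?_⟩
    · rw [s5.1 1 (by decide), s5.1 2 (by decide), s5.1 aT1 (by decide), s5.1 aT2 (by decide)]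
      simp only [State.setNat_nat, Nat.reduceEqDiff, reduceIte, l3, l4, k3, k4, g3, g4, f3, f4]
      rw [s3.1 aT2 (by decide), s2.1 aT1 (by decide), f1.1 2 (by decide)]
      exact (((b1.insert (quadKey_zero _ _ _ _ k)).insert (quadKey_one _ _ _ _ k)).insert
        (quadKey_two _ _ _ _ k)).insert (quadKey_three _ _ _ _ k)
    · intro c hc
      simp only [State.setNat_nat, Nat.reduceEqDiff, reduceIte, l5, k5, g5, f5,
        Function.update_apply]
      have := b2 c
      split_ifs <;> omega
  · rintro τ t ⟨h1, h2, h3, h4⟩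
    exact ⟨h1.trans (Nat.mul_le_mul_left _ (by simp [NExp.cost])), h4, h2⟩

/-! ## Programs that run in linear time -/

/-- Started in a memory that satisfies `pre g`, the program `P` halts in a memory that satisfies
`post g`, after a number of steps that is at most linear in `size g`. -/
def Triple {γ : Type} (size : γ → ℕ) (P : Prog) (pre post : γ → State → Prop) : Prop :=
  ∃ B, ∀ g σ, pre g σ → Ex P σ fun τ t => t ≤ B * (size g + 1) ∧ post g τ

namespace Triple

variable {γ : Type} {size : γ → ℕ} {P P' : Prog} {pre mid post : γ → State → Prop}

theorem seq (h : Triple size P pre mid) (h' : Triple size P' mid post) :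
    Triple size (.seq P P') pre post := by
  obtain ⟨B, hB⟩ := h
  obtain ⟨B', hB'⟩ := h'
  refine ⟨B + B' + 1, fun g σ hσ => Ex.seq ((hB g σ hσ).mono ?_)⟩
  rintro τ t ⟨ht, hm⟩
  refine (hB' g τ hm).mono ?_
  rintro υ s ⟨hs, hp⟩
  refine ⟨?_, hp⟩
  rw [Nat.add_mul, Nat.add_mul]; omega

/-- The auxiliary data may change, depending on the memory: in this way the outer boxes found at run
time become part of the instance, and the four names can be rotated. -/
theorem conseq {γ' : Type} {size' : γ' → ℕ} {pre' post' : γ' → State → Prop}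
    (h : Triple size' P pre' post')
    (hc : ∀ g σ, pre g σ → ∃ g', size' g' ≤ size g ∧ pre' g' σ ∧ ∀ τ, post' g' τ → post g τ) :
    Triple size P pre post := by
  obtain ⟨B, hB⟩ := h
  refine ⟨B, fun g σ hσ => ?_⟩
  obtain ⟨g', hs, hp, hq⟩ := hc g σ hσ
  refine (hB g' σ hp).mono ?_
  rintro τ t ⟨ht, hτ⟩
  exact ⟨ht.trans (Nat.mul_le_mul_left _ (by omega)), hq τ hτ⟩

theorem of_exec (hP : P.LoopFree) (h : ∀ g σ, pre g σ → post g (P.exec σ)) :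
    Triple size P pre post := by
  refine ⟨P.bound, fun g σ hσ => Ex.of_exec hP fun t ht => ⟨?_, h g σ hσ⟩⟩
  rw [Nat.mul_add]; omega

theorem ite {b : BExp} (h : Triple size P (fun g σ => pre g σ ∧ b.Holds σ) post)
    (h' : Triple size P' (fun g σ => pre g σ ∧ ¬ b.Holds σ) post) :
    Triple size (.ite b P P') pre post := by
  obtain ⟨B, hB⟩ := h
  obtain ⟨B', hB'⟩ := h'
  refine ⟨B + B' + b.cost + 1, fun g σ hσ => ?_⟩
  by_cases hb : b.Holds σ
  · refine Ex.iteTrue hb ((hB g σ ⟨hσ, hb⟩).mono ?_)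
    rintro τ t ⟨ht, hp⟩
    refine ⟨?_, hp⟩
    have : (b.cost + 1) * 1 ≤ (b.cost + 1) * (size g + 1) := Nat.mul_le_mul_left _ (by omega)
    rw [Nat.add_assoc (B + B'), Nat.add_mul, Nat.add_mul]; omega
  · refine Ex.iteFalse hb ((hB' g σ ⟨hσ, hb⟩).mono ?_)
    rintro τ t ⟨ht, hp⟩
    refine ⟨?_, hp⟩
    have : (b.cost + 1) * 1 ≤ (b.cost + 1) * (size g + 1) := Nat.mul_le_mul_left _ (by omega)
    rw [Nat.add_assoc (B + B'), Nat.add_mul, Nat.add_mul]; omega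

theorem of_skip (h : ∀ g σ, pre g σ → post g σ) : Triple size .skip pre post :=
  of_exec trivial h

end Triple

/-- Look for an index below `N` with the property `cond`; the scalar `dst` receives its successor, or
`0` if there is none. -/
def findProg (dst : ℕ) (N : NExp) (cond : BExp) : Prog :=
  .seq (.nset dst (.lit 0) (.lit 0))
    (forLoop sI N (.ite cond (.nset dst (.lit 0) (.succ (sc sI))) .skip))

theorem findProg_spec {dst : ℕ} {Nx : NExp} {cond : BExp} {σ : State} {N : ℕ} (p : ℕ → Prop)
    (hdst : dst ≠ sI) (hN : ∀ τ, SameBut [sI, dst] [] σ τ → Nx.eval τ = N)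
    (hc : ∀ τ e, e < N → SameBut [sI, dst] [] σ τ → τ.nat sI 0 = e → (cond.Holds τ ↔ p e)) :
    Ex (findProg dst Nx cond) σ fun τ t => t ≤ (N + 1) * (cond.cost + Nx.cost + 60) ∧
      SameBut [sI, dst] [] σ τ ∧
      ((τ.nat dst 0 = 0 ∧ ∀ e < N, ¬ p e) ∨ ∃ e < N, p e ∧ τ.nat dst 0 = e + 1) := by
  refine Ex.seq ⟨_, _, .nset _ _ _ _, ?_⟩
  simp only [NExp.eval]
  refine (Ex.forLoop (σ := σ.setNat dst 0 0) N (cond.cost + 20)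
    (fun k τ => SameBut [sI, dst] [] σ τ ∧
      ((τ.nat dst 0 = 0 ∧ ∀ e < k, ¬ p e) ∨ ∃ e < k, p e ∧ τ.nat dst 0 = e + 1)) ?_ ?_ ?_).mono ?_
  · rintro k τ ⟨h, -⟩; exact hN τ h
  · refine ⟨((SameBut.refl _ _ σ).setNat _ _ (by simp)).setNat _ _ (by simp), .inl ?_⟩
    simp [State.setNat_nat, hdst]
  · rintro k τ hk hi ⟨h1, h2⟩
    by_cases hb : cond.Holds τ
    · refine Ex.iteTrue hb ⟨_, _, .nset _ _ _ _, ?_⟩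
      simp only [NExp.eval, NExp.cost]
      refine ⟨by omega, by simp [State.setNat_nat, hdst.symm, hi],
        (h1.setNat _ _ (by simp)).setNat _ _ (by simp), .inr ⟨k, by omega, (hc τ k hk h1 hi).1 hb, ?_⟩⟩
      simp [State.setNat_nat, hdst, hi]
    · refine Ex.iteFalse hb ⟨_, _, .skip _, ?_⟩
      refine ⟨by omega, hi, h1.setNat _ _ (by simp), ?_⟩
      have hp := mt (hc τ k hk h1 hi).2 hb
      simp only [State.setNat_nat, hdst, if_false]
      rcases h2 with ⟨h2, h3⟩ | ⟨e, h2, h3⟩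
      · refine .inl ⟨h2, fun e he => ?_⟩
        rcases Nat.lt_succ_iff_lt_or_eq.1 he with h | rfl
        · exact h3 e h
        · exact hp
      · exact .inr ⟨e, by omega, h3⟩
  · rintro τ t ⟨h1, h2, h3⟩
    refine ⟨?_, h2, h3⟩
    simp only [NExp.cost]
    have := add_le_mul (c := 4) (b := cond.cost + Nx.cost + 60) h1 (by omega)
    omega

/-- Go on with `rest` only if no index below `N` has the property `cond`. -/
def require (dst : ℕ) (N : NExp) (cond : BExp) (rest : Prog) : Prog :=
  .seq (findProg dst N cond) (.ite (.nlt (sc dst) (.lit 1)) rest .skip)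

/-- Find an index below `N` with the property `cond`; go on with `rest` only if there is one. -/
def acquire (dst : ℕ) (N : NExp) (cond : BExp) (rest : Prog) : Prog :=
  .seq (findProg dst N cond) (.ite (.nlt (.lit 0) (sc dst)) rest .skip)

namespace Triple

variable {γ : Type} {size : γ → ℕ} {pre mid post : γ → State → Prop} {dst : ℕ} {Nx : NExp}
  {cond : BExp} {rest : Prog}

theorem find (N : γ → ℕ) (p : γ → State → ℕ → Prop) (hdst : dst ≠ sI) (hs : ∀ g, N g ≤ size g)
    (hN : ∀ g σ τ, pre g σ → SameBut [sI, dst] [] σ τ → Nx.eval τ = N g)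
    (hc : ∀ g σ τ e, pre g σ → e < N g → SameBut [sI, dst] [] σ τ → τ.nat sI 0 = e →
      (cond.Holds τ ↔ p g σ e)) :
    Triple size (findProg dst Nx cond) pre fun g τ => ∃ σ, pre g σ ∧ SameBut [sI, dst] [] σ τ ∧
      ((τ.nat dst 0 = 0 ∧ ∀ e < N g, ¬ p g σ e) ∨ ∃ e < N g, p g σ e ∧ τ.nat dst 0 = e + 1) := by
  refine ⟨cond.cost + Nx.cost + 60, fun g σ hσ => ?_⟩
  refine (findProg_spec (p g σ) hdst (fun τ h => hN g σ τ hσ h)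
    (fun τ e he h hi => hc g σ τ e hσ he h hi)).mono ?_
  rintro τ t ⟨ht, h⟩
  refine ⟨ht.trans ?_, σ, hσ, h⟩
  rw [Nat.mul_comm]
  exact Nat.mul_le_mul_left _ (by have := hs g; omega)

theorem require (N : γ → ℕ) (p : γ → State → ℕ → Prop) (hdst : dst ≠ sI) (hs : ∀ g, N g ≤ size g)
    (hN : ∀ g σ τ, pre g σ → SameBut [sI, dst] [] σ τ → Nx.eval τ = N g)
    (hc : ∀ g σ τ e, pre g σ → e < N g → SameBut [sI, dst] [] σ τ → τ.nat sI 0 = e →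
      (cond.Holds τ ↔ p g σ e))
    (hfail : ∀ g σ τ e, pre g σ → SameBut [sI, dst] [] σ τ → e < N g → p g σ e → post g τ)
    (hok : ∀ g σ τ, pre g σ → SameBut [sI, dst] [] σ τ → (∀ e < N g, ¬ p g σ e) → mid g τ)
    (h : Triple size rest mid post) : Triple size (require dst Nx cond rest) pre post := by
  refine (find N p hdst hs hN hc).seq (Triple.ite (h.conseq ?_) (of_skip ?_))
  · rintro g τ ⟨⟨σ, hσ, hf, h⟩, hb⟩
    refine ⟨g, le_rfl, ?_, fun _ h => h⟩
    simp only [BExp.Holds, NExp.eval] at hb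
    rcases h with ⟨-, h⟩ | ⟨e, -, -, h⟩
    · exact hok g σ τ hσ hf h
    · omega
  · rintro g τ ⟨⟨σ, hσ, hf, h⟩, hb⟩
    simp only [BExp.Holds, NExp.eval] at hb
    rcases h with ⟨h, -⟩ | ⟨e, he, hp, -⟩
    · omega
    · exact hfail g σ τ e hσ hf he hp

theorem acquire (N : γ → ℕ) (p : γ → State → ℕ → Prop) (hdst : dst ≠ sI) (hs : ∀ g, N g ≤ size g)
    (hN : ∀ g σ τ, pre g σ → SameBut [sI, dst] [] σ τ → Nx.eval τ = N g)
    (hc : ∀ g σ τ e, pre g σ → e < N g → SameBut [sI, dst] [] σ τ → τ.nat sI 0 = e →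
      (cond.Holds τ ↔ p g σ e))
    (hfail : ∀ g σ τ, pre g σ → SameBut [sI, dst] [] σ τ → (∀ e < N g, ¬ p g σ e) → post g τ)
    (hok : ∀ g σ τ e, pre g σ → SameBut [sI, dst] [] σ τ → e < N g → p g σ e →
      τ.nat dst 0 = e + 1 → mid g τ)
    (h : Triple size rest mid post) : Triple size (acquire dst Nx cond rest) pre post := by
  refine (find N p hdst hs hN hc).seq (Triple.ite (h.conseq ?_) (of_skip ?_))
  · rintro g τ ⟨⟨σ, hσ, hf, h⟩, hb⟩
    refine ⟨g, le_rfl, ?_, fun _ h => h⟩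
    simp only [BExp.Holds, NExp.eval] at hb
    rcases h with ⟨h, -⟩ | ⟨e, he, hp, h⟩
    · omega
    · exact hok g σ τ e hσ hf he hp h
  · rintro g τ ⟨⟨σ, hσ, hf, h⟩, hb⟩
    simp only [BExp.Holds, NExp.eval] at hb
    rcases h with ⟨-, h⟩ | ⟨e, -, -, h⟩
    · exact hfail g σ τ hσ hf h
    · omega

end Triple

notation "sBad" => (18 : ℕ)
notation "sEab" => (19 : ℕ)
notation "sEbc" => (20 : ℕ)
notation "sEcd" => (21 : ℕ)
notation "sEda" => (22 : ℕ)
notation "sA" => (23 : ℕ)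
notation "sB" => (24 : ℕ)
notation "sC" => (25 : ℕ)
notation "sD" => (26 : ℕ)

/-! ## Common neighbours in realizable graphs -/

section

variable {V : Type*} {G : SimpleGraph V} {w h : V → ℝ} {B : V → Box} {a b c d : V}

theorem OuterCycle.reflect (hO : OuterCycle G a b c d) : OuterCycle G b a d c where
  nodup := by have := hO.nodup; tauto
  hab := hO.hab.symm
  hbc := hO.hda.symm
  hcd := hO.hcd.symm
  hda := hO.hbc.symm
  one_ab := by obtain ⟨z, h1, h2⟩ := hO.one_ab; exact ⟨z, h2, h1⟩
  one_bc := by obtain ⟨z, h1, h2⟩ := hO.one_da; exact ⟨z, h2, h1⟩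
  one_cd := by obtain ⟨z, h1, h2⟩ := hO.one_cd; exact ⟨z, h2, h1⟩
  one_da := by obtain ⟨z, h1, h2⟩ := hO.one_bc; exact ⟨z, h2, h1⟩
  two u v huv h1 h2 h3 h4 := hO.two u v huv (by rwa [Sym2.eq_swap (a := a)])
    (by rwa [Sym2.eq_swap (a := b)]) (by rwa [Sym2.eq_swap (a := c)])
    (by rwa [Sym2.eq_swap (a := d)])
  not_K4 hv h := hO.not_K4 (fun v => by have := hv v; tauto) ⟨h.2, h.1⟩

theorem OuterCycle.exists_of_edge (hO : OuterCycle G a b c d) {x y : V}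
    (h : s(x, y) = s(a, b) ∨ s(x, y) = s(b, c) ∨ s(x, y) = s(c, d) ∨ s(x, y) = s(d, a)) :
    ∃ z z', OuterCycle G x y z z' := by
  rcases h with h | h | h | h <;> rcases Sym2.eq_iff.1 h with ⟨rfl, rfl⟩ | ⟨rfl, rfl⟩
  · exact ⟨_, _, hO⟩
  · exact ⟨_, _, hO.reflect⟩
  · exact ⟨_, _, hO.rotate⟩
  · exact ⟨_, _, hO.rotate.reflect⟩
  · exact ⟨_, _, hO.rotate.rotate⟩
  · exact ⟨_, _, hO.rotate.rotate.reflect⟩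
  · exact ⟨_, _, hO.rotate.rotate.rotate⟩
  · exact ⟨_, _, hO.rotate.rotate.rotate.reflect⟩

theorem OuterCycle.two_of_inner (hO : OuterCycle G a b c d) {u v : V} (huv : G.Adj u v)
    (hu : u ≠ a ∧ u ≠ b ∧ u ≠ c ∧ u ≠ d) :
    ∃ z z', z ≠ z' ∧ G.Adj u z ∧ G.Adj v z ∧ G.Adj u z' ∧ G.Adj v z' := by
  obtain ⟨h1, h2, h3, h4⟩ := hu
  apply hO.two u v huv <;> simp [h1, h2, h3, h4]

theorem OuterCycle.toLocal (hO : OuterCycle G a b c d) (hB : Rep G w h B) (hw : ∀ v, 0 < w v)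
    (hh : ∀ v, 0 < h v) : Local G {v | v ≠ a ∧ v ≠ b ∧ v ≠ c ∧ v ≠ d} B where
  pos := hB.pos hw hh
  contact := hB.contact
  two u v huv hu := by
    obtain ⟨z, z', hne, h1, h2, h3, h4⟩ := hO.two_of_inner huv hu
    exact ⟨z, z', h1, h2, h3, h4, hB.apart z z' hne⟩

theorem OuterCycle.exists_normal [Finite V] (hO : OuterCycle G a b c d) (hB : Rep G w h B)
    (hw : ∀ v, 0 < w v) (hh : ∀ v, 0 < h v) (hnb : ∀ v, ∃ u, G.Adj v u)
    (hne : ∃ v, v ≠ a ∧ v ≠ b ∧ v ≠ c ∧ v ≠ d) :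
    (∃ B', Normal G w h {v | v ≠ a ∧ v ≠ b ∧ v ≠ c ∧ v ≠ d} B' a b c d) ∨
      ∃ B', Normal G w h {v | v ≠ b ∧ v ≠ c ∧ v ≠ d ∧ v ≠ a} B' b c d a := by
  obtain ⟨B', hB', ⟨s, h1, h2⟩ | ⟨s, h1, h2⟩⟩ := WRAC.exists_normal
    (I := {v | v ≠ a ∧ v ≠ b ∧ v ≠ c ∧ v ≠ d}) hB (fun v => Iff.rfl)
    (hO.toLocal hB hw hh) hne (fun v _ => hnb v) hO.hab hO.hbc hO.hcd hO.hda
  · exact .inl ⟨B', hB', hw, hh, s, h1, h2, fun v => Iff.rfl, hO.hab, hO.hbc, hO.hcd, hO.hda⟩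
  · have hI : {v | v ≠ a ∧ v ≠ b ∧ v ≠ c ∧ v ≠ d} = {v | v ≠ b ∧ v ≠ c ∧ v ≠ d ∧ v ≠ a} := by
      ext v
      simp only [Set.mem_ofPred_eq]
      tauto
    rw [hI] at s
    exact .inr ⟨B', hB', hw, hh, s, h1, h2, fun v => Iff.rfl, hO.hbc, hO.hcd, hO.hda, hO.hab⟩

/-- In normal position `a` and `b` are consecutive sides of the frame, and a common neighbour has a
corner of its own at the corner of the frame between them. There is room for only one such box. In
the rotated orientation the same holds upside down. -/
theorem OuterCycle.common_unique [Finite V] (hO : OuterCycle G a b c d) (hB : Rep G w h B)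
    (hw : ∀ v, 0 < w v) (hh : ∀ v, 0 < h v) (hnb : ∀ v, ∃ u, G.Adj v u) {z z' : V}
    (haz : G.Adj a z) (hbz : G.Adj b z) (haz' : G.Adj a z') (hbz' : G.Adj b z') : z = z' := by
  by_cases hne : ∃ v, v ≠ a ∧ v ≠ b ∧ v ≠ c ∧ v ≠ d
  · rcases hO.exists_normal hB hw hh hnb hne with ⟨B', N⟩ | ⟨B', N⟩
    · exact N.sides.common_ab_unique N.pos N.cover N.rep.contact N.rep.apart haz hbz haz' hbz'
    · have hR := N.rep.flipY
      exact N.sides.flipY.common_ab_unique (hR.pos hw hh)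
        (fun v => by have := N.cover v; tauto) hR.contact hR.apart hbz haz hbz' haz'
  -- Without inner boxes, two common neighbours of `a` and `b` would have to be `c` and `d`, and
  -- both diagonals would be edges.
  · push Not at hne
    have hv : ∀ v, v = a ∨ v = b ∨ v = c ∨ v = d := fun v => by
      have := hne v; tauto
    have hK := hO.not_K4 hv
    by_contra hzz
    rcases hv z with rfl | rfl | rfl | rfl
    · exact haz.ne rfl
    · exact hbz.ne rfl
    · rcases hv z' with rfl | rfl | rfl | rfl
      · exact haz'.ne rfl
      · exact hbz'.ne rfl
      · exact hzz rfl
      · exact hK ⟨haz, hbz'⟩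
    · rcases hv z' with rfl | rfl | rfl | rfl
      · exact haz'.ne rfl
      · exact hbz'.ne rfl
      · exact hK ⟨haz', hbz⟩
      · exact hzz rfl

theorem Rep.no_three_common (hB : Rep G w h B) (hw : ∀ v, 0 < w v) (hh : ∀ v, 0 < h v)
    {x y z z' z'' : V} (hxy : G.Adj x y) (h1 : G.Adj x z ∧ G.Adj y z) (h2 : G.Adj x z' ∧ G.Adj y z')
    (h3 : G.Adj x z'' ∧ G.Adj y z'') (n1 : z ≠ z') (n2 : z ≠ z'') (n3 : z' ≠ z'') : False :=
  have hp := hB.pos hw hh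
  have hc := fun {u v} => hB.contact u v
  three_common (hp x) (hp y) (hp z) (hp z') (hp z'') (hc hxy) (hc h1.1) (hc h1.2) (hc h2.1)
    (hc h2.2) (hc h3.1) (hc h3.2) (hB.apart _ _ n1) (hB.apart _ _ n2) (hB.apart _ _ n3)

end

/-! ## Instances in memory -/

/-- An instance with `n` boxes and `m` edges. -/
structure Inst where
  n : ℕ
  m : ℕ
  w : Fin n → ℝ
  h : Fin n → ℝ
  G : SimpleGraph (Fin n)

def Inst.size (g : Inst) : ℕ := g.n + g.m

/-- The box of `v` at the position that is stored in memory. -/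
noncomputable def boxAt (σ : State) (v : ℕ) : Box :=
  ⟨σ.real 2 v, σ.real 2 v + σ.real 0 v, σ.real 3 v, σ.real 3 v + σ.real 1 v⟩

/-- The memory holds the instance `g` and the common neighbours of the ends of the edges. -/
structure Tri (g : Inst) (σ : State) : Prop where
  n_eq : σ.nat 0 0 = g.n
  m_eq : σ.nat 0 1 = g.m
  edges : EdgeList (σ.nat 1) (σ.nat 2) g.m g.n
  quads : Quads σ g.m
  adj : ∀ u v : Fin g.n, g.G.Adj u v ↔ Nb (σ.nat 1) (σ.nat 2) g.m u v
  reg : ∀ e < g.m, Reg (σ.nat aCnt e) (σ.nat aT1 e) (σ.nat aT2 e)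
    {x | Nb (σ.nat 1) (σ.nat 2) g.m (σ.nat 1 e) x ∧ Nb (σ.nat 1) (σ.nat 2) g.m (σ.nat 2 e) x}
  w_eq : ∀ v : Fin g.n, σ.real 0 v = g.w v
  h_eq : ∀ v : Fin g.n, σ.real 1 v = g.h v
  w_pos : ∀ v, 0 < g.w v
  h_pos : ∀ v, 0 < g.h v
  outer : ∃ a b c d, OuterCycle g.G a b c d
  nbr : ∀ v, ∃ u, g.G.Adj v u

/-- The answer for the instance `g` is in memory. -/
def Answer (g : Inst) (τ : State) : Prop :=
  (τ.nat 3 0 = 1 ∧ Rep g.G g.w g.h fun v => boxAt τ v) ∨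
    (τ.nat 3 0 = 0 ∧ ¬ ∃ B, Rep g.G g.w g.h B)

theorem nb_iff {e₁ e₂ : ℕ → ℕ} {m u v : ℕ} :
    Nb e₁ e₂ m u v ↔ ∃ e < m, e₁ e = u ∧ e₂ e = v ∨ e₁ e = v ∧ e₂ e = u := by
  constructor
  · rintro ⟨c, hc, h1, h2⟩
    obtain ⟨e, he, -, ⟨-, k1, k2⟩ | ⟨-, k1, k2⟩⟩ := endKey_cases e₁ e₂ hc
    · exact ⟨e, he, .inl ⟨k1 ▸ h1, k2 ▸ h2⟩⟩
    · exact ⟨e, he, .inr ⟨k2 ▸ h2, k1 ▸ h1⟩⟩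
  · rintro ⟨e, he, ⟨rfl, rfl⟩ | ⟨rfl, rfl⟩⟩
    · exact ⟨2 * e, by omega, endKey_two_mul _ _ _, endKey_two_mul _ _ _⟩
    · exact ⟨2 * e + 1, by omega, endKey_two_mul_add_one _ _ _, endKey_two_mul_add_one _ _ _⟩

namespace Tri

variable {g : Inst} {σ τ : State}

theorem frame (hT : Tri g σ) {ns rs : List ℕ} (h : SameBut ns rs σ τ)
    (hn : ∀ a ∈ [0, 1, 2, aCnt, aT1, aT2, aHd2, aNx2, aVal2], a ∉ ns)
    (hr : ∀ a ∈ [0, 1], a ∉ rs) : Tri g τ := by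
  obtain ⟨h1, h2, h3, ⟨q1, q2⟩, h4, h5, h6, h7, h8, h9, h10, h11⟩ := hT
  have e0 := h.1 0 (hn _ (by simp))
  have e1 := h.1 1 (hn _ (by simp))
  have e2 := h.1 2 (hn _ (by simp))
  have e3 := h.1 aCnt (hn _ (by simp))
  have e4 := h.1 aT1 (hn _ (by simp))
  have e5 := h.1 aT2 (hn _ (by simp))
  have e8 := h.1 aHd2 (hn _ (by simp))
  have e9 := h.1 aNx2 (hn _ (by simp))
  have e10 := h.1 aVal2 (hn _ (by simp))
  have e6 := h.2 0 (hr _ (by simp))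
  have e7 := h.2 1 (hr _ (by simp))
  have hq : Quads τ g.m := by
    constructor
    · rwa [e1, e2, e4, e5, e8, e9]
    · rwa [e10]
  constructor <;> (try simp only [e0, e1, e2, e3, e4, e5, e6, e7]) <;> assumption

theorem edge (hT : Tri g σ) {e : ℕ} (he : e < g.m) :
    ∃ x y : Fin g.n, σ.nat 1 e = x ∧ σ.nat 2 e = y ∧ g.G.Adj x y := by
  refine ⟨⟨_, hT.edges.lt₁ e he⟩, ⟨_, hT.edges.lt₂ e he⟩, rfl, rfl, ?_⟩
  rw [hT.adj, nb_iff]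
  exact ⟨e, he, .inl ⟨rfl, rfl⟩⟩

theorem exists_edge (hT : Tri g σ) {x y : Fin g.n} (h : g.G.Adj x y) :
    ∃ e < g.m, σ.nat 1 e = x ∧ σ.nat 2 e = y ∨ σ.nat 1 e = y ∧ σ.nat 2 e = x :=
  nb_iff.1 ((hT.adj x y).1 h)

theorem common_eq (hT : Tri g σ) {e : ℕ} {x y : Fin g.n} (hx : σ.nat 1 e = x)
    (hy : σ.nat 2 e = y) :
    {x | Nb (σ.nat 1) (σ.nat 2) g.m (σ.nat 1 e) x ∧ Nb (σ.nat 1) (σ.nat 2) g.m (σ.nat 2 e) x} =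
      Fin.val '' {u : Fin g.n | g.G.Adj x u ∧ g.G.Adj y u} := by
  ext u
  simp only [Set.mem_ofPred_eq, Set.mem_image, hT.adj, hx, hy]
  constructor
  · rintro ⟨h1, h2⟩
    have hu : u < g.n := by
      obtain ⟨e', he', ⟨-, rfl⟩ | ⟨rfl, -⟩⟩ := nb_iff.1 h1
      · exact hT.edges.lt₂ e' he'
      · exact hT.edges.lt₁ e' he'
    exact ⟨⟨u, hu⟩, ⟨h1, h2⟩, rfl⟩
  · rintro ⟨u, h, rfl⟩; exact h

theorem cnt_eq (hT : Tri g σ) {e : ℕ} (he : e < g.m) {x y : Fin g.n} (hx : σ.nat 1 e = x)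
    (hy : σ.nat 2 e = y) : σ.nat aCnt e = {u : Fin g.n | g.G.Adj x u ∧ g.G.Adj y u}.ncard := by
  rw [← (hT.reg e he).2.1, hT.common_eq hx hy, Set.ncard_image_of_injective _ Fin.val_injective]

/-- What the memory says about an edge whose ends have one common neighbour. -/
theorem third (hT : Tri g σ) {e : ℕ} (he : e < g.m) (h1 : σ.nat aCnt e = 1) {x y : Fin g.n}
    (hx : σ.nat 1 e = x) (hy : σ.nat 2 e = y) :
    ∃ z : Fin g.n, σ.nat aT1 e = z ∧ ∀ u, g.G.Adj x u ∧ g.G.Adj y u ↔ u = z := by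
  have h := (hT.reg e he).2.2.1 h1
  rw [hT.common_eq hx hy] at h
  have : σ.nat aT1 e ∈ Fin.val '' {u : Fin g.n | g.G.Adj x u ∧ g.G.Adj y u} := by rw [h]; rfl
  obtain ⟨z, hz, hz'⟩ := this
  refine ⟨z, hz'.symm, fun u => ⟨fun hu => ?_, ?_⟩⟩
  · have : (u : ℕ) ∈ Fin.val '' {u : Fin g.n | g.G.Adj x u ∧ g.G.Adj y u} := ⟨u, hu, rfl⟩
    rw [h, ← hz'] at this
    exact Fin.ext this
  · rintro rfl; exact hz

/-- What the memory says about an edge whose ends have two common neighbours. -/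
theorem thirds (hT : Tri g σ) {e : ℕ} (he : e < g.m) (h2 : σ.nat aCnt e = 2) {x y : Fin g.n}
    (hx : σ.nat 1 e = x) (hy : σ.nat 2 e = y) :
    ∃ z z' : Fin g.n, σ.nat aT1 e = z ∧ σ.nat aT2 e = z' ∧ z ≠ z' ∧
      ∀ u, g.G.Adj x u ∧ g.G.Adj y u ↔ u = z ∨ u = z' := by
  have h := (hT.reg e he).2.2.2 h2
  have hc := (hT.reg e he).2.1
  rw [h, h2] at hc
  rw [hT.common_eq hx hy] at h
  have m1 : σ.nat aT1 e ∈ Fin.val '' {u : Fin g.n | g.G.Adj x u ∧ g.G.Adj y u} := by rw [h]; simp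
  have m2 : σ.nat aT2 e ∈ Fin.val '' {u : Fin g.n | g.G.Adj x u ∧ g.G.Adj y u} := by rw [h]; simp
  obtain ⟨z, hz, hz'⟩ := m1
  obtain ⟨y', hy', hy''⟩ := m2
  refine ⟨z, y', hz'.symm, hy''.symm, ?_, fun u => ⟨fun hu => ?_, ?_⟩⟩
  · rintro rfl
    rw [← hz', ← hy''] at hc
    simp at hc
  · have : (u : ℕ) ∈ Fin.val '' {u : Fin g.n | g.G.Adj x u ∧ g.G.Adj y u} := ⟨u, hu, rfl⟩
    rw [h, ← hz', ← hy''] at this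
    exact this.imp Fin.ext Fin.ext
  · rintro (rfl | rfl)
    · exact hz
    · exact hy'

/-- This is where a contact having only two ends bounds the counts. Any larger count refutes
realizability. -/
theorem cnt_le_two (hT : Tri g σ) {e : ℕ} (he : e < g.m) {B : Fin g.n → Box}
    (hB : Rep g.G g.w g.h B) : σ.nat aCnt e ≤ 2 := by
  obtain ⟨x, y, hx, hy, hxy⟩ := hT.edge he
  rw [hT.cnt_eq he hx hy]
  by_contra! h
  obtain ⟨z, h1, z', h2, z'', h3, n1, n2, n3⟩ := (Set.two_lt_ncard).1 h
  exact hB.no_three_common hT.w_pos hT.h_pos hxy h1 h2 h3 n1 n2 n3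

theorem cnt_pos (hT : Tri g σ) {e : ℕ} (he : e < g.m) : 1 ≤ σ.nat aCnt e := by
  obtain ⟨x, y, hx, hy, hxy⟩ := hT.edge he
  obtain ⟨a, b, c, d, hO⟩ := hT.outer
  rw [hT.cnt_eq he hx hy]
  refine (Set.ncard_pos).2 ?_
  by_cases hc : s(x, y) = s(a, b) ∨ s(x, y) = s(b, c) ∨ s(x, y) = s(c, d) ∨ s(x, y) = s(d, a)
  · obtain ⟨_, _, hO'⟩ := hO.exists_of_edge hc
    exact hO'.one_ab
  · push Not at hc
    obtain ⟨z, z', -, h1, h2, -⟩ := hO.two x y hxy hc.1 hc.2.1 hc.2.2.1 hc.2.2.2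
    exact ⟨z, h1, h2⟩

/-- An edge off the outer cycle has two common neighbours. So count `1` recognises outer edges,
realizable or not. -/
theorem outer_of_cnt (hT : Tri g σ) {e : ℕ} (he : e < g.m) (h1 : σ.nat aCnt e = 1)
    {a b c d : Fin g.n} (hO : OuterCycle g.G a b c d) {x y : Fin g.n} (hx : σ.nat 1 e = x)
    (hy : σ.nat 2 e = y) :
    s(x, y) = s(a, b) ∨ s(x, y) = s(b, c) ∨ s(x, y) = s(c, d) ∨ s(x, y) = s(d, a) := by
  obtain ⟨x', y', hx', hy', hxy⟩ := hT.edge he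
  obtain rfl : x = x' := Fin.ext (hx.symm.trans hx')
  obtain rfl : y = y' := Fin.ext (hy.symm.trans hy')
  by_contra hc
  push Not at hc
  obtain ⟨z, z', hne, k1, k2, k3, k4⟩ := hO.two x y hxy hc.1 hc.2.1 hc.2.2.1 hc.2.2.2
  obtain ⟨u, -, hu⟩ := hT.third he h1 hx hy
  exact hne (((hu z).1 ⟨k1, k2⟩).trans ((hu z').1 ⟨k3, k4⟩).symm)

/-- The converse of `outer_of_cnt`, which needs a representation: a failed search for an outer edge
by its count is a proof that there is none. -/
theorem cnt_eq_one (hT : Tri g σ) {a b c d : Fin g.n} (hO : OuterCycle g.G a b c d)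
    {B : Fin g.n → Box} (hB : Rep g.G g.w g.h B) {e : ℕ} (he : e < g.m)
    (hab : σ.nat 1 e = a ∧ σ.nat 2 e = b ∨ σ.nat 1 e = b ∧ σ.nat 2 e = a) : σ.nat aCnt e = 1 := by
  have key : ∀ {a b c d : Fin g.n}, OuterCycle g.G a b c d → σ.nat 1 e = a → σ.nat 2 e = b →
      σ.nat aCnt e = 1 := by
    intro a b c d hO h1 h2
    rw [hT.cnt_eq he h1 h2, Set.ncard_eq_one]
    obtain ⟨z, hz⟩ := hO.one_ab
    refine ⟨z, Set.ext fun u => ⟨fun hu => ?_, ?_⟩⟩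
    · exact hO.common_unique hB hT.w_pos hT.h_pos hT.nbr hu.1 hu.2 hz.1 hz.2
    · rintro rfl; exact hz
  rcases hab with ⟨h1, h2⟩ | ⟨h1, h2⟩
  · exact key hO h1 h2
  · exact key hO.reflect h1 h2

end Tri

/-! ## Finding the outer cycle -/

/-- An instance with four distinguished boxes. -/
structure OInst extends Inst where
  a : Fin n
  b : Fin n
  c : Fin n
  d : Fin n

/-- `e` is the number of the edge `x y`, which has one common neighbour. -/
structure AtEdge (m : ℕ) (σ : State) (e : ℕ) (x y : ℕ) : Prop where
  lt : e < m
  cnt : σ.nat aCnt e = 1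
  ends : σ.nat 1 e = x ∧ σ.nat 2 e = y ∨ σ.nat 1 e = y ∧ σ.nat 2 e = x

structure Pending (g : Inst) (σ : State) : Prop where
  tri : Tri g σ
  ans : σ.nat 3 0 = 0

structure Counted (g : Inst) (σ : State) : Prop extends Pending g σ where
  cnt : ∀ e < g.m, σ.nat aCnt e = 1 ∨ σ.nat aCnt e = 2

structure OuterAB (g : OInst) (σ : State) : Prop extends Counted g.toInst σ where
  cycle : OuterCycle g.G g.a g.b g.c g.d
  a_eq : σ.nat sA 0 = g.a
  b_eq : σ.nat sB 0 = g.b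
  ab : AtEdge g.m σ (σ.nat sEab 0 - 1) g.a g.b

structure OuterABC (g : OInst) (σ : State) : Prop extends OuterAB g σ where
  c_eq : σ.nat sC 0 = g.c
  bc : AtEdge g.m σ (σ.nat sEbc 0 - 1) g.b g.c

structure OuterABCD (g : OInst) (σ : State) : Prop extends OuterABC g σ where
  d_eq : σ.nat sD 0 = g.d
  da : AtEdge g.m σ (σ.nat sEda 0 - 1) g.d g.a

/-- The memory holds the outer cycle and the numbers of its edges. -/
structure Outer (g : OInst) (σ : State) : Prop extends OuterABCD g σ where
  cd : AtEdge g.m σ (σ.nat sEcd 0 - 1) g.c g.d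

section Frame

variable {g : Inst} {q : OInst} {σ τ : State} {ns rs : List ℕ}

theorem AtEdge.frame {m e e' x y : ℕ} (h : AtEdge m σ e x y) (hs : SameBut ns rs σ τ)
    (hn : ∀ a ∈ [1, 2, aCnt], a ∉ ns) (he : e' = e) : AtEdge m τ e' x y := by
  obtain ⟨h1, h2, h3⟩ := h
  subst he
  refine ⟨h1, ?_, ?_⟩
  · rwa [hs.1 aCnt (hn _ (by simp))]
  · rwa [hs.1 1 (hn _ (by simp)), hs.1 2 (hn _ (by simp))]

theorem Pending.frame (h : Pending g σ) (hs : SameBut ns rs σ τ)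
    (hn : ∀ a ∈ [0, 1, 2, 3, aCnt, aT1, aT2, aHd2, aNx2, aVal2], a ∉ ns)
    (hr : ∀ a ∈ [0, 1], a ∉ rs) :
    Pending g τ :=
  ⟨h.tri.frame hs (fun a ha => hn a (by revert ha; simp; tauto)) hr, by
    rw [hs.1 3 (hn _ (by simp))]; exact h.ans⟩

theorem Counted.frame (h : Counted g σ) (hs : SameBut ns rs σ τ)
    (hn : ∀ a ∈ [0, 1, 2, 3, aCnt, aT1, aT2, aHd2, aNx2, aVal2], a ∉ ns)
    (hr : ∀ a ∈ [0, 1], a ∉ rs) :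
    Counted g τ :=
  ⟨h.toPending.frame hs hn hr, by rw [hs.1 aCnt (hn _ (by simp))]; exact h.cnt⟩

theorem OuterAB.frame (h : OuterAB q σ) (hs : SameBut ns rs σ τ)
    (hn : ∀ a ∈ [0, 1, 2, 3, aCnt, aT1, aT2, aHd2, aNx2, aVal2, sA, sB, sEab], a ∉ ns)
    (hr : ∀ a ∈ [0, 1], a ∉ rs) :
    OuterAB q τ :=
  ⟨h.toCounted.frame hs (fun a ha => hn a (by revert ha; simp; tauto)) hr, h.cycle,
    by rw [hs.1 sA (hn _ (by simp))]; exact h.a_eq, by rw [hs.1 sB (hn _ (by simp))]; exact h.b_eq,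
    h.ab.frame hs (fun a ha => hn a (by revert ha; simp; tauto)) (by rw [hs.1 sEab (hn _ (by simp))])⟩

theorem OuterABC.frame (h : OuterABC q σ) (hs : SameBut ns rs σ τ)
    (hn : ∀ a ∈ [0, 1, 2, 3, aCnt, aT1, aT2, aHd2, aNx2, aVal2, sA, sB, sEab, sC, sEbc], a ∉ ns)
    (hr : ∀ a ∈ [0, 1], a ∉ rs) : OuterABC q τ :=
  ⟨h.toOuterAB.frame hs (fun a ha => hn a (by revert ha; simp; tauto)) hr,
    by rw [hs.1 sC (hn _ (by simp))]; exact h.c_eq,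
    h.bc.frame hs (fun a ha => hn a (by revert ha; simp; tauto)) (by rw [hs.1 sEbc (hn _ (by simp))])⟩

theorem OuterABCD.frame (h : OuterABCD q σ) (hs : SameBut ns rs σ τ)
    (hn : ∀ a ∈ [0, 1, 2, 3, aCnt, aT1, aT2, aHd2, aNx2, aVal2, sA, sB, sEab, sC, sEbc,
      sD, sEda], a ∉ ns)
    (hr : ∀ a ∈ [0, 1], a ∉ rs) : OuterABCD q τ :=
  ⟨h.toOuterABC.frame hs (fun a ha => hn a (by revert ha; simp; tauto)) hr,
    by rw [hs.1 sD (hn _ (by simp))]; exact h.d_eq,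
    h.da.frame hs (fun a ha => hn a (by revert ha; simp; tauto)) (by rw [hs.1 sEda (hn _ (by simp))])⟩

theorem Outer.frame (h : Outer q σ) (hs : SameBut ns rs σ τ)
    (hn : ∀ a ∈ [0, 1, 2, 3, aCnt, aT1, aT2, aHd2, aNx2, aVal2, sA, sB, sEab, sC, sEbc,
      sD, sEda, sEcd], a ∉ ns)
    (hr : ∀ a ∈ [0, 1], a ∉ rs) : Outer q τ :=
  ⟨h.toOuterABCD.frame hs (fun a ha => hn a (by revert ha; simp; tauto)) hr,
    h.cd.frame hs (fun a ha => hn a (by revert ha; simp; tauto)) (by rw [hs.1 sEcd (hn _ (by simp))])⟩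

end Frame

theorem Pending.answer_no {g : Inst} {σ : State} (h : Pending g σ)
    (hB : ∀ B, ¬ Rep g.G g.w g.h B) : Answer g σ :=
  .inr ⟨h.ans, fun ⟨B, hR⟩ => hB B hR⟩

abbrev nX : NExp := .get 0 (.lit 0)
abbrev mX : NExp := .get 0 (.lit 1)
/-- The edge whose successor is stored in the scalar `s`. -/
abbrev eX (s : ℕ) : NExp := .pred (sc s)

/-- The scalar `r` receives the end other than `p` of the edge stored in `s`. -/
def otherEnd (r p s : ℕ) : Prog :=
  .ite (NExp.eq (.get 1 (eX s)) (sc p)) (.nset r (.lit 0) (.get 2 (eX s)))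
    (.nset r (.lit 0) (.get 1 (eX s)))

abbrev outerTest : BExp := NExp.eq (.get aCnt (sc sI)) (.lit 1)

/-- The current edge is an outer edge at the vertex `p` other than `ab`. -/
abbrev outerAt (p : ℕ) : BExp :=
  .and outerTest (.and (.not (NExp.eq (sc sI) (eX sEab)))
    (.or (NExp.eq (.get 1 (sc sI)) (sc p)) (NExp.eq (.get 2 (sc sI)) (sc p))))

/-- Find the outer cycle, and go on with `rest` if it looks as it should. -/
def outerProg (rest : Prog) : Prog :=
  require sBad mX (.or (.nlt (.get aCnt (sc sI)) (.lit 1)) (.nlt (.lit 2) (.get aCnt (sc sI)))) <|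
  acquire sEab mX outerTest <|
  .seq (seqs [.nset sA (.lit 0) (.get 1 (eX sEab)), .nset sB (.lit 0) (.get 2 (eX sEab))]) <|
  acquire sEbc mX (outerAt sB) <|
  .seq (otherEnd sC sB sEbc) <|
  acquire sEda mX (outerAt sA) <|
  .seq (otherEnd sD sA sEda) <|
  acquire sEcd mX (.and outerTest
    (.or (.and (NExp.eq (.get 1 (sc sI)) (sc sC)) (NExp.eq (.get 2 (sc sI)) (sc sD)))
      (.and (NExp.eq (.get 1 (sc sI)) (sc sD)) (NExp.eq (.get 2 (sc sI)) (sc sC))))) rest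

theorem NExp.eq_holds {σ : State} {e f : NExp} : (NExp.eq e f).Holds σ ↔ e.eval σ = f.eval σ := by
  simp only [BExp.Holds]; omega

theorem BExp.or_holds {σ : State} {b c : BExp} : (BExp.or b c).Holds σ ↔ b.Holds σ ∨ c.Holds σ := by
  simp only [BExp.Holds]; tauto

theorem otherEnd_spec {r p s : ℕ} {τ : State} {x y : ℕ} (hp : τ.nat p 0 = x)
    (h : τ.nat 1 (τ.nat s 0 - 1) = x ∧ τ.nat 2 (τ.nat s 0 - 1) = y ∨
      τ.nat 1 (τ.nat s 0 - 1) = y ∧ τ.nat 2 (τ.nat s 0 - 1) = x) :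
    SameBut [r] [] τ ((otherEnd r p s).exec τ) ∧ ((otherEnd r p s).exec τ).nat r 0 = y := by
  unfold otherEnd
  simp only [Prog.exec, NExp.eq_holds, NExp.eval, hp]
  split_ifs with hc
  · refine ⟨(SameBut.refl _ _ τ).setNat _ _ (by simp), ?_⟩
    simp only [State.setNat_nat, if_true, Function.update_self]
    omega
  · refine ⟨(SameBut.refl _ _ τ).setNat _ _ (by simp), ?_⟩
    simp only [State.setNat_nat, if_true, Function.update_self]
    omega

theorem outerAt_holds {σ τ : State} {p dst e : ℕ} (hs : SameBut [sI, dst] [] σ τ)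
    (hd : dst ∉ [1, 2, aCnt, sEab, p]) (hpI : p ≠ sI) (hi : τ.nat sI 0 = e) :
    (outerAt p).Holds τ ↔ σ.nat aCnt e = 1 ∧ e ≠ σ.nat sEab 0 - 1 ∧
      (σ.nat 1 e = σ.nat p 0 ∨ σ.nat 2 e = σ.nat p 0) := by
  simp only [List.mem_cons, List.not_mem_nil, or_false, not_or] at hd
  have e1 := hs.1 1 (by simp; omega)
  have e2 := hs.1 2 (by simp; omega)
  have e3 := hs.1 aCnt (by simp; omega)
  have e4 := hs.1 sEab (by simp; omega)
  have e5 := hs.1 p (by simp; omega)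
  show (outerTest.Holds τ ∧ ¬ (NExp.eq _ _).Holds τ ∧ (BExp.or _ _).Holds τ) ↔ _
  rw [NExp.eq_holds, NExp.eq_holds, BExp.or_holds, NExp.eq_holds, NExp.eq_holds]
  simp only [NExp.eval, hi, e1, e2, e3, e4, e5]

theorem Inst.m_le_size (g : Inst) : g.m ≤ g.size := Nat.le_add_left _ _

theorem Inst.n_le_size (g : Inst) : g.n ≤ g.size := Nat.le_add_right _ _

theorem OuterCycle.edge_at_b {V : Type*} {G : SimpleGraph V} {a b c d : V}
    (hO : OuterCycle G a b c d) {x y : V}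
    (h : s(x, y) = s(a, b) ∨ s(x, y) = s(b, c) ∨ s(x, y) = s(c, d) ∨ s(x, y) = s(d, a))
    (hne : s(x, y) ≠ s(a, b)) (hb : x = b ∨ y = b) : s(x, y) = s(b, c) := by
  have hn := hO.nodup
  rcases h with h | h | h | h
  · exact (hne h).elim
  · exact h
  · rcases Sym2.eq_iff.1 h with ⟨rfl, rfl⟩ | ⟨rfl, rfl⟩ <;> tauto
  · rcases Sym2.eq_iff.1 h with ⟨rfl, rfl⟩ | ⟨rfl, rfl⟩ <;> tauto

/-- The edge found at `b` is `b c`. -/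
theorem Tri.atEdge_bc {g : Inst} {σ : State} (hT : Tri g σ) {a b c d : Fin g.n}
    (hO : OuterCycle g.G a b c d) {e e' : ℕ} (hab : AtEdge g.m σ e' a b) (he : e < g.m)
    (h1 : σ.nat aCnt e = 1) (hne : e ≠ e') (hb : σ.nat 1 e = b ∨ σ.nat 2 e = b) :
    AtEdge g.m σ e b c := by
  obtain ⟨x, y, hx, hy, hxy⟩ := hT.edge he
  have hs := hO.edge_at_b (hT.outer_of_cnt he h1 hO hx hy) ?_ ?_
  · refine ⟨he, h1, ?_⟩
    rcases Sym2.eq_iff.1 hs with ⟨rfl, rfl⟩ | ⟨rfl, rfl⟩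
    · exact .inl ⟨hx, hy⟩
    · exact .inr ⟨hx, hy⟩
  · intro h
    apply hne
    apply hT.edges.inj e he e' hab.lt
    have := hab.ends
    rcases Sym2.eq_iff.1 h with ⟨rfl, rfl⟩ | ⟨rfl, rfl⟩ <;> omega
  · rw [hx, hy] at hb
    exact hb.imp Fin.ext Fin.ext

theorem Tri.atEdge_of_rep {g : Inst} {σ : State} (hT : Tri g σ) {a b c d : Fin g.n}
    (hO : OuterCycle g.G a b c d) {B : Fin g.n → Box} (hB : Rep g.G g.w g.h B) :
    ∃ e, AtEdge g.m σ e a b := by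
  obtain ⟨e, he, h⟩ := hT.exists_edge hO.hab
  exact ⟨e, he, hT.cnt_eq_one hO hB he h, h⟩

theorem AtEdge.symm {m : ℕ} {σ : State} {e x y : ℕ} (h : AtEdge m σ e x y) : AtEdge m σ e y x :=
  ⟨h.lt, h.cnt, h.ends.symm⟩

/-- Every early exit leaves the answer `0`, and is justified because a representation forces all
counts to be `1` or `2` and every outer edge to have count `1`. -/
theorem outerProg_spec {rest : Prog}
    (h : Triple (fun q : OInst => q.size) rest Outer fun q τ => Answer q.toInst τ) :
    Triple Inst.size (outerProg rest) Pending Answer := by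
  refine Triple.require (mid := Counted) Inst.m
    (fun _ σ e => ¬ (σ.nat aCnt e = 1 ∨ σ.nat aCnt e = 2)) (by decide) Inst.m_le_size
    ?_ ?_ ?_ ?_ ?_
  · intro g σ τ hσ hs
    simp only [NExp.eval]; rw [hs.1 0 (by decide)]; exact hσ.tri.m_eq
  · intro g σ τ e hσ he hs hi
    rw [BExp.or_holds]
    simp only [BExp.Holds, NExp.eval, hi, hs.1 aCnt (by decide)]
    omega
  · intro g σ τ e hσ hs he hp
    refine (hσ.frame hs (by decide) (by decide)).answer_no fun B hB => hp ?_
    have := hσ.tri.cnt_le_two he hB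
    have := hσ.tri.cnt_pos he
    omega
  · intro g σ τ hσ hs hp
    have : Counted g σ := ⟨hσ, fun e he => not_not.1 (hp e he)⟩
    exact this.frame hs (by decide) (by decide)
  refine Triple.acquire
    (mid := fun g τ => ∃ a b c d : Fin g.n, OuterAB ⟨g, a, b, c, d⟩ (Prog.exec (seqs
      [.nset sA (.lit 0) (.get 1 (eX sEab)), .nset sB (.lit 0) (.get 2 (eX sEab))]) τ))
    Inst.m (fun _ σ e => σ.nat aCnt e = 1) (by decide) Inst.m_le_size ?_ ?_ ?_ ?_
    (Triple.seq (mid := fun g τ => ∃ a b c d : Fin g.n, OuterAB ⟨g, a, b, c, d⟩ τ)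
      (Triple.of_exec (by simp [seqs, Prog.LoopFree]) fun _ _ h => h) ?_)
  · intro g σ τ hσ hs
    simp only [NExp.eval]; rw [hs.1 0 (by decide)]; exact hσ.tri.m_eq
  · intro g σ τ e hσ he hs hi
    rw [NExp.eq_holds]
    simp only [NExp.eval, hi, hs.1 aCnt (by decide)]
  · intro g σ τ hσ hs hp
    refine (hσ.toPending.frame hs (by decide) (by decide)).answer_no fun B hB => ?_
    obtain ⟨a, b, c, d, hO⟩ := hσ.tri.outer
    obtain ⟨e, he⟩ := hσ.tri.atEdge_of_rep hO hB
    exact hp e he.lt he.cnt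
  · intro g σ τ e hσ hs he hp hd
    have hC : Counted g τ := hσ.frame hs (by decide) (by decide)
    obtain ⟨a, b, c, d, hO⟩ := hC.tri.outer
    obtain ⟨x, y, hx, hy, hxy⟩ := hC.tri.edge he
    have h1 : τ.nat aCnt e = 1 := by rw [hs.1 aCnt (by decide)]; exact hp
    -- The outer cycle is renamed so that it starts with the edge found. Its other two vertices
    -- exist at this point but are read from memory only later.
    obtain ⟨z, z', hO'⟩ := hO.exists_of_edge (hC.tri.outer_of_cnt he h1 hO hx hy)
    have hs' : SameBut [sA, sB] [] τ (Prog.exec (seqs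
      [.nset sA (.lit 0) (.get 1 (eX sEab)), .nset sB (.lit 0) (.get 2 (eX sEab))]) τ) :=
      (SameBut.of_exec (by simp [seqs, Prog.LoopFree]) _).mono (by decide) (by decide)
    refine ⟨x, y, z, z', hC.frame hs' (by decide) (by decide), hO', ?_, ?_, ?_⟩
    · simp [seqs, Prog.exec, NExp.eval, State.setNat_nat, hd, hx]
    · simp [seqs, Prog.exec, NExp.eval, State.setNat_nat, hd, hy]
    · refine AtEdge.frame (e := e) ⟨he, h1, .inl ⟨hx, hy⟩⟩ hs' (by decide) ?_
      rw [hs'.1 sEab (by decide), hd, Nat.add_sub_cancel]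
  -- From here on the four outer vertices belong to the auxiliary data; the later searches find the
  -- edges and vertices already named there.
  refine Triple.conseq (size' := fun q : OInst => q.size) (pre' := OuterAB)
    (post' := fun q τ => Answer q.toInst τ) ?_
    (by rintro g σ ⟨a, b, c, d, h⟩; exact ⟨⟨g, a, b, c, d⟩, le_rfl, h, fun _ h => h⟩)
  refine Triple.acquire (mid := fun g τ => OuterABC g (Prog.exec (otherEnd sC sB sEbc) τ))
    (fun q => q.m) (fun q σ e => σ.nat aCnt e = 1 ∧ e ≠ σ.nat sEab 0 - 1 ∧
      (σ.nat 1 e = σ.nat sB 0 ∨ σ.nat 2 e = σ.nat sB 0)) (by decide)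
    (fun q => q.m_le_size) ?_ ?_ ?_ ?_
    (Triple.seq (mid := OuterABC) (Triple.of_exec (by simp [otherEnd, Prog.LoopFree]) fun _ _ h => h) ?_)
  · intro g σ τ hσ hs
    simp only [NExp.eval]; rw [hs.1 0 (by decide)]; exact hσ.tri.m_eq
  · intro g σ τ e hσ he hs hi
    exact outerAt_holds hs (by decide) (by decide) hi
  · intro g σ τ hσ hs hp
    refine (hσ.toPending.frame hs (by decide) (by decide)).answer_no fun B hB => ?_
    obtain ⟨e, he⟩ := hσ.tri.atEdge_of_rep hσ.cycle.rotate hB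
    have hn := hσ.cycle.nodup
    refine hp e he.lt ⟨he.cnt, ?_, ?_⟩
    · rintro rfl
      have h1 := he.ends
      have h2 := hσ.ab.ends
      simp only [ne_eq, Fin.ext_iff] at hn
      omega
    · rw [hσ.b_eq]; have h1 := he.ends; omega
  · rintro g σ τ e hσ hs he ⟨h1, h2, h3⟩ hd
    rw [hσ.b_eq] at h3
    have hbc := hσ.tri.atEdge_bc hσ.cycle hσ.ab he h1 h2 h3
    have hτ := hσ.frame hs (by decide) (by decide)
    have hbc' : AtEdge g.m τ (τ.nat sEbc 0 - 1) g.b g.c :=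
      hbc.frame hs (by decide) (by rw [hd, Nat.add_sub_cancel])
    obtain ⟨k1, k2⟩ := otherEnd_spec (r := sC) (p := sB) (s := sEbc) hτ.b_eq hbc'.ends
    exact ⟨hτ.frame k1 (by decide) (by decide), k2,
      hbc'.frame k1 (by decide) (by rw [k1.1 sEbc (by decide)])⟩
  refine Triple.acquire (mid := fun g τ => OuterABCD g (Prog.exec (otherEnd sD sA sEda) τ))
    (fun q => q.m) (fun q σ e => σ.nat aCnt e = 1 ∧ e ≠ σ.nat sEab 0 - 1 ∧
      (σ.nat 1 e = σ.nat sA 0 ∨ σ.nat 2 e = σ.nat sA 0)) (by decide)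
    (fun q => q.m_le_size) ?_ ?_ ?_ ?_
    (Triple.seq (mid := OuterABCD) (Triple.of_exec (by simp [otherEnd, Prog.LoopFree]) fun _ _ h => h) ?_)
  · intro g σ τ hσ hs
    simp only [NExp.eval]; rw [hs.1 0 (by decide)]; exact hσ.tri.m_eq
  · intro g σ τ e hσ he hs hi
    exact outerAt_holds hs (by decide) (by decide) hi
  · intro g σ τ hσ hs hp
    refine (hσ.toPending.frame hs (by decide) (by decide)).answer_no fun B hB => ?_
    obtain ⟨e, he⟩ := hσ.tri.atEdge_of_rep hσ.cycle.rotate.rotate.rotate hB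
    have hn := hσ.cycle.nodup
    refine hp e he.lt ⟨he.cnt, ?_, ?_⟩
    · rintro rfl
      have h1 := he.ends
      have h2 := hσ.ab.ends
      simp only [ne_eq, Fin.ext_iff] at hn
      omega
    · rw [hσ.a_eq]; have h1 := he.ends; omega
  · rintro g σ τ e hσ hs he ⟨h1, h2, h3⟩ hd
    rw [hσ.a_eq] at h3
    have hda := (hσ.tri.atEdge_bc hσ.cycle.reflect hσ.ab.symm he h1 h2 h3).symm
    have hτ := hσ.frame hs (by decide) (by decide)
    have hda' : AtEdge g.m τ (τ.nat sEda 0 - 1) g.d g.a :=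
      hda.frame hs (by decide) (by rw [hd, Nat.add_sub_cancel])
    obtain ⟨k1, k2⟩ := otherEnd_spec (r := sD) (p := sA) (s := sEda) hτ.a_eq hda'.symm.ends
    exact ⟨hτ.frame k1 (by decide) (by decide), k2,
      hda'.frame k1 (by decide) (by rw [k1.1 sEda (by decide)])⟩
  refine Triple.acquire (mid := Outer) (fun q => q.m)
    (fun q σ e => σ.nat aCnt e = 1 ∧ (σ.nat 1 e = q.c ∧ σ.nat 2 e = q.d ∨
      σ.nat 1 e = q.d ∧ σ.nat 2 e = q.c)) (by decide) (fun q => q.m_le_size) ?_ ?_ ?_ ?_ h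
  · intro g σ τ hσ hs
    simp only [NExp.eval]; rw [hs.1 0 (by decide)]; exact hσ.tri.m_eq
  · intro g σ τ e hσ he hs hi
    show (NExp.eq _ _).Holds τ ∧ (BExp.or _ _).Holds τ ↔ _
    rw [BExp.or_holds, NExp.eq_holds]
    show _ ∧ ((NExp.eq _ _).Holds τ ∧ (NExp.eq _ _).Holds τ ∨
      (NExp.eq _ _).Holds τ ∧ (NExp.eq _ _).Holds τ) ↔ _
    simp only [NExp.eq_holds, NExp.eval, hi, hs.1 aCnt (by decide), hs.1 1 (by decide),
      hs.1 2 (by decide), hs.1 sC (by decide), hs.1 sD (by decide), hσ.c_eq, hσ.d_eq]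
  · intro g σ τ hσ hs hp
    refine (hσ.toPending.frame hs (by decide) (by decide)).answer_no fun B hB => ?_
    obtain ⟨e, he⟩ := hσ.tri.atEdge_of_rep hσ.cycle.rotate.rotate hB
    exact hp e he.lt ⟨he.cnt, he.ends⟩
  · rintro g σ τ e hσ hs he ⟨h1, h2⟩ hd
    refine ⟨hσ.frame hs (by decide) (by decide), ?_⟩
    exact AtEdge.frame (e := e) ⟨he, h1, h2⟩ hs (by decide) (by rw [hd, Nat.add_sub_cancel])

/-! ## Placing the inner boxes -/

notation "sE" => (17 : ℕ)
notation "sQt" => (27 : ℕ)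
notation "sQi" => (28 : ℕ)
notation "aSt" => (48 : ℕ)
notation "aQ" => (50 : ℕ)

def OInst.inner (q : OInst) : Set (Fin q.n) := {v | v ≠ q.a ∧ v ≠ q.b ∧ v ≠ q.c ∧ v ≠ q.d}

/-- The box of `v` while the inner boxes are being placed. -/
def provAt (σ : State) (v : ℕ) : Box := ⟨σ.real 2 v, σ.real 4 v, σ.real 3 v, σ.real 5 v⟩

abbrev quadKeyAt (σ : State) : ℕ → ℕ := quadKey (σ.nat 1) (σ.nat 2) (σ.nat aT1) (σ.nat aT2)

/-- Inner boxes that have been placed have status `1`, the boxes `a` and `b` have status `2`. -/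
def Placed (σ : State) (v : ℕ) : Prop := 0 < σ.nat aSt v ∧ σ.nat aSt v < 3

/-- `x`, `y` are the ends of `e`, and `z`, `z'` their common neighbours. -/
def Variant (σ : State) (e x y z z' : ℕ) : Prop :=
  (x = σ.nat 1 e ∧ y = σ.nat 2 e ∨ x = σ.nat 2 e ∧ y = σ.nat 1 e) ∧
    (z = σ.nat aT1 e ∧ z' = σ.nat aT2 e ∨ z = σ.nat aT2 e ∧ z' = σ.nat aT1 e)

/-- The boxes placed so far agree with the representation `B`. -/
structure Good (q : OInst) (B : Fin q.n → Box) (σ : State) : Prop where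
  sta : σ.nat aSt q.a = 2
  stb : σ.nat aSt q.b = 2
  stc : σ.nat aSt q.c = 3
  std : σ.nat aSt q.d = 3
  pa : provAt σ q.a = ⟨-q.w q.a, 0, -q.h q.b, q.h q.a⟩
  pb : provAt σ q.b = ⟨0, q.w q.b, -q.h q.b, 0⟩
  corner : ∀ z : Fin q.n, q.G.Adj q.a z → q.G.Adj q.b z → σ.nat aSt z ≠ 0
  inner : ∀ v ∈ q.inner, σ.nat aSt v ≠ 0 → σ.nat aSt v = 1 ∧ provAt σ v = B v

/-- The state of the search for boxes that can be placed; the cells in `D` have been treated. -/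
structure Queue (q : OInst) (D : ℕ → Prop) (σ : State) : Prop where
  lt : ∀ i < σ.nat sQt 0, σ.nat aQ i < q.n
  st : ∀ i < σ.nat sQt 0, σ.nat aSt (σ.nat aQ i) ≠ 0
  inj : ∀ i < σ.nat sQt 0, ∀ j < σ.nat sQt 0, σ.nat aQ i = σ.nat aQ j → i = j
  placed : ∀ v < q.n, Placed σ v → ∃ i < σ.nat sQt 0, σ.nat aQ i = v
  done : ∀ c < 4 * q.m, D c → σ.nat aSt (quadKeyAt σ c) ≠ 0
  settled : ∀ e < q.m, σ.nat aCnt e = 2 → ∀ x y z z', Variant σ e x y z z' → Placed σ x →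
    Placed σ y → Placed σ z' → CornerTest (provAt σ x) (provAt σ y) (provAt σ z') →
    σ.nat aSt z ≠ 0 ∨ ∃ c < 4 * q.m, c / 4 = e ∧ Placed σ (quadKeyAt σ c) ∧ ¬ D c
  good : ∀ B, Normal q.G q.w q.h q.inner B q.a q.b q.c q.d → Good q B σ

theorem quadKey_variant {σ : State} {e x y z z' : ℕ} (h : Variant σ e x y z z') {u : ℕ}
    (hu : u = x ∨ u = y ∨ u = z ∨ u = z') : ∃ r < 4, quadKeyAt σ (4 * e + r) = u := by
  obtain ⟨h1, h2⟩ := h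
  have k0 := quadKey_zero (σ.nat 1) (σ.nat 2) (σ.nat aT1) (σ.nat aT2) e
  have k1 := quadKey_one (σ.nat 1) (σ.nat 2) (σ.nat aT1) (σ.nat aT2) e
  have k2 := quadKey_two (σ.nat 1) (σ.nat 2) (σ.nat aT1) (σ.nat aT2) e
  have k3 := quadKey_three (σ.nat 1) (σ.nat 2) (σ.nat aT1) (σ.nat aT2) e
  have : u = σ.nat 1 e ∨ u = σ.nat 2 e ∨ u = σ.nat aT1 e ∨ u = σ.nat aT2 e := by omega
  rcases this with rfl | rfl | rfl | rfl
  · exact ⟨0, by omega, k0⟩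
  · exact ⟨1, by omega, k1⟩
  · exact ⟨2, by omega, k2⟩
  · exact ⟨3, by omega, k3⟩

theorem Tri.quadKey_lt {g : Inst} {σ : State} (hT : Tri g σ) {e c : ℕ} (he : e < g.m)
    (h2 : σ.nat aCnt e = 2) (hc : c / 4 = e) : quadKeyAt σ c < g.n := by
  obtain ⟨x, y, hx, hy, -⟩ := hT.edge he
  obtain ⟨z, z', hz, hz', -⟩ := hT.thirds he h2 hx hy
  unfold quadKeyAt quadKey
  rw [hc, hx, hy, hz, hz']
  split_ifs <;> exact Fin.is_lt _

/-- The boxes that represent `a` and `b` while the inner boxes are being placed, and the given boxes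
for the others. -/
noncomputable def provBox (q : OInst) (B : Fin q.n → Box) (v : Fin q.n) : Box :=
  if v = q.a then ⟨-q.w q.a, 0, -q.h q.b, q.h q.a⟩
  else if v = q.b then ⟨0, q.w q.b, -q.h q.b, 0⟩ else B v

theorem provisional_provBox {q : OInst} {B : Fin q.n → Box} (hab : q.a ≠ q.b) :
    Provisional q.w q.h q.inner B (provBox q B) q.a q.b where
  inner i hi := by simp [provBox, hi.1, hi.2.1]
  pa := by simp [provBox]
  pb := by simp [provBox, hab.symm]

theorem Good.placed {q : OInst} {B : Fin q.n → Box} {σ : State} (h : Good q B σ) (hab : q.a ≠ q.b)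
    {v : Fin q.n} (hv : Placed σ v) :
    (v ∈ q.inner ∨ v = q.a ∨ v = q.b) ∧ provAt σ v = provBox q B v := by
  obtain ⟨h1, h2⟩ := hv
  by_cases ha : v = q.a
  · subst ha; exact ⟨by tauto, by rw [h.pa]; simp [provBox]⟩
  by_cases hb : v = q.b
  · subst hb; exact ⟨by tauto, by rw [h.pb]; simp [provBox, hab.symm]⟩
  by_cases hc : v = q.c
  · subst hc; have := h.stc; omega
  by_cases hd : v = q.d
  · subst hd; have := h.std; omega
  have hI : v ∈ q.inner := ⟨ha, hb, hc, hd⟩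
  refine ⟨.inl hI, ?_⟩
  rw [(h.inner v hI (by omega)).2]
  simp [provBox, ha, hb]

/-- The memory after placing `z` in the corner of `x` and `y`. -/
structure PlacedAt (σ τ : State) (x y z : ℕ) : Prop where
  same : SameBut [aSt, aQ, sQt] [2, 3, 4, 5] σ τ
  st : τ.nat aSt = Function.update (σ.nat aSt) z 1
  queue : τ.nat aQ = Function.update (σ.nat aQ) (σ.nat sQt 0) z
  tail : τ.nat sQt 0 = σ.nat sQt 0 + 1
  l : τ.real 2 = Function.update (σ.real 2) z (σ.real 4 x)
  b : τ.real 3 = Function.update (σ.real 3) z (σ.real 5 y)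
  r : τ.real 4 = Function.update (σ.real 4) z (σ.real 4 x + σ.real 0 z)
  t : τ.real 5 = Function.update (σ.real 5) z (σ.real 5 y + σ.real 1 z)

/-- Two points need care. A corner test that succeeds only because of the new box must remain
pending, and the new position must agree with every representation in normal position, which is
`Normal.corner_of_test`. -/
theorem Queue.place {q : OInst} {D : ℕ → Prop} {σ τ : State} (hQ : Queue q D σ) (hO : Outer q σ)
    {e x y z z' : ℕ} (he : e < q.m) (hc : σ.nat aCnt e = 2) (hv : Variant σ e x y z z')
    (hx : Placed σ x) (hy : Placed σ y) (hz' : Placed σ z') (hz : σ.nat aSt z = 0)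
    (ht : CornerTest (provAt σ x) (provAt σ y) (provAt σ z')) (hτ : PlacedAt σ τ x y z) :
    Queue q D τ := by
  obtain ⟨same, st, queue, tail, pl, pb, pr, pt⟩ := hτ
  have hst : ∀ v, σ.nat aSt v ≠ 0 → τ.nat aSt v = σ.nat aSt v := fun v h => by
    rw [st, Function.update_of_ne]; rintro rfl; exact h hz
  have hst' : ∀ v, σ.nat aSt v ≠ 0 → τ.nat aSt v ≠ 0 := fun v h => by rwa [hst v h]
  have hstz : τ.nat aSt z = 1 := by rw [st, Function.update_self]
  have hpl : ∀ v, Placed σ v → Placed τ v := fun v h => by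
    unfold Placed; rw [hst v (by have := h.1; omega)]; exact h
  have hpl' : ∀ v, v ≠ z → Placed τ v → Placed σ v := fun v h h' => by
    unfold Placed at *; rwa [st, Function.update_of_ne h] at h'
  have hprov : ∀ v, v ≠ z → provAt τ v = provAt σ v := fun v h => by
    simp [provAt, pl, pb, pr, pt, h]
  have hq : ∀ i < σ.nat sQt 0, τ.nat aQ i = σ.nat aQ i := fun i hi => by
    rw [queue, Function.update_of_ne hi.ne]
  have hqt : τ.nat aQ (σ.nat sQt 0) = z := by rw [queue, Function.update_self]
  have hkey : quadKeyAt τ = quadKeyAt σ := by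
    unfold quadKeyAt
    rw [same.1 1 (by decide), same.1 2 (by decide), same.1 aT1 (by decide), same.1 aT2 (by decide)]
  have hnz : ∀ i < σ.nat sQt 0, σ.nat aQ i ≠ z := fun i hi h => hQ.st i hi (by rw [h, hz])
  obtain ⟨x₁, y₁, hx₁, hy₁, hxy⟩ := hO.tri.edge he
  obtain ⟨z₁, z₂, hz₁, hz₂, hne, hcom⟩ := hO.tri.thirds he hc hx₁ hy₁
  constructor
  · intro i hi
    rcases Nat.lt_succ_iff_lt_or_eq.1 (tail ▸ hi) with h | rfl
    · rw [hq i h]; exact hQ.lt i h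
    · rw [hqt]
      rcases hv.2 with ⟨h, -⟩ | ⟨h, -⟩
      · rw [h, hz₁]; exact z₁.2
      · rw [h, hz₂]; exact z₂.2
  · intro i hi
    rcases Nat.lt_succ_iff_lt_or_eq.1 (tail ▸ hi) with h | rfl
    · rw [hq i h]; exact hst' _ (hQ.st i h)
    · rw [hqt, hstz]; omega
  · intro i hi j hj hij
    rcases Nat.lt_succ_iff_lt_or_eq.1 (tail ▸ hi) with h | rfl <;>
      rcases Nat.lt_succ_iff_lt_or_eq.1 (tail ▸ hj) with h' | rfl
    · rw [hq i h, hq j h'] at hij; exact hQ.inj i h j h' hij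
    · rw [hq i h, hqt] at hij; exact (hnz i h hij).elim
    · rw [hq j h', hqt] at hij; exact (hnz j h' hij.symm).elim
    · rfl
  · intro v hvn hv
    by_cases hvz : v = z
    · subst hvz; exact ⟨σ.nat sQt 0, by omega, hqt⟩
    · obtain ⟨i, hi, h⟩ := hQ.placed v hvn (hpl' v hvz hv)
      exact ⟨i, by omega, by rw [hq i hi, h]⟩
  · intro c hc' hd
    rw [hkey]
    exact hst' _ (hQ.done c hc' hd)
  · intro e' he' hc' x' y' u u' hv' hx' hy' hu' ht'
    rw [same.1 aCnt (by decide)] at hc'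
    have hv'' : Variant σ e' x' y' u u' := by
      unfold Variant at *
      rwa [same.1 1 (by decide), same.1 2 (by decide), same.1 aT1 (by decide),
        same.1 aT2 (by decide)] at hv'
    rw [hkey]
    by_cases hz0 : z = x' ∨ z = y' ∨ z = u'
    -- A configuration that involves the new box `z` is pending through the cell of `z` at this
    -- edge: treated cells belong to boxes that already had a status, and `z` had none.
    · right
      obtain ⟨r, hr, hk⟩ := quadKey_variant hv'' (u := z) (by tauto)
      refine ⟨4 * e' + r, by omega, by omega, ?_, fun hd => ?_⟩
      · rw [hk]; unfold Placed; omega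
      · exact hQ.done _ (by omega) hd (by rw [hk, hz])
    · push Not at hz0
      obtain ⟨n1, n2, n3⟩ := hz0
      rw [hprov _ n1.symm, hprov _ n2.symm, hprov _ n3.symm] at ht'
      rcases hQ.settled e' he' hc' x' y' u u' hv'' (hpl' _ n1.symm hx') (hpl' _ n2.symm hy')
        (hpl' _ n3.symm hu') ht' with h | ⟨c, h1, h2, h3, h4⟩
      · exact .inl (hst' _ h)
      · exact .inr ⟨c, h1, h2, hpl _ h3, h4⟩
  · intro B N
    have hG := hQ.good B N
    have hab : q.a ≠ q.b := N.hab.ne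
    have na : (q.a : ℕ) ≠ z := by rintro rfl; have := hG.sta; omega
    have nb : (q.b : ℕ) ≠ z := by rintro rfl; have := hG.stb; omega
    have nc : (q.c : ℕ) ≠ z := by rintro rfl; have := hG.stc; omega
    have nd : (q.d : ℕ) ≠ z := by rintro rfl; have := hG.std; omega
    refine ⟨by rw [hst] <;> simp [hG.sta], by rw [hst] <;> simp [hG.stb],
      by rw [hst] <;> simp [hG.stc], by rw [hst] <;> simp [hG.std],
      by rw [hprov _ na]; exact hG.pa, by rw [hprov _ nb]; exact hG.pb,
      fun u h1 h2 => hst' u (hG.corner u h1 h2), ?_⟩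
    intro v hvI hvs
    by_cases hvz : (v : ℕ) = z
    · obtain ⟨x₂, y₂, hx₂, hy₂, hadj, w₂, rfl, hvw, hc2⟩ : ∃ x₂ y₂ : Fin q.n, x = x₂ ∧ y = y₂ ∧
          q.G.Adj x₂ y₂ ∧ ∃ w₂ : Fin q.n, z' = w₂ ∧ v ≠ w₂ ∧
          (∀ u, q.G.Adj x₂ u ∧ q.G.Adj y₂ u ↔ u = v ∨ u = w₂) := by
        obtain ⟨h1, h2⟩ := hv
        rw [hx₁, hy₁, hz₁, hz₂] at *
        rcases h2 with ⟨h3, rfl⟩ | ⟨h3, rfl⟩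
        · obtain rfl : v = z₁ := Fin.ext (hvz.trans h3)
          rcases h1 with ⟨rfl, rfl⟩ | ⟨rfl, rfl⟩
          · exact ⟨_, _, rfl, rfl, hxy, _, rfl, hne, hcom⟩
          · exact ⟨_, _, rfl, rfl, hxy.symm, _, rfl, hne, fun u => and_comm.trans (hcom u)⟩
        · obtain rfl : v = z₂ := Fin.ext (hvz.trans h3)
          rcases h1 with ⟨rfl, rfl⟩ | ⟨rfl, rfl⟩
          · exact ⟨_, _, rfl, rfl, hxy, _, rfl, hne.symm, fun u => (hcom u).trans or_comm⟩
          · exact ⟨_, _, rfl, rfl, hxy.symm, _, rfl, hne.symm,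
              fun u => and_comm.trans ((hcom u).trans or_comm)⟩
      subst hx₂ hy₂
      obtain ⟨i1, p1⟩ := hG.placed hab hx
      obtain ⟨i2, p2⟩ := hG.placed hab hy
      obtain ⟨i3, p3⟩ := hG.placed hab hz'
      have e1 := (hc2 v).2 (.inl rfl)
      have e2 := (hc2 w₂).2 (.inr rfl)
      rw [p1, p2, p3] at ht
      obtain ⟨k1, k2⟩ := N.corner_of_test (provisional_provBox hab) i1 i2 hvI i3 hvw hadj e1.1 e1.2
        e2.1 e2.2 ht
      rw [← p1] at k1
      rw [← p2] at k2
      refine ⟨by rw [hvz, hstz], ?_⟩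
      have hr := N.rep.r_eq v
      have hT := N.rep.t_eq v
      have w1 := hO.tri.w_eq v
      have w2 := hO.tri.h_eq v
      simp only [provAt] at k1 k2
      rw [hvz] at w1 w2
      simp only [provAt, pl, pb, pr, pt, hvz, Function.update_self]
      rw [← k1, ← k2, w1, w2, ← hr, ← hT]
    · rw [hprov _ hvz]
      rw [st, Function.update_of_ne hvz] at hvs ⊢
      exact hG.inner v hvI hvs

theorem Queue.frame {q : OInst} {D : ℕ → Prop} {σ τ : State} (hQ : Queue q D σ) {ns rs : List ℕ}
    (hs : SameBut ns rs σ τ) (hn : ∀ a ∈ [1, 2, aT1, aT2, aCnt, aSt, aQ, sQt], a ∉ ns)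
    (hr : ∀ a ∈ [2, 3, 4, 5], a ∉ rs) : Queue q D τ := by
  have n1 := hs.1 1 (hn _ (by simp))
  have n2 := hs.1 2 (hn _ (by simp))
  have n3 := hs.1 aT1 (hn _ (by simp))
  have n4 := hs.1 aT2 (hn _ (by simp))
  have n5 := hs.1 aSt (hn _ (by simp))
  have n6 := hs.1 aQ (hn _ (by simp))
  have n7 := hs.1 sQt (hn _ (by simp))
  have n8 := hs.1 aCnt (hn _ (by simp))
  have hpl : ∀ v, Placed τ v = Placed σ v := fun v => by unfold Placed; rw [n5]
  have hpr : ∀ v, provAt τ v = provAt σ v := fun v => by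
    unfold provAt
    rw [hs.2 2 (hr _ (by simp)), hs.2 3 (hr _ (by simp)), hs.2 4 (hr _ (by simp)),
      hs.2 5 (hr _ (by simp))]
  have hva : ∀ e x y z z', Variant τ e x y z z' = Variant σ e x y z z' := by
    intros; unfold Variant; rw [n1, n2, n3, n4]
  have hkey : quadKeyAt τ = quadKeyAt σ := by unfold quadKeyAt; rw [n1, n2, n3, n4]
  obtain ⟨q1, q2, q3, q4, q5, q6, q7⟩ := hQ
  refine ⟨?_, ?_, ?_, ?_, ?_, ?_, ?_⟩
  · rwa [n6, n7]
  · rwa [n6, n7, n5]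
  · rwa [n6, n7]
  · simp only [hpl, n6, n7]; exact q4
  · rwa [hkey, n5]
  · simp only [hpl, hpr, hva, n8, hkey, n5]; exact q6
  · intro B N
    obtain ⟨g1, g2, g3, g4, g5, g6, g7, g8⟩ := q7 B N
    refine ⟨?_, ?_, ?_, ?_, ?_, ?_, ?_, ?_⟩ <;> simp only [n5, hpr] <;> assumption

theorem Queue.congr {q : OInst} {D D' : ℕ → Prop} {σ : State} (hQ : Queue q D σ)
    (h : ∀ c < 4 * q.m, D c ↔ D' c) : Queue q D' σ := by
  obtain ⟨q1, q2, q3, q4, q5, q6, q7⟩ := hQ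
  refine ⟨q1, q2, q3, q4, fun c hc hd => q5 c hc ((h c hc).2 hd), ?_, q7⟩
  intro e he hc x y z z' hv hx hy hz ht
  rcases q6 e he hc x y z z' hv hx hy hz ht with k | ⟨c, h1, h2, h3, h4⟩
  · exact .inl k
  · exact .inr ⟨c, h1, h2, h3, fun hd => h4 ((h c h1).2 hd)⟩

abbrev placedX (v : NExp) : BExp := .and (.nlt (.lit 0) (.get aSt v)) (.nlt (.get aSt v) (.lit 3))

abbrev cornerX (x y z z' : NExp) : BExp :=
  .and (.and (placedX x) (.and (placedX y) (.and (placedX z') (.nlt (.get aSt z) (.lit 1)))))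
    (.and (.rlt (.get 4 x) (.get 4 y)) (.and (.rlt (.get 5 y) (.get 5 x))
      (.or (.rlt (.get 2 z') (.get 4 x)) (.rlt (.get 3 z') (.get 5 y)))))

def placeProg (x y z : NExp) : Prog :=
  seqs [.rset 2 z (.get 4 x), .rset 3 z (.get 5 y), .rset 4 z (.add (.get 4 x) (.get 0 z)),
    .rset 5 z (.add (.get 5 y) (.get 1 z)), .nset aQ (sc sQt) z, .nset aSt z (.lit 1),
    .nset sQt (.lit 0) (.succ (sc sQt))]

/-- Place `z` in the corner of `x` and `y` if the test succeeds. -/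
def tryProg (x y z z' : NExp) : Prog := .ite (cornerX x y z z') (placeProg x y z) .skip

/-- An end or a common neighbour of the ends of the current edge. -/
abbrev vX (p : ℕ) : NExp := .get p (sc sE)

theorem cornerX_holds {σ : State} {x y z z' : NExp} : (cornerX x y z z').Holds σ ↔
    (Placed σ (x.eval σ) ∧ Placed σ (y.eval σ) ∧ Placed σ (z'.eval σ) ∧ σ.nat aSt (z.eval σ) = 0) ∧
    CornerTest (provAt σ (x.eval σ)) (provAt σ (y.eval σ)) (provAt σ (z'.eval σ)) := by
  unfold Placed CornerTest provAt cornerX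
  show (_ ∧ _ ∧ _ ∧ _) ∧ (_ ∧ _ ∧ BExp.Holds σ (BExp.or _ _)) ↔ _
  rw [BExp.or_holds]
  simp only [BExp.Holds, NExp.eval, RExp.eval, Nat.lt_one_iff]

theorem placeProg_exec {σ : State} {p q r : ℕ} (hr : r ∉ [aSt, aQ, sQt]) :
    PlacedAt σ ((placeProg (vX p) (vX q) (vX r)).exec σ) ((vX p).eval σ) ((vX q).eval σ)
      ((vX r).eval σ) := by
  simp only [List.mem_cons, List.not_mem_nil, or_false, not_or] at hr
  refine ⟨(SameBut.of_exec (by simp [placeProg, seqs, Prog.LoopFree]) _).mono (by simp [placeProg,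
    seqs, Prog.natWrites]) (by simp [placeProg, seqs, Prog.realWrites]), ?_, ?_, ?_, ?_, ?_, ?_, ?_⟩ <;>
  simp [placeProg, seqs, Prog.exec, NExp.eval, RExp.eval, State.setNat_nat, State.setReal_real, hr]

/-- Try to place a box in a corner that belongs to the edge `sE`. -/
def tryFour : Prog :=
  .ite (.nlt (.lit 1) (.get aCnt (sc sE)))
    (.seq (tryProg (vX 1) (vX 2) (vX aT1) (vX aT2)) (.seq (tryProg (vX 2) (vX 1) (vX aT1) (vX aT2))
      (.seq (tryProg (vX 1) (vX 2) (vX aT2) (vX aT1)) (tryProg (vX 2) (vX 1) (vX aT2) (vX aT1)))))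
    .skip

/-- Try to place a box in a corner that belongs to the edge of the current cell. -/
def tryAll : Prog := .seq (.nset sE (.lit 0) (.get aVal2 (.pred (sc sP)))) tryFour

/-- The queue has only been extended. -/
def Extends (σ τ : State) : Prop :=
  σ.nat sQt 0 ≤ τ.nat sQt 0 ∧ ∀ i < σ.nat sQt 0, τ.nat aQ i = σ.nat aQ i

theorem Extends.refl (σ : State) : Extends σ σ := ⟨le_rfl, fun _ _ => rfl⟩

theorem Extends.trans {σ τ υ : State} (h : Extends σ τ) (h' : Extends τ υ) : Extends σ υ :=
  ⟨h.1.trans h'.1, fun i hi => (h'.2 i (hi.trans_le h.1)).trans (h.2 i hi)⟩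

theorem Extends.congr {σ τ υ : State} (h : Extends σ τ) (h1 : υ.nat sQt = τ.nat sQt)
    (h2 : υ.nat aQ = τ.nat aQ) : Extends σ υ := by
  unfold Extends; rwa [h1, h2]

section

variable {q : OInst} {D : ℕ → Prop} {e : ℕ}

/-- What holds while the corners of the edge `e` are being tried. -/
structure Trying (q : OInst) (D : ℕ → Prop) (e : ℕ) (σ τ : State) : Prop where
  queue : Queue q D τ
  same : SameBut [aSt, aQ, sQt] [2, 3, 4, 5] σ τ
  ext : Extends σ τ
  mono : ∀ v, σ.nat aSt v ≠ 0 → τ.nat aSt v ≠ 0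
  /-- Either nothing has changed or both common neighbours have been treated. -/
  res : τ = σ ∨ (τ.nat aSt (σ.nat aT1 e) ≠ 0 ∧ τ.nat aSt (σ.nat aT2 e) ≠ 0)

/-- A successful attempt leaves both common neighbours of the edge with a status, since `z'` was
already placed. The second claim reads an unchanged memory backwards: this attempt failed, and so
nothing had happened before it either. -/
theorem Trying.tryProg {σ τ : State} (h : Trying q D e σ τ) (hO : Outer q σ) (he : e < q.m)
    (hE : σ.nat sE 0 = e) (hc : σ.nat aCnt e = 2) {p p' r r' : ℕ}
    (hp : p ∈ [1, 2, aT1, aT2]) (hp' : p' ∈ [1, 2, aT1, aT2])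
    (hr : r ∈ [1, 2, aT1, aT2])
    (hv : Variant σ e (σ.nat p e) (σ.nat p' e) (σ.nat r e) (σ.nat r' e)) :
    Trying q D e σ ((tryProg (vX p) (vX p') (vX r) (vX r')).exec τ) ∧
    ((tryProg (vX p) (vX p') (vX r) (vX r')).exec τ = σ →
      τ = σ ∧ ¬ (cornerX (vX p) (vX p') (vX r) (vX r')).Holds σ) := by
  have hnot : ∀ {p : ℕ}, p ∈ [1, 2, aT1, aT2] → p ∉ [aSt, aQ, sQt] := by
    intro p hp hp'
    simp only [List.mem_cons, List.not_mem_nil, or_false] at hp hp'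
    omega
  have hO' : Outer q τ := hO.frame h.same (by decide) (by decide)
  unfold WRAC.tryProg
  simp only [Prog.exec]
  split_ifs with hb
  · have hP := placeProg_exec (σ := τ) (p := p) (q := p') (hnot hr)
    obtain ⟨⟨b1, b2, b3, b4⟩, b5⟩ := cornerX_holds.1 hb
    have key : ∀ p ∈ [1, 2, aT1, aT2], (vX p).eval τ = σ.nat p e := by
      intro p hp
      simp only [NExp.eval]
      rw [h.same.1 p (hnot hp), h.same.1 sE (by decide), hE]
    have hr' : (vX r').eval τ = σ.nat r' e := by
      -- `r'` is known only through its values, so its array might be one that has been written. In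
      -- that case a box has been placed, both common neighbours have a status, and the test on `z`
      -- could not have succeeded.
      by_cases hr' : r' ∈ [aSt, aQ, sQt]
      · rcases h.res with rfl | ⟨k1, k2⟩
        · simp only [NExp.eval, hE]
        · exfalso
          have := key r hr
          rcases hv.2 with ⟨h1, h2⟩ | ⟨h1, h2⟩
          · rw [this, h1] at b4; exact k1 b4
          · rw [this, h1] at b4; exact k2 b4
      · simp only [NExp.eval]
        rw [h.same.1 r' hr', h.same.1 sE (by decide), hE]
    rw [key p hp, key p' hp', key r hr] at hP
    rw [key p hp, key p' hp', hr'] at b5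
    rw [key p hp] at b1
    rw [key p' hp'] at b2
    rw [hr'] at b3
    rw [key r hr] at b4
    have hvτ : Variant τ e (σ.nat p e) (σ.nat p' e) (σ.nat r e) (σ.nat r' e) := by
      unfold Variant at *
      rwa [h.same.1 1 (by decide), h.same.1 2 (by decide), h.same.1 aT1 (by decide),
        h.same.1 aT2 (by decide)]
    have hQ := h.queue.place hO' he (by rw [h.same.1 aCnt (by decide)]; exact hc) hvτ b1 b2 b3 b4
      b5 hP
    have k1 : ((placeProg (vX p) (vX p') (vX r)).exec τ).nat aSt (σ.nat r e) ≠ 0 := by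
      rw [hP.st, Function.update_self]; omega
    have k2 : ((placeProg (vX p) (vX p') (vX r)).exec τ).nat aSt (σ.nat r' e) ≠ 0 := by
      rw [hP.st, Function.update_apply]
      split_ifs
      · omega
      · have := b3.1; omega
    refine ⟨⟨hQ, h.same.trans hP.same (by simp) (by simp), h.ext.trans ⟨by rw [hP.tail]; omega, ?_⟩,
      fun v hv => ?_, .inr ?_⟩, fun hσ => ?_⟩
    · intro i hi
      rw [hP.queue, Function.update_of_ne hi.ne]
    · rw [hP.st, Function.update_apply]
      split_ifs
      · omega
      · exact h.mono v hv
    · rcases hv.2 with ⟨h1, h2⟩ | ⟨h1, h2⟩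
      · rw [← h1, ← h2]; exact ⟨k1, k2⟩
      · rw [← h1, ← h2]; exact ⟨k2, k1⟩
    · have h1 := hP.tail
      have h2 := h.ext.1
      rw [hσ] at h1
      omega
  · exact ⟨h, fun hσ => ⟨hσ, hσ ▸ hb⟩⟩

/-- All four corners of the edge `e` are settled after the attempts. -/
theorem tryAll_spec {σ : State} {c : ℕ} (hQ : Queue q D σ) (hO : Outer q σ) (hcm : c < 4 * q.m)
    (hp : σ.nat sP 0 = c + 1) (hst : σ.nat aSt (quadKeyAt σ c) ≠ 0) :
    Queue q (fun c' => D c' ∨ c' = c) (tryAll.exec σ) ∧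
      SameBut [sE, aSt, aQ, sQt] [2, 3, 4, 5] σ (tryAll.exec σ) ∧
      Extends σ (tryAll.exec σ) := by
  have hval : σ.nat aVal2 c = c / 4 := hO.tri.quads.val c hcm
  set e := c / 4 with he
  have hem : e < q.m := by omega
  set σ' := σ.setNat sE 0 e with hσ'
  have hex : tryAll.exec σ = tryFour.exec σ' := by
    simp only [tryAll, Prog.exec, NExp.eval, hp, Nat.add_sub_cancel, hval, ← hσ']
  rw [hex]
  have hsame : SameBut [sE, aSt, aQ, sQt] [2, 3, 4, 5] σ σ' :=
    (SameBut.refl _ _ σ).setNat _ _ (by simp)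
  have hsame' : SameBut [sE] [] σ σ' := (SameBut.refl _ _ σ).setNat _ _ (by simp)
  have hext : Extends σ σ' := (Extends.refl σ).congr (hsame'.1 _ (by decide)) (hsame'.1 _ (by decide))
  have hO' : Outer q σ' := hO.frame hsame' (by decide) (by decide)
  have n1 : σ'.nat 1 = σ.nat 1 := hsame'.1 _ (by decide)
  have n2 : σ'.nat 2 = σ.nat 2 := hsame'.1 _ (by decide)
  have n3 : σ'.nat aT1 = σ.nat aT1 := hsame'.1 _ (by decide)
  have n4 : σ'.nat aT2 = σ.nat aT2 := hsame'.1 _ (by decide)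
  have n5 : σ'.nat aSt = σ.nat aSt := hsame'.1 _ (by decide)
  have n6 : σ'.nat aQ = σ.nat aQ := hsame'.1 _ (by decide)
  have n7 : σ'.nat sQt = σ.nat sQt := hsame'.1 _ (by decide)
  have n8 : σ'.nat aCnt = σ.nat aCnt := hsame'.1 _ (by decide)
  have n9 : σ'.real = σ.real := rfl
  have hkey : quadKeyAt σ' = quadKeyAt σ := by unfold quadKeyAt; rw [n1, n2, n3, n4]
  have hQ' : Queue q D σ' := hQ.frame hsame' (by decide) (by decide)
  -- The cell `c` may be declared treated as soon as no corner test of its edge can succeed for a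
  -- box without status.
  have hmark : ∀ τ, Queue q D τ → SameBut [aSt, aQ, sQt] [2, 3, 4, 5] σ' τ →
      (∀ v, σ.nat aSt v ≠ 0 → τ.nat aSt v ≠ 0) →
      (σ.nat aCnt e = 2 → ∀ x y z z', Variant σ e x y z z' → Placed τ x → Placed τ y →
        Placed τ z' → CornerTest (provAt τ x) (provAt τ y) (provAt τ z') → τ.nat aSt z ≠ 0) →
      Queue q (fun c' => D c' ∨ c' = c) τ := by
    rintro τ ⟨q1, q2, q3, q4, q5, q6, q7⟩ hs hmon hset
    have m1 : τ.nat 1 = σ.nat 1 := (hs.1 _ (by decide)).trans n1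
    have m2 : τ.nat 2 = σ.nat 2 := (hs.1 _ (by decide)).trans n2
    have m3 : τ.nat aT1 = σ.nat aT1 := (hs.1 _ (by decide)).trans n3
    have m4 : τ.nat aT2 = σ.nat aT2 := (hs.1 _ (by decide)).trans n4
    have hkτ : quadKeyAt τ = quadKeyAt σ := by unfold quadKeyAt; rw [m1, m2, m3, m4]
    refine ⟨q1, q2, q3, q4, ?_, ?_, q7⟩
    · rintro c' hc' (h | rfl)
      · exact q5 c' hc' h
      · rw [hkτ]; exact hmon _ hst
    · intro e' he' hc' x y z z' hv hx hy hz' ht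
      rcases q6 e' he' hc' x y z z' hv hx hy hz' ht with h | ⟨c', h1, h2, h3, h4⟩
      · exact .inl h
      · by_cases hcc : c' = c
        · left
          obtain rfl : e' = e := by rw [← h2, hcc]
          rw [hs.1 aCnt (by decide), n8] at hc'
          refine hset hc' x y z z' ?_ hx hy hz' ht
          unfold Variant at *
          rwa [m1, m2, m3, m4] at hv
        · exact .inr ⟨c', h1, h2, h3, fun h => h.elim h4 hcc⟩
  have hcnt : (BExp.nlt (.lit 1) (.get aCnt (sc sE))).Holds σ' ↔ σ.nat aCnt e = 2 := by
    have hE : σ'.nat sE 0 = e := by simp [hσ', State.setNat_nat]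
    simp only [BExp.Holds, NExp.eval, hE, n8]
    rcases hO.cnt e hem with h | h <;> omega
  unfold tryFour
  rw [Prog.exec]
  split_ifs with hc
  · simp only [Prog.exec]
    have hc2 := hcnt.1 hc
    have hE : σ'.nat sE 0 = e := by simp [hσ', State.setNat_nat]
    have hc2' : σ'.nat aCnt e = 2 := by rw [n8]; exact hc2
    have h0 : Trying q D e σ' σ' := ⟨hQ', SameBut.refl _ _ _, Extends.refl _, fun _ h => h, .inl rfl⟩
    obtain ⟨h1, r1⟩ := h0.tryProg hO' hem hE hc2' (p := 1) (p' := 2) (r := aT1) (r' := aT2)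
      (by decide) (by decide) (by decide) ⟨.inl ⟨rfl, rfl⟩, .inl ⟨rfl, rfl⟩⟩
    generalize (tryProg (vX 1) (vX 2) (vX aT1) (vX aT2)).exec σ' = τ₁ at *
    obtain ⟨h2, r2⟩ := h1.tryProg hO' hem hE hc2' (p := 2) (p' := 1) (r := aT1) (r' := aT2)
      (by decide) (by decide) (by decide) ⟨.inr ⟨rfl, rfl⟩, .inl ⟨rfl, rfl⟩⟩
    generalize (tryProg (vX 2) (vX 1) (vX aT1) (vX aT2)).exec τ₁ = τ₂ at *
    obtain ⟨h3, r3⟩ := h2.tryProg hO' hem hE hc2' (p := 1) (p' := 2) (r := aT2) (r' := aT1)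
      (by decide) (by decide) (by decide) ⟨.inl ⟨rfl, rfl⟩, .inr ⟨rfl, rfl⟩⟩
    generalize (tryProg (vX 1) (vX 2) (vX aT2) (vX aT1)).exec τ₂ = τ₃ at *
    obtain ⟨h4, r4⟩ := h3.tryProg hO' hem hE hc2' (p := 2) (p' := 1) (r := aT2) (r' := aT1)
      (by decide) (by decide) (by decide) ⟨.inr ⟨rfl, rfl⟩, .inr ⟨rfl, rfl⟩⟩
    generalize (tryProg (vX 2) (vX 1) (vX aT2) (vX aT1)).exec τ₃ = τ₄ at *
    have hs4 : SameBut [sE, aSt, aQ, sQt] [2, 3, 4, 5] σ τ₄ :=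
      hsame.trans h4.same (by simp) (by simp)
    have hmon : ∀ v, σ.nat aSt v ≠ 0 → τ₄.nat aSt v ≠ 0 := by rw [← n5]; exact h4.mono
    refine ⟨hmark τ₄ h4.queue h4.same hmon ?_, hs4, hext.trans h4.ext⟩
    intro _ x y z z' hv hx hy hz' ht hz
    -- If nothing has changed, all four tests failed in this very memory. Otherwise neither common
    -- neighbour is left to be placed.
    rcases h4.res with rfl | ⟨k1, k2⟩
    · obtain ⟨rfl, c4⟩ := r4 rfl
      obtain ⟨rfl, c3⟩ := r3 rfl
      obtain ⟨rfl, c2⟩ := r2 rfl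
      obtain ⟨-, c1⟩ := r1 rfl
      rw [cornerX_holds] at c1 c2 c3 c4
      simp only [NExp.eval, hE, n1, n2, n3, n4] at c1 c2 c3 c4
      obtain ⟨⟨rfl, rfl⟩ | ⟨rfl, rfl⟩, ⟨rfl, rfl⟩ | ⟨rfl, rfl⟩⟩ := hv
      · exact c1 ⟨⟨hx, hy, hz', hz⟩, ht⟩
      · exact c3 ⟨⟨hx, hy, hz', hz⟩, ht⟩
      · exact c2 ⟨⟨hx, hy, hz', hz⟩, ht⟩
      · exact c4 ⟨⟨hx, hy, hz', hz⟩, ht⟩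
    · rw [n3] at k1
      rw [n4] at k2
      rcases hv.2 with ⟨rfl, -⟩ | ⟨rfl, -⟩
      · exact k1 hz
      · exact k2 hz
  · refine ⟨hmark σ' hQ' (SameBut.refl _ _ _) (by rw [n5]; exact fun _ h => h)
      (fun h => (hc (hcnt.2 h)).elim), hsame, hext⟩

end

/-- Treat the first box in the queue. -/
def treatProg : Prog := traverse sP aHd2 aNx2 (.get aQ (sc sQi)) trueTest tryAll

/-- Place boxes as long as possible. -/
def placeLoop : Prog :=
  .while (.nlt (sc sQi) (sc sQt)) (.seq treatProg (.nset sQi (.lit 0) (.succ (sc sQi))))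

/-- The cells of the boxes that have been taken from the queue. -/
def Treated (σ : State) (k c : ℕ) : Prop := ∃ i < k, σ.nat aQ i = quadKeyAt σ c

theorem quadKeyAt_congr {σ τ : State} {ns rs : List ℕ} (h : SameBut ns rs σ τ)
    (hn : ∀ a ∈ [1, 2, aT1, aT2], a ∉ ns) : quadKeyAt τ = quadKeyAt σ := by
  unfold quadKeyAt
  rw [h.1 1 (hn _ (by simp)), h.1 2 (hn _ (by simp)), h.1 aT1 (hn _ (by simp)),
    h.1 aT2 (hn _ (by simp))]

/-- The cost is proportional to the number of cells of the box taken from the queue. Boxes queued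
meanwhile do not disturb this, since the queue is only extended and keys of cells never change. -/
theorem treatProg_spec {q : OInst} {σ : State} (hO : Outer q σ) {k : ℕ} (hk : σ.nat sQi 0 = k)
    (hlt : k < σ.nat sQt 0) (hQ : Queue q (Treated σ k) σ) :
    Ex treatProg σ fun τ t => SameBut [sP, sE, aSt, aQ, sQt] [2, 3, 4, 5] σ τ ∧
      Queue q (Treated τ (k + 1)) τ ∧ Extends σ τ ∧
      t ≤ (tryAll.bound + 50) *
        (Nat.count (fun c => quadKeyAt σ c = σ.nat aQ k) (4 * q.m) + 1) := by
  set v := σ.nat aQ k with hv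
  set key := quadKeyAt σ with hkey
  set C := tryAll.bound with hC
  refine (Ex.traverse (σ := σ) (v := v) hO.tri.quads.buckets
    (fun j τ t => SameBut [sP, sE, aSt, aQ, sQt] [2, 3, 4, 5] σ τ ∧
      Queue q (fun c => Treated σ k c ∨ key c = v ∧ j ≤ c) τ ∧ Extends σ τ ∧
      t + (C + 50) * Nat.count (fun c => key c = v) j ≤
        (C + 50) * Nat.count (fun c => key c = v) (4 * q.m))
    rfl (by simp only [NExp.eval, hk]; rfl) ?_ ?_ ?_).mono ?_
  · rintro j j' τ t hj hne ⟨h1, h2, h3, h4⟩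
    have : (C + 50) * _ ≤ (C + 50) * _ :=
      Nat.mul_le_mul_left _ (Nat.count_monotone (fun c => key c = v) hj)
    refine ⟨h1, h2.congr fun c _ => or_congr Iff.rfl (and_congr_right fun hk => ?_), h3, by omega⟩
    constructor
    · exact hj.trans
    · intro h
      by_contra! h'
      exact hne c h h' hk
  · have hs : SameBut [sP] [] σ (σ.setNat sP 0 (lastCell key v (4 * q.m))) :=
      (SameBut.refl _ _ σ).setNat _ _ (by simp)
    refine ⟨hs.mono (by simp) (by simp), ?_, (Extends.refl σ).congr (hs.1 _ (by decide))
      (hs.1 _ (by decide)), by simp⟩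
    refine (hQ.frame hs (by decide) (by decide)).congr fun c hc => ?_
    constructor
    · exact .inl
    · rintro (h | h)
      · exact h
      · omega
  · rintro c τ t hc hkc hp - ⟨h1, h2, h3, h4⟩
    have hOτ : Outer q τ := hO.frame h1 (by decide) (by decide)
    have hkτ : quadKeyAt τ = key := quadKeyAt_congr h1 (by decide)
    have hkc' : key c = v := hkc
    have hst : τ.nat aSt (quadKeyAt τ c) ≠ 0 := by
      rw [hkτ, hkc', hv, ← h3.2 k hlt]
      exact h2.st k (hlt.trans_le h3.1)
    refine Ex.of_exec (by simp [tryAll, tryFour, tryProg, placeProg, seqs, Prog.LoopFree]) fun s hs => ?_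
    obtain ⟨g1, g2, g3⟩ := tryAll_spec h2 hOτ hc hp hst
    generalize tryAll.exec τ = υ at *
    have hs' : SameBut [sP] [] υ (υ.setNat sP 0 (lastCell key v c)) :=
      (SameBut.refl _ _ υ).setNat _ _ (by simp)
    have hct : Nat.count (fun c => key c = v) (c + 1) = Nat.count (fun c => key c = v) c + 1 := by
      rw [Nat.count_succ, if_pos hkc']
    refine ⟨by rw [g2.1 _ (by decide)]; exact hp, by rw [g2.1 _ (by decide), h1.1 _ (by decide)],
      (h1.trans g2 (by simp) (by simp)).setNat _ _ (by simp), ?_, ?_, ?_⟩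
    · refine (g1.frame hs' (by decide) (by decide)).congr fun c' hc' => ?_
      constructor
      · rintro ((h | ⟨h, h'⟩) | rfl)
        · exact .inl h
        · exact .inr ⟨h, by omega⟩
        · exact .inr ⟨hkc', le_rfl⟩
      · rintro (h | ⟨h, h'⟩)
        · exact .inl (.inl h)
        · rcases Nat.lt_or_eq_of_le h' with h' | rfl
          · exact .inl (.inr ⟨h, h'⟩)
          · exact .inr rfl
    · exact (h3.trans g3).congr (hs'.1 _ (by decide)) (hs'.1 _ (by decide))
    · rw [hct, Nat.mul_add, Nat.mul_one] at h4
      simp only [BExp.cost, NExp.cost]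
      omega
  · rintro τ t ⟨j, t', ⟨h1, h2, h3, h4⟩, ht, hj⟩
    obtain rfl : j = 0 := hj.resolve_right (by simp [BExp.Holds, NExp.eval])
    have hkτ : quadKeyAt τ = key := quadKeyAt_congr h1 (by decide)
    refine ⟨h1, h2.congr fun c hc => ?_, h3, ?_⟩
    · unfold Treated
      rw [hkτ]
      constructor
      · rintro (⟨i, hi, h⟩ | ⟨h, -⟩)
        · exact ⟨i, by omega, by rw [h3.2 i (by omega), h]⟩
        · exact ⟨k, by omega, by rw [h3.2 k hlt, h]⟩
      · rintro ⟨i, hi, h⟩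
        rw [h3.2 i (by omega)] at h
        rcases Nat.lt_succ_iff_lt_or_eq.1 hi with hi | rfl
        · exact .inl ⟨i, hi, h⟩
        · exact .inr ⟨h.symm, by omega⟩
    · simp only [BExp.cost, NExp.cost, Nat.count_zero, Nat.mul_zero] at ht h4
      rw [Nat.mul_add]
      omega

/-! ### Amortised cost of the queue -/

theorem sum_count_eq (key : ℕ → ℕ) (n K : ℕ) :
    ∑ v ∈ Finset.range n, Nat.count (fun c => key c = v) K = Nat.count (fun c => key c < n) K := by
  induction n with
  | zero => simp [Nat.count_false]
  | succ n ih => rw [Finset.sum_range_succ, ih, count_lt_succ]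

/-- The total length of the lists of different vertices. -/
theorem sum_count_le {key f : ℕ → ℕ} {n k K : ℕ} (hlt : ∀ i < k, f i < n)
    (hinj : ∀ i < k, ∀ j < k, f i = f j → i = j) :
    ∑ i ∈ Finset.range k, (Nat.count (fun c => key c = f i) K + 1) ≤ K + n := by
  have h1 : ∑ i ∈ Finset.range k, (Nat.count (fun c => key c = f i) K + 1) =
      ∑ v ∈ (Finset.range k).image f, (Nat.count (fun c => key c = v) K + 1) := by
    rw [Finset.sum_image]
    intro i hi j hj h
    exact hinj i (by simpa using hi) j (by simpa using hj) h
  have h2 : (Finset.range k).image f ⊆ Finset.range n := by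
    intro v hv
    simp only [Finset.mem_image, Finset.mem_range] at hv ⊢
    obtain ⟨i, hi, rfl⟩ := hv
    exact hlt i hi
  rw [h1]
  refine (Finset.sum_le_sum_of_subset h2).trans ?_
  rw [Finset.sum_add_distrib, sum_count_eq]
  have := Nat.count_le (p := fun c => key c < n) (n := K)
  simp only [Finset.sum_const, Finset.card_range, smul_eq_mul, mul_one]
  omega

theorem le_of_injOn {f : ℕ → ℕ} {n k : ℕ} (hlt : ∀ i < k, f i < n)
    (hinj : ∀ i < k, ∀ j < k, f i = f j → i = j) : k ≤ n := by
  have := Finset.card_le_card_of_injOn (s := Finset.range k) (t := Finset.range n) f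
    (fun i hi => by simpa using hlt i (by simpa using hi))
    (fun i hi j hj h => hinj i (by simpa using hi) j (by simpa using hj) h)
  simpa using this

/-- A box enters the queue at most once, so the lists traversed are those of different vertices and
their total length is at most `4 m`. This bounds the work although single rounds may be long. -/
theorem placeLoop_spec : Triple (fun q : OInst => q.size) placeLoop
    (fun q σ => Outer q σ ∧ σ.nat sQi 0 = 0 ∧ Queue q (fun _ => False) σ)
    (fun q τ => Outer q τ ∧ Queue q (fun c => Placed τ (quadKeyAt τ c)) τ) := by
  set C := tryAll.bound + 70 with hC
  refine ⟨5 * C + 20, ?_⟩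
  rintro q σ ⟨hO, h0, hQ⟩
  have key := Ex.whileLoop (b := .nlt (sc sQi) (sc sQt))
    (P := .seq treatProg (.nset sQi (.lit 0) (.succ (sc sQi))))
    (fun τ t => SameBut [sQi, sP, sE, aSt, aQ, sQt] [2, 3, 4, 5] σ τ ∧
      τ.nat sQi 0 ≤ τ.nat sQt 0 ∧ Queue q (Treated τ (τ.nat sQi 0)) τ ∧
      t ≤ C * ∑ i ∈ Finset.range (τ.nat sQi 0),
        (Nat.count (fun c => quadKeyAt σ c = τ.nat aQ i) (4 * q.m) + 1))
    (fun τ => q.n - τ.nat sQi 0) ?_ σ 0 ?_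
  · refine key.mono ?_
    rintro τ s ⟨hb, t', ⟨h1, h2, h3, h4⟩, ht⟩
    simp only [BExp.Holds, NExp.eval] at hb
    have he : τ.nat sQi 0 = τ.nat sQt 0 := by omega
    rw [he] at h3 h4
    have hsum : ∑ i ∈ Finset.range (τ.nat sQt 0),
        (Nat.count (fun c => quadKeyAt σ c = τ.nat aQ i) (4 * q.m) + 1) ≤ 4 * q.m + q.n :=
      sum_count_le h3.lt h3.inj
    refine ⟨?_, hO.frame h1 (by decide) (by decide), ?_⟩
    · have h5 : C * ∑ i ∈ Finset.range (τ.nat sQt 0),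
          (Nat.count (fun c => quadKeyAt σ c = τ.nat aQ i) (4 * q.m) + 1) ≤
          C * (4 * (q.size + 1)) :=
        Nat.mul_le_mul_left _ (by unfold Inst.size; omega)
      simp only [BExp.cost, NExp.cost] at ht
      have h6 : (5 * C + 20) * (q.size + 1) = C * (4 * (q.size + 1)) + (C + 20) * (q.size + 1) := by
        ring
      have h7 : 20 * 1 ≤ (C + 20) * (q.size + 1) := Nat.mul_le_mul (by omega) (by omega)
      show s ≤ (5 * C + 20) * (q.size + 1)
      omega
    -- The queue is exhausted and contains every placed box, so a cell of a placed box has been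
    -- treated. Replacing treated cells by cells of placed boxes makes the pending alternative of
    -- `settled` contradictory.
    · obtain ⟨q1, q2, q3, q4, q5, q6, q7⟩ := h3
      refine ⟨q1, q2, q3, q4, fun c hc h => ?_, ?_, q7⟩
      · have := h.1; omega
      · intro e he' hc x y z z' hv hx hy hz' htest
        rcases q6 e he' hc x y z z' hv hx hy hz' htest with h | ⟨c, k1, k2, k3, k4⟩
        · exact .inl h
        · obtain ⟨i, hi, h⟩ := q4 _ ((hO.tri.frame h1 (by decide) (by decide)).quadKey_lt he' hc k2) k3
          exact (k4 ⟨i, hi, h⟩).elim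
  · rintro τ t ⟨h1, h2, h3, h4⟩ hb
    simp only [BExp.Holds, NExp.eval] at hb
    set k := τ.nat sQi 0 with hk
    have hOτ : Outer q τ := hO.frame h1 (by decide) (by decide)
    have hkn : k < q.n := hb.trans_le (le_of_injOn h3.lt h3.inj)
    refine Ex.seq ((treatProg_spec hOτ hk.symm hb h3).mono ?_)
    rintro υ s ⟨g1, g2, g3, g4⟩
    refine ⟨_, _, .nset _ _ _ _, ?_⟩
    have e0 : υ.nat sQi 0 = k := by rw [g1.1 _ (by decide)]
    simp only [NExp.eval, e0, NExp.cost, BExp.cost]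
    set ω := υ.setNat sQi 0 (k + 1) with hω
    have hs : SameBut [sQi] [] υ ω := (SameBut.refl _ _ υ).setNat _ _ (by simp)
    have e1 : ω.nat sQi 0 = k + 1 := by simp [hω, State.setNat_nat]
    have e2 : ω.nat sQt = υ.nat sQt := hs.1 _ (by decide)
    have e3 : ω.nat aQ = υ.nat aQ := hs.1 _ (by decide)
    have e4 : quadKeyAt ω = quadKeyAt υ := quadKeyAt_congr hs (by decide)
    have e5 : quadKeyAt τ = quadKeyAt σ := quadKeyAt_congr h1 (by decide)
    rw [e1, e2, e3]
    refine ⟨⟨(h1.trans g1 (by simp) (by simp)).setNat _ _ (by simp), ?_, ?_, ?_⟩, by omega⟩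
    · have := g3.1; omega
    · refine (g2.frame hs (by decide) (by decide)).congr fun c _ => ?_
      unfold Treated
      rw [e3, e4]
    · rw [Finset.sum_range_succ, Nat.mul_add, g3.2 k hb]
      have h5 : ∑ i ∈ Finset.range k,
          (Nat.count (fun c => quadKeyAt σ c = υ.nat aQ i) (4 * q.m) + 1) =
          ∑ i ∈ Finset.range k,
          (Nat.count (fun c => quadKeyAt σ c = τ.nat aQ i) (4 * q.m) + 1) := by
        refine Finset.sum_congr rfl fun i hi => ?_
        rw [g3.2 i (by have := Finset.mem_range.1 hi; omega)]
      rw [h5]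
      rw [e5] at g4
      set N := Nat.count (fun c => quadKeyAt σ c = τ.nat aQ k) (4 * q.m) + 1 with hN
      have h6 : C * N = (tryAll.bound + 50) * N + 20 * N := by rw [hC]; ring
      omega
  · refine ⟨SameBut.refl _ _ _, by omega, hQ.congr fun c _ => ?_, by simp⟩
    rw [h0]
    unfold Treated
    constructor
    · exact False.elim
    · rintro ⟨i, hi, -⟩; omega

/-- Mark all boxes as not placed. -/
def resetProg : Prog := forLoop sI nX (.nset aSt (sc sI) (.lit 0))

/-- Place `a`, `b` and the box in the corner between them. -/
def startProg (z : NExp) : Prog :=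
  seqs [.rset 2 (sc sA) (.sub .zero (.get 0 (sc sA))), .rset 3 (sc sA) (.sub .zero (.get 1 (sc sB))),
    .rset 4 (sc sA) .zero, .rset 5 (sc sA) (.get 1 (sc sA)),
    .rset 2 (sc sB) .zero, .rset 3 (sc sB) (.sub .zero (.get 1 (sc sB))),
    .rset 4 (sc sB) (.get 0 (sc sB)), .rset 5 (sc sB) .zero,
    .rset 2 z .zero, .rset 3 z .zero, .rset 4 z (.get 0 z), .rset 5 z (.get 1 z),
    .nset aSt (sc sA) (.lit 2), .nset aSt (sc sB) (.lit 2), .nset aSt z (.lit 1),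
    .nset aSt (sc sC) (.lit 3), .nset aSt (sc sD) (.lit 3),
    .nset aQ (.lit 0) (sc sA), .nset aQ (.lit 1) (sc sB), .nset aQ (.lit 2) z,
    .nset sQt (.lit 0) (.lit 3), .nset sQi (.lit 0) (.lit 0)]

/-- The common neighbour of the ends of the edge stored in the scalar `s`. -/
abbrev thirdX (s : ℕ) : NExp := .get aT1 (eX s)

def engineProg : Prog := .seq resetProg (.seq (startProg (thirdX sEab)) placeLoop)

/-- The statuses must be cleared because the placement may be run a second time, for the other
orientation, on the same memory. -/
theorem resetProg_spec : Triple (fun q : OInst => q.size) resetProg Outer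
    (fun q τ => Outer q τ ∧ ∀ v < q.n, τ.nat aSt v = 0) := by
  refine ⟨50, fun q σ hO => ?_⟩
  refine (Ex.forLoop (σ := σ) q.n 20
    (fun k τ => SameBut [sI, aSt] [] σ τ ∧ ∀ v < k, τ.nat aSt v = 0) ?_ ?_ ?_).mono ?_
  · rintro k τ ⟨h, -⟩
    simp only [NExp.eval]; rw [h.1 0 (by decide)]; exact hO.tri.n_eq
  · exact ⟨(SameBut.refl _ _ σ).setNat _ _ (by simp), by simp⟩
  · rintro k τ hk hi ⟨h1, h2⟩
    refine Ex.of_exec (by trivial) fun t ht => ?_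
    simp only [Prog.exec, NExp.eval, hi]
    refine ⟨ht.trans (by simp [Prog.bound, NExp.cost]), by simp [State.setNat_nat, hi],
      (h1.setNat _ _ (by simp)).setNat _ _ (by simp), fun v hv => ?_⟩
    simp only [State.setNat_nat, Nat.reduceEqDiff, reduceIte, Function.update_apply]
    split_ifs
    · rfl
    · exact h2 v (by omega)
  · rintro τ t ⟨h1, h2, h3⟩
    refine ⟨?_, hO.frame h2 (by decide) (by decide), h3⟩
    have := q.n_le_size
    simp only [NExp.cost] at h1
    show t ≤ 50 * (q.size + 1)
    omega

theorem startProg_exec {q : OInst} {σ : State} (hO : Outer q σ) {z : ℕ}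
    (hz : σ.nat aT1 (σ.nat sEab 0 - 1) = z) (hza : z ≠ q.a) (hzb : z ≠ q.b) :
    ∃ τ, (startProg (thirdX sEab)).exec σ = τ ∧ SameBut [aSt, aQ, sQt, sQi] [2, 3, 4, 5] σ τ ∧
      τ.nat sQi 0 = 0 ∧ τ.nat sQt 0 = 3 ∧ τ.nat aQ 0 = q.a ∧ τ.nat aQ 1 = q.b ∧ τ.nat aQ 2 = z ∧
      τ.nat aSt = Function.update (Function.update (Function.update (Function.update
        (Function.update (σ.nat aSt) q.a 2) q.b 2) z 1) q.c 3) q.d 3 ∧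
      provAt τ q.a = ⟨-σ.real 0 q.a, 0, -σ.real 1 q.b, σ.real 1 q.a⟩ ∧
      provAt τ q.b = ⟨0, σ.real 0 q.b, -σ.real 1 q.b, 0⟩ ∧
      provAt τ z = ⟨0, σ.real 0 z, 0, σ.real 1 z⟩ := by
  have hab : (q.a : ℕ) ≠ q.b := fun h => hO.cycle.nodup.1 (Fin.ext h)
  refine ⟨_, rfl, (SameBut.of_exec (by simp [startProg, seqs, Prog.LoopFree]) _).mono
    (by simp [startProg, seqs, Prog.natWrites]) (by simp [startProg, seqs, Prog.realWrites]),
    ?_, ?_, ?_, ?_, ?_, ?_, ?_, ?_, ?_⟩ <;>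
  simp [startProg, seqs, Prog.exec, NExp.eval, RExp.eval, State.setNat_nat, State.setReal_real,
    provAt, hO.a_eq, hO.b_eq, hO.c_eq, hO.d_eq, hz, hab, hza.symm, hzb.symm]

/-- In normal position the common neighbour of `a` and `b` has its bottom-left corner at the origin.
No cell has been treated yet, so every configuration is pending. -/
theorem startProg_spec : Triple (fun q : OInst => q.size) (startProg (thirdX sEab))
    (fun q τ => Outer q τ ∧ ∀ v < q.n, τ.nat aSt v = 0)
    (fun q σ => Outer q σ ∧ σ.nat sQi 0 = 0 ∧ Queue q (fun _ => False) σ) := by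
  refine Triple.of_exec (by simp [startProg, seqs, Prog.LoopFree]) ?_
  rintro q σ ⟨hO, hst⟩
  obtain ⟨z, hz, hadj, huni⟩ : ∃ z : Fin q.n, σ.nat aT1 (σ.nat sEab 0 - 1) = z ∧
      (q.G.Adj q.a z ∧ q.G.Adj q.b z) ∧ ∀ u, q.G.Adj q.a u → q.G.Adj q.b u → u = z := by
    rcases hO.ab.ends with ⟨h1, h2⟩ | ⟨h1, h2⟩
    · obtain ⟨z, hz, h⟩ := hO.tri.third hO.ab.lt hO.ab.cnt h1 h2
      exact ⟨z, hz, (h z).2 rfl, fun u k1 k2 => (h u).1 ⟨k1, k2⟩⟩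
    · obtain ⟨z, hz, h⟩ := hO.tri.third hO.ab.lt hO.ab.cnt h1 h2
      exact ⟨z, hz, ((h z).2 rfl).symm, fun u k1 k2 => (h u).1 ⟨k2, k1⟩⟩
  have hza : (z : ℕ) ≠ q.a := fun h => hadj.1.ne (Fin.ext h.symm)
  have hzb : (z : ℕ) ≠ q.b := fun h => hadj.2.ne (Fin.ext h.symm)
  have hn := hO.cycle.nodup
  simp only [ne_eq, Fin.ext_iff] at hn
  obtain ⟨τ, hτ, hs, h1, h2, h3, h4, h5, h6, h7, h8, h9⟩ := startProg_exec hO hz hza hzb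
  rw [hτ]
  refine ⟨hO.frame hs (by decide) (by decide), h1, ?_⟩
  have sa : τ.nat aSt q.a = 2 := by
    rw [h6]; simp only [Function.update_apply]; split_ifs <;> omega
  have sb : τ.nat aSt q.b = 2 := by
    rw [h6]; simp only [Function.update_apply]; split_ifs <;> omega
  -- `z` may coincide with `c` or `d`; its status is then `3`, and there is no representation in
  -- normal position to agree with.
  have sz : τ.nat aSt z ≠ 0 := by
    rw [h6]; simp only [Function.update_apply]; split_ifs <;> omega
  have sv : ∀ v, v < q.n → τ.nat aSt v ≠ 0 → τ.nat aSt v < 3 → v = q.a ∨ v = q.b ∨ v = z := by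
    intro v hv
    rw [h6]
    have := hst v hv
    simp only [Function.update_apply]; split_ifs <;> omega
  have cases3 : ∀ i < 3, i = 0 ∨ i = 1 ∨ i = 2 := by omega
  constructor
  · intro i hi
    rw [h2] at hi
    rcases cases3 i hi with rfl | rfl | rfl
    · rw [h3]; exact q.a.2
    · rw [h4]; exact q.b.2
    · rw [h5]; exact z.2
  · intro i hi
    rw [h2] at hi
    rcases cases3 i hi with rfl | rfl | rfl
    · rw [h3, sa]; omega
    · rw [h4, sb]; omega
    · rw [h5]; exact sz
  · intro i hi j hj hij
    rw [h2] at hi hj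
    rcases cases3 i hi with rfl | rfl | rfl <;> rcases cases3 j hj with rfl | rfl | rfl <;>
      simp only [h3, h4, h5] at hij <;> omega
  · intro v hv hp
    rw [h2]
    rcases sv v hv (by have := hp.1; omega) hp.2 with rfl | rfl | rfl
    · exact ⟨0, by omega, h3⟩
    · exact ⟨1, by omega, h4⟩
    · exact ⟨2, by omega, h5⟩
  · exact fun _ _ h => h.elim
  · intro e he hc x y u u' hv hx hy hu ht
    obtain ⟨r, hr, hk⟩ := quadKey_variant hv (u := x) (.inl rfl)
    exact .inr ⟨4 * e + r, by omega, by omega, by rw [hk]; exact hx, fun h => h⟩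
  · intro B N
    obtain ⟨zI, zl, zb⟩ := N.sides.common_ab N.pos N.cover N.rep.contact hadj.1 hadj.2
    have hzc : (z : ℕ) ≠ q.c := fun h => zI.2.2.1 (Fin.ext h)
    have hzd : (z : ℕ) ≠ q.d := fun h => zI.2.2.2 (Fin.ext h)
    rw [N.ra] at zl
    rw [N.tb] at zb
    have wa := hO.tri.w_eq q.a
    have wb := hO.tri.w_eq q.b
    have ha := hO.tri.h_eq q.a
    have hb := hO.tri.h_eq q.b
    refine ⟨sa, sb, ?_, ?_, by rw [h7, wa, ha, hb], by rw [h8, wb, hb],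
      fun u k1 k2 => by rw [huni u k1 k2]; exact sz, ?_⟩
    · rw [h6]; simp only [Function.update_apply]; split_ifs <;> omega
    · rw [h6]; simp only [Function.update_apply]; split_ifs <;> omega
    · rintro v ⟨v1, v2, v3, v4⟩ hv
      simp only [ne_eq, Fin.ext_iff] at v1 v2 v3 v4
      have hvz : (v : ℕ) = z := by
        by_contra hvz
        apply hv
        have := hst v v.2
        rw [h6]; simp only [Function.update_apply]; split_ifs; omega
      obtain rfl : v = z := Fin.ext hvz
      refine ⟨?_, ?_⟩
      · rw [h6]; simp only [Function.update_apply]; split_ifs; omega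
      · have e1 := N.rep.r_eq v
        have e2 := N.rep.t_eq v
        rw [zl, zero_add] at e1
        rw [zb, zero_add] at e2
        rw [h9, hO.tri.w_eq, hO.tri.h_eq, ← e1, ← e2]
        cases hB : B v
        simp_all

/-- When no more box can be placed, all inner boxes are in their places. -/
theorem Queue.all_placed {q : OInst} {τ : State} (hO : Outer q τ)
    (hQ : Queue q (fun c => Placed τ (quadKeyAt τ c)) τ) {B : Fin q.n → Box}
    (N : Normal q.G q.w q.h q.inner B q.a q.b q.c q.d) : ∀ v ∈ q.inner, provAt τ v = B v := by
  have hG := hQ.good B N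
  have hab : q.a ≠ q.b := N.hab.ne
  have hn := hO.cycle.nodup
  have hall : q.inner ⊆ {v : Fin q.n | Placed τ v} := by
    refine N.all_placed (provisional_provBox hab) (hO.cycle.toLocal N.rep N.wpos N.hpos)
      (fun v _ => hO.tri.nbr v) ?_ _ ?_ ?_ ?_ ?_
    · intro x y z hx hy hxy hadj hxz hyz
      obtain ⟨u, u', hne, k1, k2, k3, k4⟩ : ∃ u u', u ≠ u' ∧ q.G.Adj x u ∧ q.G.Adj y u ∧
          q.G.Adj x u' ∧ q.G.Adj y u' := by
        by_cases hxI : x ∈ q.inner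
        · exact hO.cycle.two_of_inner hadj hxI
        by_cases hyI : y ∈ q.inner
        · obtain ⟨u, u', h1, h2, h3, h4, h5⟩ := hO.cycle.two_of_inner hadj.symm hyI
          exact ⟨u, u', h1, h3, h2, h5, h4⟩
        · exact (hxy ⟨hx.resolve_left hxI, hy.resolve_left hyI⟩).elim
      by_cases hu : u = z
      · exact ⟨u', by rw [← hu]; exact hne.symm, k3, k4⟩
      · exact ⟨u, hu, k1, k2⟩
    · show Placed τ q.a
      unfold Placed; rw [hG.sta]; omega
    · show Placed τ q.b
      unfold Placed; rw [hG.stb]; omega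
    · intro z haz hbz
      obtain ⟨zI, -⟩ := N.sides.common_ab N.pos N.cover N.rep.contact haz hbz
      have h1 := hG.corner z haz hbz
      have h2 := (hG.inner z zI h1).1
      show Placed τ z
      unfold Placed; omega
    · intro x y z z' hx hy hxy hxS hyS hzS hzI hne hadj hxz hyz hxz' hyz' ht
      obtain ⟨-, p1⟩ := hG.placed hab hxS
      obtain ⟨-, p2⟩ := hG.placed hab hyS
      obtain ⟨-, p3⟩ := hG.placed hab hzS
      rw [← p1, ← p2, ← p3] at ht
      obtain ⟨e, he, hends⟩ := hO.tri.exists_edge hadj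
      have hc : τ.nat aCnt e = 2 := by
        refine (hO.cnt e he).resolve_left fun h1 => ?_
        rcases hends with ⟨h2, h3⟩ | ⟨h2, h3⟩
        · obtain ⟨u, -, hu⟩ := hO.tri.third he h1 h2 h3
          exact hne (((hu z).1 ⟨hxz, hyz⟩).trans ((hu z').1 ⟨hxz', hyz'⟩).symm)
        · obtain ⟨u, -, hu⟩ := hO.tri.third he h1 h2 h3
          exact hne (((hu z).1 ⟨hyz, hxz⟩).trans ((hu z').1 ⟨hyz', hxz'⟩).symm)
      have hv : Variant τ e x y z z' := by
        rcases hends with ⟨h2, h3⟩ | ⟨h2, h3⟩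
        · obtain ⟨u, u', hu1, hu2, -, hu⟩ := hO.tri.thirds he hc h2 h3
          refine ⟨.inl ⟨h2.symm, h3.symm⟩, ?_⟩
          rw [hu1, hu2]
          rcases (hu z).1 ⟨hxz, hyz⟩ with rfl | rfl <;> rcases (hu z').1 ⟨hxz', hyz'⟩ with rfl | rfl
          · exact (hne rfl).elim
          · exact .inl ⟨rfl, rfl⟩
          · exact .inr ⟨rfl, rfl⟩
          · exact (hne rfl).elim
        · obtain ⟨u, u', hu1, hu2, -, hu⟩ := hO.tri.thirds he hc h2 h3
          refine ⟨.inr ⟨h3.symm, h2.symm⟩, ?_⟩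
          rw [hu1, hu2]
          rcases (hu z).1 ⟨hyz, hxz⟩ with rfl | rfl <;> rcases (hu z').1 ⟨hyz', hxz'⟩ with rfl | rfl
          · exact (hne rfl).elim
          · exact .inl ⟨rfl, rfl⟩
          · exact .inr ⟨rfl, rfl⟩
          · exact (hne rfl).elim
      have hz : τ.nat aSt z ≠ 0 := by
        rcases hQ.settled e he hc x y z z' hv hxS hyS hzS ht with h | ⟨c, -, -, h1, h2⟩
        · exact h
        · exact (h2 h1).elim
      have := (hG.inner z hzI hz).1
      show Placed τ z
      unfold Placed; omega
  intro v hv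
  have h1 : Placed τ v := hall hv
  exact (hG.inner v hv (by have := h1.1; omega)).2

/-- The inner boxes are in the places that any representation in normal position prescribes. -/
structure Engine (q : OInst) (τ : State) : Prop extends Outer q τ where
  inner : ∀ B, Normal q.G q.w q.h q.inner B q.a q.b q.c q.d → ∀ v ∈ q.inner, provAt τ v = B v

theorem engineProg_spec : Triple (fun q : OInst => q.size) engineProg Outer Engine := by
  refine resetProg_spec.seq (startProg_spec.seq (placeLoop_spec.conseq ?_))
  intro q σ hσ
  exact ⟨q, le_rfl, hσ, fun τ h => ⟨h.1, fun B N => h.2.all_placed h.1 N⟩⟩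

/-! ## Placing the outer boxes -/

abbrev wX : RExp := .get 6 (.lit 0)
abbrev hX : RExp := .get 7 (.lit 0)

/-- Place the outer boxes around the inner ones. -/
def frameProg : Prog :=
  seqs [.rset 6 (.lit 0) (.get 4 (thirdX sEbc)), .rset 7 (.lit 0) (.get 5 (thirdX sEda)),
    .rset 2 (sc sA) (.sub .zero (.get 0 (sc sA))),
    .ite (.rlt wX (.get 0 (sc sD))) (.rset 3 (sc sA) (.sub hX (.get 1 (sc sA))))
      (.rset 3 (sc sA) (.half (.sub hX (.get 1 (sc sA))))),
    .ite (.rlt hX (.get 1 (sc sA))) (.rset 2 (sc sB) .zero)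
      (.rset 2 (sc sB) (.half (.sub wX (.get 0 (sc sB))))),
    .rset 3 (sc sB) (.sub .zero (.get 1 (sc sB))), .rset 2 (sc sC) wX,
    .ite (.rlt wX (.get 0 (sc sB))) (.rset 3 (sc sC) .zero)
      (.rset 3 (sc sC) (.half (.sub hX (.get 1 (sc sC))))),
    .ite (.rlt hX (.get 1 (sc sC))) (.rset 2 (sc sD) (.sub wX (.get 0 (sc sD))))
      (.rset 2 (sc sD) (.half (.sub wX (.get 0 (sc sD))))),
    .rset 3 (sc sD) hX]

structure Framing (q : OInst) (τ : State) : Prop extends Outer q τ where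
  framed : Framed q.w q.h (fun v => boxAt τ v) q.a q.b q.c q.d (τ.real 6 0) (τ.real 7 0)
  normal : ∀ B, Normal q.G q.w q.h q.inner B q.a q.b q.c q.d →
    τ.real 6 0 = (B q.c).l ∧ τ.real 7 0 = (B q.d).b ∧ ∀ v ∈ q.inner, boxAt τ v = B v

theorem frameProg_exec {q : OInst} {σ : State} (hO : Outer q σ) :
    ∃ τ W H, frameProg.exec σ = τ ∧ W = σ.real 4 (σ.nat aT1 (σ.nat sEbc 0 - 1)) ∧
      H = σ.real 5 (σ.nat aT1 (σ.nat sEda 0 - 1)) ∧ SameBut [] [2, 3, 6, 7] σ τ ∧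
      τ.real 6 0 = W ∧ τ.real 7 0 = H ∧
      τ.real 2 = Function.update (Function.update (Function.update (Function.update (σ.real 2)
        q.a (-σ.real 0 q.a)) q.b (if H < σ.real 1 q.a then 0 else (W - σ.real 0 q.b) / 2)) q.c W)
        q.d (if H < σ.real 1 q.c then W - σ.real 0 q.d else (W - σ.real 0 q.d) / 2) ∧
      τ.real 3 = Function.update (Function.update (Function.update (Function.update (σ.real 3)
        q.a (if W < σ.real 0 q.d then H - σ.real 1 q.a else (H - σ.real 1 q.a) / 2))
        q.b (-σ.real 1 q.b)) q.c (if W < σ.real 0 q.b then 0 else (H - σ.real 1 q.c) / 2)) q.d H := by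
  refine ⟨_, _, _, rfl, rfl, rfl, (SameBut.of_exec (by simp [frameProg, seqs, Prog.LoopFree]) _).mono
    (by simp [frameProg, seqs, Prog.natWrites]) (by simp [frameProg, seqs, Prog.realWrites]), ?_⟩
  by_cases c1 : σ.real 4 (σ.nat aT1 (σ.nat sEbc 0 - 1)) < σ.real 0 q.d <;>
  by_cases c2 : σ.real 5 (σ.nat aT1 (σ.nat sEda 0 - 1)) < σ.real 1 q.a <;>
  by_cases c3 : σ.real 4 (σ.nat aT1 (σ.nat sEbc 0 - 1)) < σ.real 0 q.b <;>
  by_cases c4 : σ.real 5 (σ.nat aT1 (σ.nat sEda 0 - 1)) < σ.real 1 q.c <;>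
  simp [frameProg, seqs, Prog.exec, NExp.eval, RExp.eval, BExp.Holds, hO.a_eq, hO.b_eq, hO.c_eq,
    hO.d_eq, State.setReal_real, c1, c2, c3, c4]

/-- The common neighbour of `b` and `c` lies in the lower right corner of the rectangle and the one
of `d` and `a` in the upper left corner. Hence the right side of the former gives `W` and the top of
the latter gives `H`. -/
theorem frameProg_spec :
    Triple (fun q : OInst => q.size) frameProg Engine Framing := by
  refine Triple.of_exec (by simp [frameProg, seqs, Prog.LoopFree]) ?_
  intro q σ hE
  have hO := hE.toOuter
  obtain ⟨τ, W, H, hτ, hW, hH, hs, h6, h7, h2, h3⟩ := frameProg_exec hO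
  have hn := hO.cycle.nodup
  simp only [ne_eq, Fin.ext_iff] at hn
  obtain ⟨n1, n2, n3, n4, n5, n6⟩ := hn
  rw [hτ]
  have hO' := hO.frame hs (by decide) (by decide)
  have hin : ∀ v ∈ q.inner, boxAt τ v = ⟨σ.real 2 v, σ.real 2 v + q.w v, σ.real 3 v,
      σ.real 3 v + q.h v⟩ := by
    rintro v ⟨k1, k2, k3, k4⟩
    simp only [ne_eq, Fin.ext_iff] at k1 k2 k3 k4
    simp [boxAt, hO'.tri.w_eq, hO'.tri.h_eq, h2, h3, k1, k2, k3, k4]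
  refine ⟨hO', ?_, ?_⟩
  · rw [h6, h7]
    constructor <;>
    simp [boxAt, h2, h3, n1, n2, n3, n4, n5, n6,
      hO'.tri.w_eq, hO'.tri.h_eq, hO.tri.w_eq, hO.tri.h_eq]
  · intro B N
    have hb : ∀ v ∈ q.inner, boxAt τ v = B v := by
      intro v hv
      rw [hin v hv]
      have h := hE.inner B N v hv
      have e1 := N.rep.r_eq v
      have e2 := N.rep.t_eq v
      have e3 : σ.real 2 v = (B v).l := by rw [← h]; rfl
      have e4 : σ.real 3 v = (B v).b := by rw [← h]; rfl
      rw [e3, e4, ← e1, ← e2]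
    refine ⟨?_, ?_, hb⟩
    · obtain ⟨z, hz, k1, k2⟩ : ∃ z : Fin q.n, σ.nat aT1 (σ.nat sEbc 0 - 1) = z ∧
          q.G.Adj q.b z ∧ q.G.Adj q.c z := by
        rcases hO.bc.ends with ⟨k1, k2⟩ | ⟨k1, k2⟩
        · obtain ⟨z, hz, h⟩ := hO.tri.third hO.bc.lt hO.bc.cnt k1 k2
          exact ⟨z, hz, (h z).2 rfl⟩
        · obtain ⟨z, hz, h⟩ := hO.tri.third hO.bc.lt hO.bc.cnt k1 k2
          exact ⟨z, hz, ((h z).2 rfl).symm⟩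
      have hR := N.rep.flipX
      obtain ⟨zI, zl, -⟩ := N.sides.flipX.common_ab (hR.pos N.wpos N.hpos)
        (fun v => by have := N.cover v; tauto) hR.contact k2 k1
      have h := hE.inner B N z zI
      rw [h6, hW, hz, ← neg_inj.1 zl, ← h]
      rfl
    · obtain ⟨z, hz, k1, k2⟩ : ∃ z : Fin q.n, σ.nat aT1 (σ.nat sEda 0 - 1) = z ∧
          q.G.Adj q.d z ∧ q.G.Adj q.a z := by
        rcases hO.da.ends with ⟨k1, k2⟩ | ⟨k1, k2⟩
        · obtain ⟨z, hz, h⟩ := hO.tri.third hO.da.lt hO.da.cnt k1 k2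
          exact ⟨z, hz, (h z).2 rfl⟩
        · obtain ⟨z, hz, h⟩ := hO.tri.third hO.da.lt hO.da.cnt k1 k2
          exact ⟨z, hz, ((h z).2 rfl).symm⟩
      have hR := N.rep.flipY
      obtain ⟨zI, -, zb⟩ := N.sides.flipY.common_ab (hR.pos N.wpos N.hpos)
        (fun v => by have := N.cover v; tauto) hR.contact k2 k1
      have h := hE.inner B N z zI
      rw [h7, hH, hz, ← neg_inj.1 zb, ← h]
      rfl

/-- If there is a representation in normal position, the memory holds one. -/
theorem Framing.rep {q : OInst} {τ : State} (hF : Framing q τ) {B : Fin q.n → Box}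
    (N : Normal q.G q.w q.h q.inner B q.a q.b q.c q.d) :
    Rep q.G q.w q.h (fun v => boxAt τ v) ∧ 0 < τ.real 6 0 ∧ 0 < τ.real 7 0 ∧
      ∀ v ∈ q.inner, 0 ≤ (boxAt τ v).l ∧ (boxAt τ v).r ≤ τ.real 6 0 ∧ 0 ≤ (boxAt τ v).b ∧
        (boxAt τ v).t ≤ τ.real 7 0 := by
  obtain ⟨h1, h2, h3⟩ := hF.normal B N
  have hfr := hF.framed
  rw [h1, h2] at hfr ⊢
  have f := N.fits
  refine ⟨N.rep_framed hfr h3, f.W_pos, f.H_pos, fun v hv => ?_⟩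
  rw [h3 v hv, ← N.ra]
  nth_rw 2 [N.ra]
  exact ⟨N.sides.left v hv, N.sides.right v hv, by rw [← N.tb]; exact N.sides.bottom v hv,
    N.sides.top v hv⟩

/-! ## Checking a placement -/

notation "aRt" => (49 : ℕ)

section Tests

variable (u v : NExp)

abbrev leftX : RExp := .get 2 u
abbrev rightX : RExp := .add (.get 2 u) (.get 0 u)
abbrev bottomX : RExp := .get 3 u
abbrev topX : RExp := .add (.get 3 u) (.get 1 u)

def besideX : BExp :=
  .and (.and (.not (.rlt (rightX u) (leftX v))) (.not (.rlt (leftX v) (rightX u))))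
    (.and (.rlt (bottomX u) (topX v)) (.rlt (bottomX v) (topX u)))

def belowX : BExp :=
  .and (.and (.not (.rlt (topX u) (bottomX v))) (.not (.rlt (bottomX v) (topX u))))
    (.and (.rlt (leftX u) (rightX v)) (.rlt (leftX v) (rightX u)))

def contactX : BExp :=
  .or (besideX u v) (.or (besideX v u) (.or (belowX u v) (belowX v u)))

def apartX : BExp :=
  .not (.and (.and (.rlt (leftX v) (rightX u)) (.rlt (leftX u) (rightX v)))
    (.and (.rlt (bottomX v) (topX u)) (.rlt (bottomX u) (topX v))))

def innerX : BExp :=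
  .and (.and (.not (NExp.eq u (sc sA))) (.not (NExp.eq u (sc sB))))
    (.and (.not (NExp.eq u (sc sC))) (.not (NExp.eq u (sc sD))))

def insideX : BExp :=
  .and (.and (.not (.rlt (leftX u) .zero)) (.not (.rlt wX (rightX u))))
    (.and (.not (.rlt (bottomX u) .zero)) (.not (.rlt hX (topX u))))

/-- `v` is an inner box to the right of `u` that reaches down to the bottom of `u` or of the whole
rectangle. -/
def rootX : BExp :=
  .and (innerX v) (.and (besideX u v)
    (.not (.and (.rlt (bottomX u) (bottomX v)) (.rlt .zero (bottomX v)))))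

variable {u v} {σ : State}

theorem besideX_holds : (besideX u v).Holds σ ↔ Beside (boxAt σ (u.eval σ)) (boxAt σ (v.eval σ)) := by
  simp only [besideX, BExp.Holds, RExp.eval, Beside, boxAt, not_lt, le_antisymm_iff]
  tauto

theorem belowX_holds : (belowX u v).Holds σ ↔ Below (boxAt σ (u.eval σ)) (boxAt σ (v.eval σ)) := by
  simp only [belowX, BExp.Holds, RExp.eval, Below, boxAt, not_lt, le_antisymm_iff]
  tauto

theorem contactX_holds :
    (contactX u v).Holds σ ↔ Contact (boxAt σ (u.eval σ)) (boxAt σ (v.eval σ)) := by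
  simp only [contactX, BExp.or_holds, besideX_holds, belowX_holds, Contact]

theorem apartX_holds : (apartX u v).Holds σ ↔ Apart (boxAt σ (u.eval σ)) (boxAt σ (v.eval σ)) := by
  simp only [apartX, BExp.Holds, RExp.eval, Apart, boxAt, ← not_lt]
  tauto

theorem innerX_holds {q : OInst} (hO : Outer q σ) {i : Fin q.n} (hv : v.eval σ = i) :
    (innerX v).Holds σ ↔ i ∈ q.inner := by
  show ((¬ (NExp.eq _ _).Holds σ ∧ ¬ (NExp.eq _ _).Holds σ) ∧ ¬ (NExp.eq _ _).Holds σ ∧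
    ¬ (NExp.eq _ _).Holds σ) ↔ _
  simp only [NExp.eq_holds, NExp.eval, hv, hO.a_eq, hO.b_eq, hO.c_eq, hO.d_eq, OInst.inner,
    Set.mem_ofPred_eq, ne_eq, Fin.ext_iff]
  tauto

theorem insideX_holds : (insideX u).Holds σ ↔ 0 ≤ (boxAt σ (u.eval σ)).l ∧
    (boxAt σ (u.eval σ)).r ≤ σ.real 6 0 ∧ 0 ≤ (boxAt σ (u.eval σ)).b ∧
      (boxAt σ (u.eval σ)).t ≤ σ.real 7 0 := by
  simp only [insideX, BExp.Holds, RExp.eval, NExp.eval, boxAt, not_lt]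
  tauto

end Tests

/-- What `rootX` tests. -/
def IsRoot (q : OInst) (σ : State) (j i : Fin q.n) : Prop :=
  i ∈ q.inner ∧ Beside (boxAt σ j) (boxAt σ i) ∧
    ((boxAt σ i).b ≤ (boxAt σ j).b ∨ (boxAt σ i).b ≤ 0)

theorem rootX_holds {q : OInst} {σ : State} (hO : Outer q σ) {u v : NExp} {j i : Fin q.n}
    (hu : u.eval σ = j) (hv : v.eval σ = i) : (rootX u v).Holds σ ↔ IsRoot q σ j i := by
  show (innerX v).Holds σ ∧ (besideX u v).Holds σ ∧ _ ↔ _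
  rw [innerX_holds hO hv, besideX_holds, hu, hv]
  simp only [IsRoot, BExp.Holds, RExp.eval, boxAt, hu, hv, ← not_lt]
  tauto

theorem boxAt_congr {ns : List ℕ} {σ τ : State} (hs : SameBut ns [] σ τ) (v : ℕ) :
    boxAt τ v = boxAt σ v := by
  simp only [boxAt, hs.2 _ List.not_mem_nil]

theorem isRoot_congr {q : OInst} {ns : List ℕ} {σ τ : State} (hs : SameBut ns [] σ τ)
    {j i : Fin q.n} : IsRoot q τ j i ↔ IsRoot q σ j i := by
  simp only [IsRoot, boxAt_congr hs]

theorem Framing.frame {q : OInst} {ns : List ℕ} {σ τ : State} (h : Framing q σ)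
    (hs : SameBut ns [] σ τ)
    (hn : ∀ a ∈ [0, 1, 2, 3, aCnt, aT1, aT2, aHd2, aNx2, aVal2, sA, sB, sEab, sC, sEbc,
      sD, sEda, sEcd], a ∉ ns) :
    Framing q τ := by
  refine ⟨h.toOuter.frame hs hn (by simp), ?_, ?_⟩
  · simp only [boxAt_congr hs, hs.2 _ List.not_mem_nil]
    exact h.framed
  · simp only [boxAt_congr hs, hs.2 _ List.not_mem_nil]
    exact h.normal

/-- A box has at most one root. -/
theorem root_unique {V : Type*} {G : SimpleGraph V} {w h : V → ℝ} {F : V → Box} (hR : Rep G w h F)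
    (hp : ∀ v, (F v).Pos) {j i i' : V} (hi : 0 ≤ (F i).b) (hi' : 0 ≤ (F i').b)
    (h1 : Beside (F j) (F i)) (h2 : Beside (F j) (F i'))
    (k1 : (F i).b ≤ (F j).b ∨ (F i).b ≤ 0) (k2 : (F i').b ≤ (F j).b ∨ (F i').b ≤ 0) : i = i' := by
  by_contra hne
  obtain ⟨a1, a2, a3⟩ := h1
  obtain ⟨b1, b2, b3⟩ := h2
  have p1 := hp i
  have p2 := hp i'
  unfold Pos at p1 p2
  rcases hR.apart i i' hne with h | h | h | h
  · linarith
  · linarith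
  · rcases k1 with k1 | k1 <;> rcases k2 with k2 | k2 <;> linarith
  · rcases k1 with k1 | k1 <;> rcases k2 with k2 | k2 <;> linarith

abbrev end1X : NExp := .get 1 (sc sI)
abbrev end2X : NExp := .get 2 (sc sI)

def recordRoot (u v : NExp) : Prog := .ite (rootX u v) (.nset aRt u v) .skip

/-- Record a root of every box that has one. -/
def rootPass : Prog :=
  forLoop sI mX (.seq (recordRoot end1X end2X) (recordRoot end2X end1X))

/-- Check whether the placement in memory is a representation. -/
def verifyProg : Prog :=
  .ite (.and (.rlt .zero wX) (.rlt .zero hX))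
    (require sBad nX (.and (innerX (sc sI)) (.not (insideX (sc sI)))) <|
      require sBad mX (.not (contactX end1X end2X)) <|
      require sBad mX (.and (NExp.eq (.get aCnt (sc sI)) (.lit 2))
        (.not (apartX (.get aT1 (sc sI)) (.get aT2 (sc sI))))) <|
      .seq rootPass <|
      require sBad mX (.or (.and (rootX end1X end2X) (.not (NExp.eq (.get aRt end1X) end2X)))
        (.and (rootX end2X end1X) (.not (NExp.eq (.get aRt end2X) end1X)))) <|
      .nset 3 (.lit 0) (.lit 1))
    .skip

structure Stretched (q : OInst) (σ : State) : Prop extends Framing q σ where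
  W_pos : 0 < σ.real 6 0
  H_pos : 0 < σ.real 7 0

structure Inside (q : OInst) (σ : State) : Prop extends Stretched q σ where
  inside : ∀ v ∈ q.inner, 0 ≤ (boxAt σ v).l ∧ (boxAt σ v).r ≤ σ.real 6 0 ∧ 0 ≤ (boxAt σ v).b ∧
    (boxAt σ v).t ≤ σ.real 7 0

structure Touching (q : OInst) (σ : State) : Prop extends Inside q σ where
  touching : ∀ u v, q.G.Adj u v → Contact (boxAt σ u) (boxAt σ v)

structure Separated (q : OInst) (σ : State) : Prop extends Touching q σ where
  pair : ∀ u v, q.G.Adj u v → u ∈ q.inner → ∃ z z', q.G.Adj u z ∧ q.G.Adj v z ∧ q.G.Adj u z' ∧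
    q.G.Adj v z' ∧ Apart (boxAt σ z) (boxAt σ z') ∧ ∀ y, q.G.Adj u y → q.G.Adj v y → y = z ∨ y = z'

structure Rooted (q : OInst) (σ : State) : Prop extends Separated q σ where
  root : ∀ j i, q.G.Adj j i → IsRoot q σ j i → ∃ k : Fin q.n, σ.nat aRt j = k ∧ IsRoot q σ j k

/-- The outcome of an attempt to find a representation in normal position. -/
def Verdict (q : OInst) (τ : State) : Prop :=
  (τ.nat 3 0 = 1 ∧ Rep q.G q.w q.h fun v => boxAt τ v) ∨
    (Outer q τ ∧ ¬ ∃ B, Normal q.G q.w q.h q.inner B q.a q.b q.c q.d)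

section Frame

variable {q : OInst} {σ τ : State} {ns : List ℕ}

theorem Stretched.frame (h : Stretched q σ) (hs : SameBut ns [] σ τ)
    (hn : ∀ a ∈ [0, 1, 2, 3, aCnt, aT1, aT2, aHd2, aNx2, aVal2, sA, sB, sEab, sC, sEbc,
      sD, sEda, sEcd], a ∉ ns) :
    Stretched q τ :=
  ⟨h.toFraming.frame hs hn, by rw [hs.2 6 (by simp)]; exact h.W_pos,
    by rw [hs.2 7 (by simp)]; exact h.H_pos⟩

theorem Inside.frame (h : Inside q σ) (hs : SameBut ns [] σ τ)
    (hn : ∀ a ∈ [0, 1, 2, 3, aCnt, aT1, aT2, aHd2, aNx2, aVal2, sA, sB, sEab, sC, sEbc,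
      sD, sEda, sEcd], a ∉ ns) :
    Inside q τ :=
  ⟨h.toStretched.frame hs hn, by
    simp only [boxAt_congr hs, hs.2 _ List.not_mem_nil]; exact h.inside⟩

theorem Touching.frame (h : Touching q σ) (hs : SameBut ns [] σ τ)
    (hn : ∀ a ∈ [0, 1, 2, 3, aCnt, aT1, aT2, aHd2, aNx2, aVal2, sA, sB, sEab, sC, sEbc,
      sD, sEda, sEcd], a ∉ ns) :
    Touching q τ :=
  ⟨h.toInside.frame hs hn, by simp only [boxAt_congr hs]; exact h.touching⟩

theorem Separated.frame (h : Separated q σ) (hs : SameBut ns [] σ τ)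
    (hn : ∀ a ∈ [0, 1, 2, 3, aCnt, aT1, aT2, aHd2, aNx2, aVal2, sA, sB, sEab, sC, sEbc,
      sD, sEda, sEcd], a ∉ ns) :
    Separated q τ :=
  ⟨h.toTouching.frame hs hn, by simp only [boxAt_congr hs]; exact h.pair⟩

theorem Framing.verdict_no (h : Framing q σ) (hs : SameBut ns [] σ τ)
    (hn : ∀ a ∈ [0, 1, 2, 3, aCnt, aT1, aT2, aHd2, aNx2, aVal2, sA, sB, sEab, sC, sEbc,
      sD, sEda, sEcd], a ∉ ns)
    (hB : (Rep q.G q.w q.h (fun v => boxAt σ v) ∧ 0 < σ.real 6 0 ∧ 0 < σ.real 7 0 ∧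
      ∀ v ∈ q.inner, 0 ≤ (boxAt σ v).l ∧ (boxAt σ v).r ≤ σ.real 6 0 ∧ 0 ≤ (boxAt σ v).b ∧
        (boxAt σ v).t ≤ σ.real 7 0) → False) : Verdict q τ :=
  .inr ⟨(h.frame hs hn).toOuter, fun ⟨_, N⟩ => hB (h.rep N)⟩

end Frame

/-- A recorded root may be overwritten, but only by another root. It does not matter which one is
kept, because all of them are compared with it afterwards. -/
theorem recordRoot_exec {q : OInst} {σ : State} (hO : Outer q σ) {u v : NExp} {j i : Fin q.n}
    (hu : u.eval σ = j) (hv : v.eval σ = i) :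
    SameBut [aRt] [] σ ((recordRoot u v).exec σ) ∧
      (∀ k i' : Fin q.n, σ.nat aRt k = i' → IsRoot q σ k i' → ∃ i'' : Fin q.n,
        ((recordRoot u v).exec σ).nat aRt k = i'' ∧ IsRoot q σ k i'') ∧
      (IsRoot q σ j i → ((recordRoot u v).exec σ).nat aRt j = i) := by
  unfold recordRoot
  simp only [Prog.exec]
  split_ifs with hc <;> rw [rootX_holds hO hu hv] at hc
  · refine ⟨(SameBut.refl _ _ σ).setNat _ _ (by simp), ?_, ?_⟩
    · intro k i' h1 h2
      simp only [State.setNat_nat, if_true, Function.update_apply, hu, hv]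
      by_cases hk : k = j
      · subst hk; exact ⟨i, if_pos rfl, hc⟩
      · exact ⟨i', by rw [if_neg (fun h => hk (Fin.ext h)), h1], h2⟩
    · simp [State.setNat_nat, hu, hv]
  · exact ⟨SameBut.refl _ _ σ, fun k i' h1 h2 => ⟨i', h1, h2⟩, fun h => (hc h).elim⟩

theorem rootPass_spec : Triple (fun q : OInst => q.size) rootPass Separated Rooted := by
  refine ⟨(Prog.seq (recordRoot end1X end2X) (recordRoot end2X end1X)).bound + 30, fun q σ hS => ?_⟩
  refine (Ex.forLoop (σ := σ) q.m
    (Prog.seq (recordRoot end1X end2X) (recordRoot end2X end1X)).bound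
    (fun k τ => SameBut [sI, aRt] [] σ τ ∧ ∀ e < k, ∀ j i : Fin q.n,
      (σ.nat 1 e = j ∧ σ.nat 2 e = i ∨ σ.nat 1 e = i ∧ σ.nat 2 e = j) → IsRoot q σ j i →
      ∃ i' : Fin q.n, τ.nat aRt j = i' ∧ IsRoot q σ j i') ?_ ?_ ?_).mono ?_
  · rintro k τ ⟨h, -⟩
    simp only [NExp.eval]; rw [h.1 0 (by decide)]; exact hS.tri.m_eq
  · exact ⟨(SameBut.refl _ _ σ).setNat _ _ (by simp), by simp⟩
  · rintro k τ hk hi ⟨h1, h2⟩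
    refine Ex.of_exec (by simp [recordRoot, Prog.LoopFree]) fun t ht => ?_
    obtain ⟨x, y, hx, hy, -⟩ := hS.tri.edge hk
    have hO : Outer q τ := hS.toOuter.frame h1 (by decide) (by decide)
    have ex : end1X.eval τ = x := by simp only [NExp.eval, hi, h1.1 1 (by decide), hx]
    have ey : end2X.eval τ = y := by simp only [NExp.eval, hi, h1.1 2 (by decide), hy]
    obtain ⟨a1, a2, a3⟩ := recordRoot_exec hO ex ey
    simp only [Prog.exec]
    set υ := (recordRoot end1X end2X).exec τ with hυ
    have hO' : Outer q υ := hO.frame a1 (by decide) (by decide)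
    have ex' : end1X.eval υ = x := by
      simp only [NExp.eval, a1.1 1 (by decide), a1.1 sI (by decide)]; exact ex
    have ey' : end2X.eval υ = y := by
      simp only [NExp.eval, a1.1 2 (by decide), a1.1 sI (by decide)]; exact ey
    obtain ⟨b1, b2, b3⟩ := recordRoot_exec hO' ey' ex'
    set φ := (recordRoot end2X end1X).exec υ with hφ
    simp only [isRoot_congr a1] at b2 b3
    simp only [isRoot_congr h1] at a2 a3 b2 b3
    refine ⟨ht, ?_, ?_, ?_⟩
    · rw [b1.1 sI (by decide), a1.1 sI (by decide), hi]
    · exact ((h1.trans a1 (by simp) (by simp)).trans b1 (by simp) (by simp)).setNat _ _ (by simp)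
    · intro e he j i hji hr
      have keep : (∃ i' : Fin q.n, τ.nat aRt j = i' ∧ IsRoot q σ j i') →
          ∃ i' : Fin q.n, φ.nat aRt j = i' ∧ IsRoot q σ j i' := by
        rintro ⟨i', k1, k2⟩
        obtain ⟨i', k1, k2⟩ := a2 j i' k1 k2
        exact b2 j i' k1 k2
      simp only [State.setNat_nat, Nat.reduceEqDiff, reduceIte]
      rcases Nat.lt_succ_iff_lt_or_eq.1 he with h | rfl
      · exact keep (h2 e h j i hji hr)
      · rw [hx, hy] at hji
        rcases hji with ⟨k1, k2⟩ | ⟨k1, k2⟩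
        · obtain rfl := Fin.ext k1
          obtain rfl := Fin.ext k2
          exact b2 _ _ (a3 hr) hr
        · obtain rfl := Fin.ext k1
          obtain rfl := Fin.ext k2
          exact ⟨_, b3 hr, hr⟩
  · rintro τ t ⟨h1, h2, h3⟩
    refine ⟨?_, hS.frame h2 (by decide), ?_⟩
    · have := q.m_le_size
      simp only [NExp.cost] at h1
      refine h1.trans ?_
      rw [Nat.mul_comm]
      exact Nat.mul_le_mul (by omega) (Nat.succ_le_succ this)
    · intro j i hji hr
      rw [isRoot_congr h2] at hr
      simp only [isRoot_congr h2]
      obtain ⟨e, he, h⟩ := hS.tri.exists_edge hji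
      exact h3 e he j i h hr

/-- If every root found along the edges at `j` equals the recorded one, `j` has at most one root,
which is the remaining hypothesis of `rep_of_checks`. -/
theorem Rooted.rep {q : OInst} {σ : State} (hS : Rooted q σ)
    (hr : ∀ j i i' : Fin q.n, q.G.Adj j i → IsRoot q σ j i → σ.nat aRt j = i' → i = i') :
    Rep q.G q.w q.h fun v => boxAt σ v := by
  refine rep_of_checks (I := q.inner) hS.tri.w_pos hS.tri.h_pos hS.framed hS.W_pos hS.H_pos
    hS.touching hS.pair (fun v => ?_) (fun v _ => hS.tri.nbr v) hS.inside ?_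
  · simp only [OInst.inner, Set.mem_ofPred_eq]; tauto
  · intro j i i' a1 a2 b1 b2 c1 c2 d1 d2
    obtain ⟨i'', h1, -⟩ := hS.root j i a1 ⟨b1, c1, d1⟩
    exact (hr j i i'' a1 ⟨b1, c1, d1⟩ h1).trans (hr j i' i'' a2 ⟨b2, c2, d2⟩ h1).symm

/-- If a representation in normal position exists, `Framing.rep` makes the placement in memory
itself a representation with all the properties tested. So a failing check refutes normal position,
while passing all checks proves the placement correct whether or not it arose from one. -/
theorem verifyProg_spec : Triple (fun q : OInst => q.size) verifyProg Framing Verdict := by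
  refine Triple.ite (Triple.conseq (pre' := Stretched) (post' := Verdict)
    (size' := fun q : OInst => q.size) ?_ ?_) (Triple.of_skip ?_)
  rotate_left
  · rintro q σ ⟨h1, h2, h3⟩
    exact ⟨q, le_rfl, ⟨h1, h2, h3⟩, fun _ h => h⟩
  · rintro q σ ⟨h1, h2⟩
    exact h1.verdict_no (SameBut.refl [] [] σ) (by decide) fun ⟨_, h3, h4, _⟩ => h2 ⟨h3, h4⟩
  refine Triple.require (mid := Inside) (fun q => q.n)
    (fun q σ e => ∃ v : Fin q.n, e = v ∧ v ∈ q.inner ∧ ¬ (0 ≤ (boxAt σ v).l ∧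
      (boxAt σ v).r ≤ σ.real 6 0 ∧ 0 ≤ (boxAt σ v).b ∧ (boxAt σ v).t ≤ σ.real 7 0)) (by decide)
    (fun q => q.n_le_size) ?_ ?_ ?_ ?_ ?_
  · intro q σ τ hσ hs
    simp only [NExp.eval]; rw [hs.1 0 (by decide)]; exact hσ.tri.n_eq
  · intro q σ τ e hσ he hs hi
    have hO : Outer q τ := hσ.toOuter.frame hs (by decide) (by decide)
    show (innerX _).Holds τ ∧ ¬ (insideX _).Holds τ ↔ _
    rw [innerX_holds hO (i := ⟨e, he⟩) (by simp only [NExp.eval, hi]), insideX_holds]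
    simp only [NExp.eval, hi, boxAt_congr hs, hs.2 _ List.not_mem_nil]
    constructor
    · intro h; exact ⟨⟨e, he⟩, rfl, h⟩
    · rintro ⟨v, rfl, h⟩; exact h
  · rintro q σ τ e hσ hs he ⟨v, rfl, h1, h2⟩
    exact hσ.verdict_no hs (by decide) fun ⟨_, _, _, h⟩ => h2 (h v h1)
  · intro q σ τ hσ hs hp
    refine Inside.frame ⟨hσ, fun v hv => ?_⟩ hs (by decide)
    by_contra h
    exact hp v v.2 ⟨v, rfl, hv, h⟩
  refine Triple.require (mid := Touching) (fun q => q.m)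
    (fun q σ e => ¬ Contact (boxAt σ (σ.nat 1 e)) (boxAt σ (σ.nat 2 e))) (by decide)
    (fun q => q.m_le_size) ?_ ?_ ?_ ?_ ?_
  · intro q σ τ hσ hs
    simp only [NExp.eval]; rw [hs.1 0 (by decide)]; exact hσ.tri.m_eq
  · intro q σ τ e hσ he hs hi
    show ¬ (contactX _ _).Holds τ ↔ _
    rw [contactX_holds]
    simp only [NExp.eval, hi, boxAt_congr hs, hs.1 1 (by decide), hs.1 2 (by decide)]
  · rintro q σ τ e hσ hs he hp
    obtain ⟨x, y, hx, hy, hxy⟩ := hσ.tri.edge he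
    rw [hx, hy] at hp
    exact hσ.verdict_no hs (by decide) fun ⟨h, _⟩ => hp (h.contact x y hxy)
  · intro q σ τ hσ hs hp
    refine Touching.frame ⟨hσ, fun u v huv => ?_⟩ hs (by decide)
    obtain ⟨e, he, ⟨h1, h2⟩ | ⟨h1, h2⟩⟩ := hσ.tri.exists_edge huv
    · have := not_not.1 (hp e he); rwa [h1, h2] at this
    · have := not_not.1 (hp e he); rw [h1, h2] at this; exact this.symm
  refine Triple.require (mid := Separated) (fun q => q.m)
    (fun q σ e => σ.nat aCnt e = 2 ∧ ¬ Apart (boxAt σ (σ.nat aT1 e)) (boxAt σ (σ.nat aT2 e)))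
    (by decide) (fun q => q.m_le_size) ?_ ?_ ?_ ?_ (rootPass_spec.seq ?_)
  · intro q σ τ hσ hs
    simp only [NExp.eval]; rw [hs.1 0 (by decide)]; exact hσ.tri.m_eq
  · intro q σ τ e hσ he hs hi
    show (NExp.eq _ _).Holds τ ∧ ¬ (apartX _ _).Holds τ ↔ _
    rw [NExp.eq_holds, apartX_holds]
    simp only [NExp.eval, hi, boxAt_congr hs, hs.1 aT1 (by decide), hs.1 aT2 (by decide),
      hs.1 aCnt (by decide)]
  · rintro q σ τ e hσ hs he ⟨h2, hp⟩
    obtain ⟨x, y, hx, hy, hxy⟩ := hσ.tri.edge he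
    obtain ⟨z, z', hz, hz', hne, -⟩ := hσ.tri.thirds he h2 hx hy
    rw [hz, hz'] at hp
    exact hσ.verdict_no hs (by decide) fun ⟨h, _⟩ => hp (h.apart z z' hne)
  · intro q σ τ hσ hs hp
    refine Separated.frame ⟨hσ, fun u v huv hu => ?_⟩ hs (by decide)
    have key : ∀ e < q.m, ∀ x y : Fin q.n, σ.nat 1 e = x → σ.nat 2 e = y →
        (x ∈ q.inner ∨ y ∈ q.inner) → ∃ z z', q.G.Adj x z ∧ q.G.Adj y z ∧ q.G.Adj x z' ∧
          q.G.Adj y z' ∧ Apart (boxAt σ z) (boxAt σ z') ∧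
            ∀ u, q.G.Adj x u → q.G.Adj y u → u = z ∨ u = z' := by
      -- An edge with an inner end is not on the outer cycle, so its count is `2` and the stored
      -- common neighbours have been tested.
      intro e he x y hx hy hxy
      have h2 : σ.nat aCnt e = 2 := by
        refine (hσ.cnt e he).resolve_left fun h1 => ?_
        have h := hσ.tri.outer_of_cnt he h1 hσ.cycle hx hy
        simp only [Sym2.eq_iff] at h
        rcases hxy with ⟨k1, k2, k3, k4⟩ | ⟨k1, k2, k3, k4⟩ <;> tauto
      obtain ⟨z, z', hz, hz', hne, h⟩ := hσ.tri.thirds he h2 hx hy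
      have ha := hp e he
      rw [hz, hz'] at ha
      refine ⟨z, z', ((h z).2 (.inl rfl)).1, ((h z).2 (.inl rfl)).2, ((h z').2 (.inr rfl)).1,
        ((h z').2 (.inr rfl)).2, ?_, fun u h1 h2 => (h u).1 ⟨h1, h2⟩⟩
      by_contra hA
      exact ha ⟨h2, hA⟩
    obtain ⟨e, he, ⟨h1, h2⟩ | ⟨h1, h2⟩⟩ := hσ.tri.exists_edge huv
    · exact key e he u v h1 h2 (.inl hu)
    · obtain ⟨z, z', k1, k2, k3, k4, k5, k6⟩ := key e he v u h1 h2 (.inr hu)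
      exact ⟨z, z', k2, k1, k4, k3, k5, fun y a b => k6 y b a⟩
  refine Triple.require (mid := fun (q : OInst) σ => Rep q.G q.w q.h fun v : Fin q.n => boxAt σ v)
    (fun q => q.m)
    (fun q σ e => ∃ x y : Fin q.n, σ.nat 1 e = x ∧ σ.nat 2 e = y ∧
      (IsRoot q σ x y ∧ σ.nat aRt x ≠ y ∨ IsRoot q σ y x ∧ σ.nat aRt y ≠ x))
    (by decide) (fun q => q.m_le_size) ?_ ?_ ?_ ?_ ?_
  · intro q σ τ hσ hs
    simp only [NExp.eval]; rw [hs.1 0 (by decide)]; exact hσ.tri.m_eq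
  · intro q σ τ e hσ he hs hi
    have hO : Outer q τ := hσ.toOuter.frame hs (by decide) (by decide)
    obtain ⟨x, y, hx, hy, -⟩ := hσ.tri.edge he
    have ex : end1X.eval τ = x := by simp only [NExp.eval, hi, hs.1 1 (by decide), hx]
    have ey : end2X.eval τ = y := by simp only [NExp.eval, hi, hs.1 2 (by decide), hy]
    rw [BExp.or_holds]
    show ((rootX _ _).Holds τ ∧ ¬ (NExp.eq _ _).Holds τ) ∨
      ((rootX _ _).Holds τ ∧ ¬ (NExp.eq _ _).Holds τ) ↔ _
    rw [rootX_holds hO ex ey, rootX_holds hO ey ex, NExp.eq_holds, NExp.eq_holds, ex, ey]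
    simp only [isRoot_congr hs]
    have e1 : (NExp.get aRt end1X).eval τ = σ.nat aRt x := by
      show τ.nat aRt (end1X.eval τ) = _
      rw [ex, hs.1 aRt (by decide)]
    have e2 : (NExp.get aRt end2X).eval τ = σ.nat aRt y := by
      show τ.nat aRt (end2X.eval τ) = _
      rw [ey, hs.1 aRt (by decide)]
    rw [e1, e2]
    constructor
    · intro h; exact ⟨x, y, hx, hy, h⟩
    · rintro ⟨x', y', hx', hy', h⟩
      obtain rfl : x = x' := Fin.ext (hx.symm.trans hx')
      obtain rfl : y = y' := Fin.ext (hy.symm.trans hy')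
      exact h
  · rintro q σ τ e hσ hs he ⟨x, y, hx, hy, h⟩
    refine hσ.verdict_no hs (by decide) fun ⟨hR, _, _, hin⟩ => ?_
    obtain ⟨x', y', hx', hy', hxy⟩ := hσ.tri.edge he
    obtain rfl : x = x' := Fin.ext (hx.symm.trans hx')
    obtain rfl : y = y' := Fin.ext (hy.symm.trans hy')
    -- In a representation two roots of `j` would overlap just above the level at which the column
    -- starts, so the recorded root is the only one.
    have key : ∀ j i : Fin q.n, q.G.Adj j i → IsRoot q σ j i → σ.nat aRt j = i := by
      intro j i hji hi
      obtain ⟨i', h1, hi'⟩ := hσ.root j i hji hi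
      obtain rfl : i = i' := root_unique hR (hR.pos hσ.tri.w_pos hσ.tri.h_pos) (hin i hi.1).2.2.1
        (hin i' hi'.1).2.2.1 hi.2.1 hi'.2.1 hi.2.2 hi'.2.2
      exact h1
    rcases h with ⟨h1, h2⟩ | ⟨h1, h2⟩
    · exact h2 (key x y hxy h1)
    · exact h2 (key y x hxy.symm h1)
  · intro q σ τ hσ hs hp
    simp only [boxAt_congr hs]
    refine hσ.rep fun j i i' hji hi h => ?_
    by_contra hne
    have hne' : (σ.nat aRt j) ≠ i := by rw [h]; exact fun h => hne (Fin.ext h.symm)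
    obtain ⟨e, he, ⟨h1, h2⟩ | ⟨h1, h2⟩⟩ := hσ.tri.exists_edge hji
    · exact hp e he ⟨j, i, h1, h2, .inl ⟨hi, hne'⟩⟩
    · exact hp e he ⟨i, j, h1, h2, .inr ⟨hi, hne'⟩⟩
  refine Triple.of_exec trivial fun q σ hσ => .inl ⟨?_, ?_⟩
  · simp [Prog.exec, NExp.eval, State.setNat_nat]
  · exact hσ

/-- Look for a representation in normal position. -/
def attemptProg : Prog := .seq engineProg (.seq frameProg verifyProg)

theorem attemptProg_spec : Triple (fun q : OInst => q.size) attemptProg Outer Verdict :=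
  engineProg_spec.seq (frameProg_spec.seq verifyProg_spec)

/-! ## Four boxes -/

section

variable {V : Type*} {G : SimpleGraph V} {w h : V → ℝ} {F : V → Box} {a b c d : V}

/-- Four boxes, two of which lie side by side below the third one and above the fourth one. -/
structure Crossed (w h : V → ℝ) (F : V → Box) (a b c d : V) : Prop where
  r_eq : ∀ v, (F v).r = (F v).l + w v
  t_eq : ∀ v, (F v).t = (F v).b + h v
  al : (F a).l = -w a
  ab : (F a).b = -h a
  bl : (F b).l = -w b / 2
  bb : (F b).b = 0
  cl : (F c).l = 0
  cb : (F c).b = -h c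
  dl : (F d).l = if h a < h c then -w d else if h c < h a then 0 else -w d / 2
  db : (F d).b = if h c < h a then -h c - h d else -h a - h d

/-- `a` and `c` meet along abscissa `0` with their tops at height `0`, and `b` lies across both. If
they are equally high, `d` touches both bottoms from below; otherwise `d` fits under the shorter one
and beside the longer one. The pair `b`, `d` need not touch, as `not_K4` excludes the second
diagonal. -/
theorem Crossed.rep (hF : Crossed w h F a b c d) (hO : OuterCycle G a b c d)
    (hw : ∀ v, 0 < w v) (hh : ∀ v, 0 < h v) (hV : ∀ v, v = a ∨ v = b ∨ v = c ∨ v = d)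
    (hac : G.Adj a c) : Rep G w h F := by
  obtain ⟨hr, ht, al, ab, bl, bb, cl, cb, dl, db⟩ := hF
  have wa := hw a; have wb := hw b; have wc := hw c; have wd := hw d
  have ha := hh a; have hb := hh b; have hc := hh c; have hd := hh d
  have ra := hr a; have rb := hr b; have rc := hr c; have rd := hr d
  have ta := ht a; have tb := ht b; have tc := ht c; have td := ht d
  have cab : Below (F a) (F b) := ⟨by linarith, by linarith, by linarith⟩
  have ccb : Below (F c) (F b) := ⟨by linarith, by linarith, by linarith⟩
  have cac : Beside (F a) (F c) := ⟨by linarith, by linarith, by linarith⟩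
  have cdac : Contact (F d) (F a) ∧ Contact (F d) (F c) ∧ Apart (F d) (F a) ∧ Apart (F d) (F c) ∧
      Apart (F b) (F d) := by
    rcases lt_trichotomy (h a) (h c) with k | k | k
    · rw [if_pos k] at dl
      rw [if_neg k.not_gt] at db
      exact ⟨.inr (.inr (.inl ⟨by linarith, by linarith, by linarith⟩)),
        .inl ⟨by linarith, by linarith, by linarith⟩, .inr (.inr (.inl (by linarith))),
        .inl (by linarith), .inr (.inr (.inr (by linarith)))⟩
    · rw [if_neg k.not_lt, if_neg k.not_gt] at dl
      rw [if_neg k.not_gt] at db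
      exact ⟨.inr (.inr (.inl ⟨by linarith, by linarith, by linarith⟩)),
        .inr (.inr (.inl ⟨by linarith, by linarith, by linarith⟩)), .inr (.inr (.inl (by linarith))),
        .inr (.inr (.inl (by linarith))), .inr (.inr (.inr (by linarith)))⟩
    · rw [if_neg k.not_gt, if_pos k] at dl
      rw [if_pos k] at db
      exact ⟨.inr (.inl ⟨by linarith, by linarith, by linarith⟩),
        .inr (.inr (.inl ⟨by linarith, by linarith, by linarith⟩)), .inr (.inl (by linarith)),
        .inr (.inr (.inl (by linarith))), .inr (.inr (.inr (by linarith)))⟩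
  obtain ⟨k1, k2, k3, k4, k5⟩ := cdac
  have aab : Apart (F a) (F b) := .inr (.inr (.inl cab.1.le))
  have acb : Apart (F c) (F b) := .inr (.inr (.inl ccb.1.le))
  have aac : Apart (F a) (F c) := .inl cac.1.le
  have hbd : ¬ G.Adj b d := fun h => hO.not_K4 hV ⟨hac, h⟩
  refine ⟨hr, ht, fun u v huv => ?_, fun u v huv => ?_⟩
  · rcases hV u with rfl | rfl | rfl | rfl <;> rcases hV v with rfl | rfl | rfl | rfl
    · exact (huv rfl).elim
    · exact aab
    · exact aac
    · exact k3.symm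
    · exact aab.symm
    · exact (huv rfl).elim
    · exact acb.symm
    · exact k5
    · exact aac.symm
    · exact acb
    · exact (huv rfl).elim
    · exact k4.symm
    · exact k3
    · exact k5.symm
    · exact k4
    · exact (huv rfl).elim
  · rcases hV u with rfl | rfl | rfl | rfl <;> rcases hV v with rfl | rfl | rfl | rfl
    · exact (huv.ne rfl).elim
    · exact .inr (.inr (.inl cab))
    · exact .inl cac
    · exact k1.symm
    · exact .inr (.inr (.inr cab))
    · exact (huv.ne rfl).elim
    · exact .inr (.inr (.inr ccb))
    · exact (hbd huv).elim
    · exact .inr (.inl cac)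
    · exact .inr (.inr (.inl ccb))
    · exact (huv.ne rfl).elim
    · exact k2.symm
    · exact k1
    · exact (hbd huv.symm).elim
    · exact k2
    · exact (huv.ne rfl).elim

end

def crossProg : Prog :=
  seqs [.rset 2 (sc sA) (.sub .zero (.get 0 (sc sA))), .rset 3 (sc sA) (.sub .zero (.get 1 (sc sA))),
    .rset 2 (sc sB) (.half (.sub .zero (.get 0 (sc sB)))), .rset 3 (sc sB) .zero,
    .rset 2 (sc sC) .zero, .rset 3 (sc sC) (.sub .zero (.get 1 (sc sC))),
    .ite (.rlt (.get 1 (sc sA)) (.get 1 (sc sC))) (.rset 2 (sc sD) (.sub .zero (.get 0 (sc sD))))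
      (.ite (.rlt (.get 1 (sc sC)) (.get 1 (sc sA))) (.rset 2 (sc sD) .zero)
        (.rset 2 (sc sD) (.half (.sub .zero (.get 0 (sc sD)))))),
    .ite (.rlt (.get 1 (sc sC)) (.get 1 (sc sA)))
      (.rset 3 (sc sD) (.sub (.sub .zero (.get 1 (sc sC))) (.get 1 (sc sD))))
      (.rset 3 (sc sD) (.sub (.sub .zero (.get 1 (sc sA))) (.get 1 (sc sD)))),
    .nset 3 (.lit 0) (.lit 1)]

theorem crossProg_exec {q : OInst} {σ : State} (hO : Outer q σ) :
    ∃ τ, crossProg.exec σ = τ ∧ SameBut [3] [2, 3] σ τ ∧ τ.nat 3 0 = 1 ∧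
      τ.real 2 = Function.update (Function.update (Function.update (Function.update (σ.real 2)
        q.a (-σ.real 0 q.a)) q.b (-σ.real 0 q.b / 2)) q.c 0)
        q.d (if σ.real 1 q.a < σ.real 1 q.c then -σ.real 0 q.d else
          if σ.real 1 q.c < σ.real 1 q.a then 0 else -σ.real 0 q.d / 2) ∧
      τ.real 3 = Function.update (Function.update (Function.update (Function.update (σ.real 3)
        q.a (-σ.real 1 q.a)) q.b 0) q.c (-σ.real 1 q.c))
        q.d (if σ.real 1 q.c < σ.real 1 q.a then -σ.real 1 q.c - σ.real 1 q.d else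
          -σ.real 1 q.a - σ.real 1 q.d) := by
  refine ⟨_, rfl, (SameBut.of_exec (by simp [crossProg, seqs, Prog.LoopFree]) _).mono
    (by simp [crossProg, seqs, Prog.natWrites]) (by simp [crossProg, seqs, Prog.realWrites]), ?_⟩
  by_cases c1 : σ.real 1 q.a < σ.real 1 q.c <;> by_cases c2 : σ.real 1 q.c < σ.real 1 q.a <;>
  simp [crossProg, seqs, Prog.exec, NExp.eval, RExp.eval, BExp.Holds, hO.a_eq, hO.b_eq, hO.c_eq,
    hO.d_eq, State.setReal_real, State.setNat_nat, c1, c2]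

theorem OInst.cover_of_lt {q : OInst} (hc : OuterCycle q.G q.a q.b q.c q.d) (h : q.n < 5)
    (v : Fin q.n) : v = q.a ∨ v = q.b ∨ v = q.c ∨ v = q.d := by
  have hn := hc.nodup
  simp only [ne_eq, Fin.ext_iff] at hn ⊢
  have := v.2; have := q.a.2; have := q.b.2; have := q.c.2; have := q.d.2
  omega

theorem OInst.exists_inner {q : OInst} (h : ¬ q.n < 5) : ∃ v, v ∈ q.inner := by
  by_contra! hv
  have hu : (Finset.univ : Finset (Fin q.n)) ⊆ {q.a, q.b, q.c, q.d} := fun v _ => by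
    have := hv v
    simp only [OInst.inner, Set.mem_ofPred_eq] at this
    simp only [Finset.mem_insert, Finset.mem_singleton]
    tauto
  have h1 := Finset.card_le_card hu
  rw [Finset.card_univ, Fintype.card_fin] at h1
  have h2 := Finset.card_le_four (a := q.a) (b := q.b) (c := q.c) (d := q.d)
  omega

theorem crossProg_spec : Triple (fun q : OInst => q.size) crossProg
    (fun q σ => Outer q σ ∧ q.n < 5 ∧ q.G.Adj q.a q.c) (fun q τ => Answer q.toInst τ) := by
  refine Triple.of_exec (by simp [crossProg, seqs, Prog.LoopFree]) ?_
  rintro q σ ⟨hO, hn, hac⟩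
  obtain ⟨τ, hτ, hs, h1, h2, h3⟩ := crossProg_exec hO
  rw [hτ]
  have hT : Tri q.toInst τ := hO.tri.frame hs (by decide) (by decide)
  have hn := hO.cycle.nodup
  simp only [ne_eq, Fin.ext_iff] at hn
  obtain ⟨n1, n2, n3, n4, n5, n6⟩ := hn
  refine .inl ⟨h1, Crossed.rep (a := q.a) (b := q.b) (c := q.c) (d := q.d) ?_ hO.cycle hO.tri.w_pos
    hO.tri.h_pos (OInst.cover_of_lt hO.cycle ‹_›) hac⟩
  constructor <;> simp [boxAt, h2, h3, n1, n2, n3, n4, n5, n6, hT.w_eq, hT.h_eq, hO.tri.w_eq,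
    hO.tri.h_eq]

/-! ## Both orientations -/

def OInst.rotate (q : OInst) : OInst := ⟨q.toInst, q.b, q.c, q.d, q.a⟩

def rotateProg : Prog :=
  seqs [.nset sBad (.lit 0) (sc sA), .nset sA (.lit 0) (sc sB), .nset sB (.lit 0) (sc sC),
    .nset sC (.lit 0) (sc sD), .nset sD (.lit 0) (sc sBad),
    .nset sBad (.lit 0) (sc sEab), .nset sEab (.lit 0) (sc sEbc), .nset sEbc (.lit 0) (sc sEcd),
    .nset sEcd (.lit 0) (sc sEda), .nset sEda (.lit 0) (sc sBad)]

theorem rotateProg_spec : Triple (fun q : OInst => q.size) rotateProg Outer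
    (fun q τ => Outer q.rotate τ) := by
  refine Triple.of_exec (by simp [rotateProg, seqs, Prog.LoopFree]) ?_
  intro q σ hO
  have hs : SameBut [sBad, sA, sB, sC, sD, sEab, sEbc, sEcd, sEda] [] σ (rotateProg.exec σ) :=
    (SameBut.of_exec (by simp [rotateProg, seqs, Prog.LoopFree]) _).mono (by decide) (by decide)
  exact ⟨⟨⟨⟨hO.toCounted.frame hs (by decide) (by decide), hO.cycle.rotate, hO.b_eq, hO.c_eq,
    hO.bc.frame hs (by decide) rfl⟩, hO.d_eq, hO.cd.frame hs (by decide) rfl⟩, hO.a_eq,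
    hO.ab.frame hs (by decide) rfl⟩, hO.da.frame hs (by decide) rfl⟩

/-- Solve an instance whose outer cycle is known. -/
def solveProg : Prog :=
  .ite (.nlt nX (.lit 5))
    (.ite (NExp.eq (thirdX sEab) (sc sC)) crossProg (.seq rotateProg crossProg))
    (.seq attemptProg (.ite (.nlt (sc 3) (.lit 1)) (.seq rotateProg attemptProg) .skip))

/-- With four boxes the common neighbour of `a` and `b` is `c` or `d`, so `ac` or `bd` is an edge,
and after a rotation of the names `Crossed.rep` applies. With an inner box,
`OuterCycle.exists_normal` says that two orientations exhaust all representations. -/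
theorem solveProg_spec : Triple (fun q : OInst => q.size) solveProg Outer
    (fun q τ => Answer q.toInst τ) := by
  have hthird : ∀ {q : OInst} {σ : State}, Outer q σ → ∃ z : Fin q.n,
      σ.nat aT1 (σ.nat sEab 0 - 1) = z ∧ q.G.Adj q.a z ∧ q.G.Adj q.b z := by
    intro q σ hO
    rcases hO.ab.ends with ⟨h1, h2⟩ | ⟨h1, h2⟩
    · obtain ⟨z, hz, h⟩ := hO.tri.third hO.ab.lt hO.ab.cnt h1 h2
      exact ⟨z, hz, (h z).2 rfl⟩
    · obtain ⟨z, hz, h⟩ := hO.tri.third hO.ab.lt hO.ab.cnt h1 h2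
      exact ⟨z, hz, ((h z).2 rfl).symm⟩
  refine Triple.ite (Triple.ite (crossProg_spec.conseq ?_) ?_) ?_
  · rintro q σ ⟨⟨hO, h1⟩, h2⟩
    simp only [BExp.Holds, NExp.eval, hO.tri.n_eq] at h1
    rw [NExp.eq_holds] at h2
    simp only [NExp.eval, hO.c_eq] at h2
    obtain ⟨z, hz, h3, -⟩ := hthird hO
    obtain rfl : z = q.c := Fin.ext (hz.symm.trans h2)
    exact ⟨q, le_rfl, ⟨hO, h1, h3⟩, fun _ h => h⟩
  · refine Triple.seq (mid := fun q σ => Outer q.rotate σ ∧ q.n < 5 ∧ q.G.Adj q.b q.d)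
      (rotateProg_spec.conseq ?_) (crossProg_spec.conseq ?_)
    · rintro q σ ⟨⟨hO, h1⟩, h2⟩
      simp only [BExp.Holds, NExp.eval, hO.tri.n_eq] at h1
      rw [NExp.eq_holds] at h2
      simp only [NExp.eval, hO.c_eq] at h2
      obtain ⟨z, hz, h3, h4⟩ := hthird hO
      refine ⟨q, le_rfl, hO, fun _ h => ⟨h, h1, ?_⟩⟩
      rcases OInst.cover_of_lt hO.cycle h1 z with rfl | rfl | rfl | rfl
      · exact (h3.ne rfl).elim
      · exact (h4.ne rfl).elim
      · exact (h2 hz).elim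
      · exact h4
    · rintro q σ ⟨hO, h1, h2⟩
      exact ⟨q.rotate, le_rfl, ⟨hO, h1, h2⟩, fun _ h => h⟩
  · refine Triple.seq (mid := fun q σ => Verdict q σ ∧ ¬ q.n < 5) (attemptProg_spec.conseq ?_)
      (Triple.ite ((rotateProg_spec.seq (mid := fun (q : OInst) τ => Outer q.rotate τ)
        (post := fun (q : OInst) τ => Verdict q.rotate τ) (attemptProg_spec.conseq ?_)).conseq ?_)
        (Triple.of_skip ?_))
    · rintro q σ ⟨hO, h1⟩
      simp only [BExp.Holds, NExp.eval, hO.tri.n_eq] at h1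
      exact ⟨q, le_rfl, hO, fun _ h => ⟨h, h1⟩⟩
    · rintro q σ hO
      exact ⟨q.rotate, le_rfl, hO, fun _ h => h⟩
    · rintro q σ ⟨⟨hV, h1⟩, h2⟩
      simp only [BExp.Holds, NExp.eval] at h2
      rcases hV with ⟨h3, -⟩ | ⟨hO, hN⟩
      · omega
      refine ⟨q, le_rfl, hO, fun τ hτ => ?_⟩
      rcases hτ with h | ⟨hO', hN'⟩
      · exact .inl h
      · refine .inr ⟨hO'.ans, fun ⟨B, hB⟩ => ?_⟩
        rcases hO.cycle.exists_normal hB hO.tri.w_pos hO.tri.h_pos hO.tri.nbr (q.exists_inner h1)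
          with h | h
        · exact hN h
        · exact hN' h
    · rintro q σ ⟨⟨hV, h1⟩, h2⟩
      simp only [BExp.Holds, NExp.eval] at h2
      rcases hV with h | ⟨hO, -⟩
      · exact .inl h
      · have := hO.ans; omega

/-! ## The number of edges of realizable graphs -/

/-- Every edge of a realizable graph can be assigned to one of its ends, at most four to each box. -/
theorem EdgeList.exists_code {e₁ e₂ : ℕ → ℕ} {m n : ℕ} (hE : EdgeList e₁ e₂ m n)
    {G : SimpleGraph (Fin n)} {w h : Fin n → ℝ} {B : Fin n → Box} (hB : Rep G w h B)
    (hw : ∀ v, 0 < w v) (hh : ∀ v, 0 < h v)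
    (hadj : ∀ u v : Fin n, G.Adj u v ↔ Nb e₁ e₂ m u v) :
    ∃ code : ℕ → ℕ, (∀ e < m, code e < 4 * n) ∧
      (∀ e < m, ∀ e' < m, code e = code e' → e = e') ∧
      ∀ e < m, code e / 4 = e₁ e ∨ code e / 4 = e₂ e := by
  -- The code of an edge is `4 u + k`, where the contact occupies slot `k` of its owner `u`.
  -- Different edges have different codes since a slot holds only one box.
  have key : ∀ e, ∃ c, e < m → ∃ (u v : Fin n) (k : Fin 4), c = 4 * (u : ℕ) + k ∧
      Owns (B u) k (B v) ∧ (e₁ e = u ∧ e₂ e = v ∨ e₁ e = v ∧ e₂ e = u) := by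
    intro e
    by_cases he : e < m
    · have hxy : G.Adj ⟨_, hE.lt₁ e he⟩ ⟨_, hE.lt₂ e he⟩ :=
        (hadj _ _).2 (nb_iff.2 ⟨e, he, .inl ⟨rfl, rfl⟩⟩)
      rcases (hB.contact _ _ hxy).owns with ⟨k, hk⟩ | ⟨k, hk⟩
      · exact ⟨_, fun _ => ⟨_, _, k, rfl, hk, .inl ⟨rfl, rfl⟩⟩⟩
      · exact ⟨_, fun _ => ⟨_, _, k, rfl, hk, .inr ⟨rfl, rfl⟩⟩⟩
    · exact ⟨0, fun h => (he h).elim⟩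
  choose code hcode using key
  refine ⟨code, fun e he => ?_, fun e he e' he' hee => ?_, fun e he => ?_⟩
  · obtain ⟨u, v, k, h1, -⟩ := hcode e he
    have := u.2; have := k.2
    omega
  · obtain ⟨u, v, k, h1, h2, h3⟩ := hcode e he
    obtain ⟨u', v', k', h1', h2', h3'⟩ := hcode e' he'
    have := k.2; have := k'.2
    obtain rfl : u = u' := Fin.ext (by omega)
    obtain rfl : k = k' := Fin.ext (by omega)
    obtain rfl : v = v' := by
      by_contra hne
      have hp := hB.pos hw hh
      exact h2.not_apart (hp u) (hp v) (hp v') h2' (hB.apart v v' hne)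
    exact hE.inj e he e' he' (by omega)
  · obtain ⟨u, v, k, h1, -, h3⟩ := hcode e he
    have := k.2
    omega

theorem sum_range_four_mul (f : ℕ → ℕ) (n : ℕ) :
    ∑ i ∈ Finset.range (4 * n), f (i / 4) = 4 * ∑ v ∈ Finset.range n, f v := by
  induction n with
  | zero => simp
  | succ n ih =>
    rw [show 4 * (n + 1) = 4 * n + 1 + 1 + 1 + 1 by ring, Finset.sum_range_succ,
      Finset.sum_range_succ, Finset.sum_range_succ, Finset.sum_range_succ, ih,
      Finset.sum_range_succ, show 4 * n / 4 = n by omega, show (4 * n + 1) / 4 = n by omega,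
      show (4 * n + 1 + 1) / 4 = n by omega, show (4 * n + 1 + 1 + 1) / 4 = n by omega]
    ring

/-- If every edge can be assigned to one of its ends, at most four to each vertex, then the sum of the
smaller degrees of the ends of the edges is linear. -/
theorem sum_small_le {e₁ e₂ code deg : ℕ → ℕ} {m n : ℕ} (hlt : ∀ e < m, code e < 4 * n)
    (hinj : ∀ e < m, ∀ e' < m, code e = code e' → e = e')
    (hend : ∀ e < m, code e / 4 = e₁ e ∨ code e / 4 = e₂ e)
    (hdeg : ∀ v, deg v = Nat.count (fun c => endKey e₁ e₂ c = v) (2 * m))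
    {S : Finset ℕ} (hS : ∀ c ∈ S, c < 2 * m ∧ SmallCell e₁ e₂ deg c) :
    ∑ c ∈ S, deg (endKey e₂ e₁ c) ≤ 8 * m := by
  -- The smaller end has at most the degree of the end to which the edge is assigned; each degree is
  -- then counted at most four times, and the degrees add up to at most `2 m`.
  have h1 : ∀ c ∈ S, deg (endKey e₂ e₁ c) ≤ deg (code (c / 2) / 4) := by
    intro c hc
    obtain ⟨h1, h2⟩ := hS c hc
    have h3 := hend (c / 2) (by omega)
    unfold SmallCell Smaller at h2
    obtain ⟨e, -, he, ⟨-, h4, h5⟩ | ⟨-, h4, h5⟩⟩ := endKey_cases e₁ e₂ h1 <;>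
      rw [h4, h5] at h2 <;> rw [h5] <;> rw [he] at h3 ⊢ <;> rcases h3 with h3 | h3 <;> rw [h3] <;>
      omega
  have hinj' : Set.InjOn (fun c => code (c / 2)) S := by
    intro c hc c' hc' h
    obtain ⟨k1, k2⟩ := hS c hc
    obtain ⟨k3, k4⟩ := hS c' hc'
    exact k2.unique k1 k4 (hinj _ (by omega) _ (by omega) h)
  calc ∑ c ∈ S, deg (endKey e₂ e₁ c) ≤ ∑ c ∈ S, deg (code (c / 2) / 4) := Finset.sum_le_sum h1
    _ = ∑ i ∈ S.image (fun c => code (c / 2)), deg (i / 4) := 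
      (Finset.sum_image (f := fun i => deg (i / 4)) hinj').symm
    _ ≤ ∑ i ∈ Finset.range (4 * n), deg (i / 4) := by
      refine Finset.sum_le_sum_of_subset fun i hi => ?_
      obtain ⟨c, hc, rfl⟩ := Finset.mem_image.1 hi
      have := (hS c hc).1
      exact Finset.mem_range.2 (hlt _ (by omega))
    _ = 4 * ∑ v ∈ Finset.range n, deg v := sum_range_four_mul _ _
    _ ≤ 8 * m := by
      simp only [hdeg]
      rw [sum_count_eq]
      have := Nat.count_le (p := fun c => endKey e₁ e₂ c < n) (n := 2 * m)
      omega

/-! ## The whole program -/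

/-- The memory holds the instance `g` and nothing else. -/
structure Input (g : Inst) (σ : State) : Prop where
  n_eq : σ.nat 0 0 = g.n
  m_eq : σ.nat 0 1 = g.m
  edges : EdgeList (σ.nat 1) (σ.nat 2) g.m g.n
  adj : ∀ u v : Fin g.n, g.G.Adj u v ↔ Nb (σ.nat 1) (σ.nat 2) g.m u v
  w_eq : ∀ v : Fin g.n, σ.real 0 v = g.w v
  h_eq : ∀ v : Fin g.n, σ.real 1 v = g.h v
  w_pos : ∀ v, 0 < g.w v
  h_pos : ∀ v, 0 < g.h v
  outer : ∃ a b c d, OuterCycle g.G a b c d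
  nbr : ∀ v, ∃ u, g.G.Adj v u
  zero : ∀ a i, 3 ≤ a → σ.nat a i = 0

def mainProg : Prog :=
  .seq limitProg <| .ite (.nlt (sc sLim) mX) .skip <|
  .seq incidenceProg <| .seq thirdsProg <| .ite (.nlt (.lit 0) (sc sFuel))
    (.seq quadsProg (outerProg solveProg)) .skip

/-- There are two exits before the geometry starts, too many edges and exhausted fuel. Both
contradict the assignment of contacts to slots, so the answer `0` left there is correct. -/
theorem mainProg_spec : ∃ C, ∀ g σ, Input g σ →
    Ex mainProg σ fun τ t => t ≤ C * (g.n + 1) ∧ Answer g τ := by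
  obtain ⟨B₁, h₁⟩ := incidenceProg_spec
  obtain ⟨B₂, h₂⟩ := outerProg_spec solveProg_spec
  -- The summands pay for the edge limit, the incidence lists, the fuel (`200 * (8 m + 1)`), the
  -- remaining search for common neighbours, the lists of cells, and the solver. Each is expressed
  -- in `n + 1` by means of `m ≤ 4 n`; the last `100` covers tests and sequencing.
  refine ⟨40 + 4 * B₁ + 6600 + 4500 + 1200 + 5 * B₂ + 100, fun g σ hI => ?_⟩
  have hno : ∀ {τ : State}, τ.nat 3 0 = 0 → (∀ B, ¬ Rep g.G g.w g.h B) → Answer g τ :=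
    fun h3 hB => .inr ⟨h3, fun ⟨B, h⟩ => hB B h⟩
  refine Ex.seq ((limitProg_spec σ (hI.zero _ _ (by omega))).frame.mono ?_)
  rintro σ₁ t₁ ⟨⟨ht₁, hl⟩, hs₁⟩
  rw [hI.n_eq] at ht₁ hl
  have z₁ : σ₁.nat 3 0 = 0 := by rw [hs₁.1 3 (by decide)]; exact hI.zero _ _ (by omega)
  have m₁ : σ₁.nat 0 1 = g.m := by rw [hs₁.1 0 (by decide)]; exact hI.m_eq
  by_cases hm : 4 * g.n < g.m
  · refine Ex.iteTrue (by simpa only [BExp.Holds, NExp.eval, hl, m₁] using hm) ⟨_, _, .skip _, ?_⟩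
    refine ⟨?_, hno z₁ fun B hB => ?_⟩
    · simp only [BExp.cost, NExp.cost]
      nlinarith
    · obtain ⟨code, k1, k2, -⟩ := hI.edges.exists_code hB hI.w_pos hI.h_pos hI.adj
      exact hm.not_ge (le_of_injOn k1 k2)
  refine Ex.iteFalse (by simpa only [BExp.Holds, NExp.eval, hl, m₁] using hm) ?_
  refine Ex.seq ((h₁ σ₁ ?_ ?_ ?_).frame.mono ?_)
  · intro v; rw [hs₁.1 aHead (by decide)]; exact hI.zero _ _ (by omega)
  · intro v; rw [hs₁.1 aDeg (by decide)]; exact hI.zero _ _ (by omega)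
  · rw [hs₁.1 sK (by decide)]; exact hI.zero _ _ (by omega)
  rintro σ₂ t₂ ⟨⟨ht₂, hinc, hfuel⟩, hs₂⟩
  rw [m₁] at ht₂ hinc hfuel
  have e₂ : ∀ a, a ∉ limitProg.natWrites → a ∉ incidenceProg.natWrites → σ₂.nat a = σ.nat a :=
    fun a h h' => (hs₂.1 a h').trans (hs₁.1 a h)
  have r₂ : ∀ a, σ₂.real a = σ.real a := fun a =>
    (hs₂.2 a List.not_mem_nil).trans (hs₁.2 a List.not_mem_nil)
  have c1 := e₂ 1 (by decide) (by decide)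
  have c2 := e₂ 2 (by decide) (by decide)
  have hE : EdgeList (σ₂.nat 1) (σ₂.nat 2) g.m g.n := by rw [c1, c2]; exact hI.edges
  refine Ex.seq ((thirdsProg_spec (σ := σ₂) (n := g.n) ?_ hE hinc ?_ ?_).frame.mono ?_)
  · rw [e₂ 0 (by decide) (by decide)]; exact hI.n_eq
  · intro v; rw [e₂ aMark (by decide) (by decide)]; exact hI.zero _ _ (by omega)
  · intro v; rw [e₂ aCnt (by decide) (by decide)]; exact hI.zero _ _ (by omega)
  rintro σ₃ t₃ ⟨⟨ht₃, hreg, hsum⟩, hs₃⟩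
  rw [hfuel] at ht₃ hsum
  have e₃ : ∀ a, a ∉ limitProg.natWrites → a ∉ incidenceProg.natWrites → a ∉ thirdsProg.natWrites →
      σ₃.nat a = σ.nat a := fun a h h' h'' => (hs₃.1 a h'').trans (e₂ a h h')
  have z₃ : σ₃.nat 3 0 = 0 := by
    rw [e₃ 3 (by decide) (by decide) (by decide)]; exact hI.zero _ _ (by omega)
  by_cases hf : 0 < σ₃.nat sFuel 0
  swap
  · refine Ex.iteFalse (by simpa only [BExp.Holds, NExp.eval] using hf) ⟨_, _, .skip _, ?_⟩
    refine ⟨?_, hno z₃ fun B hB => ?_⟩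
    · simp only [BExp.cost, NExp.cost]
      have : (g.m + 1) * B₁ ≤ (4 * (g.n + 1)) * B₁ := Nat.mul_le_mul_right _ (by omega)
      nlinarith [Nat.zero_le (B₂ * (g.n + 1))]
    · obtain ⟨code, k1, k2, k3⟩ := hI.edges.exists_code hB hI.w_pos hI.h_pos hI.adj
      rw [← c1, ← c2] at k3
      classical
      -- For a realizable graph the small cells, one for each edge, have total degree at most `8 m`,
      -- whereas exhausting the `8 m + 1` units of fuel requires more.
      have h8 := sum_small_le (S := (Finset.range (2 * g.m)).filter
        (SmallCell (σ₂.nat 1) (σ₂.nat 2) (σ₂.nat aDeg))) k1 k2 k3 hinc.deg (by simp)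
      have h9 := hsum ((Finset.range (2 * g.m)).filter
        (SmallCell (σ₂.nat 1) (σ₂.nat 2) (σ₂.nat aDeg))) (by simp +contextual)
      omega
  refine Ex.iteTrue (by simpa only [BExp.Holds, NExp.eval] using hf) ?_
  have m₃ : σ₃.nat 0 1 = g.m := by
    rw [e₃ 0 (by decide) (by decide) (by decide)]; exact hI.m_eq
  refine Ex.seq ((quadsProg_spec m₃ ?_ ?_).mono ?_)
  · intro v; rw [e₃ aHd2 (by decide) (by decide) (by decide)]; exact hI.zero _ _ (by omega)
  · rw [e₃ sK2 (by decide) (by decide) (by decide)]; exact hI.zero _ _ (by omega)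
  rintro σ₄ t₄ ⟨ht₄, hq, hs₄⟩
  have d1 : σ₄.nat 1 = σ.nat 1 :=
    (hs₄.1 1 (by decide)).trans (e₃ 1 (by decide) (by decide) (by decide))
  have d2 : σ₄.nat 2 = σ.nat 2 :=
    (hs₄.1 2 (by decide)).trans (e₃ 2 (by decide) (by decide) (by decide))
  have r₄ : ∀ a, σ₄.real a = σ.real a := fun a =>
    (hs₄.2 a List.not_mem_nil).trans ((hs₃.2 a List.not_mem_nil).trans (r₂ a))
  have hP : Pending g σ₄ := by
    refine ⟨⟨?_, ?_, ?_, hq, ?_, ?_, ?_, ?_, hI.w_pos, hI.h_pos, hI.outer, hI.nbr⟩, ?_⟩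
    · rw [hs₄.1 0 (by decide), e₃ 0 (by decide) (by decide) (by decide)]; exact hI.n_eq
    · rw [hs₄.1 0 (by decide)]; exact m₃
    · rw [d1, d2]; exact hI.edges
    · rw [d1, d2]; exact hI.adj
    · rw [d1, d2, hs₄.1 aCnt (by decide), hs₄.1 aT1 (by decide), hs₄.1 aT2 (by decide), ← c1, ← c2]
      exact hreg hf
    · rw [r₄]; exact hI.w_eq
    · rw [r₄]; exact hI.h_eq
    · rw [hs₄.1 3 (by decide)]; exact z₃
  refine (h₂ g σ₄ hP).mono ?_
  rintro τ t₅ ⟨ht₅, hA⟩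
  refine ⟨?_, hA⟩
  simp only [BExp.cost, NExp.cost]
  unfold Inst.size at ht₅
  have k1 : (g.m + 1) * B₁ ≤ (4 * (g.n + 1)) * B₁ := Nat.mul_le_mul_right _ (by omega)
  have k2 : B₂ * (g.n + g.m + 1) ≤ B₂ * (5 * (g.n + 1)) := Nat.mul_le_mul_left _ (by omega)
  nlinarith

/-! ## Input and output -/

/-- The box of width `w` and height `h` whose bottom-left corner is `p`. -/
def boxOf (w h : ℝ) (p : ℝ × ℝ) : Box := ⟨p.1, p.1 + w, p.2, p.2 + h⟩

theorem contact_boxOf {w h w' h' : ℝ} (hw : 0 < w) (hh : 0 < h) (hw' : 0 < w') (hh' : 0 < h')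
    {p p' : ℝ × ℝ} : Contact (boxOf w h p) (boxOf w' h' p') ↔ Touch w h p w' h' p' := by
  simp only [Contact, Beside, Below, boxOf, Touch, max_lt_iff, lt_min_iff, lt_add_iff_pos_right, hw,
    hh, hw', hh', true_and, and_true]
  tauto

theorem apart_boxOf {w h w' h' : ℝ} (hw : 0 < w) (hh : 0 < h) (hw' : 0 < w') (hh' : 0 < h')
    {p p' : ℝ × ℝ} :
    Apart (boxOf w h p) (boxOf w' h' p') ↔ Disjoint (openBox w h p) (openBox w' h' p') := by
  rw [openBox, openBox, Set.disjoint_prod, Set.Ioo_disjoint_Ioo, Set.Ioo_disjoint_Ioo]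
  have := not_le.2 (lt_add_of_pos_right p.1 hw)
  have := not_le.2 (lt_add_of_pos_right p.2 hh)
  have := not_le.2 (lt_add_of_pos_right p'.1 hw')
  have := not_le.2 (lt_add_of_pos_right p'.2 hh')
  simp only [Apart, boxOf, min_le_iff, le_max_iff]
  tauto

theorem realizes_iff {n : ℕ} {w h : Fin n → ℝ} {G : SimpleGraph (Fin n)} (hw : ∀ v, 0 < w v)
    (hh : ∀ v, 0 < h v) {pos : Fin n → ℝ × ℝ} :
    Realizes w h G pos ↔ Rep G w h fun v => boxOf (w v) (h v) (pos v) := by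
  constructor
  · rintro ⟨h1, h2⟩
    exact ⟨fun _ => rfl, fun _ => rfl,
      fun u v huv => (apart_boxOf (hw u) (hh u) (hw v) (hh v)).2 (h1 u v huv),
      fun u v huv => (contact_boxOf (hw u) (hh u) (hw v) (hh v)).2 (h2 u v huv)⟩
  · rintro ⟨-, -, h1, h2⟩
    exact ⟨fun u v huv => (apart_boxOf (hw u) (hh u) (hw v) (hh v)).1 (h1 u v huv),
      fun u v huv => (contact_boxOf (hw u) (hh u) (hw v) (hh v)).1 (h2 u v huv)⟩

theorem realizable_iff {n : ℕ} {w h : Fin n → ℝ} {G : SimpleGraph (Fin n)} (hw : ∀ v, 0 < w v)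
    (hh : ∀ v, 0 < h v) : Realizable w h G ↔ ∃ B, Rep G w h B := by
  constructor
  · rintro ⟨pos, h⟩
    exact ⟨_, (realizes_iff hw hh).1 h⟩
  · rintro ⟨B, hB⟩
    refine ⟨fun v => ((B v).l, (B v).b), (realizes_iff hw hh).2 ?_⟩
    convert hB using 1
    funext v
    exact Box.ext rfl (hB.r_eq v).symm rfl (hB.t_eq v).symm

theorem ListsEdges.adj_iff {n : ℕ} {G : SimpleGraph (Fin n)} {E : List (Fin n × Fin n)}
    (hE : ListsEdges G E) {u v : Fin n} : G.Adj u v ↔ ∃ (e : ℕ) (he : e < E.length),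
      E[e].1 = u ∧ E[e].2 = v ∨ E[e].1 = v ∧ E[e].2 = u := by
  rw [hE.2, List.mem_iff_getElem]
  simp only [List.length_map, List.getElem_map, Sym2.eq_iff]

theorem input_inputState {n : ℕ} {w h : Fin n → ℝ} {G : SimpleGraph (Fin n)}
    {E : List (Fin n × Fin n)} (hw : ∀ v, 0 < w v) (hh : ∀ v, 0 < h v) (hG : IsQuasiTriangulated G)
    (hE : ListsEdges G E) : Input ⟨n, E.length, w, h, G⟩ (inputState w h E) := by
  have n1 : ∀ e (he : e < E.length), (inputState w h E).nat 1 e = E[e].1 := fun e he => dif_pos he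
  have n2 : ∀ e (he : e < E.length), (inputState w h E).nat 2 e = E[e].2 := fun e he => dif_pos he
  have hadj : ∀ e (he : e < E.length), G.Adj E[e].1 E[e].2 := fun e he =>
    hE.adj_iff.2 ⟨e, he, .inl ⟨rfl, rfl⟩⟩
  obtain ⟨a, b, c, d, hO⟩ := hG.exists_outerCycle
  refine ⟨rfl, rfl, ⟨?_, ?_, ?_, ?_⟩, ?_, fun v => dif_pos v.2, fun v => dif_pos v.2, hw, hh,
    ⟨a, b, c, d, hO⟩, ?_, ?_⟩
  · intro e he; rw [n1 e he]; exact Fin.is_lt _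
  · intro e he; rw [n2 e he]; exact Fin.is_lt _
  · intro e he; rw [n1 e he, n2 e he]; exact fun h => (hadj e he).ne (Fin.ext h)
  · intro e he e' he' h
    rw [n1 e he, n2 e he, n1 e' he', n2 e' he'] at h
    simp only [Fin.val_inj] at h
    refine (hE.1.getElem_inj_iff (hi := by simpa using he) (hj := by simpa using he')).1 ?_
    simpa only [List.getElem_map, Sym2.eq_iff] using h
  · intro u v
    rw [nb_iff, hE.adj_iff]
    refine exists_congr fun e => ?_
    constructor
    · rintro ⟨he, h⟩
      refine ⟨he, ?_⟩
      rw [n1 e he, n2 e he]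
      simpa only [Fin.val_inj] using h
    · rintro ⟨he, h⟩
      rw [n1 e he, n2 e he] at h
      exact ⟨he, by simpa only [Fin.val_inj] using h⟩
  · intro v
    have : Nontrivial (Fin n) := ⟨a, b, hO.hab.ne⟩
    exact hG.1.preconnected.exists_adj_of_nontrivial v
  · intro a i ha
    match a, ha with
    | k + 3, _ => rfl

end WRAC

/-- One program `P` decides, within `C * n` steps, whether `n` given boxes have a representation that
realizes a given quasi-triangulated supporting graph: it leaves the answer (`1` for yes, `0` for no)
in cell `0` of natural array `3`, and if the answer is yes, it leaves the bottom-left corners of the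
boxes in such a representation in real arrays `2` and `3`. -/
theorem theorem2 :
    ∃ (P : WRAC.Prog) (C : ℕ), ∀ (n : ℕ) (w h : Fin n → ℝ) (G : SimpleGraph (Fin n))
      (E : List (Fin n × Fin n)), (∀ i, 0 < w i) → (∀ i, 0 < h i) →
      WRAC.IsQuasiTriangulated G → WRAC.ListsEdges G E →
      ∃ (t : ℕ) (τ : WRAC.State), WRAC.Run P (WRAC.inputState w h E) t τ ∧ t ≤ C * n ∧
        (WRAC.Realizable w h G → τ.nat 3 0 = 1 ∧
          WRAC.Realizes w h G (fun i => (τ.real 2 i, τ.real 3 i))) ∧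
        (¬ WRAC.Realizable w h G → τ.nat 3 0 = 0) := by
  obtain ⟨C, hC⟩ := WRAC.mainProg_spec
  refine ⟨WRAC.mainProg, 2 * C, fun n w h G E hw hh hG hE => ?_⟩
  obtain ⟨t, τ, hrun, ht, hA⟩ := hC _ _ (WRAC.input_inputState hw hh hG hE)
  -- A positive number of boxes allows the bound in `n + 1` to be replaced by one in `n`, at the
  -- price of a factor `2`.
  have hn : 1 ≤ n := by
    obtain ⟨a, -⟩ := hG.exists_outerCycle
    have := a.2
    omega
  refine ⟨t, τ, hrun, ?_, ?_⟩
  · have : C * (n + 1) ≤ C * (2 * n) := Nat.mul_le_mul_left _ (by omega)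
    calc t ≤ C * (n + 1) := ht
      _ ≤ C * (2 * n) := this
      _ = 2 * C * n := by ring
  · rw [WRAC.realizable_iff hw hh]
    rcases hA with ⟨h1, h2⟩ | ⟨h1, h2⟩
    · refine ⟨fun _ => ⟨h1, (WRAC.realizes_iff hw hh).2 ?_⟩, fun h => (h ⟨_, h2⟩).elim⟩
      convert h2 using 1
      funext v
      exact WRAC.Box.ext rfl (h2.r_eq v).symm rfl (h2.t_eq v).symm
    · exact ⟨fun h => (h2 h).elim, fun _ => h1⟩
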